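/- **Setting.** Let $\hbar\in\mathbb C\setminus\{0\}$ and let $V'$ be a rational function. A *kernel system* for $(\hbar,V')$ consists of distinct complex numbers $s_1,\dots,s_m$, none of them a pole of $V'$, and functions $G(x_0,x)$, $K(x_0,x)$ such that: 1. for fixed $x_0\notin\{s_i\}$, $G(x_0,x)$ is a rational function of $x$ with poles only at the $s_i$ and a simple pole of residue $+1$ at $x=x_0$, and $G(x_0,x)=O(1/x)$ as $x\to\infty$; 2. for fixed $x\notin\{s_i\}$, $G(x_0,x)$ is a rational function of $x_0$ with poles only at the $s_i$ and a simple pole at $x_0=x$, and $G(x_0,x)=O(1/x_0)$ as $x_0\to\infty$; 3. $B(x_0,x)=-\tfrac12\,\partial_xG(x_0,x)$ is symmetric; 4. near each $s_i$, $\bigl(2\hbar\sum_{j}\frac1{x-s_j}-V'(x)-\hbar\,\partial_x\bigr)K(x_0,x)=G(x_0,x)$; 5. $K(x_0,x)$ is analytic at $x=s_i$ for every $i$. ($K$ is otherwise multivalued; only its germs at the $s_i$ matter, and any choice of solution $K$ is allowed.) The correlators are defined by $W_1^{(0)}(x)=\hbar\sum_i\frac1{x-s_i}$, $W_2^{(0)}=B$,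 and $$W^{(g)}_{n+1}(x_0,J)=\sum_{i=1}^m\operatorname*{Res}_{x\to s_i}K(x_0,x)\Bigl(\overline W^{(g-1)}_{n+2}(x,x,J)+\sum_{h=0}^g\sum_{I\subset J}{}^{'}\,W^{(h)}_{|I|+1}(x,I)\,W^{(g-h)}_{n-|I|+1}(x,J\setminus I)\Bigr),$$ where $J=\{x_1,\dots,x_n\}$, the prime excludes $(h,I)=(0,\emptyset)$ and $(g,J)$, $\overline W^{(g)}_n=W^{(g)}_n-\frac{\delta_{n,2}\delta_{g,0}}{2(x_1-x_2)^2}$, and $W^{(-1)}=0$. For $n=0$ write $W_0^{(g)}=F^{(g)}$. With $T_{i,i}=\frac1\hbar V''(s_i)+2\sum_{j\ne i}(s_i-s_j)^{-2}$, $T_{i,j}=-2(s_i-s_j)^{-2}$ for $i\neq j$, $A=T^{-1}$ and $\Delta(s)=\prod_{i>j}(s_i-s_j)$, $$F^{(0)}=\hbar^2\sum_{i\ne j}\ln(s_i-s_j)-\hbar\sum_iV(s_i),\qquad F^{(1)}=\tfrac12\ln\det A+\ln(\Delta(s)^2)+\hbar^{-2}F^{(0)}$$ (any branches of the logarithms,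 varying continuously), and for $g\ge2$, $F^{(g)}$ is a solution of the differential equation $$\bigl(2-2g-\hbar\tfrac{\partial}{\partial\hbar}\bigr)F^{(g)}=-\sum_i\operatorname*{Res}_{x\to s_i}W_1^{(g)}(x)\,V(x).\qquad(*)$$ **Theorem (variation with respect to the potential).** Let $s^0_1,\dots,s^0_m$ be the points of a kernel system for $(\hbar,V')$, let $\delta V'$ be a rational function, and let $V,\delta V$ be holomorphic primitives of $V',\delta V'$ near the $s_i^0$ (so $\delta V'$ has no pole at any $s^0_i$). (a) There is, for all $t\in\mathbb C$ near $0$, a kernel system $(s(t),G_t,K_t)$ for $(\hbar,V'+t\,\delta V')$, with $s(0)=s^0$ and $s$ continuous at $t=0$. (b) Let $(s(t),G_t,K_t)$ be any such family, and let $\delta=\frac{d}{dt}\big|_{t=0}$ denote the derivative along it. Then for all $g\ge0$, $n\geq 1$ and all $x_1,\dots,x_n\notin\{s^0_i\}$ (with $x_1\ne x_2$ if $(g,n)=(0,2)$), and also for $n=0$ and $g\in\{0,1\}$, the derivative exists and $$\delta W^{(g)}_n(x_1,\dots,x_n)=-\sum_i\operatorname*{Res}_{x\to s_i}W^{(g)}_{n+1}(x,x_1,\dots,x_n)\,\delta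 V(x).$$ (c) Let $g\ge2$, $n=0$. Let $\delta V_1',\dots,\delta V'_p$ be rational functions with holomorphic primitives $\delta V_1,\dots,\delta V_p$ near the $s_i^0$, and let there be given, for all $(h,t)$ near $(\hbar,0)$ in $\mathbb C\times\mathbb C^p$, a kernel system for $(h,V'+\sum_kt_k\,\delta V'_k)$ whose points equal $s^0$ at $(\hbar,0)$ and are continuous there. Then there is a holomorphic function $F^{(g)}(h,t)$ near $(\hbar,0)$ which solves $(*)$ (in the variable $h$, with the potential $V+\sum_kt_k\,\delta V_k$) and satisfies there $$\frac{\partial F^{(g)}}{\partial t_k}=-\sum_i\operatorname*{Res}_{x\to s_i}W_1^{(g)}(x)\,\delta V_k(x),\qquad k=1,\dots,p.$$ (d) Let $g\ge2$, $n=0$, $r>0$. Suppose that for all $h=u\hbar$, $u\in(0,1]$, and $|t|<r$ there is given a kernel system for $(h,V'+t\,\delta V')$ whose points $s_i(u,t)$ depend continuously on $(u,t)$, with $s(1,0)=s^0$, and that $V,\delta V$ are primitives of $V',\delta V'$ near all the $s_i(u,t)$. Suppose that for every $|t|<r$ the integral $$F^{(g)}(t)=\hbar^{2-2g}\int_0^\hbar\frac{dh}{h^{3-2g}}\sum_i\operatorname*{Res}_{x\to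 s_i}\bigl(V(x)+t\,\delta V(x)\bigr)\,W_1^{(g)}(x)\Big|_{h,t}$$ (along the segment from $0$ to $\hbar$) converges absolutely, and that there is no boundary term at $h=0$: $h^{2g-2}\sum_i\operatorname{Res}_{x\to s_i}W_1^{(g)}(x)\big|_{h,t}\,\delta V(x)\to0$ as $h\to0$, uniformly in $|t|<r$. Then, at $t=0$, $$\delta F^{(g)}=-\sum_i\operatorname*{Res}_{x\to s_i}W_1^{(g)}(x)\,\delta V(x).$$ -/

import Mathlib

open Filter Topology Asymptotics

noncomputable section

namespace BetheRecursion

/-- The residue at `c` of a function that is holomorphic in a punctured neighbourhood of `c`: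
the (eventually constant) value of `(2πi)⁻¹ ∮ f` over small circles around `c`. -/
def residue (f : ℂ → ℂ) (c : ℂ) : ℂ :=
  limUnder (𝓝[>] (0 : ℝ)) fun r =>
    (2 * (Real.pi : ℂ) * Complex.I)⁻¹ * ∮ z in C(c, r), f z

/-- The value of a rational function at a point (only used away from its poles). -/
def val (f : RatFunc ℂ) (x : ℂ) : ℂ := RatFunc.eval (RingHom.id ℂ) x f

/-- `V` is a (local branch of a) primitive of the rational function `dV` near `c`;
in particular `dV` has no pole at `c`. -/
def IsPrimitiveNear (V : ℂ → ℂ) (dV : RatFunc ℂ) (c : ℂ) : Prop :=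
  ∀ᶠ x in 𝓝 c, HasDerivAt V (val dV x) x

/-- `L` is a branch of `log f` near `t₀`. -/
def IsLogBranch (f L : ℂ → ℂ) (t₀ : ℂ) : Prop :=
  ContinuousAt L t₀ ∧ ∀ᶠ t in 𝓝 t₀, Complex.exp (L t) = f t

/-- The points `s i`, together with the kernels `G(x₀,x)` and `K(x₀,x)`, solve the problem with
potential `V' = dV`.  The kernel `K(x₀,·)` is in general multivalued away from the `s i`; only its
germs at the points `s i` are recorded (`K x₀` is only constrained near the `s i`). -/
structure IsKernelSystem {m : ℕ} (ħ : ℂ) (dV : RatFunc ℂ) (s : Fin m → ℂ) (G K : ℂ → ℂ → ℂ) :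
    Prop where
  /-- the roots are distinct -/
  inj : Function.Injective s
  /-- the roots are not poles of `V'` -/
  denom_ne : ∀ i, dV.denom.eval (s i) ≠ 0
  /-- `G(x₀,·)` is rational, with poles at the `s i` and at most a simple pole at `x₀` -/
  rational_right : ∀ x₀ ∉ Set.range s, ∃ (p : Polynomial ℂ) (N : ℕ), ∀ x ∉ Set.range s, x ≠ x₀ →
    G x₀ x = p.eval x / ((x - x₀) * ∏ i, (x - s i) ^ N)
  /-- the residue of `G(x₀,·)` at the simple pole `x₀` is `1` -/
  residue_right : ∀ x₀ ∉ Set.range s, Tendsto (fun x => (x - x₀) * G x₀ x) (𝓝[≠] x₀) (𝓝 1)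
  /-- `G(x₀,x) = O(1/x)` as `x → ∞` -/
  decay_right : ∀ x₀ ∉ Set.range s, (fun x => G x₀ x) =O[Bornology.cobounded ℂ] fun x => x⁻¹
  /-- `G(·,x)` is rational, with poles at the `s i` and at most a simple pole at `x` -/
  rational_left : ∀ x ∉ Set.range s, ∃ (p : Polynomial ℂ) (N : ℕ), ∀ x₀ ∉ Set.range s, x₀ ≠ x →
    G x₀ x = p.eval x₀ / ((x₀ - x) * ∏ i, (x₀ - s i) ^ N)
  /-- `G(x₀,x) = O(1/x₀)` as `x₀ → ∞` -/
  decay_left : ∀ x ∉ Set.range s, (fun x₀ => G x₀ x) =O[Bornology.cobounded ℂ] fun x₀ => x₀⁻¹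
  /-- `B(x₀,x) = -½ ∂ₓ G(x₀,x)` is symmetric -/
  symm : ∀ x₀ ∉ Set.range s, ∀ x ∉ Set.range s, x₀ ≠ x → deriv (G x₀) x = deriv (G x) x₀
  /-- the differential equation relating `K` and `G` -/
  ode : ∀ x₀ ∉ Set.range s, ∀ i, ∀ᶠ x in 𝓝[≠] (s i),
    (2 * ħ * ∑ j, 1 / (x - s j) - val dV x) * K x₀ x - ħ * deriv (K x₀) x = G x₀ x
  /-- absence of monodromy: `K(x₀,·)` is analytic at the `s i` -/
  analytic : ∀ x₀ ∉ Set.range s, ∀ i, AnalyticAt ℂ (K x₀) (s i)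

/-- `B(x₀,x) = -½ ∂ₓ G(x₀,x)`. -/
def kernelB (G : ℂ → ℂ → ℂ) (x₀ x : ℂ) : ℂ := -(1 / 2) * deriv (G x₀) x

/-- The value at `x₁ = x₂ = z` of `B(x₁,x₂) - ½ (x₁-x₂)⁻²`, which is regular there. -/
def kernelBDiag (G : ℂ → ℂ → ℂ) (z : ℂ) : ℂ :=
  limUnder (𝓝[≠] z) fun y => kernelB G z y - 1 / (2 * (z - y) ^ 2)

/-- The sub-tuple of `x` with indices in `I` (in increasing order). -/
def subTuple {n : ℕ} (x : Fin n → ℂ) (I : Finset (Fin n)) : Fin I.card → ℂ :=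
  fun k => x (I.orderEmbOfFin rfl k)

/-- The correlators: `W ħ s G K g n (x₀,…,xₙ)` is `W_{n+1}^{(g)}(x₀,…,xₙ)`, the genus `g`
correlator with `n + 1` arguments. -/
def W {m : ℕ} (ħ : ℂ) (s : Fin m → ℂ) (G K : ℂ → ℂ → ℂ) (g n : ℕ) (x : Fin (n + 1) → ℂ) : ℂ :=
  if g = 0 ∧ n = 0 then ħ * ∑ i, 1 / (x 0 - s i)
  else if g = 0 ∧ n = 1 then kernelB G (x 0) (x (Fin.last n))
  else ∑ i, residue (fun z => K (x 0) z *
    ((if hg : g = 0 then 0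
      else if g = 1 ∧ n = 0 then kernelBDiag G z
      else W ħ s G K (g - 1) (n + 1) (Fin.cons z (Fin.cons z (Fin.tail x)))) +
    ∑ h : Fin (g + 1), ∑ I : Finset (Fin n),
      if hI : ((h : ℕ) = 0 ∧ I = ∅) ∨ ((h : ℕ) = g ∧ I = Finset.univ) then 0
      else W ħ s G K h I.card (Fin.cons z (subTuple (Fin.tail x) I)) *
        W ħ s G K (g - h) Iᶜ.card (Fin.cons z (subTuple (Fin.tail x) Iᶜ)))) (s i)
termination_by 2 * g + n
decreasing_by
  · omega
  · have h1 := h.isLt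
    have h2 : I.card ≤ n := by simpa using Finset.card_le_univ I
    rcases Nat.lt_or_ge h g with h3 | h3
    · omega
    · have h4 : I.card ≠ n := fun h5 =>
        hI (Or.inr ⟨by omega, (Finset.card_eq_iff_eq_univ I).1 (by simpa using h5)⟩)
      omega
  · have h1 := h.isLt
    have h2 : Iᶜ.card ≤ n := by simpa using Finset.card_le_univ Iᶜ
    rcases Nat.eq_zero_or_pos (h : ℕ) with h3 | h3
    · have h4 : Iᶜ.card ≠ n := fun h5 =>
        hI (Or.inl ⟨h3, by
          have := (Finset.card_eq_iff_eq_univ Iᶜ).1 (by simpa using h5)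
          simpa using this⟩)
      omega
    · omega

/-- `∑ᵢ Res_{x → sᵢ} W_{n+1}^{(g)}(x, x₁, …, xₙ) f(x)`. -/
def resPairing {m : ℕ} (ħ : ℂ) (s : Fin m → ℂ) (G K : ℂ → ℂ → ℂ) (g n : ℕ) (x : Fin n → ℂ)
    (f : ℂ → ℂ) : ℂ :=
  ∑ i, residue (fun z => W ħ s G K g n (Fin.cons z x) * f z) (s i)

/-- The Hessian matrix `T`, with `T i i = V''(sᵢ)/ħ + 2 ∑_{j ≠ i} (sᵢ-sⱼ)⁻²` and
`T i j = -2 (sᵢ-sⱼ)⁻²` for `i ≠ j`. -/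
def hessian {m : ℕ} (ħ : ℂ) (dV : RatFunc ℂ) (s : Fin m → ℂ) : Matrix (Fin m) (Fin m) ℂ :=
  Matrix.of fun i j =>
    if i = j then
      deriv (val dV) (s i) / ħ + 2 * ∑ k ∈ Finset.univ.erase i, 1 / (s i - s k) ^ 2
    else -2 / (s i - s j) ^ 2

/-- The matrix `A = T⁻¹`. -/
def matA {m : ℕ} (ħ : ℂ) (dV : RatFunc ℂ) (s : Fin m → ℂ) : Matrix (Fin m) (Fin m) ℂ :=
  (hessian ħ dV s)⁻¹

/-- The Vandermonde product `Δ(s) = ∏_{i > j} (sᵢ - sⱼ)`. -/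
def vandermonde {m : ℕ} (s : Fin m → ℂ) : ℂ := ∏ i, ∏ j ∈ Finset.Iio i, (s i - s j)

/-- `F^{(0)} = ħ² ∑_{i ≠ j} ln(sᵢ-sⱼ) - ħ ∑ᵢ V(sᵢ)`, where `l i j` is the chosen value of
`ln(sᵢ-sⱼ)`. -/
def F0 {m : ℕ} (ħ : ℂ) (V : ℂ → ℂ) (s : Fin m → ℂ) (l : Fin m → Fin m → ℂ) : ℂ :=
  ħ ^ 2 * ∑ i, ∑ j ∈ Finset.univ.erase i, l i j - ħ * ∑ i, V (s i)

/-- `F^{(1)} = ½ ln det A + ln(Δ(s)²) + F^{(0)}/ħ²`, where `lA`, `lΔ` and `l i j` are the chosen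
values of `ln det A`, `ln(Δ(s)²)` and `ln(sᵢ-sⱼ)`. -/
def F1 {m : ℕ} (ħ : ℂ) (V : ℂ → ℂ) (s : Fin m → ℂ) (l : Fin m → Fin m → ℂ) (lA lΔ : ℂ) : ℂ :=
  1 / 2 * lA + lΔ + F0 ħ V s l / ħ ^ 2

/-- The integrand `h^{2g-3} R(h)` of the free energy of genus `g`, at the point `h = u ħ` of the
segment from `0` to `ħ`. -/
def freeEnergyIntegrand (ħ : ℂ) (g : ℕ) (R : ℝ → ℂ) (u : ℝ) : ℂ :=
  ((u : ℂ) * ħ) ^ (2 * (g : ℤ) - 3) * R u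

/-- `ħ^{2-2g} ∫₀^ħ h^{2g-3} R(h) dh`, the integral being taken along the segment `h = u ħ`;
`R u` is the value of the residue sum at `h = u ħ`. -/
def freeEnergy (ħ : ℂ) (g : ℕ) (R : ℝ → ℂ) : ℂ :=
  ħ ^ (2 - 2 * (g : ℤ)) * ∫ u in (0 : ℝ)..1, freeEnergyIntegrand ħ g R u * ħ

end BetheRecursion

end

noncomputable section
namespace BetheRecursion

/-! The correlators are the coefficients of a formal integral over `m` points, and varying the
potential inserts `-δV` into that integral.

The integrand is the exponential of `(κ / X²) (κ ∑_{i ≠ j} ln(sᵢ - sⱼ) - ∑ᵢ V(sᵢ))` with `X` formal,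
expanded around a fixed configuration by `sᵢ ↦ sᵢ + X uᵢ`. Here `κ = ħ + …` solves `κ (κ - ħ) = X²`.
The configuration is critical when `V'(sᵢ) = 2ħ ∑_{j ≠ i} 1 / (sᵢ - sⱼ)` (the Bethe equations). The
exponent then starts with the quadratic form `-½ ħ² ∑ Tᵢⱼ uᵢ uⱼ`. If `T` is invertible, expectation
values are Gaussian order by order in `X`, a purely algebraic construction over any commutative
`ℂ`-algebra (`BetheData`). Integration by parts against `1 / (z - sᵢ)` gives the loop equations
(`loop_equation`), and the equation for `κ` is chosen so that their derivative term has the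
coefficient `ħ`.

Kernel systems enter twice. Absence of monodromy and symmetry of `B` force the Bethe equations and
`det T ≠ 0` (`isBethe_and_K_eq`). Conversely, such points carry a kernel system
(`exists_isKernelSystem`). With the implicit function theorem (`exists_family`) this gives (a), and
it makes every continuous family differentiable. Moreover, residues against `K` invert the linear
operator of the loop equations (`IsKernelSystem.sum_res_eq`), which turns these equations into the
residue recursion. Hence `W` of genus `g` with `n + 1` arguments is the coefficient of `X^(2g+n)` of
the connected correlator of resolvents, up to the double pole of `B` (`IsKernelSystem.W_eq`), and
its residue pairing with `f` is the same correlator with `∑ᵢ f(sᵢ)` in the place of one resolvent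
(`resPairing_eq`).

For (b), a derivation of the coefficient ring that moves the points and the potential acts on
connected correlators by inserting minus the variation of the potential (`IsVariation.corr`). Each
insertion raises the order in `X` by one, as does one more argument of `W`. Actual derivatives are
obtained by passing to the algebra of functions differentiable at the base point and then to dual
numbers with the derivation `a + ε b ↦ ε b`.

Free energies come from the partition function `Z`. Genus 0 is a direct computation at a critical
point. Genus 1 is the order zero of the variation formula for `log Z`, where `log Z` itself has no
constant term. For `g ≥ 2` the coefficient of `X^(2g-2)` in `log Z`, corrected by a multiple of
`F0`, has the required derivatives at constant `ħ` (`exists_freeEnergy`). A change of `h` is reduced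
to a change of potential by homogeneity: rescaling to the value `ħ` multiplies the potential by `ħ /
h`, so `V` itself becomes one of the directions of deformation. This gives (c). For (d) the same
local function is a primitive of the integrand along the segment, so the `t`-derivative of the
integral over `[a, 1]` is a difference of boundary terms, and the one at `a` tends to zero. -/

lemma derivation_prod {S M ι : Type*} [CommRing S] [CommRing M] [Algebra S M] [DecidableEq ι]
    (D : Derivation S M M) (J : Finset ι) (X : ι → M) :
    D (∏ j ∈ J, X j) = ∑ j ∈ J, (∏ k ∈ J.erase j, X k) • D (X j) := by
  induction J using Finset.induction_on with
  | empty => simp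
  | insert a J ha ih =>
    rw [Finset.prod_insert ha, Derivation.leibniz, ih, Finset.sum_insert ha, Finset.erase_insert ha,
      add_comm, Finset.smul_sum]
    congr 1
    refine Finset.sum_congr rfl fun j hj => ?_
    have hja : a ≠ j := fun h => ha (h ▸ hj)
    rw [Finset.erase_insert_of_ne hja, Finset.prod_insert (by simp [ha]), smul_smul]

/-! ### Connected parts of expectation values (cumulants). -/

section Connected

variable {ι M : Type*} [DecidableEq ι] [AddCommMonoid M]

/-- Both sides run over the ordered partitions of `J` into three parts. -/
lemma sum_powerset_sum_powerset (J : Finset ι) (F : Finset ι → Finset ι → Finset ι → M) :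
    ∑ I ∈ J.powerset, ∑ L ∈ I.powerset, F L (I \ L) (J \ I) =
      ∑ L ∈ J.powerset, ∑ N ∈ (J \ L).powerset, F L N ((J \ L) \ N) := by
  rw [Finset.sum_sigma', Finset.sum_sigma']
  refine Finset.sum_bij' (fun p _ => ⟨p.2, p.1 \ p.2⟩) (fun p _ => ⟨p.1 ∪ p.2, p.1⟩) ?_ ?_ ?_ ?_ ?_
  · rintro ⟨I, L⟩ h
    simp only [Finset.mem_sigma, Finset.mem_powerset] at h ⊢
    exact ⟨h.2.trans h.1, Finset.sdiff_subset_sdiff h.1 le_rfl⟩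
  · rintro ⟨L, N⟩ h
    simp only [Finset.mem_sigma, Finset.mem_powerset] at h ⊢
    exact ⟨Finset.union_subset h.1 (h.2.trans Finset.sdiff_subset), Finset.subset_union_left⟩
  · rintro ⟨I, L⟩ h
    simp only [Finset.mem_sigma, Finset.mem_powerset] at h
    simp only [Finset.union_sdiff_of_subset h.2]
  · rintro ⟨L, N⟩ h
    simp only [Finset.mem_sigma, Finset.mem_powerset] at h
    have h3 : Disjoint L N := by
      refine Finset.disjoint_left.2 fun a ha hb => ?_
      exact (Finset.mem_sdiff.1 (h.2 hb)).2 ha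
    have : (L ∪ N) \ L = N := by
      rw [Finset.union_sdiff_left, Finset.sdiff_eq_self_of_disjoint h3.symm]
    simp only [this]
  · rintro ⟨I, L⟩ h
    simp only [Finset.mem_sigma, Finset.mem_powerset] at h
    have : (J \ L) \ (I \ L) = J \ I := by
      ext a
      have := @h.2 a
      simp only [Finset.mem_sdiff]
      tauto
    simp only [this]

lemma sum_powerset_sum_mem (J : Finset ι) (F : ι → Finset ι → Finset ι → M) :
    ∑ I ∈ J.powerset, ∑ j ∈ I, F j (I.erase j) (J \ I) =
      ∑ j ∈ J, ∑ I ∈ (J.erase j).powerset, F j I (J.erase j \ I) := by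
  rw [Finset.sum_sigma', Finset.sum_sigma']
  refine Finset.sum_bij' (fun p _ => ⟨p.2, p.1.erase p.2⟩) (fun p _ => ⟨insert p.1 p.2, p.1⟩)
    ?_ ?_ ?_ ?_ ?_
  · rintro ⟨I, j⟩ h
    simp only [Finset.mem_sigma, Finset.mem_powerset] at h ⊢
    exact ⟨h.1 h.2, Finset.erase_subset_erase _ h.1⟩
  · rintro ⟨j, I⟩ h
    simp only [Finset.mem_sigma, Finset.mem_powerset] at h ⊢
    exact ⟨Finset.insert_subset h.1 (h.2.trans (Finset.erase_subset _ _)),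
      Finset.mem_insert_self _ _⟩
  · rintro ⟨I, j⟩ h
    simp only [Finset.mem_sigma, Finset.mem_powerset] at h
    simp only [Finset.insert_erase h.2]
  · rintro ⟨j, I⟩ h
    simp only [Finset.mem_sigma, Finset.mem_powerset] at h
    have h3 : j ∉ I := fun hj => by simpa using h.2 hj
    simp only [Finset.erase_insert h3]
  · rintro ⟨I, j⟩ h
    simp only [Finset.mem_sigma, Finset.mem_powerset] at h
    have : J.erase j \ I.erase j = J \ I := by
      ext a
      have := h.2
      by_cases ha : a = j
      · subst ha; simp [this]
      · simp [ha]
    simp only [this]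

lemma sum_powerset_sum_sdiff (J : Finset ι) (F : ι → Finset ι → Finset ι → M) :
    ∑ I ∈ J.powerset, ∑ j ∈ J \ I, F j I ((J \ I).erase j) =
      ∑ j ∈ J, ∑ I ∈ (J.erase j).powerset, F j I (J.erase j \ I) := by
  rw [Finset.sum_sigma', Finset.sum_sigma']
  refine Finset.sum_bij' (fun p _ => ⟨p.2, p.1⟩) (fun p _ => ⟨p.2, p.1⟩) ?_ ?_ ?_ ?_ ?_
  · rintro ⟨I, j⟩ h
    simp only [Finset.mem_sigma, Finset.mem_powerset, Finset.mem_sdiff] at h ⊢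
    exact ⟨h.2.1, Finset.subset_erase.2 ⟨h.1, h.2.2⟩⟩
  · rintro ⟨j, I⟩ h
    simp only [Finset.mem_sigma, Finset.mem_powerset, Finset.mem_sdiff, Finset.subset_erase] at h ⊢
    exact ⟨h.2.1, h.1, h.2.2⟩
  · rintro ⟨I, j⟩ h; rfl
  · rintro ⟨I, j⟩ h; rfl
  · rintro ⟨I, j⟩ h
    simp only [Finset.erase_sdiff_comm]

lemma sum_powerset_sdiff_comm (J : Finset ι) (F : Finset ι → Finset ι → M) :
    ∑ I ∈ J.powerset, F I (J \ I) = ∑ I ∈ J.powerset, F (J \ I) I := by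
  refine Finset.sum_bij' (fun I _ => J \ I) (fun I _ => J \ I) ?_ ?_ ?_ ?_ ?_ <;>
    simp +contextual

variable {R 𝓕 : Type*} [CommRing R] [CommRing 𝓕] [Algebra R 𝓕] (E : 𝓕 →ₗ[R] R) (X : ι → 𝓕)

/-- The expectation value of `f` multiplied by the insertions with indices in `J`. -/
def moment (f : 𝓕) (J : Finset ι) : R := E (f * ∏ j ∈ J, X j)

/-- The connected part, with respect to `f` and the insertions with indices in `J`, of the
expectation value of `f ∏_{j ∈ J} X j`, where `f` is kept as a single factor. -/
def conn (f : 𝓕) (J : Finset ι) : R :=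
  moment E X f J - ∑ I ∈ J.ssubsets.attach, conn f I.1 * moment E X 1 (J \ I.1)
termination_by J.card
decreasing_by exact Finset.card_lt_card (Finset.mem_ssubsets.1 I.2)

variable {E X}

lemma moment_one_empty (hE : E 1 = 1) : moment E X 1 ∅ = 1 := by simp [moment, hE]

lemma moment_mul (f : 𝓕) {a : ι} {J : Finset ι} (ha : a ∉ J) :
    moment E X (f * X a) J = moment E X f (insert a J) := by
  rw [moment, moment, Finset.prod_insert ha, mul_assoc]

lemma sum_powerset_eq_add_ssubsets (J : Finset ι) (F : Finset ι → M) :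
    ∑ I ∈ J.powerset, F I = F J + ∑ I ∈ J.ssubsets, F I := by
  rw [Finset.ssubsets, Finset.add_sum_erase _ _ (Finset.mem_powerset_self J)]

lemma sum_conn (hE : E 1 = 1) (f : 𝓕) (J : Finset ι) :
    ∑ I ∈ J.powerset, conn E X f I * moment E X 1 (J \ I) = moment E X f J := by
  rw [sum_powerset_eq_add_ssubsets, Finset.sdiff_self, moment_one_empty hE, conn, mul_one,
    Finset.sum_attach J.ssubsets fun I => conn E X f I * moment E X 1 (J \ I)]
  ring

/-- The relation between connected parts and moments is triangular with diagonal `E 1 = 1`, so it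
has only one solution. The identities for `conn` below are obtained by checking this relation on
moments. -/
lemma eq_conn (hE : E 1 = 1) (f : 𝓕) (c : Finset ι → R) (J : Finset ι)
    (h : ∀ J' ⊆ J, ∑ I ∈ J'.powerset, c I * moment E X 1 (J' \ I) = moment E X f J') :
    c J = conn E X f J := by
  induction J using Finset.strongInduction with
  | H J ih =>
    have h1 := (h J le_rfl).trans (sum_conn hE f J).symm
    rw [sum_powerset_eq_add_ssubsets, sum_powerset_eq_add_ssubsets] at h1
    have h2 : ∑ I ∈ J.ssubsets, c I * moment E X 1 (J \ I) =
        ∑ I ∈ J.ssubsets, conn E X f I * moment E X 1 (J \ I) := by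
      refine Finset.sum_congr rfl fun I hI => ?_
      have hI' := Finset.mem_ssubsets.1 hI
      rw [ih I hI' fun J' hJ' => h J' (hJ'.trans hI'.subset)]
    rw [h2, Finset.sdiff_self, moment_one_empty hE, mul_one, mul_one] at h1
    exact add_right_cancel h1

lemma moment_add (f g : 𝓕) (J : Finset ι) :
    moment E X (f + g) J = moment E X f J + moment E X g J := by
  simp [moment, add_mul]

lemma moment_smul (r : R) (f : 𝓕) (J : Finset ι) :
    moment E X (r • f) J = r * moment E X f J := by
  simp [moment]

lemma conn_add (hE : E 1 = 1) (f g : 𝓕) (J : Finset ι) :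
    conn E X (f + g) J = conn E X f J + conn E X g J := by
  refine (eq_conn hE (f + g) (fun J => conn E X f J + conn E X g J) J fun J' _ => ?_).symm
  simp only [add_mul, Finset.sum_add_distrib, sum_conn hE, moment_add]

lemma conn_smul (hE : E 1 = 1) (r : R) (f : 𝓕) (J : Finset ι) :
    conn E X (r • f) J = r * conn E X f J := by
  refine (eq_conn hE (r • f) (fun J => r * conn E X f J) J fun J' _ => ?_).symm
  simp only [mul_assoc, ← Finset.mul_sum, sum_conn hE, moment_smul]

variable (X) in
/-- `conn` as a linear map in its first argument. -/
def connL (hE : E 1 = 1) (J : Finset ι) : 𝓕 →ₗ[R] R where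
  toFun f := conn E X f J
  map_add' f g := conn_add hE f g J
  map_smul' r f := conn_smul hE r f J

lemma conn_empty (f : 𝓕) : conn E X f ∅ = E f := by
  have h : (∅ : Finset ι).ssubsets = ∅ := by simp [Finset.ssubsets]
  rw [conn, Finset.sum_attach (∅ : Finset ι).ssubsets fun I => conn E X f I * moment E X 1 (∅ \ I), h]
  simp [moment]

lemma conn_one (hE : E 1 = 1) (J : Finset ι) : conn E X 1 J = if J = ∅ then 1 else 0 := by
  refine (eq_conn hE 1 (fun J => if J = ∅ then 1 else 0) J fun J' _ => ?_).symm
  rw [Finset.sum_eq_single ∅]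
  · simp
  · intro b _ hb; simp [hb]
  · simp

/-- Integration by parts for connected parts. On moments it is `hD` applied to `f ∏ X j`: the
derivation hits either `f` or one insertion, and the factor `w` always stays with `f`. -/
lemma conn_derivation (hE : E 1 = 1) (D : Derivation R 𝓕 𝓕) (w : 𝓕)
    (hD : ∀ f, E (D f + f * w) = 0) (f : 𝓕) (J : Finset ι) :
    conn E X (D f + f * w) J + ∑ j ∈ J, conn E X (f * D (X j)) (J.erase j) = 0 := by
  have key := eq_conn hE (D f + f * w)
    (fun J => -∑ j ∈ J, conn E X (f * D (X j)) (J.erase j)) J fun J' _ => by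
      have h1 : ∀ I ∈ J'.powerset, (-∑ j ∈ I, conn E X (f * D (X j)) (I.erase j)) *
          moment E X 1 (J' \ I) =
          -∑ j ∈ I, conn E X (f * D (X j)) (I.erase j) * moment E X 1 (J' \ I) := by
        intro I _
        rw [neg_mul, Finset.sum_mul]
      rw [Finset.sum_congr rfl h1, Finset.sum_neg_distrib,
        sum_powerset_sum_mem J' fun j I K => conn E X (f * D (X j)) I * moment E X 1 K]
      simp only [sum_conn hE]
      have h2 := hD (f * ∏ j ∈ J', X j)
      rw [Derivation.leibniz, derivation_prod] at h2
      rw [← sub_eq_zero, ← neg_eq_zero, ← h2]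
      simp only [moment, smul_eq_mul, map_add, Finset.mul_sum, map_sum, add_mul]
      have h3 : ∀ j ∈ J', E (f * D (X j) * ∏ k ∈ J'.erase j, X k) =
          E (f * ((∏ k ∈ J'.erase j, X k) * D (X j))) := fun j _ => by congr 1; ring
      rw [Finset.sum_congr rfl h3]
      have h4 : (∏ j ∈ J', X j) * D f = D f * ∏ j ∈ J', X j := mul_comm _ _
      have h5 : f * (∏ j ∈ J', X j) * w = f * w * ∏ j ∈ J', X j := by ring
      rw [h4, h5]
      ring
  rw [← key]
  ring

lemma moment_insert_eq (hE : E 1 = 1) (f : 𝓕) {a : ι} {J : Finset ι} (ha : a ∉ J) :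
    moment E X f (insert a J) =
      ∑ I ∈ J.powerset, conn E X f I * moment E X 1 (insert a (J \ I)) +
      ∑ I ∈ J.powerset, conn E X f (insert a I) * moment E X 1 (J \ I) := by
  rw [← sum_conn hE, Finset.sum_powerset_insert ha]
  congr 1
  · refine Finset.sum_congr rfl fun I hI => ?_
    have : a ∉ I := fun h => ha (Finset.mem_powerset.1 hI h)
    rw [Finset.insert_sdiff_of_notMem _ this]
  · refine Finset.sum_congr rfl fun I hI => ?_
    have : insert a J \ insert a I = J \ I := by
      rw [Finset.insert_sdiff_insert, Finset.sdiff_insert, Finset.erase_eq_of_notMem]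
      simp [ha]
    rw [this]

/-- When the composite factor `f * X a` is split, its cluster either remains connected or falls
apart into a cluster of `f` and a cluster of `X a`, which share the insertions in `J`. -/
lemma conn_mul (hE : E 1 = 1) (f : 𝓕) {a : ι} {J : Finset ι} (ha : a ∉ J) :
    conn E X (f * X a) J = conn E X f (insert a J) +
      ∑ I ∈ J.powerset, conn E X f I * conn E X (X a) (J \ I) := by
  refine (eq_conn hE (f * X a) (fun J => conn E X f (insert a J) +
      ∑ I ∈ J.powerset, conn E X f I * conn E X (X a) (J \ I)) J fun J' hJ' => ?_).symm
  have ha' : a ∉ J' := fun h => ha (hJ' h)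
  rw [moment_mul f ha', moment_insert_eq hE f ha']
  simp only [add_mul, Finset.sum_add_distrib, Finset.sum_mul]
  rw [add_comm, sum_powerset_sum_powerset J' fun L N K =>
    conn E X f L * conn E X (X a) N * moment E X 1 K]
  congr 1
  refine Finset.sum_congr rfl fun I hI => ?_
  have h1 : a ∉ J' \ I := fun h => ha' (Finset.mem_sdiff.1 h).1
  rw [← moment_mul 1 h1, one_mul, ← sum_conn hE (X a), Finset.mul_sum]
  exact Finset.sum_congr rfl fun _ _ => by ring

/-- The product `X a * X b` is commutative, and the disconnected terms of `conn_mul` are symmetric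
under the exchange of `I` and its complement. -/
lemma conn_swap (hE : E 1 = 1) {a b : ι} {J : Finset ι} (ha : a ∉ J) (hb : b ∉ J) :
    conn E X (X a) (insert b J) = conn E X (X b) (insert a J) := by
  have h1 := conn_mul (X := X) hE (X a) hb
  have h2 := conn_mul (X := X) hE (X b) ha
  rw [mul_comm, h2, sum_powerset_sdiff_comm J fun I K => conn E X (X b) I * conn E X (X a) K] at h1
  have h3 : ∑ I ∈ J.powerset, conn E X (X b) (J \ I) * conn E X (X a) I =
      ∑ I ∈ J.powerset, conn E X (X a) I * conn E X (X b) (J \ I) :=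
    Finset.sum_congr rfl fun _ _ => mul_comm _ _
  rw [h3] at h1
  exact (add_right_cancel h1).symm

lemma conn_map {ι' : Type*} [DecidableEq ι'] (hE : E 1 = 1) (e : ι' ↪ ι) (f : 𝓕)
    (J : Finset ι') : conn E X f (J.map e) = conn E (X ∘ e) f J := by
  have hm : ∀ (g : 𝓕) (K : Finset ι'), moment E X g (K.map e) = moment E (X ∘ e) g K := by
    intro g K; simp [moment]
  refine eq_conn hE f (fun J => conn E X f (J.map e)) J fun J' _ => ?_
  rw [← hm, ← sum_conn hE]
  refine Finset.sum_bij' (fun I _ => I.map e) (fun I _ => I.preimage e e.injective.injOn)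
    ?_ ?_ ?_ ?_ ?_
  · intro I hI
    simpa using hI
  · intro I hI
    rw [Finset.mem_powerset] at hI ⊢
    intro x hx
    have := hI (Finset.mem_preimage.1 hx)
    simpa using this
  · intro I _
    ext x; simp
  · intro I hI
    rw [Finset.mem_powerset] at hI
    ext x
    simp only [Finset.mem_map, Finset.mem_preimage]
    constructor
    · rintro ⟨y, hy, rfl⟩; exact hy
    · intro hx
      obtain ⟨y, -, rfl⟩ := Finset.mem_map.1 (hI hx)
      exact ⟨y, hx, rfl⟩
  · intro I _
    rw [← hm, Finset.map_sdiff]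

/-- If the derivative of an expectation value is minus a covariance with `X o`, then the derivative
of a connected part is minus the connected part with the insertion `X o`. The scalars `γ j` that `Δ`
produces on the insertions appear on both sides of the moment relation and cancel. -/
lemma derivation_conn {S S' : Type*} [CommRing S] [CommRing S'] [Algebra S R] [Algebra S' 𝓕]
    (hE : E 1 = 1) (d : Derivation S R R) (Δ : Derivation S' 𝓕 𝓕) (x : R) (o : ι)
    (γ : ι → R)
    (hd : ∀ f, x * d (E f) = E (Δ f) - (E (f * X o) - E f * E (X o))) (f : 𝓕) {J : Finset ι}
    (ho : o ∉ J) (hX : ∀ j ∈ J, Δ (X j) = algebraMap R 𝓕 (γ j)) :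
    x * d (conn E X f J) = conn E X (Δ f) J - conn E X f (insert o J) := by
  have hmom : ∀ (g : 𝓕) (K : Finset ι), K ⊆ J → x * d (moment E X g K) =
      moment E X (Δ g) K + ∑ j ∈ K, γ j * moment E X g (K.erase j) -
        moment E X g (insert o K) + E (X o) * moment E X g K := by
    intro g K hK
    rw [← moment_mul g fun h => ho (hK h)]
    simp only [moment]
    rw [hd, Derivation.leibniz, derivation_prod]
    have h1 : ∀ j ∈ K, (∏ k ∈ K.erase j, X k) • Δ (X j) = γ j • ∏ k ∈ K.erase j, X k := by
      intro j hj
      rw [hX j (hK hj), smul_eq_mul, Algebra.smul_def, mul_comm]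
    rw [Finset.sum_congr rfl h1]
    have h2 : E (g • ∑ j ∈ K, γ j • ∏ k ∈ K.erase j, X k) =
        ∑ j ∈ K, γ j * E (g * ∏ k ∈ K.erase j, X k) := by
      rw [smul_eq_mul, Finset.mul_sum, map_sum]
      refine Finset.sum_congr rfl fun j _ => ?_
      rw [mul_smul_comm, map_smul, smul_eq_mul]
    rw [map_add, h2, smul_eq_mul, mul_comm (∏ j ∈ K, X j) (Δ g),
      show g * (∏ j ∈ K, X j) * X o = g * X o * ∏ j ∈ K, X j by ring]
    ring
  have key := eq_conn hE (Δ f) (fun I => x * d (conn E X f I) + conn E X f (insert o I)) J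
    fun J' hJ' => by
      have ho' : o ∉ J' := fun h => ho (hJ' h)
      have h1 := congrArg (fun t => x * d t) (sum_conn (X := X) hE f J')
      simp only [map_sum, Derivation.leibniz, smul_eq_mul, Finset.mul_sum] at h1
      rw [hmom f J' hJ', moment_insert_eq hE f ho'] at h1
      have h2 : ∀ I ∈ J'.powerset, x * (conn E X f I * d (moment E X 1 (J' \ I)) +
          moment E X 1 (J' \ I) * d (conn E X f I)) =
          x * d (conn E X f I) * moment E X 1 (J' \ I) +
          (∑ j ∈ J' \ I, γ j * (conn E X f I * moment E X 1 ((J' \ I).erase j)) -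
            conn E X f I * moment E X 1 (insert o (J' \ I)) +
            E (X o) * (conn E X f I * moment E X 1 (J' \ I))) := by
        intro I _
        have h3 := hmom 1 (J' \ I) (Finset.sdiff_subset.trans hJ')
        rw [Derivation.map_one_eq_zero] at h3
        have h4 : moment E X 0 (J' \ I) = 0 := by simp [moment]
        have h5 : ∑ j ∈ J' \ I, γ j * (conn E X f I * moment E X 1 ((J' \ I).erase j)) =
            conn E X f I * ∑ j ∈ J' \ I, γ j * moment E X 1 ((J' \ I).erase j) := by
          rw [Finset.mul_sum]
          exact Finset.sum_congr rfl fun _ _ => by ring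
        rw [h5]
        linear_combination conn E X f I * h3 + conn E X f I * h4
      rw [Finset.sum_congr rfl h2, Finset.sum_add_distrib, Finset.sum_add_distrib,
        Finset.sum_sub_distrib, sum_powerset_sum_sdiff J' fun j I K =>
          γ j * (conn E X f I * moment E X 1 K)] at h1
      simp only [← Finset.mul_sum, sum_conn hE] at h1
      simp only [add_mul, Finset.sum_add_distrib]
      linear_combination h1
  rw [← key]
  ring

end Connected

/-! ### Coefficientwise derivations and the exponential of a power series. -/

open PowerSeries in
/-- The coefficientwise extension of a derivation to formal power series. -/
def coeffDerivation {S M : Type*} [CommRing S] [CommRing M] [Algebra S M] (δ : Derivation S M M) :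
    Derivation S⟦X⟧ M⟦X⟧ M⟦X⟧ :=
  Derivation.mk'
    { toFun := fun f => PowerSeries.mk fun k => δ (coeff k f)
      map_add' := fun f g => by ext k; simp
      map_smul' := fun r f => by
        ext k
        simp only [Algebra.smul_def, algebraMap_apply'', RingHom.id_apply, coeff_mk, coeff_mul,
          map_sum, coeff_map]
        refine Finset.sum_congr rfl fun p _ => ?_
        rw [← Algebra.smul_def, Derivation.map_smul, Algebra.smul_def] }
    fun f g => by
      ext k
      simp only [LinearMap.coe_mk, AddHom.coe_mk, coeff_mk, coeff_mul, map_sum, smul_eq_mul,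
        map_add, Derivation.leibniz, Finset.sum_add_distrib]
      congr 1
      rw [← Finset.Nat.sum_antidiagonal_swap]
      exact Finset.sum_congr rfl fun _ _ => rfl

open PowerSeries

@[simp]
lemma coeff_coeffDerivation {S M : Type*} [CommRing S] [CommRing M] [Algebra S M]
    (δ : Derivation S M M) (f : M⟦X⟧) (k : ℕ) :
    coeff k (coeffDerivation δ f) = δ (coeff k f) := by
  simp [coeffDerivation, Derivation.mk']

section Exp

variable {M : Type*} [CommRing M] [Algebra ℂ M]

/-- The coefficients of the exponential of a power series. -/
def expCoeff (R : M⟦X⟧) : ℕ → M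
  | 0 => 1
  -- This is the coefficient of `X^k` in `Y' = R' Y`, solved for the coefficient `k + 1` of `Y`.
  | k + 1 => ((k + 1 : ℂ)⁻¹) • ∑ j : Fin (k + 1), ((k - j + 1 : ℕ) : M) * coeff (k - j + 1) R *
      expCoeff R j

/-- The exponential of a power series without constant coefficient. -/
def expSeries (R : M⟦X⟧) : M⟦X⟧ := PowerSeries.mk (expCoeff R)

lemma constantCoeff_expSeries (R : M⟦X⟧) : constantCoeff (expSeries R) = 1 := by
  rw [← coeff_zero_eq_constantCoeff_apply, expSeries, coeff_mk, expCoeff]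

lemma natCast_succ_mul_inv_smul (k : ℕ) (x : M) : ((k + 1 : ℂ)⁻¹ • x) * ((k : M) + 1) = x := by
  have h : ((k : M) + 1) = algebraMap ℂ M (k + 1) := by simp
  rw [h, mul_comm, ← Algebra.smul_def, smul_smul, mul_inv_cancel₀ (Nat.cast_add_one_ne_zero k),
    one_smul]

lemma derivative_expSeries (R : M⟦X⟧) :
    derivative M (expSeries R) = derivative M R * expSeries R := by
  ext k
  rw [coeff_derivative, expSeries, coeff_mk, expCoeff, natCast_succ_mul_inv_smul, coeff_mul,
    ← Finset.Nat.sum_antidiagonal_swap, Finset.Nat.sum_antidiagonal_eq_sum_range_succ_mk,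
    Finset.sum_range]
  refine Finset.sum_congr rfl fun j _ => ?_
  simp only [Prod.fst_swap, Prod.snd_swap, coeff_derivative, coeff_mk, Nat.cast_add, Nat.cast_one]
  ring

/-- The equation determines each coefficient from the earlier ones, the integers being invertible.
All identities for exponentials, primitives and logarithms are reduced to this uniqueness. -/
lemma eq_zero_of_derivative_eq (R Y : M⟦X⟧) (h : derivative M Y = R * Y)
    (h0 : constantCoeff Y = 0) : Y = 0 := by
  ext k
  rw [map_zero]
  induction k using Nat.strong_induction_on with
  | _ k ih =>
    cases k with
    | zero => simpa using h0
    | succ k =>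
      have h1 := congrArg (coeff k) h
      rw [coeff_derivative, coeff_mul, Finset.sum_eq_zero] at h1
      · have h2 := natCast_succ_mul_inv_smul k (coeff (k + 1) Y)
        rw [smul_mul_assoc, h1, smul_zero] at h2
        exact h2.symm
      · rintro ⟨i, j⟩ hij
        rw [Finset.HasAntidiagonal.mem_antidiagonal] at hij
        rw [ih j (by simp only at hij; omega), mul_zero]

lemma eq_expSeries (R Y : M⟦X⟧) (h : derivative M Y = derivative M R * Y)
    (h0 : constantCoeff Y = 1) : Y = expSeries R := by
  refine sub_eq_zero.1 (eq_zero_of_derivative_eq (derivative M R) _ ?_ ?_)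
  · rw [map_sub, h, derivative_expSeries]; ring
  · rw [map_sub, h0, constantCoeff_expSeries, sub_self]

lemma map_expSeries {N : Type*} [CommRing N] [Algebra ℂ N] (φ : M →+* N) (R : M⟦X⟧) :
    map φ (expSeries R) = expSeries (map φ R) := by
  have hd : ∀ f : M⟦X⟧, derivative N (map φ f) = map φ (derivative M f) := by
    intro f; ext k; simp [coeff_derivative]
  refine eq_expSeries _ _ ?_ ?_
  · rw [hd, hd, derivative_expSeries, map_mul]
  · rw [← coeff_zero_eq_constantCoeff_apply, coeff_map, coeff_zero_eq_constantCoeff_apply,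
      constantCoeff_expSeries, map_one]

/-- The difference of the two sides solves `Y' = R' Y`; since `R` has no constant coefficient, the
difference has none either. -/
lemma coeffDerivation_expSeries {S : Type*} [CommRing S] [Algebra S M] (δ : Derivation S M M)
    (R : M⟦X⟧) (hR : constantCoeff R = 0) :
    coeffDerivation δ (expSeries R) = coeffDerivation δ R * expSeries R := by
  have hd : ∀ f : M⟦X⟧, derivative M (coeffDerivation δ f) = coeffDerivation δ (derivative M f) := by
    intro f; ext k
    simp only [coeff_derivative, coeff_coeffDerivation, Derivation.leibniz, smul_eq_mul, map_add,
      Derivation.map_natCast, Derivation.map_one_eq_zero]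
    ring
  refine sub_eq_zero.1 (eq_zero_of_derivative_eq (derivative M R) _ ?_ ?_)
  · rw [map_sub, hd, derivative_expSeries, Derivation.leibniz, Derivation.leibniz, hd,
      derivative_expSeries]
    simp only [smul_eq_mul]
    ring
  · rw [map_sub, map_mul]
    simp only [← coeff_zero_eq_constantCoeff_apply, coeff_coeffDerivation]
    simp only [coeff_zero_eq_constantCoeff_apply, hR, constantCoeff_expSeries]
    simp

end Exp

/-! ### Formal Gaussian integration: the expectation `exp (½ ∑ Γᵢⱼ ∂ᵢ∂ⱼ)` at the origin. -/

section Gauss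

open MvPolynomial

variable {σ A : Type*} [Fintype σ] [CommRing A] [Algebra ℂ A]

/-- The second order operator `½ ∑ Γᵢⱼ ∂ᵢ∂ⱼ`. -/
def laplacian (Γ : σ → σ → A) : MvPolynomial σ A →ₗ[A] MvPolynomial σ A :=
  ∑ i, ∑ j, ((1 / 2 : ℂ) • Γ i j) • (pderiv i).toLinearMap ∘ₗ (pderiv j).toLinearMap

lemma laplacian_apply (Γ : σ → σ → A) (f : MvPolynomial σ A) :
    laplacian Γ f = ∑ i, ∑ j, ((1 / 2 : ℂ) • Γ i j) • pderiv i (pderiv j f) := by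
  simp [laplacian]

lemma pderiv_comm (i j : σ) (f : MvPolynomial σ A) :
    pderiv i (pderiv j f) = pderiv j (pderiv i f) := by
  classical
  induction f using MvPolynomial.induction_on with
  | C a => simp
  | add p q hp hq => simp [hp, hq]
  | mul_X p k hp =>
    simp only [Derivation.leibniz, map_add, smul_eq_mul, hp, pderiv_X, Pi.single_apply]
    split_ifs <;> simp <;> ring

lemma laplacian_X_mul (Γ : σ → σ → A) (hΓ : ∀ i j, Γ i j = Γ j i) (k : σ) (f : MvPolynomial σ A) :
    laplacian Γ (X k * f) = X k * laplacian Γ f + ∑ j, Γ k j • pderiv j f := by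
  classical
  have h1 : ∀ i j, pderiv i (pderiv j (X k * f)) = X k * pderiv i (pderiv j f) +
      (if i = k then pderiv j f else 0) + (if j = k then pderiv i f else 0) := by
    intro i j
    simp only [Derivation.leibniz, map_add, smul_eq_mul, pderiv_X, Pi.single_apply]
    split_ifs <;> subst_vars <;> simp_all <;> ring
  simp only [laplacian_apply, h1, smul_add, Finset.sum_add_distrib, smul_ite, smul_zero,
    Finset.sum_ite_irrel, Finset.sum_const_zero, Finset.sum_ite_eq', Finset.mem_univ, if_true,
    Finset.mul_sum, mul_smul_comm, add_assoc]
  congr 1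
  rw [← Finset.sum_add_distrib]
  refine Finset.sum_congr rfl fun j _ => ?_
  rw [hΓ j k, ← add_smul, ← add_smul]
  norm_num

lemma totalDegree_pderiv_le (i : σ) (f : MvPolynomial σ A) :
    (pderiv i f).totalDegree ≤ f.totalDegree - 1 := by
  classical
  conv_lhs => rw [f.as_sum, map_sum]
  refine totalDegree_finsetSum_le fun s hs => ?_
  rw [pderiv_monomial]
  by_cases h : s i = 0
  · simp [h]
  · refine (totalDegree_monomial_le _ _).trans ?_
    have h1 := le_totalDegree hs
    have h2 : s = (s - Finsupp.single i 1) + Finsupp.single i 1 := by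
      rw [tsub_add_cancel_of_le]
      simpa [Finsupp.single_le_iff] using Nat.one_le_iff_ne_zero.2 h
    have h3 : (s.sum fun _ e => e) = ((s - Finsupp.single i 1).sum fun _ e => e) + 1 := by
      conv_lhs => rw [h2]
      rw [Finsupp.sum_add_index' (by simp) (by simp)]
      simp
    have h4 : ((s - Finsupp.single i 1).sum fun _ => id) =
      ((s - Finsupp.single i 1).sum fun _ e => e) := rfl
    omega

lemma totalDegree_laplacian_le (Γ : σ → σ → A) (f : MvPolynomial σ A) :
    (laplacian Γ f).totalDegree ≤ f.totalDegree - 1 := by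
  rw [laplacian_apply]
  refine totalDegree_finsetSum_le fun i _ => totalDegree_finsetSum_le fun j _ => ?_
  refine (totalDegree_smul_le _ _).trans ((totalDegree_pderiv_le _ _).trans ?_)
  have := totalDegree_pderiv_le j f
  omega

/-- The crude bound `totalDegree - 1` suffices for termination. In degree zero the natural
subtraction gives no decrease, so there one uses that the operator kills constants. -/
lemma laplacian_pow_eq_zero (Γ : σ → σ → A) (k : ℕ) (f : MvPolynomial σ A)
    (hk : f.totalDegree < k) : (laplacian Γ ^ k) f = 0 := by
  induction k generalizing f with
  | zero => omega
  | succ k ih =>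
    rw [pow_succ, Module.End.mul_apply]
    rcases Nat.eq_zero_or_pos f.totalDegree with h | h
    · rw [(totalDegree_eq_zero_iff_eq_C).1 h, laplacian_apply]
      simp
    · exact ih _ (lt_of_le_of_lt (totalDegree_laplacian_le Γ f) (by omega))

/-- The partial sums of the Gaussian expectation value `exp (½ ∑ Γᵢⱼ ∂ᵢ∂ⱼ) f` at `0`. -/
def gaussPartial (Γ : σ → σ → A) (N : ℕ) : MvPolynomial σ A →ₗ[A] A where
  toFun f := ∑ k ∈ Finset.range N, ((k.factorial : ℂ)⁻¹) • constantCoeff ((laplacian Γ ^ k) f)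
  map_add' f g := by simp [Finset.sum_add_distrib]
  map_smul' r f := by
    rw [Finset.smul_sum]
    refine Finset.sum_congr rfl fun k _ => ?_
    rw [map_smul, MvPolynomial.constantCoeff_smul, RingHom.id_apply, smul_comm]

lemma gaussPartial_eq (Γ : σ → σ → A) {N N' : ℕ} (f : MvPolynomial σ A) (h : f.totalDegree < N)
    (h' : N ≤ N') : gaussPartial Γ N' f = gaussPartial Γ N f := by
  symm
  refine Finset.sum_subset (Finset.range_mono h') fun k _ hk => ?_
  rw [laplacian_pow_eq_zero Γ k f (by simp at hk; omega)]
  simp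

/-- The Gaussian expectation value with covariance `Γ`. -/
def gauss (Γ : σ → σ → A) : MvPolynomial σ A →ₗ[A] A where
  toFun f := gaussPartial Γ (f.totalDegree + 1) f
  -- The truncation order in the definition depends on the polynomial; additivity is proved at an
  -- order beyond all three degrees.
  map_add' f g := by
    have hf := gaussPartial_eq Γ f (Nat.lt_succ_self _)
      (le_max_left (f.totalDegree + 1) (max (g.totalDegree + 1) ((f + g).totalDegree + 1)))
    have hg := gaussPartial_eq Γ g (Nat.lt_succ_self _)
      ((le_max_left (g.totalDegree + 1) ((f + g).totalDegree + 1)).trans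
        (le_max_right (f.totalDegree + 1) _))
    have hfg := gaussPartial_eq Γ (f + g) (Nat.lt_succ_self _)
      ((le_max_right (g.totalDegree + 1) ((f + g).totalDegree + 1)).trans
        (le_max_right (f.totalDegree + 1) _))
    simp only [Nat.succ_eq_add_one] at hf hg hfg
    rw [← hf, ← hg, ← hfg, map_add]
  map_smul' r f := by
    rw [← gaussPartial_eq Γ (r • f) (Nat.lt_succ_self _)
      (Nat.succ_le_succ (totalDegree_smul_le r f)), map_smul]
    rfl

lemma gauss_eq (Γ : σ → σ → A) {N : ℕ} (f : MvPolynomial σ A) (h : f.totalDegree < N) :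
    gauss Γ f = ∑ k ∈ Finset.range N, ((k.factorial : ℂ)⁻¹) • constantCoeff ((laplacian Γ ^ k) f) :=
  (gaussPartial_eq Γ f (Nat.lt_succ_self _) h).symm

lemma gauss_one (Γ : σ → σ → A) : gauss Γ 1 = 1 := by
  rw [gauss_eq Γ 1 (N := 1) (by simp)]
  simp

lemma laplacian_comm_pderivs (Γ : σ → σ → A) (c : σ → A) (f : MvPolynomial σ A) :
    laplacian Γ (∑ j, c j • pderiv j f) = ∑ j, c j • pderiv j (laplacian Γ f) := by
  have h : ∀ i j l, pderiv i (pderiv j (pderiv l f)) = pderiv l (pderiv i (pderiv j f)) := by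
    intro i j l
    rw [pderiv_comm j l, pderiv_comm i l]
  have h1 : ∀ l, laplacian Γ (pderiv l f) = pderiv l (laplacian Γ f) := by
    intro l
    rw [laplacian_apply, laplacian_apply, map_sum]
    refine Finset.sum_congr rfl fun i _ => ?_
    rw [map_sum]
    refine Finset.sum_congr rfl fun j _ => ?_
    rw [h, Derivation.map_smul]
  rw [map_sum]
  refine Finset.sum_congr rfl fun l _ => ?_
  rw [map_smul, h1]

lemma laplacian_pow_X_mul (Γ : σ → σ → A) (hΓ : ∀ i j, Γ i j = Γ j i) (i : σ) (k : ℕ)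
    (f : MvPolynomial σ A) :
    (laplacian Γ ^ (k + 1)) (X i * f) = X i * (laplacian Γ ^ (k + 1)) f +
      (k + 1 : ℕ) • (laplacian Γ ^ k) (∑ j, Γ i j • pderiv j f) := by
  induction k generalizing f with
  | zero => simp [laplacian_X_mul Γ hΓ]
  | succ k ih =>
    rw [pow_succ, Module.End.mul_apply, laplacian_X_mul Γ hΓ, map_add, ih,
      ← laplacian_comm_pderivs, ← Module.End.mul_apply, ← Module.End.mul_apply, ← pow_succ,
      ← pow_succ]
    simp only [add_smul, one_smul]
    abel

/-- Wick's formula. The commutator of the second order operator with `X i` is `∑ⱼ Γᵢⱼ ∂ⱼ`, which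
commutes with the operator. Hence moving `X i` past the exponential adds exactly this term, and `X
i` itself vanishes at the origin. -/
lemma gauss_X_mul (Γ : σ → σ → A) (hΓ : ∀ i j, Γ i j = Γ j i) (i : σ) (f : MvPolynomial σ A) :
    gauss Γ (X i * f) = ∑ j, Γ i j * gauss Γ (pderiv j f) := by
  have h1 : ∑ j, Γ i j * gauss Γ (pderiv j f) = gauss Γ (∑ j, Γ i j • pderiv j f) := by
    simp [map_sum]
  rw [h1]
  set g := ∑ j, Γ i j • pderiv j f
  set N := max (X i * f).totalDegree g.totalDegree + 1
  rw [gauss_eq Γ (N := N + 1) (X i * f) (by omega), gauss_eq Γ (N := N) g (by omega),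
    Finset.sum_range_succ']
  simp only [laplacian_pow_X_mul Γ hΓ, map_add, map_mul, constantCoeff_X, zero_mul, zero_add,
    pow_zero, Module.End.one_apply, smul_zero, add_zero]
  refine Finset.sum_congr rfl fun k _ => ?_
  rw [map_nsmul, ← Nat.cast_smul_eq_nsmul ℂ, smul_smul, Nat.factorial_succ]
  congr 1
  have := Nat.cast_add_one_ne_zero (R := ℂ) k
  have := Nat.cast_ne_zero (R := ℂ).2 (Nat.factorial_ne_zero k)
  push_cast
  field_simp

lemma gauss_map {B : Type*} [CommRing B] [Algebra ℂ B] (φ : A →ₐ[ℂ] B) (Γ : σ → σ → A)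
    (f : MvPolynomial σ A) :
    gauss (fun i j => φ (Γ i j)) (MvPolynomial.map (φ : A →+* B) f) = φ (gauss Γ f) := by
  set N := max f.totalDegree (MvPolynomial.map (φ : A →+* B) f).totalDegree + 1
  have h1 : ∀ g : MvPolynomial σ A, laplacian (fun i j => φ (Γ i j)) (MvPolynomial.map (φ : A →+* B) g) =
      MvPolynomial.map (φ : A →+* B) (laplacian Γ g) := by
    intro g
    simp only [laplacian_apply, map_sum, pderiv_map, MvPolynomial.smul_eq_C_mul, map_mul,
      MvPolynomial.map_C, RingHom.coe_coe, map_smul]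
  have h2 : ∀ (k : ℕ) (g : MvPolynomial σ A),
      (laplacian (fun i j => φ (Γ i j)) ^ k) (MvPolynomial.map (φ : A →+* B) g) =
      MvPolynomial.map (φ : A →+* B) ((laplacian Γ ^ k) g) := by
    intro k
    induction k with
    | zero => simp
    | succ k ih => intro g; rw [pow_succ, pow_succ, Module.End.mul_apply, h1, ih]; rfl
  rw [gauss_eq Γ (N := N) f (by omega), gauss_eq _ (N := N) _ (by omega), map_sum]
  refine Finset.sum_congr rfl fun k _ => ?_
  rw [h2, map_smul, constantCoeff_map]
  rfl

end Gauss

/-! ### The series `κ` with `κ (κ - ħ) = X²`. -/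

section Kappa

variable {A : Type*} [CommRing A]

/-- The Catalan series at `-b² X²`. -/
def catalanSq (b : A) : A⟦X⟧ :=
  expand 2 two_ne_zero (rescale (-b ^ 2) (map (Nat.castRingHom A) catalanSeries))

/-- The solution `κ = a + b X² + …` of `κ (κ - a) = X²`, where `b = a⁻¹`. -/
def kappa (a b : A) : A⟦X⟧ := C a + C b * X ^ 2 * catalanSq b

/-- The functional equation `C = 1 + x C²` of the Catalan series at `x = -b² X²`. -/
lemma catalanSq_eq (b : A) : catalanSq b = 1 - C b ^ 2 * X ^ 2 * catalanSq b ^ 2 := by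
  have h := congrArg (fun f => expand 2 two_ne_zero (rescale (-b ^ 2)
    (map (Nat.castRingHom A) f))) catalanSeries_sq_mul_X_add_one
  simp only [map_add, map_mul, map_pow, map_X, map_one, rescale_X, expand_X] at h
  have hC : expand 2 two_ne_zero (C (-b ^ 2) : A⟦X⟧) = C (-b ^ 2) := expand_C _ _ _
  rw [hC] at h
  simp only [map_neg, map_pow] at h
  change catalanSq b ^ 2 * _ + 1 = catalanSq b at h
  linear_combination -h

lemma kappa_mul (a b : A) (h : a * b = 1) : kappa a b * (kappa a b - C a) = X ^ 2 := by
  have h1 : (C a : A⟦X⟧) * C b = 1 := by rw [← map_mul, h, map_one]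
  rw [kappa]
  linear_combination (X ^ 2 * catalanSq b) * h1 + X ^ 2 * catalanSq_eq b

lemma map_kappa {B : Type*} [CommRing B] (φ : A →+* B) (a b : A) :
    map φ (kappa a b) = kappa (φ a) (φ b) := by
  have h1 : map φ (catalanSq b) = catalanSq (φ b) := by
    rw [catalanSq, catalanSq, map_expand]
    congr 1
    ext k
    simp
  simp [kappa, h1]

lemma coeff_zero_kappa (a b : A) : coeff 0 (kappa a b) = a := by
  simp [kappa]

lemma constantCoeff_catalanSq (b : A) : constantCoeff (catalanSq b) = 1 := by
  rw [catalanSq_eq]; simp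

lemma coeff_one_kappa (a b : A) : coeff 1 (kappa a b) = 0 := by
  have : C b * X ^ 2 * catalanSq b = X ^ 2 * (C b * catalanSq b) := by ring
  rw [kappa, this, map_add, coeff_X_pow_mul']
  simp

lemma coeff_two_kappa (a b : A) : coeff 2 (kappa a b) = b := by
  have : C b * X ^ 2 * catalanSq b = X ^ 2 * (C b * catalanSq b) := by ring
  rw [kappa, this, map_add, coeff_X_pow_mul']
  simp [constantCoeff_catalanSq]

/-- The element `2κ - a` is the derivative of `κ (κ - a)` with respect to `κ`. Its invertibility
lets a derivation that kills `a` also kill `κ`. -/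
lemma isUnit_two_kappa_sub (a b : A) (h : a * b = 1) : IsUnit (2 * kappa a b - C a) := by
  rw [isUnit_iff_constantCoeff, map_sub, map_mul, ← coeff_zero_eq_constantCoeff_apply (kappa a b),
    coeff_zero_kappa, constantCoeff_C, show constantCoeff (2 : A⟦X⟧) = 2 from map_ofNat _ 2]
  exact IsUnit.of_mul_eq_one b (by linear_combination h)

end Kappa

/-! ### Geometric series and primitives. -/

section Series

variable {A : Type*} [CommRing A]

/-- `f ↦ (f - f(0)) / X`. -/
def divX (f : A⟦X⟧) : A⟦X⟧ := PowerSeries.mk fun k => coeff (k + 1) f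

lemma X_mul_divX (f : A⟦X⟧) : X * divX f = f - C (constantCoeff f) := by
  ext k
  cases k with
  | zero => simp
  | succ k => simp [divX, coeff_succ_X_mul]

/-- The power series of `1 / (ζ⁻¹ - X)`. -/
def geom (ζ : A) : A⟦X⟧ := PowerSeries.mk fun k => ζ ^ (k + 1)

lemma mul_geom {a ζ : A} (h : a * ζ = 1) : (C a - X) * geom ζ = 1 := by
  ext k
  rw [sub_mul, map_sub, coeff_C_mul, geom, coeff_mk]
  cases k with
  | zero => simp [h]
  | succ k =>
    rw [coeff_succ_X_mul, coeff_mk, coeff_one, if_neg k.succ_ne_zero]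
    linear_combination ζ ^ (k + 1) * h

lemma map_geom {B : Type*} [CommRing B] (φ : A →+* B) (ζ : A) : map φ (geom ζ) = geom (φ ζ) := by
  ext k; simp [geom]

/-- The primitive of a power series without constant coefficient. -/
def primitive [Algebra ℂ A] (f : A⟦X⟧) : A⟦X⟧ :=
  -- At `k = 0` the value `0⁻¹ = 0` makes the constant coefficient vanish, whatever the truncated
  -- index `k - 1` gives.
  PowerSeries.mk fun k => ((k : ℂ)⁻¹) • coeff (k - 1) f

lemma derivative_primitive [Algebra ℂ A] (f : A⟦X⟧) : derivative A (primitive f) = f := by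
  ext k
  rw [coeff_derivative, primitive, coeff_mk]
  have := natCast_succ_mul_inv_smul k (coeff k f)
  simpa using this

lemma constantCoeff_primitive [Algebra ℂ A] (f : A⟦X⟧) : constantCoeff (primitive f) = 0 := by
  rw [← coeff_zero_eq_constantCoeff_apply, primitive, coeff_mk]
  simp

lemma map_primitive [Algebra ℂ A] {B : Type*} [CommRing B] [Algebra ℂ B] (φ : A →ₐ[ℂ] B)
    (f : A⟦X⟧) : map (φ : A →+* B) (primitive f) = primitive (map (φ : A →+* B) f) := by
  ext k
  simp only [primitive, coeff_map, coeff_mk]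
  exact map_smul φ _ _

lemma eq_of_derivative_eq [Algebra ℂ A] {f g : A⟦X⟧} (h : derivative A f = derivative A g)
    (h0 : constantCoeff f = constantCoeff g) : f = g := by
  refine sub_eq_zero.1 (eq_zero_of_derivative_eq 0 _ ?_ ?_)
  · rw [map_sub, h]; ring
  · rw [map_sub, h0, sub_self]

end Series

/-! ### The action around a solution of the Bethe equations. -/

section Functional

variable {m : ℕ} {A : Type*} [CommRing A] [Algebra ℂ A]

/-- Formal power series whose coefficients are polynomials in the fluctuations `uᵢ`. -/
abbrev FluctSeries (m : ℕ) (A : Type*) [CommRing A] := (MvPolynomial (Fin m) A)⟦X⟧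

/-- `f(w X)`. -/
def substLin (w : MvPolynomial (Fin m) A) : A⟦X⟧ →+* FluctSeries m A :=
  (rescale w).comp (map MvPolynomial.C)

omit [Algebra ℂ A] in
lemma coeff_substLin (w : MvPolynomial (Fin m) A) (f : A⟦X⟧) (k : ℕ) :
    coeff k (substLin w f) = w ^ k * MvPolynomial.C (coeff k f) := by
  simp [substLin, coeff_rescale]

omit [Algebra ℂ A] in
lemma substLin_C (w : MvPolynomial (Fin m) A) (a : A) :
    substLin w (C a) = C (MvPolynomial.C a) := by
  ext k
  rw [coeff_substLin, coeff_C, coeff_C]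
  split_ifs with h <;> simp [h]

omit [Algebra ℂ A] in
lemma substLin_X (w : MvPolynomial (Fin m) A) : substLin w X = C w * X := by
  simp [substLin, rescale_X]

/-- The partial derivative with respect to the fluctuation `uᵢ`. -/
def fluctDeriv (i : Fin m) : Derivation A⟦X⟧ (FluctSeries m A) (FluctSeries m A) :=
  coeffDerivation (MvPolynomial.pderiv i)

omit [Algebra ℂ A] in
lemma coeffDerivation_substLin {S : Type*} [CommRing S] [Algebra S (MvPolynomial (Fin m) A)]
    (δ : Derivation S (MvPolynomial (Fin m) A) (MvPolynomial (Fin m) A))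
    (hδ : ∀ a : A, δ (MvPolynomial.C a) = 0) (w : MvPolynomial (Fin m) A) (f : A⟦X⟧) :
    coeffDerivation δ (substLin w f) = X * C (δ w) * substLin w (derivative A f) := by
  ext1 k
  rw [coeff_coeffDerivation, coeff_substLin, mul_assoc]
  cases k with
  | zero => simp [hδ]
  | succ k =>
    rw [coeff_succ_X_mul, coeff_C_mul, coeff_substLin, coeff_derivative, Derivation.leibniz, hδ,
      Derivation.leibniz_pow]
    simp
    ring

omit [Algebra ℂ A] in
lemma fluctDeriv_substLin (i : Fin m) (w : MvPolynomial (Fin m) A) (f : A⟦X⟧) :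
    fluctDeriv i (substLin w f) =
      X * C (MvPolynomial.pderiv i w) * substLin w (derivative A f) :=
  coeffDerivation_substLin _ (fun _ => MvPolynomial.pderiv_C) w f

/-- The linear statistic `∑ᵢ φᵢ(sᵢ + X uᵢ)`, for power series `φᵢ` centred at `sᵢ`. -/
def linStat (φ : Fin m → A⟦X⟧) : FluctSeries m A := ∑ i, substLin (MvPolynomial.X i) (φ i)

/-- The coefficientwise Gaussian expectation value. -/
def gaussSeries (Γ : Fin m → Fin m → A) : FluctSeries m A →ₗ[A⟦X⟧] A⟦X⟧ where
  toFun f := PowerSeries.mk fun k => gauss Γ (coeff k f)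
  map_add' f g := by ext k; simp
  map_smul' r f := by
    ext k
    rw [Algebra.smul_def, algebraMap_apply'', RingHom.id_apply, smul_eq_mul]
    simp only [coeff_mul, coeff_mk, map_sum, coeff_map, MvPolynomial.algebraMap_eq]
    refine Finset.sum_congr rfl fun p _ => ?_
    rw [← MvPolynomial.smul_eq_C_mul, map_smul, smul_eq_mul]

lemma coeff_gaussSeries (Γ : Fin m → Fin m → A) (f : FluctSeries m A) (k : ℕ) :
    coeff k (gaussSeries Γ f) = gauss Γ (coeff k f) := by
  simp [gaussSeries]

/-- The Hessian matrix of the action, `ħ²` times the matrix `T`. -/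
def dataHessian (ħ : A) (r : Fin m → Fin m → A) (v : Fin m → A⟦X⟧) (i j : Fin m) : A :=
  if i = j then ħ * coeff 1 (v i) + 2 * ħ ^ 2 * ∑ k, r i k ^ 2 else -2 * ħ ^ 2 * r i j ^ 2

/-- A nondegenerate solution of the Bethe equations over a commutative ring: `r i j` stands for
`1 / (sᵢ - sⱼ)`, `v i` for the Taylor series of `V'` at `sᵢ`, and `Γ` for the inverse of the Hessian
matrix of the action. -/
structure BetheData (m : ℕ) (A : Type*) [CommRing A] where
  ħ : A
  ħinv : A
  s : Fin m → A
  r : Fin m → Fin m → A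
  v : Fin m → A⟦X⟧
  Γ : Fin m → Fin m → A
  mul_ħinv : ħ * ħinv = 1
  -- With this convention the sums over `j ≠ i` become sums over all `j`; over `ℂ` it is the
  -- convention `0⁻¹ = 0`.
  r_self : ∀ i, r i i = 0
  r_mul : ∀ i j, i ≠ j → (s i - s j) * r i j = 1
  bethe : ∀ i, constantCoeff (v i) = 2 * ħ * ∑ j, r i j
  Γ_symm : ∀ i j, Γ i j = Γ j i
  hessian_mul : ∀ i k, ∑ j, dataHessian ħ r v i j * Γ j k = if i = k then 1 else 0

namespace BetheData

variable (D : BetheData m A)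

/-- The series `κ`, with `κ (κ - ħ) = X²`. -/
def kap : A⟦X⟧ := kappa D.ħ D.ħinv

/-- The matrix `ħ² T`. -/
def hess : Fin m → Fin m → A := dataHessian D.ħ D.r D.v

omit [Algebra ℂ A] in
lemma kap_mul : D.kap * (D.kap - C D.ħ) = X ^ 2 := kappa_mul _ _ D.mul_ħinv

omit [Algebra ℂ A] in
lemma r_neg (i j : Fin m) : D.r j i = -D.r i j := by
  rcases eq_or_ne i j with rfl | h
  · simp [D.r_self]
  · linear_combination -(D.r j i) * D.r_mul i j h - (D.r i j) * D.r_mul j i h.symm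

omit [Algebra ℂ A] in
lemma hess_symm (i j : Fin m) : D.hess i j = D.hess j i := by
  rcases eq_or_ne i j with rfl | h
  · rfl
  · simp only [hess, dataHessian, if_neg h, if_neg h.symm]
    rw [D.r_neg i j]; ring

/-- The expansion of `1 / (sᵢ - sⱼ + X (uᵢ - uⱼ))`. -/
def rho (i j : Fin m) : FluctSeries m A :=
  substLin (MvPolynomial.X j - MvPolynomial.X i) (geom (D.r i j))

omit [Algebra ℂ A] in
lemma rho_mul {i j : Fin m} (h : i ≠ j) :
    (C (MvPolynomial.C (D.s i - D.s j)) - X * C (MvPolynomial.X j - MvPolynomial.X i)) *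
      D.rho i j = 1 := by
  have := congrArg (substLin (MvPolynomial.X j - MvPolynomial.X i)) (mul_geom (D.r_mul i j h))
  rw [map_mul, map_sub, substLin_C, substLin_X, map_one] at this
  rw [rho, ← this]; ring

omit [Algebra ℂ A] in
lemma rho_neg (i j : Fin m) : D.rho j i = -D.rho i j := by
  ext1 k
  rw [rho, rho, map_neg, coeff_substLin, coeff_substLin, geom, geom, coeff_mk, coeff_mk,
    D.r_neg i j, ← neg_sub (MvPolynomial.X j), neg_pow _ k, neg_pow _ (k + 1)]
  have : ((-1 : MvPolynomial (Fin m) A) ^ k) * (-1) ^ k = 1 := by rw [← mul_pow]; simp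
  simp only [map_mul, map_pow, map_neg, map_one, pow_succ (-1 : MvPolynomial (Fin m) A)]
  linear_combination (-((MvPolynomial.X j - MvPolynomial.X i) ^ k * MvPolynomial.C (D.r i j) ^ (k + 1)
    : MvPolynomial (Fin m) A)) * this

/-- `κ ∑_{k ≠ l} ln(s_k - s_l) - ∑_k V(s_k)` at `s + X u`, up to a constant. -/
def preAction : FluctSeries m A :=
  -(algebraMap A⟦X⟧ (FluctSeries m A) D.kap * ∑ i, ∑ j,
      substLin (MvPolynomial.X j - MvPolynomial.X i) (primitive (geom (D.r i j)))) -
    linStat fun i => primitive (D.v i)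

/-- The logarithmic derivative `∂ᵢ` of the weight, as a function of `s + X u`. -/
def force (i : Fin m) : FluctSeries m A :=
  2 * algebraMap A⟦X⟧ (FluctSeries m A) D.kap * (∑ j, D.rho i j) -
    substLin (MvPolynomial.X i) (D.v i)

omit [Algebra ℂ A] in
lemma rho_self (i : Fin m) : D.rho i i = 0 := by
  ext1 k
  rw [rho, coeff_substLin, geom, coeff_mk, D.r_self]
  simp

omit [Algebra ℂ A] in
lemma fluctDeriv_linStat (i : Fin m) (φ : Fin m → A⟦X⟧) :
    fluctDeriv i (linStat φ) = X * substLin (MvPolynomial.X i) (derivative A (φ i)) := by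
  rw [linStat, map_sum, Finset.sum_eq_single i]
  · rw [fluctDeriv_substLin, MvPolynomial.pderiv_X_self]; simp
  · intro j _ hj
    rw [fluctDeriv_substLin, MvPolynomial.pderiv_X_of_ne hj]; simp
  · simp

lemma fluctDeriv_preAction (i : Fin m) : fluctDeriv i D.preAction = X * D.force i := by
  have h1 : ∀ k j : Fin m, fluctDeriv i (substLin (MvPolynomial.X j - MvPolynomial.X k)
      (primitive (geom (D.r k j)))) =
      X * ((if j = i then D.rho k j else 0) - (if k = i then D.rho k j else 0)) := by
    intro k j
    rw [fluctDeriv_substLin, derivative_primitive, map_sub, MvPolynomial.pderiv_X,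
      MvPolynomial.pderiv_X, Pi.single_apply, Pi.single_apply]
    split_ifs <;> simp [rho]
  rw [preAction, map_sub, map_neg, ← Algebra.smul_def, Derivation.map_smul, map_sum]
  simp only [map_sum, h1, fluctDeriv_linStat, derivative_primitive]
  simp only [← Finset.mul_sum, Finset.sum_sub_distrib, Finset.sum_ite_irrel, Finset.sum_const_zero,
    Finset.sum_ite_eq', Finset.mem_univ, if_true, Algebra.smul_def]
  have h2 : ∑ k, D.rho k i = -∑ k, D.rho i k := by
    rw [← Finset.sum_neg_distrib]
    exact Finset.sum_congr rfl fun k _ => D.rho_neg i k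
  rw [h2, force]
  ring

/-- The exponent of the weight, expanded around the critical point. -/
def action : FluctSeries m A :=
  PowerSeries.mk fun k => coeff (k + 2) (algebraMap A⟦X⟧ (FluctSeries m A) D.kap * D.preAction)

lemma coeff_zero_preAction : coeff 0 D.preAction = 0 := by
  simp only [preAction, linStat, coeff_zero_eq_constantCoeff, map_sub, map_neg, map_mul, map_sum]
  simp only [← coeff_zero_eq_constantCoeff_apply, coeff_substLin]
  simp [constantCoeff_primitive]

/-- At order one only the leading coefficient `ħ` of `κ` contributes, since the logarithms have no
constant term. The Bethe equations then say that `s` is a critical point. This is what makes the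
division by `X²` in `action` lossless. -/
lemma coeff_preAction_one : coeff 1 D.preAction = 0 := by
  have h0 : ∀ f : A⟦X⟧, coeff 0 (primitive f) = 0 := by
    intro f
    rw [coeff_zero_eq_constantCoeff_apply, constantCoeff_primitive]
  have h1 : ∀ f : A⟦X⟧, coeff 1 (primitive f) = constantCoeff f := by
    intro f; simp [primitive]
  rw [preAction, map_sub, map_neg, coeff_mul, Finset.Nat.sum_antidiagonal_eq_sum_range_succ_mk,
    Finset.sum_range_succ, Finset.sum_range_one]
  simp only [map_sum, Nat.sub_self, h0, map_zero, Finset.sum_const_zero, mul_zero, add_zero,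
    Nat.sub_zero, linStat, coeff_substLin, h1, pow_one, D.bethe, algebraMap_apply'', coeff_map, kap,
    coeff_zero_kappa, geom, constantCoeff_mk, zero_add]
  simp only [sub_mul, Finset.sum_sub_distrib, MvPolynomial.algebraMap_eq, map_mul, map_sum]
  rw [Finset.sum_comm]
  have h2 : ∀ i : Fin m, ∑ j, MvPolynomial.X i * MvPolynomial.C (D.r j i) =
      (-∑ j, MvPolynomial.X i * MvPolynomial.C (D.r i j) : MvPolynomial (Fin m) A) := by
    intro i
    rw [← Finset.sum_neg_distrib]
    refine Finset.sum_congr rfl fun j _ => ?_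
    rw [D.r_neg i j]; simp
  simp only [h2, Finset.sum_neg_distrib, ← Finset.mul_sum]
  have h3 : ∀ i : Fin m, (MvPolynomial.X i : MvPolynomial (Fin m) A) *
      (MvPolynomial.C 2 * MvPolynomial.C D.ħ * ∑ x, MvPolynomial.C (D.r i x)) =
      2 * MvPolynomial.C D.ħ * (MvPolynomial.X i * ∑ x, MvPolynomial.C (D.r i x)) := by
    intro i
    rw [show (MvPolynomial.C 2 : MvPolynomial (Fin m) A) = 2 from map_ofNat _ 2]; ring
  simp only [h3, ← Finset.mul_sum]
  ring

lemma X_sq_mul_action :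
    X ^ 2 * D.action = algebraMap A⟦X⟧ (FluctSeries m A) D.kap * D.preAction := by
  ext1 k
  rw [coeff_X_pow_mul']
  split_ifs with h
  · rw [action, coeff_mk, Nat.sub_add_cancel h]
  · have : k = 0 ∨ k = 1 := by omega
    rcases this with rfl | rfl
    · rw [coeff_mul, Finset.Nat.sum_antidiagonal_eq_sum_range_succ_mk]
      simp [coeff_zero_preAction, -coeff_zero_eq_constantCoeff]
    · rw [coeff_mul, Finset.Nat.sum_antidiagonal_eq_sum_range_succ_mk, Finset.sum_range_succ,
        Finset.sum_range_one]
      simp [coeff_zero_preAction, coeff_preAction_one, -coeff_zero_eq_constantCoeff]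

lemma X_mul_fluctDeriv_action (i : Fin m) :
    X * fluctDeriv i D.action = algebraMap A⟦X⟧ (FluctSeries m A) D.kap * D.force i := by
  have h := congrArg (fluctDeriv i) D.X_sq_mul_action
  have hX : (X ^ 2 * D.action : FluctSeries m A) = (X ^ 2 : A⟦X⟧) • D.action := by
    rw [Algebra.smul_def, algebraMap_apply'', map_pow, map_X]
  rw [hX, ← Algebra.smul_def, Derivation.map_smul, Derivation.map_smul, D.fluctDeriv_preAction,
    Algebra.smul_def, Algebra.smul_def, algebraMap_apply'', map_pow, map_X] at h
  refine X_mul_cancel ?_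
  linear_combination h

/-- The quadratic part of the action. -/
def quadratic : MvPolynomial (Fin m) A :=
  (-1 / 2 : ℂ) • ∑ i, ∑ j, MvPolynomial.C (D.hess i j) * MvPolynomial.X i * MvPolynomial.X j

end BetheData

end Functional

/-! ### Formal expectation values, their connected correlators and the loop equation. -/

namespace BetheData

section Expectation

variable {m : ℕ} {A : Type*} [CommRing A] [Algebra ℂ A] (D : BetheData m A)

omit [Algebra ℂ A] in
lemma hess_eq (i j : Fin m) : D.hess i j =
    (if i = j then D.ħ * coeff 1 (D.v i) + 2 * D.ħ ^ 2 * ∑ k, D.r i k ^ 2 else 0) -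
      2 * D.ħ ^ 2 * D.r i j ^ 2 := by
  rw [hess, dataHessian]
  split_ifs with h
  · subst h; rw [D.r_self]; ring
  · ring

/-- The leading part of the exponent is the Gaussian weight with precision matrix `ħ² T`, hence with
covariance `Γ`. Higher coefficients of `κ` do not enter, as `κ` has no term of order one and the
logarithms have no constant term. -/
lemma coeff_zero_action : coeff 0 D.action = D.quadratic := by
  have h2 : ∀ f : A⟦X⟧, coeff 2 (primitive f) = (1 / 2 : ℂ) • coeff 1 f := by
    intro f; simp [primitive]
  have hg : ∀ f : A⟦X⟧, coeff 0 (primitive f) = 0 := by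
    intro f; rw [coeff_zero_eq_constantCoeff_apply, constantCoeff_primitive]
  have h1 : ∀ f : A⟦X⟧, coeff 1 (primitive f) = constantCoeff f := by
    intro f; simp [primitive]
  have key : coeff 2 D.preAction = -(MvPolynomial.C D.ħ * ∑ i, ∑ j,
      (MvPolynomial.X j - MvPolynomial.X i) ^ 2 * MvPolynomial.C ((1 / 2 : ℂ) • D.r i j ^ 2)) -
      ∑ i, MvPolynomial.X i ^ 2 * MvPolynomial.C ((1 / 2 : ℂ) • coeff 1 (D.v i)) := by
    rw [preAction, map_sub, map_neg, coeff_mul, Finset.Nat.sum_antidiagonal_eq_sum_range_succ_mk,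
      Finset.sum_range_succ, Finset.sum_range_succ, Finset.sum_range_one]
    simp only [map_sum, Nat.sub_self, linStat, coeff_substLin, hg, h2, algebraMap_apply'',
      coeff_map, kap, coeff_zero_kappa, coeff_one_kappa, map_zero, zero_mul, mul_zero,
      Finset.sum_const_zero, add_zero, Nat.sub_zero, geom, coeff_mk, MvPolynomial.algebraMap_eq]
  rw [action, coeff_mk, zero_add, coeff_mul, Finset.Nat.sum_antidiagonal_eq_sum_range_succ_mk,
    Finset.sum_range_succ, Finset.sum_range_succ, Finset.sum_range_one]
  simp only [Nat.sub_self, coeff_zero_preAction, mul_zero, add_zero, Nat.sub_zero,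
    coeff_preAction_one, key, algebraMap_apply'', coeff_map, kap, coeff_zero_kappa,
    MvPolynomial.algebraMap_eq, Nat.reduceSub]
  have hhalf : ∀ a : A, MvPolynomial.C ((1 / 2 : ℂ) • a) =
      ((1 / 2 : ℂ) • MvPolynomial.C a : MvPolynomial (Fin m) A) := by
    intro a
    rw [Algebra.smul_def, map_mul, Algebra.smul_def, MvPolynomial.algebraMap_apply]
  have hr : ∀ i j : Fin m, (MvPolynomial.X j - MvPolynomial.X i) ^ 2 *
      MvPolynomial.C ((1 / 2 : ℂ) • D.r i j ^ 2) = (1 / 2 : ℂ) •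
      (MvPolynomial.C (D.r i j) ^ 2 * MvPolynomial.X i ^ 2 +
        MvPolynomial.C (D.r j i) ^ 2 * MvPolynomial.X j ^ 2 -
        2 * (MvPolynomial.C (D.r i j) ^ 2 * MvPolynomial.X i * MvPolynomial.X j) :
          MvPolynomial (Fin m) A) := by
    intro i j
    rw [hhalf, D.r_neg i j, mul_smul_comm]
    congr 1
    simp only [map_pow, map_neg]
    ring
  simp only [hr]
  simp only [hhalf, mul_smul_comm, ← Finset.smul_sum, Finset.sum_add_distrib,
    Finset.sum_sub_distrib]
  rw [Finset.sum_comm (f := fun i j => MvPolynomial.C (D.r j i) ^ 2 * MvPolynomial.X j ^ 2),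
    quadratic]
  simp only [hess_eq, map_sub, sub_mul, Finset.sum_sub_distrib]
  have hd : ∀ i : Fin m, ∑ j, MvPolynomial.C (if i = j then D.ħ * coeff 1 (D.v i) +
      2 * D.ħ ^ 2 * ∑ k, D.r i k ^ 2 else 0) * MvPolynomial.X i * MvPolynomial.X j =
      (MvPolynomial.C D.ħ * (MvPolynomial.X i ^ 2 * MvPolynomial.C (coeff 1 (D.v i))) +
      2 * MvPolynomial.C D.ħ ^ 2 * (∑ k, MvPolynomial.C (D.r i k) ^ 2 * MvPolynomial.X i ^ 2) :
        MvPolynomial (Fin m) A) := by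
    intro i
    rw [Finset.sum_eq_single i]
    · rw [if_pos rfl, ← Finset.sum_mul]
      simp only [map_add, map_mul, map_pow, map_sum, map_ofNat]
      ring
    · intro j _ hj; rw [if_neg hj.symm]; simp
    · simp
  have he : ∀ i j : Fin m, MvPolynomial.C (2 * D.ħ ^ 2 * D.r i j ^ 2) * MvPolynomial.X i *
      MvPolynomial.X j = (2 * MvPolynomial.C D.ħ ^ 2 * (MvPolynomial.C (D.r i j) ^ 2 *
        MvPolynomial.X i * MvPolynomial.X j) : MvPolynomial (Fin m) A) := by
    intro i j
    simp only [map_mul, map_pow, map_ofNat]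
    ring
  simp only [hd, he, Finset.sum_add_distrib, ← Finset.mul_sum]
  set S := ∑ i, ∑ j, MvPolynomial.C (D.r i j) ^ 2 * (MvPolynomial.X i : MvPolynomial (Fin m) A) ^ 2
  set U := ∑ i, ∑ j, MvPolynomial.C (D.r i j) ^ 2 * MvPolynomial.X i *
    (MvPolynomial.X j : MvPolynomial (Fin m) A)
  set W := ∑ i, (MvPolynomial.X i : MvPolynomial (Fin m) A) ^ 2 *
    MvPolynomial.C (coeff 1 (D.v i))
  simp only [Algebra.smul_def]
  have hm : algebraMap ℂ (MvPolynomial (Fin m) A) (-1 / 2) =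
      -algebraMap ℂ (MvPolynomial (Fin m) A) (1 / 2) := by rw [← map_neg]; norm_num
  rw [hm]
  have h22 : 2 * algebraMap ℂ (MvPolynomial (Fin m) A) (1 / 2) = 1 := by
    rw [← map_ofNat (algebraMap ℂ (MvPolynomial (Fin m) A)) 2, ← map_mul]; norm_num
  ring

lemma pderiv_quadratic (i : Fin m) : MvPolynomial.pderiv i D.quadratic =
    -∑ j, MvPolynomial.C (D.hess i j) * MvPolynomial.X j := by
  have h1 : ∀ k j : Fin m, MvPolynomial.pderiv i (MvPolynomial.C (D.hess k j) * MvPolynomial.X k *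
      MvPolynomial.X j) = (if j = i then MvPolynomial.C (D.hess i k) * MvPolynomial.X k else 0) +
      (if k = i then MvPolynomial.C (D.hess i j) * MvPolynomial.X j else 0) := by
    intro k j
    simp only [Derivation.leibniz, MvPolynomial.pderiv_C, MvPolynomial.pderiv_X, Pi.single_apply,
      smul_eq_mul]
    split_ifs with h2 h3 h3
    · subst h2; subst h3; ring
    · subst h2; rw [D.hess_symm k j]; ring
    · subst h3; ring
    · ring
  have h3 : MvPolynomial.pderiv i D.quadratic =
      (-1 / 2 : ℂ) • MvPolynomial.pderiv i (∑ k, ∑ j, MvPolynomial.C (D.hess k j) *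
        MvPolynomial.X k * MvPolynomial.X j) := by
    rw [quadratic, ← IsScalarTower.algebraMap_smul A (-1 / 2 : ℂ), Derivation.map_smul,
      IsScalarTower.algebraMap_smul]
  rw [h3]
  simp only [map_sum, h1, Finset.sum_add_distrib, Finset.sum_ite_irrel, Finset.sum_const_zero,
    Finset.sum_ite_eq', Finset.mem_univ, if_true]
  rw [← two_nsmul, ← Nat.cast_smul_eq_nsmul ℂ, smul_smul]
  norm_num

/-- Wick's formula contracted with the Hessian, which is the inverse of `Γ`. -/
lemma gauss_pderiv (i : Fin m) (f : MvPolynomial (Fin m) A) :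
    gauss D.Γ (MvPolynomial.pderiv i f) =
      gauss D.Γ ((∑ j, MvPolynomial.C (D.hess i j) * MvPolynomial.X j) * f) := by
  rw [Finset.sum_mul, map_sum]
  have h1 : ∀ j, gauss D.Γ (MvPolynomial.C (D.hess i j) * MvPolynomial.X j * f) =
      ∑ k, D.hess i j * D.Γ j k * gauss D.Γ (MvPolynomial.pderiv k f) := by
    intro j
    rw [mul_assoc, ← MvPolynomial.smul_eq_C_mul, map_smul, gauss_X_mul _ D.Γ_symm, smul_eq_mul,
      Finset.mul_sum]
    exact Finset.sum_congr rfl fun _ _ => by ring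
  simp only [h1]
  rw [Finset.sum_comm]
  simp only [← Finset.sum_mul]
  have h2 : ∀ k, ∑ j, D.hess i j * D.Γ j k = if i = k then 1 else 0 := D.hessian_mul i
  simp [h2]

/-- The non-Gaussian part of the weight. -/
def weight : FluctSeries m A := expSeries (D.action - C (coeff 0 D.action))

/-- The unnormalized expectation value. -/
def expect₀ : FluctSeries m A →ₗ[A⟦X⟧] A⟦X⟧ :=
  gaussSeries D.Γ ∘ₗ LinearMap.mulRight A⟦X⟧ D.weight

lemma expect₀_apply (f : FluctSeries m A) : D.expect₀ f = gaussSeries D.Γ (f * D.weight) := rfl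

lemma fluctDeriv_C (i : Fin m) (p : MvPolynomial (Fin m) A) :
    fluctDeriv i (C p) = C (MvPolynomial.pderiv i p) := by
  ext1 k
  rw [fluctDeriv, coeff_coeffDerivation, coeff_C, coeff_C]
  split_ifs <;> simp

lemma constantCoeff_action_sub : constantCoeff (D.action - C (coeff 0 D.action)) = 0 := by
  simp

/-- The integral of a total derivative vanishes. The quadratic part of the action is accounted for
by `gauss_pderiv`, the remainder by differentiating `weight`. -/
lemma expect₀_fluctDeriv (i : Fin m) (f : FluctSeries m A) :
    D.expect₀ (fluctDeriv i f + f * fluctDeriv i D.action) = 0 := by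
  have h1 : (fluctDeriv i f + f * fluctDeriv i D.action) * D.weight =
      fluctDeriv i (f * D.weight) + f * D.weight * C (MvPolynomial.pderiv i D.quadratic) := by
    have h2 : fluctDeriv i D.weight = (fluctDeriv i D.action -
        C (MvPolynomial.pderiv i D.quadratic)) * D.weight := by
      rw [weight, fluctDeriv, coeffDerivation_expSeries _ _ D.constantCoeff_action_sub, map_sub]
      congr 2
      rw [coeff_zero_action]
      exact fluctDeriv_C i _
    rw [Derivation.leibniz, h2, smul_eq_mul, smul_eq_mul]
    ring
  rw [expect₀_apply, h1, map_add]
  ext k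
  rw [map_add, coeff_gaussSeries, coeff_gaussSeries, fluctDeriv, coeff_coeffDerivation,
    gauss_pderiv, coeff_mul_C, pderiv_quadratic, ← map_add, mul_comm (coeff k _) (-_)]
  simp

/-- The partition function. -/
def partitionFn : A⟦X⟧ := D.expect₀ 1

lemma constantCoeff_partitionFn : constantCoeff D.partitionFn = 1 := by
  rw [← coeff_zero_eq_constantCoeff_apply, partitionFn, expect₀_apply, one_mul, coeff_gaussSeries,
    coeff_zero_eq_constantCoeff_apply, weight, constantCoeff_expSeries, gauss_one]

/-- The normalized expectation value. -/
def expect : FluctSeries m A →ₗ[A⟦X⟧] A⟦X⟧ := invOfUnit D.partitionFn 1 • D.expect₀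

lemma expect_apply (f : FluctSeries m A) :
    D.expect f = invOfUnit D.partitionFn 1 * D.expect₀ f := rfl

lemma expect_one : D.expect 1 = 1 := by
  rw [expect_apply]
  exact invOfUnit_mul _ _ D.constantCoeff_partitionFn

lemma partitionFn_mul_expect (f : FluctSeries m A) : D.partitionFn * D.expect f = D.expect₀ f := by
  rw [expect_apply, ← mul_assoc, mul_invOfUnit _ _ D.constantCoeff_partitionFn, one_mul]

lemma expect_fluctDeriv (i : Fin m) (f : FluctSeries m A) :
    D.expect (fluctDeriv i f + f * fluctDeriv i D.action) = 0 := by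
  rw [expect_apply, expect₀_fluctDeriv, mul_zero]

/-- The linear statistic of `φ`, multiplied by `κ`. -/
def stat (φ : Fin m → A⟦X⟧) : FluctSeries m A := D.kap • linStat φ

/-- The insertion of the linear statistic of `φ`: its fluctuating part, divided by `X`. -/
def insertion (φ : Fin m → A⟦X⟧) : FluctSeries m A := D.kap • divX (linStat φ)

omit [Algebra ℂ A] in
lemma constantCoeff_linStat (φ : Fin m → A⟦X⟧) :
    constantCoeff (linStat φ) = MvPolynomial.C (∑ i, constantCoeff (φ i)) := by
  rw [linStat, map_sum, map_sum]
  refine Finset.sum_congr rfl fun i _ => ?_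
  rw [← coeff_zero_eq_constantCoeff_apply, coeff_substLin]
  simp

omit [Algebra ℂ A] in
lemma X_smul (f : FluctSeries m A) : (X : A⟦X⟧) • f = X * f := by
  rw [Algebra.smul_def, algebraMap_apply'', map_X]

-- A connected part with at least one further insertion does not see constants, so there the
-- statistic counts as `X` times its insertion.
omit [Algebra ℂ A] in
lemma stat_eq (φ : Fin m → A⟦X⟧) : D.stat φ = (X : A⟦X⟧) • D.insertion φ +
    (D.kap * C (∑ i, constantCoeff (φ i))) • 1 := by
  have h : C (constantCoeff (linStat φ)) =
      algebraMap A⟦X⟧ (FluctSeries m A) (C (∑ i, constantCoeff (φ i))) := by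
    rw [constantCoeff_linStat, algebraMap_apply'', map_C]; rfl
  rw [insertion, smul_comm, X_smul, X_mul_divX, mul_smul, ← Algebra.algebraMap_eq_smul_one, ← h,
    ← smul_add, sub_add_cancel, stat]

omit [Algebra ℂ A] in
lemma fluctDeriv_insertion (i : Fin m) (φ : Fin m → A⟦X⟧) :
    fluctDeriv i (D.insertion φ) =
      D.kap • substLin (MvPolynomial.X i) (derivative A (φ i)) := by
  rw [insertion, Derivation.map_smul]
  congr 1
  have h := congrArg (fluctDeriv i) (X_mul_divX (linStat φ))
  rw [← X_smul, Derivation.map_smul, map_sub, fluctDeriv_linStat, constantCoeff_linStat,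
    X_smul] at h
  have h1 : fluctDeriv i (C (MvPolynomial.C (∑ i, constantCoeff (φ i)))) =
      (0 : FluctSeries m A) := by
    ext1 k
    rw [fluctDeriv, coeff_coeffDerivation, coeff_C]
    split_ifs <;> simp
  rw [h1, sub_zero] at h
  exact X_mul_cancel h

omit [Algebra ℂ A] in
lemma derivative_geom {a ζ : A} (h : a * ζ = 1) : derivative A (geom ζ) = geom ζ ^ 2 := by
  have h1 := mul_geom h
  have h2 := congrArg (derivative A) h1
  rw [Derivation.leibniz, map_sub, derivative_C, derivative_X, Derivation.map_one_eq_zero,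
    smul_eq_mul, smul_eq_mul] at h2
  linear_combination geom ζ * h2 - derivative A (geom ζ) * h1

-- Symmetrization in `i` and `j` of the partial fraction identity `1/((z-a)(a-b)) + 1/((z-b)(b-a)) =
-- 1/((z-a)(z-b))`. The double sum on the right also contains the diagonal, which is subtracted.
omit [Algebra ℂ A] in
lemma sum_mul_rho {z : A} {ζ : Fin m → A} (hζ : ∀ i, (z - D.s i) * ζ i = 1) :
    2 * ∑ i, substLin (MvPolynomial.X i) (geom (ζ i)) * ∑ j, D.rho i j =
      linStat (fun i => geom (ζ i)) ^ 2 - linStat fun i => geom (ζ i) ^ 2 := by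
  set g : Fin m → FluctSeries m A := fun i => substLin (MvPolynomial.X i) (geom (ζ i))
  have hg : ∀ i, (C (MvPolynomial.C (z - D.s i)) - C (MvPolynomial.X i) * X) * g i = 1 := by
    intro i
    have := congrArg (substLin (MvPolynomial.X i)) (mul_geom (hζ i))
    rwa [map_mul, map_sub, substLin_C, substLin_X, map_one] at this
  have h1 : ∀ i j, g i * D.rho i j + g j * D.rho j i = g i * g j - if i = j then g i ^ 2 else 0 := by
    intro i j
    rcases eq_or_ne i j with rfl | h
    · simp [rho_self, sq]
    · rw [if_neg h]
      have h2 := D.rho_mul h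
      have h3 := D.rho_neg i j
      simp only [map_sub] at h2 hg
      linear_combination (g j) * h3 + (g i * g j) * h2 + (D.rho i j * g j) * hg i -
        (D.rho i j * g i) * hg j
  have h2 : ∑ i, ∑ j, g j * D.rho j i = ∑ i, ∑ j, g i * D.rho i j := Finset.sum_comm
  have h3 := Finset.sum_congr rfl fun i (_ : i ∈ Finset.univ) =>
    Finset.sum_congr rfl fun j (_ : j ∈ Finset.univ) => h1 i j
  simp only [Finset.sum_add_distrib, Finset.sum_sub_distrib, h2, Finset.sum_ite_eq,
    Finset.mem_univ, if_true] at h3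
  have h4 : linStat (fun i => geom (ζ i)) ^ 2 = ∑ i, ∑ j, g i * g j := by
    rw [sq, linStat, Finset.sum_mul_sum]
  have h5 : linStat (fun i => geom (ζ i) ^ 2) = ∑ i, g i ^ 2 := by
    simp only [linStat, map_pow, g]
  rw [h4, h5, ← h3, two_mul]
  simp only [Finset.mul_sum]
  rfl

variable {ι : Type*} [DecidableEq ι] (φ : ι → Fin m → A⟦X⟧)

/-- The connected correlator of the linear statistic of `ψ` with the insertions `φ j`, `j ∈ J`. -/
def corr (ψ : Fin m → A⟦X⟧) (J : Finset ι) : A⟦X⟧ :=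
  conn D.expect (fun j => D.insertion (φ j)) (D.stat ψ) J

/-- The correlator as a linear functional of the statistic. -/
lemma corr_eq_connL (ψ : Fin m → A⟦X⟧) (J : Finset ι) : D.corr φ ψ J =
    connL (fun j => D.insertion (φ j)) D.expect_one J (D.stat ψ) := rfl

/-- One of the two factors is written as `X` times the insertion plus a constant `c`, and `conn_mul`
is applied. The terms with `c` cancel, so that the answer is again expressed through statistics
alone. -/
lemma conn_stat_mul_stat {a : ι} {J : Finset ι} (ha : a ∉ J) :
    conn D.expect (fun j => D.insertion (φ j)) (D.stat (φ a) * D.stat (φ a)) J =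
      X * D.corr φ (φ a) (insert a J) +
        ∑ I ∈ J.powerset, D.corr φ (φ a) I * D.corr φ (φ a) (J \ I) := by
  set c := D.kap * C (∑ i, constantCoeff (φ a i)) with hc
  have hst := D.stat_eq (φ a)
  have h1 : D.stat (φ a) * D.stat (φ a) = (X : A⟦X⟧) • (D.stat (φ a) * D.insertion (φ a)) +
      c • D.stat (φ a) := by
    conv_lhs => rw [hst]
    rw [mul_add, ← hst, mul_smul_comm, mul_smul_comm, mul_one]
  have h2 : ∀ K : Finset ι, X * conn D.expect (fun j => D.insertion (φ j)) (D.insertion (φ a)) K =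
      D.corr φ (φ a) K - c * if K = ∅ then 1 else 0 := by
    intro K
    rw [corr, hst, conn_add D.expect_one, conn_smul D.expect_one, conn_smul D.expect_one,
      conn_one D.expect_one]
    ring
  rw [h1, conn_add D.expect_one, conn_smul D.expect_one, conn_smul D.expect_one,
    conn_mul (X := fun j => D.insertion (φ j)) D.expect_one (D.stat (φ a)) ha, mul_add, add_assoc]
  congr 1
  rw [Finset.mul_sum]
  have h3 : ∀ I ∈ J.powerset, X * (conn D.expect (fun j => D.insertion (φ j)) (D.stat (φ a)) I *
      conn D.expect (fun j => D.insertion (φ j)) (D.insertion (φ a)) (J \ I)) =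
      D.corr φ (φ a) I * D.corr φ (φ a) (J \ I) -
        c * (D.corr φ (φ a) I * if J \ I = ∅ then 1 else 0) := by
    intro I _
    have := h2 (J \ I)
    rw [show conn D.expect (fun j => D.insertion (φ j)) (D.stat (φ a)) I = D.corr φ (φ a) I from rfl]
    linear_combination D.corr φ (φ a) I * this
  rw [Finset.sum_congr rfl h3, Finset.sum_sub_distrib, ← Finset.mul_sum,
    Finset.sum_eq_single (a := J) (f := fun I => D.corr φ (φ a) I * if J \ I = ∅ then 1 else 0)]
  · simp only [Finset.sdiff_self, if_true, mul_one, corr]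
    ring
  · intro I hI hIJ
    rw [if_neg, mul_zero]
    intro h
    exact hIJ (Finset.Subset.antisymm (Finset.mem_powerset.1 hI) (Finset.sdiff_eq_empty_iff_subset.1 h))
  · simp

/-- The loop equation. -/
lemma loop_equation {z : A} {ζ : Fin m → A} (hζ : ∀ i, (z - D.s i) * ζ i = 1) {a : ι}
    {J : Finset ι} (ha : a ∉ J) (hφ : φ a = fun i => geom (ζ i)) :
    X * D.corr φ (φ a) (insert a J) + ∑ I ∈ J.powerset, D.corr φ (φ a) I * D.corr φ (φ a) (J \ I) -
      C D.ħ * D.corr φ (fun i => geom (ζ i) ^ 2) J - D.corr φ (fun i => geom (ζ i) * D.v i) J +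
      X * ∑ j ∈ J, D.corr φ (fun i => geom (ζ i) * derivative A (φ j i)) (J.erase j) = 0 := by
  set L := connL (fun j => D.insertion (φ j)) D.expect_one
  have h1 : ∀ i : Fin m, L J (fluctDeriv i (substLin (MvPolynomial.X i) (geom (ζ i))) +
      substLin (MvPolynomial.X i) (geom (ζ i)) * fluctDeriv i D.action) +
      ∑ j ∈ J, L (J.erase j) (D.kap • substLin (MvPolynomial.X i)
        (geom (ζ i) * derivative A (φ j i))) = 0 := by
    intro i
    have := conn_derivation (X := fun j => D.insertion (φ j)) D.expect_one (fluctDeriv i)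
      (fluctDeriv i D.action) (D.expect_fluctDeriv i)
      (substLin (MvPolynomial.X i) (geom (ζ i))) J
    simp only [fluctDeriv_insertion, mul_smul_comm, ← map_mul] at this
    exact this
  -- The term with `X²` comes from differentiating `1 / (z - sᵢ - X uᵢ)`, the other one from the
  -- logarithmic derivative of the weight.
  have h2 : ∀ i : Fin m, (X : A⟦X⟧) • (fluctDeriv i (substLin (MvPolynomial.X i) (geom (ζ i))) +
      substLin (MvPolynomial.X i) (geom (ζ i)) * fluctDeriv i D.action) =
      (X ^ 2 : A⟦X⟧) • substLin (MvPolynomial.X i) (geom (ζ i) ^ 2) +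
        D.kap • (substLin (MvPolynomial.X i) (geom (ζ i)) * D.force i) := by
    intro i
    have hX : algebraMap A⟦X⟧ (FluctSeries m A) X = X := by rw [algebraMap_apply'', map_X]
    rw [smul_add, X_smul, X_smul, mul_left_comm, D.X_mul_fluctDeriv_action, fluctDeriv_substLin,
      MvPolynomial.pderiv_X_self, derivative_geom (hζ i), Algebra.smul_def, Algebra.smul_def,
      map_pow (algebraMap A⟦X⟧ (FluctSeries m A)), hX, map_one, map_pow]
    ring
  have h3 : ∑ i, (X : A⟦X⟧) • (fluctDeriv i (substLin (MvPolynomial.X i) (geom (ζ i))) +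
      substLin (MvPolynomial.X i) (geom (ζ i)) * fluctDeriv i D.action) =
      D.stat (φ a) * D.stat (φ a) - C D.ħ • D.stat (fun i => geom (ζ i) ^ 2) -
        D.stat (fun i => geom (ζ i) * D.v i) := by
    simp only [h2, force, mul_sub, Finset.sum_add_distrib, ← Finset.smul_sum,
      Finset.sum_sub_distrib]
    have h4 := D.sum_mul_rho hζ
    have h5 : ∑ i, substLin (MvPolynomial.X i) (geom (ζ i)) *
        (2 * (algebraMap A⟦X⟧ (FluctSeries m A)) D.kap * ∑ j, D.rho i j) =
        (algebraMap A⟦X⟧ (FluctSeries m A)) D.kap * (2 * ∑ i, substLin (MvPolynomial.X i)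
          (geom (ζ i)) * ∑ j, D.rho i j) := by
      simp only [Finset.mul_sum]
      exact Finset.sum_congr rfl fun i _ => Finset.sum_congr rfl fun j _ => by ring
    rw [h5, h4, hφ]
    simp only [stat, linStat, Algebra.smul_def, map_mul]
    -- The squares `geom ^ 2` occur with the coefficient `X²` from the test function and `-κ²` from
    -- the diagonal of the double sum. The equation for `κ` turns `X² - κ²` into `-ħ κ`.
    have h6 := congrArg (algebraMap A⟦X⟧ (FluctSeries m A)) D.kap_mul
    rw [map_mul, map_sub] at h6
    rw [← h6]
    ring
  have h4 := congrArg (fun f => X * f) (Finset.sum_congr rfl fun i (_ : i ∈ Finset.univ) => h1 i)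
  simp only [Finset.sum_add_distrib, Finset.sum_const_zero, mul_zero, mul_add] at h4
  rw [← map_sum, ← smul_eq_mul, ← map_smul, Finset.smul_sum, h3, map_sub, map_sub, map_smul,
    smul_eq_mul] at h4
  have h5 : L J (D.stat (φ a) * D.stat (φ a)) = _ := D.conn_stat_mul_stat φ ha
  rw [h5, Finset.sum_comm] at h4
  have h6 : ∀ j, ∑ i, L (J.erase j) (D.kap • substLin (MvPolynomial.X i)
      (geom (ζ i) * derivative A (φ j i))) =
      D.corr φ (fun i => geom (ζ i) * derivative A (φ j i)) (J.erase j) := by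
    intro j
    rw [← map_sum, ← Finset.smul_sum]
    rfl
  simp only [h6] at h4
  exact h4

lemma corr_swap {a b : ι} {J : Finset ι} (ha : a ∉ J) (hb : b ∉ J) :
    D.corr φ (φ a) (insert b J) = D.corr φ (φ b) (insert a J) := by
  have h : ∀ a b : ι, D.corr φ (φ a) (insert b J) =
      X * conn D.expect (fun j => D.insertion (φ j)) (D.insertion (φ a)) (insert b J) := by
    intro a b
    rw [corr, stat_eq, conn_add D.expect_one, conn_smul D.expect_one, conn_smul D.expect_one,
      conn_one D.expect_one, if_neg (Finset.insert_ne_empty _ _), mul_zero, add_zero]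
  rw [h, h, conn_swap (X := fun j => D.insertion (φ j)) D.expect_one ha hb]

lemma corr_map {ι' : Type*} [DecidableEq ι'] (e : ι' ↪ ι) (ψ : Fin m → A⟦X⟧) (J : Finset ι') :
    D.corr φ ψ (J.map e) = D.corr (φ ∘ e) ψ J :=
  conn_map D.expect_one e _ J

end Expectation

end BetheData

/-! ### Derivations acting on the coefficients of polynomials and on the covariance. -/

section PolyDerivation

variable {σ A : Type*} [CommRing A] [Algebra ℂ A]

/-- The ring homomorphism `a ↦ a + ε d a` to the dual numbers over the polynomial ring. -/
def dualLift (σ : Type*) (d : Derivation ℂ A A) :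
    A →+* TrivSqZeroExt (MvPolynomial σ A) (MvPolynomial σ A) where
  toFun a := TrivSqZeroExt.inl (MvPolynomial.C a) + TrivSqZeroExt.inr (MvPolynomial.C (d a))
  map_one' := by ext1 <;> simp
  map_zero' := by ext1 <;> simp
  map_add' a b := by ext1 <;> simp
  map_mul' a b := by ext1 <;> simp [mul_comm]

/-- The evaluation homomorphism to the dual numbers that extends `dualLift`. -/
def dualPoly (d : Derivation ℂ A A) :
    MvPolynomial σ A →+* TrivSqZeroExt (MvPolynomial σ A) (MvPolynomial σ A) :=
  MvPolynomial.eval₂Hom (dualLift σ d) fun i => TrivSqZeroExt.inl (MvPolynomial.X i)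

lemma fst_dualPoly (d : Derivation ℂ A A) (f : MvPolynomial σ A) : (dualPoly d f).fst = f := by
  induction f using MvPolynomial.induction_on with
  | C a => simp [dualPoly, dualLift]
  | add p q hp hq => simp [hp, hq]
  | mul_X p i hp => rw [map_mul, TrivSqZeroExt.fst_mul, hp]; simp [dualPoly]

lemma snd_dualPoly_C (d : Derivation ℂ A A) (a : A) :
    (dualPoly d (MvPolynomial.C a : MvPolynomial σ A)).snd = MvPolynomial.C (d a) := by
  simp [dualPoly, dualLift]

/-- The coefficientwise extension of a derivation to polynomials. -/
def polyDerivation (σ : Type*) (d : Derivation ℂ A A) :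
    Derivation ℂ (MvPolynomial σ A) (MvPolynomial σ A) :=
  Derivation.mk'
    { toFun := fun f => (dualPoly d f).snd
      map_add' := fun f g => by simp
      map_smul' := fun c f => by
        rw [Algebra.smul_def, MvPolynomial.algebraMap_apply, map_mul, TrivSqZeroExt.snd_mul,
          fst_dualPoly, snd_dualPoly_C]
        simp [Algebra.smul_def, MvPolynomial.algebraMap_apply] }
    fun f g => by
      simp [fst_dualPoly, mul_comm]

@[simp]
lemma polyDerivation_C (d : Derivation ℂ A A) (a : A) :
    polyDerivation σ d (MvPolynomial.C a) = MvPolynomial.C (d a) :=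
  snd_dualPoly_C d a

@[simp]
lemma polyDerivation_X (d : Derivation ℂ A A) (i : σ) :
    polyDerivation σ d (MvPolynomial.X i) = 0 := by
  change (dualPoly d (MvPolynomial.X i)).snd = 0
  simp [dualPoly]

lemma polyDerivation_smul (d : Derivation ℂ A A) (a : A) (f : MvPolynomial σ A) :
    polyDerivation σ d (a • f) = d a • f + a • polyDerivation σ d f := by
  rw [MvPolynomial.smul_eq_C_mul, Derivation.leibniz, polyDerivation_C,
    MvPolynomial.smul_eq_C_mul, MvPolynomial.smul_eq_C_mul, smul_eq_mul, smul_eq_mul]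
  ring

lemma constantCoeff_polyDerivation (d : Derivation ℂ A A) (f : MvPolynomial σ A) :
    MvPolynomial.constantCoeff (polyDerivation σ d f) = d (MvPolynomial.constantCoeff f) := by
  induction f using MvPolynomial.induction_on with
  | C a => simp
  | add p q hp hq => simp [hp, hq]
  | mul_X p i hp => simp

lemma polyDerivation_pderiv (d : Derivation ℂ A A) (i : σ) (f : MvPolynomial σ A) :
    polyDerivation σ d (MvPolynomial.pderiv i f) = MvPolynomial.pderiv i (polyDerivation σ d f) := by
  classical
  induction f using MvPolynomial.induction_on with
  | C a => simp
  | add p q hp hq => simp [hp, hq]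
  | mul_X p k hp =>
    simp only [Derivation.leibniz, map_add, smul_eq_mul, hp, MvPolynomial.pderiv_X,
      Pi.single_apply, polyDerivation_X]
    split_ifs <;> simp [add_comm]

variable [Fintype σ]

lemma polyDerivation_laplacian (d : Derivation ℂ A A) (Γ : σ → σ → A) (f : MvPolynomial σ A) :
    polyDerivation σ d (laplacian Γ f) = laplacian Γ (polyDerivation σ d f) +
      laplacian (fun i j => d (Γ i j)) f := by
  simp only [laplacian_apply, map_sum, polyDerivation_smul, polyDerivation_pderiv,
    Derivation.map_smul, Finset.sum_add_distrib]
  rw [add_comm]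

lemma laplacian_comm (Γ Γ' : σ → σ → A) (f : MvPolynomial σ A) :
    laplacian Γ (laplacian Γ' f) = laplacian Γ' (laplacian Γ f) := by
  classical
  have h : ∀ k (c : σ → A) (g : MvPolynomial σ A),
      laplacian Γ (∑ j, c j • MvPolynomial.pderiv k (MvPolynomial.pderiv j g)) =
      ∑ j, c j • MvPolynomial.pderiv k (MvPolynomial.pderiv j (laplacian Γ g)) := by
    intro k c g
    have h1 := laplacian_comm_pderivs Γ c (MvPolynomial.pderiv k g)
    have h2 := laplacian_comm_pderivs Γ (fun j => if j = k then 1 else 0) g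
    simp only [ite_smul, one_smul, zero_smul, Finset.sum_ite_eq', Finset.mem_univ, if_true] at h2
    simp only [pderiv_comm k]
    rw [h1, h2]
  rw [laplacian_apply Γ', map_sum, laplacian_apply Γ' (laplacian Γ f)]
  exact Finset.sum_congr rfl fun i _ => h i _ f

lemma polyDerivation_laplacian_pow (d : Derivation ℂ A A) (Γ : σ → σ → A) (k : ℕ)
    (f : MvPolynomial σ A) :
    polyDerivation σ d ((laplacian Γ ^ (k + 1)) f) =
      (laplacian Γ ^ (k + 1)) (polyDerivation σ d f) +
      (k + 1 : ℕ) • (laplacian Γ ^ k) (laplacian (fun i j => d (Γ i j)) f) := by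
  induction k generalizing f with
  | zero => simp [polyDerivation_laplacian]
  | succ k ih =>
    have hp : ∀ (k : ℕ) (g : MvPolynomial σ A),
        (laplacian Γ ^ k) (laplacian Γ g) = (laplacian Γ ^ (k + 1)) g := fun k g => by
      rw [pow_succ, Module.End.mul_apply]
    rw [← hp (k + 1) f, ih, polyDerivation_laplacian, map_add, ← laplacian_comm Γ, hp, hp,
      add_smul (k + 1) 1, one_smul]
    abel

/-- Besides the coefficients of `f`, the derivation hits the covariance in the exponent. Operators
with constant coefficients commute, so differentiating the exponential multiplies it by the
derivative of its exponent. -/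
lemma derivation_gauss (d : Derivation ℂ A A) (Γ : σ → σ → A) (f : MvPolynomial σ A) :
    d (gauss Γ f) = gauss Γ (polyDerivation σ d f) +
      gauss Γ (laplacian (fun i j => d (Γ i j)) f) := by
  set g := polyDerivation σ d f
  set h := laplacian (fun i j => d (Γ i j)) f
  set N := max f.totalDegree (max g.totalDegree h.totalDegree) + 1
  rw [gauss_eq Γ (N := N + 1) f (by omega), gauss_eq Γ (N := N + 1) g (by omega),
    gauss_eq Γ (N := N) h (by omega), Finset.sum_range_succ', Finset.sum_range_succ' (n := N)]
  simp only [map_add, map_sum, Derivation.map_smul, ← constantCoeff_polyDerivation,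
    polyDerivation_laplacian_pow, pow_zero, Module.End.one_apply, smul_add,
    Finset.sum_add_distrib]
  have h1 : ∀ (k : ℕ) (h : MvPolynomial σ A), (((k + 1).factorial : ℂ)⁻¹) • MvPolynomial.constantCoeff
      ((k + 1) • (laplacian Γ ^ k) h) =
      ((k.factorial : ℂ)⁻¹) • MvPolynomial.constantCoeff ((laplacian Γ ^ k) h) := by
    intro k h
    rw [map_nsmul, ← Nat.cast_smul_eq_nsmul ℂ, smul_smul, Nat.factorial_succ]
    congr 1
    have := Nat.cast_add_one_ne_zero (R := ℂ) k
    have := Nat.cast_ne_zero (R := ℂ).2 (Nat.factorial_ne_zero k)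
    push_cast
    field_simp
  simp only [h1]
  abel

end PolyDerivation

/-! ### Variation of the potential over a commutative ring. -/

section Variation

variable {m : ℕ} {A : Type*} [CommRing A] [Algebra ℂ A]

/-- The coefficientwise action of a derivation on power series. -/
def seriesDerivation (d : Derivation ℂ A A) : Derivation ℂ⟦X⟧ A⟦X⟧ A⟦X⟧ := coeffDerivation d

lemma coeff_seriesDerivation (d : Derivation ℂ A A) (f : A⟦X⟧) (k : ℕ) :
    coeff k (seriesDerivation d f) = d (coeff k f) :=
  coeff_coeffDerivation d f k

/-- The coefficientwise action of a derivation on `FluctSeries`. -/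
def fluctDerivation (m : ℕ) (d : Derivation ℂ A A) :
    Derivation ℂ⟦X⟧ (FluctSeries m A) (FluctSeries m A) :=
  coeffDerivation (polyDerivation (Fin m) d)

lemma coeff_fluctDerivation (d : Derivation ℂ A A) (f : FluctSeries m A) (k : ℕ) :
    coeff k (fluctDerivation m d f) = polyDerivation (Fin m) d (coeff k f) :=
  coeff_coeffDerivation (polyDerivation (Fin m) d) f k

lemma fluctDerivation_substLin (d : Derivation ℂ A A) {w : MvPolynomial (Fin m) A}
    (hw : polyDerivation (Fin m) d w = 0) (f : A⟦X⟧) :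
    fluctDerivation m d (substLin w f) = substLin w (seriesDerivation d f) := by
  ext1 k
  rw [coeff_fluctDerivation, coeff_substLin, coeff_substLin, Derivation.leibniz,
    Derivation.leibniz_pow, hw, polyDerivation_C, coeff_seriesDerivation]
  simp

lemma fluctDerivation_algebraMap (d : Derivation ℂ A A) (f : A⟦X⟧) :
    fluctDerivation m d (algebraMap A⟦X⟧ (FluctSeries m A) f) =
      algebraMap A⟦X⟧ (FluctSeries m A) (seriesDerivation d f) := by
  ext1 k
  rw [coeff_fluctDerivation, algebraMap_apply'', algebraMap_apply'', coeff_map, coeff_map,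
    coeff_seriesDerivation]
  exact polyDerivation_C d _

lemma fluctDerivation_C (d : Derivation ℂ A A) (p : MvPolynomial (Fin m) A) :
    fluctDerivation m d (C p) = C (polyDerivation (Fin m) d p) := by
  ext1 k
  rw [coeff_fluctDerivation, coeff_C, coeff_C]
  split_ifs <;> simp

lemma fluctDerivation_X (d : Derivation ℂ A A) :
    fluctDerivation m d X = 0 := by
  ext1 k
  rw [coeff_fluctDerivation, coeff_X]
  split_ifs <;> simp

lemma seriesDerivation_primitive (d : Derivation ℂ A A) (f : A⟦X⟧) :
    seriesDerivation d (primitive f) = primitive (seriesDerivation d f) := by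
  ext k
  simp only [coeff_seriesDerivation, primitive, coeff_mk, Derivation.map_smul]

lemma seriesDerivation_kappa (d : Derivation ℂ A A) {a b : A} (h : a * b = 1) (ha : d a = 0) :
    seriesDerivation d (kappa a b) = 0 := by
  have hX : seriesDerivation d (X : A⟦X⟧) = 0 := by
    ext k; rw [coeff_seriesDerivation, coeff_X]; split_ifs <;> simp
  have hC : seriesDerivation d (C a) = 0 := by
    ext k; rw [coeff_seriesDerivation, coeff_C]; split_ifs <;> simp [ha]
  have h1 := congrArg (seriesDerivation d) (kappa_mul a b h)
  rw [Derivation.leibniz, map_sub, hC, Derivation.leibniz_pow, hX, smul_zero, smul_zero,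
    smul_eq_mul, smul_eq_mul, sub_zero] at h1
  refine (isUnit_two_kappa_sub a b h).mul_left_cancel ?_
  linear_combination h1

namespace BetheData

variable (D : BetheData m A) (d : Derivation ℂ A A)

/-- The derivative of a solution of the Bethe equations in the direction of `d`, when `ħ` is
constant, is determined by the derivatives `wᵢ` of the Taylor series of the potential at fixed
position. -/
structure IsVariation (w : Fin m → A⟦X⟧) : Prop where
  d_ħ : d D.ħ = 0
  d_v : ∀ i, seriesDerivation d (D.v i) =
    derivative A (D.v i) * C (d (D.s i)) + derivative A (w i)

/-- `φᵢ` are the Taylor series at `sᵢ` of a function that does not depend on the parameters. -/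
def IsConstStat (φ : Fin m → A⟦X⟧) : Prop :=
  ∀ i, seriesDerivation d (φ i) = C (d (D.s i)) * derivative A (φ i)

lemma derivation_r (i j : Fin m) :
    d (D.r i j) = -(D.r i j ^ 2 * (d (D.s i) - d (D.s j))) := by
  rcases eq_or_ne i j with rfl | h
  · simp [D.r_self]
  · have h1 := congrArg d (D.r_mul i j h)
    rw [Derivation.leibniz, map_sub, Derivation.map_one_eq_zero, smul_eq_mul, smul_eq_mul] at h1
    linear_combination (D.r i j) * h1 - d (D.r i j) * D.r_mul i j h

lemma seriesDerivation_geom_r (i j : Fin m) :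
    seriesDerivation d (primitive (geom (D.r i j))) =
      -(C (d (D.s i) - d (D.s j)) * (geom (D.r i j) - C (D.r i j))) := by
  ext k
  rw [coeff_seriesDerivation, map_neg, coeff_C_mul, map_sub, primitive, coeff_mk, geom, coeff_mk,
    coeff_mk, coeff_C, Derivation.map_smul, Derivation.leibniz_pow, derivation_r]
  cases k with
  | zero => simp
  | succ k =>
    simp only [Nat.add_sub_cancel, Nat.succ_ne_zero, if_false, sub_zero, smul_eq_mul]
    rw [← Nat.cast_smul_eq_nsmul ℂ, smul_smul, inv_mul_cancel₀ (Nat.cast_ne_zero.2 k.succ_ne_zero),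
      one_smul]
    ring

variable {D d} {w : Fin m → A⟦X⟧}

lemma IsVariation.seriesDerivation_kap (h : D.IsVariation d w) : seriesDerivation d D.kap = 0 :=
  seriesDerivation_kappa d D.mul_ħinv h.d_ħ

/-- The constant `∑_{i ≠ j} δsᵢ / (sᵢ - sⱼ)`. -/
def shiftConst (D : BetheData m A) (d : Derivation ℂ A A) : A := ∑ i, d (D.s i) * ∑ j, D.r i j

lemma polyDerivation_X_sub (d : Derivation ℂ A A) (i j : Fin m) :
    polyDerivation (Fin m) d (MvPolynomial.X j - MvPolynomial.X i) = 0 := by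
  simp

/-- A scalar as an element of `FluctSeries`. -/
def sc (m : ℕ) {A : Type*} [CommRing A] : A →+* FluctSeries m A :=
  (C : MvPolynomial (Fin m) A →+* FluctSeries m A).comp MvPolynomial.C

omit [Algebra ℂ A] in
lemma sc_apply (a : A) : sc m a = C (MvPolynomial.C a) := rfl

omit [Algebra ℂ A] in
lemma substLin_C' (w : MvPolynomial (Fin m) A) (a : A) : substLin w (C a) = sc m a :=
  substLin_C w a

/-- At fixed `u` the points still move, which gives the force in the direction `d sᵢ`; to this is
added the explicit variation of the potential. Both are taken relative to `u = 0`, because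
`preAction` is normalized to vanish there, and by the Bethe equations the resulting constants
combine to a multiple of `κ - ħ`. -/
lemma IsVariation.fluctDerivation_preAction (h : D.IsVariation d w) :
    fluctDerivation m d D.preAction = ∑ i, sc m (d (D.s i)) * D.force i -
      (linStat w - sc m (∑ i, constantCoeff (w i))) -
      2 * (algebraMap A⟦X⟧ (FluctSeries m A) D.kap - sc m D.ħ) * sc m (D.shiftConst d) := by
  have hk := h.seriesDerivation_kap
  have hprim : ∀ i, seriesDerivation d (primitive (D.v i)) =
      C (d (D.s i)) * (D.v i - C (constantCoeff (D.v i))) + (w i - C (constantCoeff (w i))) := by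
    intro i
    rw [seriesDerivation_primitive, h.d_v]
    refine eq_of_derivative_eq ?_ ?_
    · rw [derivative_primitive]
      simp only [map_add, map_sub, Derivation.leibniz, derivative_C, smul_eq_mul]
      ring
    · rw [constantCoeff_primitive]
      simp
  have hlin : fluctDerivation m d (linStat fun i => primitive (D.v i)) =
      ∑ i, sc m (d (D.s i)) * substLin (MvPolynomial.X i) (D.v i) -
        2 * sc m D.ħ * sc m (D.shiftConst d) + (linStat w - sc m (∑ i, constantCoeff (w i))) := by
    rw [linStat, map_sum]
    simp only [fluctDerivation_substLin d (polyDerivation_X d _), hprim, map_add, map_sub, map_mul,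
      substLin_C', mul_sub, Finset.sum_add_distrib, Finset.sum_sub_distrib, D.bethe]
    simp only [linStat, map_sum, shiftConst, map_mul, map_ofNat, Finset.mul_sum]
    have : ∑ i, ∑ j, sc m (d (D.s i)) * (2 * sc m D.ħ * sc m (D.r i j)) =
      ∑ i, ∑ j, 2 * sc m D.ħ * (sc m (d (D.s i)) * sc m (D.r i j)) :=
      Finset.sum_congr rfl fun i _ => Finset.sum_congr rfl fun j _ => by ring
    rw [this]
  have hl : ∀ i j, fluctDerivation m d (substLin (MvPolynomial.X j - MvPolynomial.X i)
      (primitive (geom (D.r i j)))) =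
      -(sc m (d (D.s i)) * (D.rho i j - sc m (D.r i j)) +
        sc m (d (D.s j)) * (D.rho j i - sc m (D.r j i))) := by
    intro i j
    rw [fluctDerivation_substLin d (polyDerivation_X_sub d i j), seriesDerivation_geom_r, map_neg,
      map_mul, map_sub, map_sub, map_sub, substLin_C', substLin_C', substLin_C', D.rho_neg i j,
      D.r_neg i j]
    simp only [map_neg, rho]
    ring
  have hsum : fluctDerivation m d (∑ i, ∑ j, substLin (MvPolynomial.X j - MvPolynomial.X i)
      (primitive (geom (D.r i j)))) =
      -(2 * (∑ i, sc m (d (D.s i)) * ∑ j, D.rho i j) - 2 * sc m (D.shiftConst d)) := by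
    simp only [map_sum, hl, Finset.sum_neg_distrib, Finset.sum_add_distrib]
    rw [Finset.sum_comm (f := fun i j => sc m (d (D.s j)) * (D.rho j i - sc m (D.r j i)))]
    simp only [mul_sub, Finset.sum_sub_distrib, shiftConst, map_sum, map_mul, Finset.mul_sum]
    simp only [← Finset.mul_sum]
    ring
  rw [preAction, map_sub, map_neg, Derivation.leibniz, fluctDerivation_algebraMap, hk, hsum, hlin,
    map_zero, smul_zero, add_zero, smul_eq_mul]
  simp only [force, mul_sub, Finset.sum_sub_distrib]
  have h3 : ∑ i, sc m (d (D.s i)) * (2 * algebraMap A⟦X⟧ (FluctSeries m A) D.kap *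
      ∑ j, D.rho i j) = algebraMap A⟦X⟧ (FluctSeries m A) D.kap *
        (2 * ∑ i, sc m (d (D.s i)) * ∑ j, D.rho i j) := by
    rw [Finset.mul_sum, Finset.mul_sum]
    exact Finset.sum_congr rfl fun i _ => by ring
  rw [h3]
  ring

/-- The variation at fixed position, `X d - ∑ᵢ δsᵢ ∂ᵢ`. -/
def totalVariation (D : BetheData m A) (d : Derivation ℂ A A) :
    Derivation ℂ⟦X⟧ (FluctSeries m A) (FluctSeries m A) :=
  (X : FluctSeries m A) • fluctDerivation m d -
    ∑ i, sc m (d (D.s i)) • coeffDerivation ((MvPolynomial.pderiv i).restrictScalars ℂ)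

lemma totalVariation_apply (f : FluctSeries m A) : D.totalVariation d f =
    X * fluctDerivation m d f - ∑ i, sc m (d (D.s i)) * fluctDeriv i f := by
  rw [totalVariation, Derivation.sub_apply, Derivation.smul_apply, smul_eq_mul]
  congr 1
  have h : ∀ i, coeffDerivation ((MvPolynomial.pderiv i).restrictScalars ℂ) f =
      fluctDeriv i f := by
    intro i
    ext1 k
    rw [fluctDeriv, coeff_coeffDerivation, coeff_coeffDerivation]
    rfl
  have : ∀ s : Finset (Fin m), (∑ i ∈ s, sc m (d (D.s i)) •
      coeffDerivation ((MvPolynomial.pderiv i).restrictScalars ℂ) :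
      Derivation ℂ⟦X⟧ (FluctSeries m A) (FluctSeries m A)) f =
      ∑ i ∈ s, sc m (d (D.s i)) * fluctDeriv i f := by
    intro s
    induction s using Finset.induction_on with
    | empty => simp
    | insert a s ha ih => rw [Finset.sum_insert ha, Finset.sum_insert ha, Derivation.add_apply, ih, Derivation.smul_apply, smul_eq_mul, h]
  exact this _

/-- The shift of `u` in `totalVariation` compensates the motion of the points, so only the explicit
variation of the potential survives. The leftover normalization constant is multiplied by `κ (κ - ħ)
= X²` and therefore becomes a pure scalar. -/
lemma IsVariation.totalVariation_action (h : D.IsVariation d w) :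
    D.totalVariation d D.action = -D.insertion w - 2 * X * sc m (D.shiftConst d) := by
  have h1 := congrArg (fluctDerivation m d) D.X_sq_mul_action
  rw [Derivation.leibniz, Derivation.leibniz, Derivation.leibniz_pow, fluctDerivation_X,
    fluctDerivation_algebraMap, h.seriesDerivation_kap, h.fluctDerivation_preAction, map_zero,
    smul_zero, smul_zero, smul_zero, smul_zero, add_zero, add_zero, smul_eq_mul, smul_eq_mul] at h1
  have h2 : algebraMap A⟦X⟧ (FluctSeries m A) D.kap * ∑ i, sc m (d (D.s i)) * D.force i =
      X * ∑ i, sc m (d (D.s i)) * fluctDeriv i D.action := by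
    rw [Finset.mul_sum, Finset.mul_sum]
    refine Finset.sum_congr rfl fun i _ => ?_
    linear_combination -sc m (d (D.s i)) * D.X_mul_fluctDeriv_action i
  have h3 : X * D.insertion w = algebraMap A⟦X⟧ (FluctSeries m A) D.kap *
      (linStat w - sc m (∑ i, constantCoeff (w i))) := by
    rw [insertion, mul_smul_comm, X_mul_divX, constantCoeff_linStat, Algebra.smul_def, sc_apply]
  have h4 := congrArg (algebraMap A⟦X⟧ (FluctSeries m A)) D.kap_mul
  have hX : algebraMap A⟦X⟧ (FluctSeries m A) X = X := by rw [algebraMap_apply'', map_X]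
  have hC : algebraMap A⟦X⟧ (FluctSeries m A) (C D.ħ) = sc m D.ħ := by
    rw [algebraMap_apply'', map_C]; rfl
  rw [map_mul, map_sub, map_pow, hX, hC] at h4
  rw [totalVariation_apply]
  refine X_mul_cancel ?_
  linear_combination h1 + h2 + h3 - 2 * sc m (D.shiftConst d) * h4

/-- Half the logarithmic derivative of the determinant of the Hessian. -/
def halfTrace (D : BetheData m A) (d : Derivation ℂ A A) : A :=
  (1 / 2 : ℂ) • ∑ i, ∑ j, d (D.hess i j) * D.Γ i j

lemma derivation_Γ (D : BetheData m A) (d : Derivation ℂ A A) (a b : Fin m) :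
    d (D.Γ a b) = -∑ i, ∑ j, D.Γ a i * d (D.hess i j) * D.Γ j b := by
  have h1 : ∀ i, ∑ j, (d (D.hess i j) * D.Γ j b + D.hess i j * d (D.Γ j b)) = 0 := by
    intro i
    have h2 := congrArg d (D.hessian_mul i b)
    rw [map_sum] at h2
    have h3 : d (if i = b then (1 : A) else 0) = 0 := by split_ifs <;> simp
    rw [h3] at h2
    rw [← h2]
    refine Finset.sum_congr rfl fun j _ => ?_
    rw [Derivation.leibniz, smul_eq_mul, smul_eq_mul, hess]
    ring
  have h4 : ∑ i, D.Γ a i * ∑ j, (d (D.hess i j) * D.Γ j b + D.hess i j * d (D.Γ j b)) = 0 := by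
    simp [h1]
  simp only [Finset.sum_add_distrib, mul_add, Finset.mul_sum] at h4
  have h5 : ∑ i, ∑ j, D.Γ a i * (D.hess i j * d (D.Γ j b)) = d (D.Γ a b) := by
    rw [Finset.sum_comm]
    have h6 : ∀ j, ∑ i, D.Γ a i * (D.hess i j * d (D.Γ j b)) = (if j = a then 1 else 0) * d (D.Γ j b) := by
      intro j
      have h7 : ∑ i, D.hess j i * D.Γ i a = if j = a then 1 else 0 := D.hessian_mul j a
      rw [← h7, Finset.sum_mul]
      refine Finset.sum_congr rfl fun i _ => ?_
      rw [D.hess_symm j i, D.Γ_symm i a]; ring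
    simp [h6]
  rw [h5] at h4
  simp only [mul_assoc]
  linear_combination h4

lemma polyDerivation_quadratic (D : BetheData m A) (d : Derivation ℂ A A) :
    polyDerivation (Fin m) d D.quadratic =
      (-1 / 2 : ℂ) • ∑ i, ∑ j, d (D.hess i j) • (MvPolynomial.X i * MvPolynomial.X j) := by
  rw [quadratic, Derivation.map_smul]
  congr 1
  simp only [map_sum]
  refine Finset.sum_congr rfl fun i _ => Finset.sum_congr rfl fun j _ => ?_
  rw [mul_assoc, ← MvPolynomial.smul_eq_C_mul, polyDerivation_smul, Derivation.leibniz]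
  simp

/-- Inserting the variation of the quadratic form contracts both of its legs with `f`, which is the
variation of the covariance, or with each other, which is the trace. Together with
`derivation_gauss` it expresses the derivative of the Gaussian functional by an insertion. -/
lemma gauss_mul_polyDerivation_quadratic (D : BetheData m A) (d : Derivation ℂ A A)
    (f : MvPolynomial (Fin m) A) :
    gauss D.Γ (f * polyDerivation (Fin m) d D.quadratic) =
      gauss D.Γ (laplacian (fun i j => d (D.Γ i j)) f) - D.halfTrace d * gauss D.Γ f := by
  have hG : ∀ (c : ℂ) g, gauss D.Γ (c • g) = c • gauss D.Γ g := fun c g => by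
    rw [← IsScalarTower.algebraMap_smul A c g, map_smul, IsScalarTower.algebraMap_smul]
  have h1 : ∀ i j, gauss D.Γ (MvPolynomial.X i * MvPolynomial.X j * f) = D.Γ i j * gauss D.Γ f +
      ∑ a, ∑ b, D.Γ i a * D.Γ j b * gauss D.Γ (MvPolynomial.pderiv a (MvPolynomial.pderiv b f)) := by
    intro i j
    rw [mul_assoc, gauss_X_mul _ D.Γ_symm]
    have h2 : ∀ a, gauss D.Γ (MvPolynomial.pderiv a (MvPolynomial.X j * f)) =
        (if j = a then gauss D.Γ f else 0) +
          ∑ b, D.Γ j b * gauss D.Γ (MvPolynomial.pderiv a (MvPolynomial.pderiv b f)) := by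
      intro a
      rw [Derivation.leibniz, map_add, smul_eq_mul, smul_eq_mul, gauss_X_mul _ D.Γ_symm,
        MvPolynomial.pderiv_X, Pi.single_apply, add_comm]
      congr 1
      · split_ifs <;> simp
      · exact Finset.sum_congr rfl fun b _ => by rw [pderiv_comm]
    simp only [h2, mul_add, Finset.sum_add_distrib, mul_ite, mul_zero, Finset.sum_ite_eq,
      Finset.mem_univ, if_true, Finset.mul_sum, mul_assoc]
  have h3 : gauss D.Γ (f * polyDerivation (Fin m) d D.quadratic) =
      (-1 / 2 : ℂ) • ∑ i, ∑ j, d (D.hess i j) *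
        gauss D.Γ (MvPolynomial.X i * MvPolynomial.X j * f) := by
    rw [polyDerivation_quadratic, mul_smul_comm, hG, mul_comm f]
    simp only [Finset.sum_mul, map_sum, smul_mul_assoc, map_smul, smul_eq_mul]
  have h4 : gauss D.Γ (laplacian (fun i j => d (D.Γ i j)) f) = (1 / 2 : ℂ) • ∑ a, ∑ b, d (D.Γ a b) *
      gauss D.Γ (MvPolynomial.pderiv a (MvPolynomial.pderiv b f)) := by
    rw [laplacian_apply]
    simp only [map_sum, map_smul, smul_eq_mul, smul_mul_assoc, Finset.smul_sum]
  have h5 : ∑ a, ∑ b, d (D.Γ a b) * gauss D.Γ (MvPolynomial.pderiv a (MvPolynomial.pderiv b f)) =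
      -∑ i, ∑ j, d (D.hess i j) * ∑ a, ∑ b, D.Γ i a * D.Γ j b *
        gauss D.Γ (MvPolynomial.pderiv a (MvPolynomial.pderiv b f)) := by
    simp only [derivation_Γ, neg_mul, Finset.sum_neg_distrib, Finset.sum_mul, Finset.mul_sum]
    congr 1
    simp only [← Finset.univ_product_univ, ← Finset.sum_product']
    refine Finset.sum_bij' (fun p _ => (p.2.2.1, p.2.2.2, p.1, p.2.1))
      (fun p _ => (p.2.2.1, p.2.2.2, p.1, p.2.1)) ?_ ?_ ?_ ?_ ?_ <;> simp
    intro a b i j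
    rw [D.Γ_symm a i]; ring
  rw [h3, h4, h5, halfTrace]
  simp only [h1, mul_add, Finset.sum_add_distrib]
  have h6 : ∑ i, ∑ j, d (D.hess i j) * (D.Γ i j * gauss D.Γ f) =
      (∑ i, ∑ j, d (D.hess i j) * D.Γ i j) * gauss D.Γ f := by
    simp only [Finset.sum_mul, mul_assoc]
  rw [h6]
  simp only [smul_add, smul_neg, Algebra.smul_def]
  have hm : algebraMap ℂ A (-1 / 2) = -algebraMap ℂ A (1 / 2) := by rw [← map_neg]; norm_num
  rw [hm]
  ring

lemma seriesDerivation_gaussSeries (D : BetheData m A) (d : Derivation ℂ A A)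
    (f : FluctSeries m A) :
    seriesDerivation d (gaussSeries D.Γ f) =
      gaussSeries D.Γ (fluctDerivation m d f + f * C (polyDerivation (Fin m) d D.quadratic)) +
        C (D.halfTrace d) * gaussSeries D.Γ f := by
  ext k
  rw [coeff_seriesDerivation, coeff_gaussSeries, map_add, coeff_C_mul, coeff_gaussSeries,
    coeff_gaussSeries, map_add, coeff_fluctDerivation, coeff_mul_C, map_add,
    gauss_mul_polyDerivation_quadratic, derivation_gauss]
  ring

lemma fluctDerivation_weight (D : BetheData m A) (d : Derivation ℂ A A) :
    fluctDerivation m d D.weight = (fluctDerivation m d D.action -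
      C (polyDerivation (Fin m) d D.quadratic)) * D.weight := by
  have h := coeffDerivation_expSeries (polyDerivation (Fin m) d) _
    D.constantCoeff_action_sub
  have h2 : fluctDerivation m d D.weight =
      fluctDerivation m d (D.action - C (coeff 0 D.action)) * D.weight := h
  rw [h2, map_sub, fluctDerivation_C, coeff_zero_action]

/-- The logarithmic derivative of the normalization that is common to all expectation values. -/
def normShift (D : BetheData m A) (d : Derivation ℂ A A) : A :=
  D.halfTrace d - 2 * D.shiftConst d

/-- Differentiation under the integral sign: the exponent changes by the insertion of `w`, and the
normalization by the determinant and the logarithms at the points themselves. -/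
lemma IsVariation.expect₀ (h : D.IsVariation d w) (f : FluctSeries m A) :
    X * seriesDerivation d (D.expect₀ f) = D.expect₀ (D.totalVariation d f - f * D.insertion w) +
      X * C (D.normShift d) * D.expect₀ f := by
  have h1 : seriesDerivation d (D.expect₀ f) =
      D.expect₀ (fluctDerivation m d f + f * fluctDerivation m d D.action) +
        C (D.halfTrace d) * D.expect₀ f := by
    simp only [expect₀_apply]
    rw [seriesDerivation_gaussSeries, Derivation.leibniz, fluctDerivation_weight]
    congr 2
    simp only [smul_eq_mul]
    ring
  -- The derivative at fixed `u` differs from the variation at fixed position by total derivatives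
  -- in the direction `d sᵢ`, which integrate to zero.
  have h2 : X * (fluctDerivation m d f + f * fluctDerivation m d D.action) =
      D.totalVariation d f - f * D.insertion w - (X * C (2 * D.shiftConst d) : A⟦X⟧) • f +
      ∑ i, (C (d (D.s i)) : A⟦X⟧) • (fluctDeriv i f + f * fluctDeriv i D.action) := by
    have h3 := h.totalVariation_action
    rw [totalVariation_apply] at h3 ⊢
    have hX : algebraMap A⟦X⟧ (FluctSeries m A) X = X := by rw [algebraMap_apply'', map_X]
    have hC : ∀ a, algebraMap A⟦X⟧ (FluctSeries m A) (C a) = sc m a := by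
      intro a; rw [algebraMap_apply'', map_C]; rfl
    simp only [Algebra.smul_def, map_mul, hX, hC, mul_add, Finset.sum_add_distrib, map_ofNat]
    have h4 : ∑ i, sc m (d (D.s i)) * (f * fluctDeriv i D.action) =
        f * ∑ i, sc m (d (D.s i)) * fluctDeriv i D.action := by
      rw [Finset.mul_sum]; exact Finset.sum_congr rfl fun i _ => by ring
    rw [h4]
    linear_combination f * h3
  rw [h1, mul_add, ← smul_eq_mul, ← map_smul, X_smul, h2, map_add, map_sub _ _ (_ • f), map_smul,
    map_sum]
  simp only [map_smul, expect₀_fluctDeriv, mul_zero, Finset.sum_const_zero, smul_eq_mul,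
    normShift, map_sub, map_mul, map_ofNat]
  ring

lemma IsVariation.partitionFn (h : D.IsVariation d w) :
    X * seriesDerivation d D.partitionFn =
      (X * C (D.normShift d) - D.expect (D.insertion w)) * D.partitionFn := by
  have h1 := h.expect₀ 1
  rw [Derivation.map_one_eq_zero, one_mul, zero_sub, map_neg,
    ← D.partitionFn_mul_expect (D.insertion w)] at h1
  rw [BetheData.partitionFn, h1, BetheData.partitionFn]
  ring

/-- Division by the partition function removes `normShift` and replaces the product with the
insertion by a covariance; this is the hypothesis of `derivation_conn`. -/
lemma IsVariation.expect (h : D.IsVariation d w) (f : FluctSeries m A) :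
    X * seriesDerivation d (D.expect f) = D.expect (D.totalVariation d f) -
      (D.expect (f * D.insertion w) - D.expect f * D.expect (D.insertion w)) := by
  have h1 := congrArg (fun g => X * seriesDerivation d g) (D.partitionFn_mul_expect f)
  simp only [Derivation.leibniz, smul_eq_mul] at h1
  rw [h.expect₀, map_sub, ← D.partitionFn_mul_expect f, ← D.partitionFn_mul_expect (f * _),
    ← D.partitionFn_mul_expect (D.totalVariation d f)] at h1
  have h2 := h.partitionFn
  have hu : IsUnit D.partitionFn := by
    rw [isUnit_iff_constantCoeff, D.constantCoeff_partitionFn]; exact isUnit_one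
  refine hu.mul_left_cancel ?_
  linear_combination h1 - D.expect f * h2

lemma totalVariation_linStat {φ : Fin m → A⟦X⟧} (hφ : D.IsConstStat d φ) :
    D.totalVariation d (linStat φ) = 0 := by
  rw [totalVariation_apply]
  simp only [fluctDeriv_linStat]
  rw [linStat, map_sum, Finset.mul_sum, ← Finset.sum_sub_distrib]
  refine Finset.sum_eq_zero fun i _ => ?_
  rw [fluctDerivation_substLin d (polyDerivation_X d i), hφ i, map_mul, substLin_C']
  ring

lemma IsVariation.totalVariation_kap_smul (h : D.IsVariation d w) (f : FluctSeries m A) :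
    D.totalVariation d (D.kap • f) = D.kap • D.totalVariation d f := by
  have h1 : fluctDerivation m d (D.kap • f) = D.kap • fluctDerivation m d f := by
    rw [Algebra.smul_def, Derivation.leibniz, fluctDerivation_algebraMap, h.seriesDerivation_kap,
      map_zero, smul_zero, add_zero, smul_eq_mul, Algebra.smul_def]
  rw [totalVariation_apply, totalVariation_apply, h1]
  simp only [Derivation.map_smul, mul_smul_comm, smul_sub, Finset.smul_sum]

/-- The statistic of a fixed function does not vary at fixed position. Its insertion has the value
at `u = 0` subtracted, and that value moves by a scalar. -/
lemma IsVariation.totalVariation_insertion (h : D.IsVariation d w) {φ : Fin m → A⟦X⟧}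
    (hφ : D.IsConstStat d φ) : D.totalVariation d (D.insertion φ) =
      algebraMap A⟦X⟧ (FluctSeries m A) (-(D.kap * C (d (∑ i, constantCoeff (φ i))))) := by
  have h1 := congrArg (D.totalVariation d) (X_mul_divX (linStat φ))
  have hX : D.totalVariation d X = 0 := by
    rw [totalVariation_apply, fluctDerivation_X]
    have : ∀ i, fluctDeriv i (X : FluctSeries m A) = 0 := by
      intro i
      ext1 k
      rw [fluctDeriv, coeff_coeffDerivation, coeff_X]
      split_ifs <;> simp
    simp [this]
  have hC : D.totalVariation d (C (constantCoeff (linStat φ))) =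
      X * sc m (d (∑ i, constantCoeff (φ i))) := by
    rw [totalVariation_apply, constantCoeff_linStat, fluctDerivation_C, polyDerivation_C]
    simp [fluctDeriv_C, sc_apply]
  rw [Derivation.leibniz, hX, smul_zero, add_zero, map_sub, totalVariation_linStat hφ, hC,
    zero_sub, smul_eq_mul, ← mul_neg] at h1
  rw [insertion, h.totalVariation_kap_smul, X_mul_cancel h1, Algebra.smul_def, map_neg, map_mul,
    algebraMap_apply'', algebraMap_apply'', map_C]
  simp [sc_apply]

variable {ι : Type*} [DecidableEq ι]

/-- The variation of the connected correlators is the insertion of the variation of the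
potential. -/
lemma IsVariation.corr (h : D.IsVariation d w) (φ : ι → Fin m → A⟦X⟧) {ψ : Fin m → A⟦X⟧}
    {o : ι} {J : Finset ι} (ho : o ∉ J) (hw : φ o = w) (hφ : ∀ j ∈ J, D.IsConstStat d (φ j))
    (hψ : D.IsConstStat d ψ) :
    X * seriesDerivation d (D.corr φ ψ J) = -D.corr φ ψ (insert o J) := by
  have key := derivation_conn (X := fun j => D.insertion (φ j)) D.expect_one
    (seriesDerivation d) (D.totalVariation d) X o
    (fun j => -(D.kap * C (d (∑ i, constantCoeff (φ j i)))))
    (fun f => by simp only [hw]; exact h.expect f) (D.stat ψ) ho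
    fun j hj => h.totalVariation_insertion (hφ j hj)
  have h0 : D.totalVariation d (D.stat ψ) = 0 := by
    rw [stat, h.totalVariation_kap_smul, totalVariation_linStat hψ, smul_zero]
  have h1 : conn D.expect (fun j => D.insertion (φ j)) 0 J = 0 :=
    map_zero (connL (fun j => D.insertion (φ j)) D.expect_one J)
  rw [h0, h1, zero_sub] at key
  exact key

end BetheData

end Variation

/-! ### Compatibility of the correlators with homomorphisms of the coefficient ring. -/

lemma map_conn {ι R R' 𝓕 𝓕' : Type*} [DecidableEq ι] [CommRing R] [CommRing R'] [CommRing 𝓕]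
    [CommRing 𝓕'] [Algebra R 𝓕] [Algebra R' 𝓕'] {E : 𝓕 →ₗ[R] R} {E' : 𝓕' →ₗ[R'] R'} (hE : E 1 = 1)
    (hE' : E' 1 = 1) (α : R →+* R') (β : 𝓕 →+* 𝓕') (h : ∀ f, α (E f) = E' (β f)) (X : ι → 𝓕) (f : 𝓕)
    (J : Finset ι) : α (conn E X f J) = conn E' (fun j => β (X j)) (β f) J := by
  have hm : ∀ (g : 𝓕) (K : Finset ι), α (moment E X g K) = moment E' (fun j => β (X j)) (β g) K := by
    intro g K
    rw [moment, h, map_mul, map_prod, moment]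
  refine eq_conn hE' (β f) (fun J => α (conn E X f J)) J fun J' _ => ?_
  have hm1 := hm 1
  rw [map_one] at hm1
  simp only [← hm, ← hm1, ← map_mul, ← map_sum, sum_conn hE]

section

variable {m : ℕ} {A B : Type*} [CommRing A] [CommRing B]

/-- The map of `FluctSeries` induced by a ring homomorphism. -/
def mapFluct (m : ℕ) (φ : A →+* B) : FluctSeries m A →+* FluctSeries m B :=
  PowerSeries.map (MvPolynomial.map φ)

lemma coeff_mapFluct (φ : A →+* B) (f : FluctSeries m A) (k : ℕ) :
    coeff k (mapFluct m φ f) = MvPolynomial.map φ (coeff k f) := coeff_map _ _ _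

lemma mapFluct_substLin (φ : A →+* B) (w : MvPolynomial (Fin m) A) (f : A⟦X⟧) :
    mapFluct m φ (substLin w f) = substLin (MvPolynomial.map φ w) (PowerSeries.map φ f) := by
  ext1 k
  simp [coeff_mapFluct, coeff_substLin]

lemma mapFluct_linStat (φ : A →+* B) (ψ : Fin m → A⟦X⟧) :
    mapFluct m φ (linStat ψ) = linStat fun i => PowerSeries.map φ (ψ i) := by
  simp [linStat, mapFluct_substLin]

lemma mapFluct_algebraMap (φ : A →+* B) (f : A⟦X⟧) :
    mapFluct m φ (algebraMap A⟦X⟧ (FluctSeries m A) f) =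
      algebraMap B⟦X⟧ (FluctSeries m B) (PowerSeries.map φ f) := by
  ext1 k
  simp [coeff_mapFluct, algebraMap_apply'']

lemma mapFluct_smul (φ : A →+* B) (f : A⟦X⟧) (g : FluctSeries m A) :
    mapFluct m φ (f • g) = PowerSeries.map φ f • mapFluct m φ g := by
  rw [Algebra.smul_def, map_mul, mapFluct_algebraMap, Algebra.smul_def]

namespace BetheData

/-- The image of a solution of the Bethe equations under a ring homomorphism. -/
def map (D : BetheData m A) (φ : A →+* B) : BetheData m B where
  ħ := φ D.ħ
  ħinv := φ D.ħinv
  s i := φ (D.s i)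
  r i j := φ (D.r i j)
  v i := PowerSeries.map φ (D.v i)
  Γ i j := φ (D.Γ i j)
  mul_ħinv := by rw [← map_mul, D.mul_ħinv, map_one]
  r_self i := by rw [D.r_self, map_zero]
  r_mul i j h := by rw [← map_sub, ← map_mul, D.r_mul i j h, map_one]
  bethe i := by
    rw [← coeff_zero_eq_constantCoeff_apply, coeff_map, coeff_zero_eq_constantCoeff_apply, D.bethe]
    have h2 : φ 2 = 2 := _root_.map_ofNat φ 2
    simp [h2]
  Γ_symm i j := by rw [D.Γ_symm]
  hessian_mul i k := by
    have h := congrArg φ (D.hessian_mul i k)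
    rw [map_sum] at h
    have h1 : ∀ j, φ (dataHessian D.ħ D.r D.v i j) = dataHessian (φ D.ħ) (fun i j => φ (D.r i j))
        (fun i => PowerSeries.map φ (D.v i)) i j := by
      intro j
      unfold dataHessian
      have h2 : φ 2 = 2 := _root_.map_ofNat φ 2
      split_ifs <;> simp [h2]
    simp only [map_mul, h1] at h
    rw [h]
    split_ifs <;> simp

variable (D : BetheData m A)

lemma map_kap (φ : A →+* B) : PowerSeries.map φ D.kap = (D.map φ).kap := by
  rw [kap, map_kappa]; rfl

lemma mapFluct_stat (φ : A →+* B) (ψ : Fin m → A⟦X⟧) :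
    mapFluct m φ (D.stat ψ) = (D.map φ).stat fun i => PowerSeries.map φ (ψ i) := by
  rw [stat, mapFluct_smul, map_kap, mapFluct_linStat, stat]

lemma mapFluct_insertion (φ : A →+* B) (ψ : Fin m → A⟦X⟧) :
    mapFluct m φ (D.insertion ψ) = (D.map φ).insertion fun i => PowerSeries.map φ (ψ i) := by
  rw [insertion, mapFluct_smul, map_kap, insertion]
  congr 1
  rw [← mapFluct_linStat]
  ext1 k
  simp [divX, coeff_mapFluct]

variable [Algebra ℂ A] [Algebra ℂ B] (φ : A →ₐ[ℂ] B)

lemma mapFluct_action : mapFluct m (φ : A →+* B) D.action = (D.map (φ : A →+* B)).action := by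
  have h1 : mapFluct m (φ : A →+* B) D.preAction = (D.map (φ : A →+* B)).preAction := by
    simp only [preAction, map_sub, map_neg, map_mul, map_sum, mapFluct_algebraMap, map_kap,
      mapFluct_linStat, mapFluct_substLin, map_primitive, map_geom, MvPolynomial.map_X]
    rfl
  ext1 k
  rw [coeff_mapFluct, action, action, coeff_mk, coeff_mk, ← coeff_mapFluct, map_mul,
    mapFluct_algebraMap, map_kap, h1]

lemma mapFluct_weight : mapFluct m (φ : A →+* B) D.weight = (D.map (φ : A →+* B)).weight := by
  rw [weight, mapFluct, map_expSeries, weight, ← mapFluct_action, coeff_mapFluct, mapFluct,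
    map_sub, map_C]

lemma map_expect₀ (f : FluctSeries m A) : PowerSeries.map (φ : A →+* B) (D.expect₀ f) =
    (D.map (φ : A →+* B)).expect₀ (mapFluct m (φ : A →+* B) f) := by
  rw [expect₀_apply, expect₀_apply, ← mapFluct_weight, ← map_mul]
  ext k
  rw [coeff_map, coeff_gaussSeries, coeff_gaussSeries, coeff_mapFluct]
  exact (gauss_map φ _ _).symm

lemma map_partitionFn : PowerSeries.map (φ : A →+* B) D.partitionFn =
    (D.map (φ : A →+* B)).partitionFn := by
  rw [partitionFn, map_expect₀, map_one, partitionFn]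

lemma map_expect (f : FluctSeries m A) : PowerSeries.map (φ : A →+* B) (D.expect f) =
    (D.map (φ : A →+* B)).expect (mapFluct m (φ : A →+* B) f) := by
  have hu : IsUnit (D.map (φ : A →+* B)).partitionFn := by
    rw [isUnit_iff_constantCoeff, constantCoeff_partitionFn]; exact isUnit_one
  refine hu.mul_left_cancel ?_
  rw [partitionFn_mul_expect, ← map_expect₀, ← D.partitionFn_mul_expect f, map_mul, map_partitionFn]

lemma map_corr {ι : Type*} [DecidableEq ι] (ψ : ι → Fin m → A⟦X⟧) (χ : Fin m → A⟦X⟧)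
    (J : Finset ι) : PowerSeries.map (φ : A →+* B) (D.corr ψ χ J) =
      (D.map (φ : A →+* B)).corr (fun j i => PowerSeries.map (φ : A →+* B) (ψ j i))
        (fun i => PowerSeries.map (φ : A →+* B) (χ i)) J := by
  rw [corr, map_conn D.expect_one (D.map (φ : A →+* B)).expect_one _ (mapFluct m (φ : A →+* B))
    (D.map_expect φ), mapFluct_stat]
  simp only [mapFluct_insertion]
  rfl

end BetheData

end

/-! ### Residues and Taylor series of analytic functions; rational functions. -/

/-- `f` has the residue `a` at `c`: the integrals over all small circles exist and have the
normalized value `a`. -/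
def HasRes (f : ℂ → ℂ) (c a : ℂ) : Prop :=
  ∀ᶠ r in 𝓝[>] (0 : ℝ), CircleIntegrable f c r ∧
    (2 * (Real.pi : ℂ) * Complex.I)⁻¹ * (∮ z in C(c, r), f z) = a

namespace HasRes

variable {f g : ℂ → ℂ} {c a b : ℂ}

lemma residue_eq (h : HasRes f c a) : residue f c = a := by
  refine Tendsto.limUnder_eq (tendsto_const_nhds.congr' ?_)
  filter_upwards [h] with r hr using hr.2.symm

lemma eventually_sphere {p : ℂ → Prop} (h : ∀ᶠ z in 𝓝[≠] c, p z) :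
    ∀ᶠ r in 𝓝[>] (0 : ℝ), ∀ z ∈ Metric.sphere c r, p z := by
  rw [eventually_nhdsWithin_iff, Metric.eventually_nhds_iff] at h
  obtain ⟨ε, hε, h⟩ := h
  filter_upwards [Ioo_mem_nhdsGT hε] with r hr z hz
  rw [Metric.mem_sphere] at hz
  exact h (by rw [hz]; exact hr.2) fun hzc => by
    rw [Set.mem_singleton_iff.1 hzc, dist_self] at hz
    exact hr.1.ne hz

lemma congr (h : HasRes f c a) (hfg : ∀ᶠ z in 𝓝[≠] c, f z = g z) : HasRes g c a := by
  filter_upwards [h, eventually_sphere hfg, self_mem_nhdsWithin] with r hr h1 hr0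
  have h2 : Set.EqOn f g (Metric.sphere c |r|) := by
    rw [abs_of_pos hr0]; exact h1
  rw [← circleIntegral.integral_congr hr0.le h1]
  exact ⟨(circleIntegrable_congr h2).1 hr.1, hr.2⟩

lemma add (hf : HasRes f c a) (hg : HasRes g c b) : HasRes (fun z => f z + g z) c (a + b) := by
  filter_upwards [hf, hg] with r h1 h2
  refine ⟨h1.1.add h2.1, ?_⟩
  rw [circleIntegral.integral_add h1.1 h2.1, mul_add, h1.2, h2.2]

lemma const_mul (k : ℂ) (hf : HasRes f c a) : HasRes (fun z => k * f z) c (k * a) := by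
  filter_upwards [hf] with r h1
  refine ⟨h1.1.const_smul, ?_⟩
  rw [circleIntegral.integral_const_mul, ← h1.2]
  ring

lemma neg (hf : HasRes f c a) : HasRes (fun z => -f z) c (-a) := by
  simpa using hf.const_mul (-1)

lemma sub (hf : HasRes f c a) (hg : HasRes g c b) : HasRes (fun z => f z - g z) c (a - b) := by
  simpa [sub_eq_add_neg] using hf.add hg.neg

lemma of_analyticAt (hf : AnalyticAt ℂ f c) : HasRes f c 0 := by
  have h := hf.eventually_analyticAt
  rw [Metric.eventually_nhds_iff] at h
  obtain ⟨ε, hε, h⟩ := h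
  filter_upwards [Ioo_mem_nhdsGT hε] with r hr
  have h1 : ∀ z ∈ Metric.closedBall c r, AnalyticAt ℂ f z := fun z hz =>
    h ((Metric.mem_closedBall.1 hz).trans_lt hr.2)
  have hc : ContinuousOn f (Metric.closedBall c r) := fun z hz =>
    (h1 z hz).continuousAt.continuousWithinAt
  refine ⟨(hc.mono Metric.sphere_subset_closedBall).circleIntegrable hr.1.le, ?_⟩
  rw [Complex.circleIntegral_eq_zero_of_differentiable_on_off_countable hr.1.le
    Set.countable_empty hc fun z hz => (h1 z (Metric.ball_subset_closedBall hz.1)).differentiableAt,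
    mul_zero]

lemma zero : HasRes (fun _ => 0) c 0 := of_analyticAt analyticAt_const

lemma sum {ι : Type*} (s : Finset ι) {F : ι → ℂ → ℂ} {A : ι → ℂ}
    (h : ∀ i ∈ s, HasRes (F i) c (A i)) : HasRes (fun z => ∑ i ∈ s, F i z) c (∑ i ∈ s, A i) := by
  classical
  induction s using Finset.induction_on with
  | empty => simpa using zero
  | insert i s hi ih =>
    simp only [Finset.sum_insert hi]
    exact (h i (Finset.mem_insert_self i s)).add
      (ih fun j hj => h j (Finset.mem_insert_of_mem hj))

lemma of_hasDerivAt {F : ℂ → ℂ} (hF : ∀ᶠ z in 𝓝[≠] c, HasDerivAt F (f z) z)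
    (hc : ∀ᶠ z in 𝓝[≠] c, ContinuousAt f z) : HasRes f c 0 := by
  filter_upwards [eventually_sphere hF, eventually_sphere hc, self_mem_nhdsWithin] with r h1 h2 hr0
  refine ⟨ContinuousOn.circleIntegrable (le_of_lt hr0) fun z hz =>
    (h2 z hz).continuousWithinAt, ?_⟩
  rw [circleIntegral.integral_eq_zero_of_hasDerivWithinAt (le_of_lt hr0) fun z hz =>
    (h1 z hz).hasDerivWithinAt, mul_zero]

lemma inv : HasRes (fun z => (z - c)⁻¹) c 1 := by
  filter_upwards [self_mem_nhdsWithin] with r hr0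
  have hr : (0 : ℝ) < r := hr0
  constructor
  · refine ContinuousOn.circleIntegrable hr.le fun z hz => ContinuousAt.continuousWithinAt ?_
    have : z - c ≠ 0 := fun h => by
      rw [Metric.mem_sphere, dist_eq_norm, h, norm_zero] at hz
      exact hr.ne hz
    fun_prop (disch := assumption)
  · rw [circleIntegral.integral_sub_center_inv c hr.ne']
    exact inv_mul_cancel₀ (by simp [Real.pi_ne_zero])

lemma inv_pow {k : ℕ} (hk : k ≠ 0) : HasRes (fun z => ((z - c) ^ (k + 1))⁻¹) c 0 := by
  have hne : ∀ᶠ z in 𝓝[≠] c, z - c ≠ 0 :=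
    eventually_nhdsWithin_of_forall fun z hz => sub_ne_zero.2 hz
  have hk' : (k : ℂ) ≠ 0 := Nat.cast_ne_zero.2 hk
  refine of_hasDerivAt (F := fun z => -(k : ℂ)⁻¹ * ((z - c) ^ k)⁻¹) ?_ ?_
  · filter_upwards [hne] with z hz
    have h1 : HasDerivAt (fun z : ℂ => (z - c) ^ k) (k * (z - c) ^ (k - 1) * 1) z :=
      ((hasDerivAt_id z).sub_const c).pow k
    refine ((h1.fun_inv (pow_ne_zero k hz)).const_mul (-(k : ℂ)⁻¹)).congr_deriv ?_
    obtain ⟨l, rfl⟩ := Nat.exists_eq_add_one_of_ne_zero hk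
    have hz2 : (z - c) ^ l ≠ 0 := pow_ne_zero l hz
    rw [Nat.add_sub_cancel, neg_div, neg_mul_neg, mul_one, mul_div_assoc, inv_mul_cancel_left₀ hk',
      pow_succ (z - c) (l + 1), pow_succ (z - c) l, sq]
    field_simp
  · filter_upwards [hne] with z hz
    have := pow_ne_zero (k + 1) hz
    fun_prop (disch := assumption)

end HasRes

/-- The Taylor series of `f` at `c`. -/
def taylor (f : ℂ → ℂ) (c : ℂ) : ℂ⟦X⟧ :=
  PowerSeries.mk fun k => iteratedDeriv k f c / k.factorial

lemma coeff_taylor (f : ℂ → ℂ) (c : ℂ) (k : ℕ) :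
    coeff k (taylor f c) = iteratedDeriv k f c / k.factorial := coeff_mk _ _

lemma coeff_zero_taylor (f : ℂ → ℂ) (c : ℂ) : coeff 0 (taylor f c) = f c := by
  simp [coeff_taylor]

lemma coeff_one_taylor (f : ℂ → ℂ) (c : ℂ) : coeff 1 (taylor f c) = deriv f c := by
  simp [coeff_taylor]

lemma taylor_congr {f g : ℂ → ℂ} {c : ℂ} (h : ∀ᶠ z in 𝓝 c, f z = g z) :
    taylor f c = taylor g c := by
  ext k
  rw [coeff_taylor, coeff_taylor, Filter.EventuallyEq.iteratedDeriv_eq k h]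

lemma taylor_const_mul (a : ℂ) {f : ℂ → ℂ} {c : ℂ} :
    taylor (fun z => a * f z) c = C a * taylor f c := by
  ext k
  rw [coeff_C_mul, coeff_taylor, coeff_taylor, iteratedDeriv_const_mul_field, mul_div_assoc]

lemma taylor_add {f g : ℂ → ℂ} {c : ℂ} (hf : AnalyticAt ℂ f c) (hg : AnalyticAt ℂ g c) :
    taylor (fun z => f z + g z) c = taylor f c + taylor g c := by
  ext k
  rw [map_add, coeff_taylor, coeff_taylor, coeff_taylor, iteratedDeriv_fun_add hf.contDiffAt
    hg.contDiffAt, add_div]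

lemma hasFPowerSeriesAt_taylor {f : ℂ → ℂ} {c : ℂ} (hf : AnalyticAt ℂ f c) :
    HasFPowerSeriesAt f (FormalMultilinearSeries.ofScalars ℂ fun k => coeff k (taylor f c)) c := by
  simp only [coeff_taylor]
  exact hf.hasFPowerSeriesAt

lemma AnalyticAt.dslope {f : ℂ → ℂ} {c : ℂ} (hf : AnalyticAt ℂ f c) :
    AnalyticAt ℂ (dslope f c) c :=
  ⟨_, (hasFPowerSeriesAt_taylor hf).has_fpower_series_dslope_fslope⟩

lemma coeff_taylor_dslope {f : ℂ → ℂ} {c : ℂ} (hf : AnalyticAt ℂ f c) (k : ℕ) :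
    coeff k (taylor (dslope f c) c) = coeff (k + 1) (taylor f c) := by
  have h1 := (hasFPowerSeriesAt_taylor hf).has_fpower_series_dslope_fslope
  have h2 := hasFPowerSeriesAt_taylor (AnalyticAt.dslope hf)
  have h3 := congrArg (fun p => p.coeff k) (h2.eq_formalMultilinearSeries h1)
  simpa [FormalMultilinearSeries.coeff_ofScalars] using h3

lemma exists_taylor_remainder {f : ℂ → ℂ} {c : ℂ} (hf : AnalyticAt ℂ f c) (k : ℕ) :
    ∃ h : ℂ → ℂ, AnalyticAt ℂ h c ∧ ∀ z, f z =
      (∑ l ∈ Finset.range k, coeff l (taylor f c) * (z - c) ^ l) + (z - c) ^ k * h z := by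
  induction k generalizing f with
  | zero => exact ⟨f, hf, fun z => by simp⟩
  | succ k ih =>
    obtain ⟨h, hh, h1⟩ := ih (AnalyticAt.dslope hf)
    refine ⟨h, hh, fun z => ?_⟩
    have h2 := sub_smul_dslope f c z
    rw [h1 z, smul_eq_mul] at h2
    rw [Finset.sum_range_succ', coeff_zero_taylor]
    simp only [coeff_taylor_dslope hf] at h2
    have h3 : ∑ l ∈ Finset.range k, coeff (l + 1) (taylor f c) * (z - c) ^ (l + 1) =
        (z - c) * ∑ l ∈ Finset.range k, coeff (l + 1) (taylor f c) * (z - c) ^ l := by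
      rw [Finset.mul_sum]; exact Finset.sum_congr rfl fun _ _ => by ring
    rw [h3]
    linear_combination -h2

/-- Multiplication by `(z - c)^{-k-1}` up to functions that are analytic at `c`. -/
lemma exists_polar_part {g : ℂ → ℂ} {c : ℂ} (hg : AnalyticAt ℂ g c) (k : ℕ) :
    ∃ h : ℂ → ℂ, AnalyticAt ℂ h c ∧ ∀ z ≠ c, g z * ((z - c)⁻¹) ^ (k + 1) =
      (∑ l ∈ Finset.range (k + 1), coeff l (taylor g c) * ((z - c)⁻¹) ^ (k - l + 1)) + h z := by
  obtain ⟨h, hh, h1⟩ := exists_taylor_remainder hg (k + 1)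
  refine ⟨h, hh, fun z hz => ?_⟩
  have hz' := sub_ne_zero.2 hz
  rw [h1 z, add_mul, Finset.sum_mul]
  congr 1
  · refine Finset.sum_congr rfl fun l hl => ?_
    have hl' : l ≤ k := Nat.lt_succ_iff.1 (Finset.mem_range.1 hl)
    obtain ⟨j, rfl⟩ := Nat.exists_eq_add_of_le hl'
    rw [Nat.add_sub_cancel_left, mul_assoc, add_assoc, pow_add, ← mul_assoc (_ ^ l), ← mul_pow,
      mul_inv_cancel₀ hz', one_pow, one_mul]
  · rw [mul_right_comm, ← mul_pow, mul_inv_cancel₀ hz', one_pow, one_mul]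

lemma hasRes_mul_inv_pow {g : ℂ → ℂ} {c : ℂ} (hg : AnalyticAt ℂ g c) (k : ℕ) :
    HasRes (fun z => g z * ((z - c)⁻¹) ^ (k + 1)) c (coeff k (taylor g c)) := by
  obtain ⟨h, hh, h1⟩ := exists_polar_part hg k
  have h2 : HasRes (fun z => (∑ l ∈ Finset.range (k + 1), coeff l (taylor g c) *
      ((z - c)⁻¹) ^ (k - l + 1)) + h z) c
      ((∑ l ∈ Finset.range (k + 1), coeff l (taylor g c) * if l = k then 1 else 0) + 0) := by
    refine (HasRes.sum _ fun l hl => HasRes.const_mul _ ?_).add (HasRes.of_analyticAt hh)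
    have hl' : l ≤ k := Nat.lt_succ_iff.1 (Finset.mem_range.1 hl)
    split_ifs with h3
    · simpa [h3] using HasRes.inv
    · simp only [_root_.inv_pow]
      exact HasRes.inv_pow (by omega)
  have h4 : (∑ l ∈ Finset.range (k + 1), coeff l (taylor g c) * if l = k then (1 : ℂ) else 0) + 0 =
      coeff k (taylor g c) := by
    simp
  rw [h4] at h2
  exact h2.congr (eventually_nhdsWithin_of_forall fun z hz => (h1 z hz).symm)

lemma analyticAt_inv_sub {b c : ℂ} (h : c ≠ b) : AnalyticAt ℂ (fun z => (z - b)⁻¹) c := by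
  have := sub_ne_zero.2 h
  fun_prop (disch := assumption)

/-- The difference quotient of `(z - b)⁻¹` at `c` is `(b - c)⁻¹` times the same function, so the
Taylor coefficients form a geometric progression. -/
lemma taylor_inv_sub {b c : ℂ} (h : c ≠ b) :
    taylor (fun z => (z - b)⁻¹) c = -geom (b - c)⁻¹ := by
  have hb : b - c ≠ 0 := sub_ne_zero.2 h.symm
  have hd : ∀ᶠ z in 𝓝 c, dslope (fun z => (z - b)⁻¹) c z = (b - c)⁻¹ * (z - b)⁻¹ := by
    have h1 := (AnalyticAt.dslope (analyticAt_inv_sub h)).continuousAt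
    have h2 : ContinuousAt (fun z => (b - c)⁻¹ * (z - b)⁻¹) c :=
      continuousAt_const.mul (analyticAt_inv_sub h).continuousAt
    have h3 : ∀ᶠ z in 𝓝[≠] c, dslope (fun z => (z - b)⁻¹) c z = (b - c)⁻¹ * (z - b)⁻¹ := by
      filter_upwards [self_mem_nhdsWithin,
        (eventually_ne_nhds h).filter_mono nhdsWithin_le_nhds] with z hz hzb
      rw [dslope_of_ne _ hz, slope_def_field]
      have e1 : z - b ≠ 0 := sub_ne_zero.2 hzb
      have e2 : z - c ≠ 0 := sub_ne_zero.2 hz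
      have e3 : c - b ≠ 0 := sub_ne_zero.2 h
      rw [div_eq_iff e2]
      field_simp
      ring
    have h4 : dslope (fun z => (z - b)⁻¹) c c = (b - c)⁻¹ * (c - b)⁻¹ :=
      tendsto_nhds_unique ((h1.tendsto.mono_left nhdsWithin_le_nhds).congr' h3)
        (h2.tendsto.mono_left nhdsWithin_le_nhds)
    rw [eventually_nhdsWithin_iff] at h3
    filter_upwards [h3] with z hz
    rcases eq_or_ne z c with rfl | hzc
    · exact h4
    · exact hz hzc
  ext k
  induction k with
  | zero =>
    rw [coeff_zero_taylor, map_neg, geom, coeff_mk, zero_add, pow_one, ← neg_sub b c, inv_neg]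
  | succ k ih =>
    rw [← coeff_taylor_dslope (analyticAt_inv_sub h), taylor_congr hd, taylor_const_mul, coeff_C_mul,
      ih, map_neg, map_neg, geom, coeff_mk, coeff_mk]
    ring

/-- The sum of all residues of `1 / ((z - c)^{k+1} (z - b))` vanishes. -/
lemma hasRes_inv_mul_inv_pow {b c : ℂ} (h : c ≠ b) (k : ℕ) :
    HasRes (fun z => (z - b)⁻¹ * ((z - c)⁻¹) ^ (k + 1)) c (-(b - c)⁻¹ ^ (k + 1)) := by
  have := hasRes_mul_inv_pow (analyticAt_inv_sub h) k
  rwa [taylor_inv_sub h, map_neg, geom, coeff_mk] at this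

lemma taylor_mul {f g : ℂ → ℂ} {c : ℂ} (hf : AnalyticAt ℂ f c) (hg : AnalyticAt ℂ g c) :
    taylor (fun z => f z * g z) c = taylor f c * taylor g c := by
  ext k
  rw [coeff_mul, coeff_taylor, show (fun z => f z * g z) = f * g from rfl,
    iteratedDeriv_mul hf.contDiffAt hg.contDiffAt, Finset.Nat.sum_antidiagonal_eq_sum_range_succ_mk,
    Finset.sum_div]
  refine Finset.sum_congr rfl fun i hi => ?_
  have hi' : i ≤ k := Nat.lt_succ_iff.1 (Finset.mem_range.1 hi)
  rw [coeff_taylor, coeff_taylor, Nat.cast_choose ℂ hi']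
  have h1 := Nat.cast_ne_zero (R := ℂ).2 (Nat.factorial_ne_zero i)
  have h2 := Nat.cast_ne_zero (R := ℂ).2 (Nat.factorial_ne_zero (k - i))
  have h3 := Nat.cast_ne_zero (R := ℂ).2 (Nat.factorial_ne_zero k)
  field_simp

lemma taylor_deriv (f : ℂ → ℂ) (c : ℂ) : taylor (deriv f) c = derivative ℂ (taylor f c) := by
  ext k
  rw [coeff_derivative, coeff_taylor, coeff_taylor, iteratedDeriv_succ', Nat.factorial_succ]
  have h3 := Nat.cast_ne_zero (R := ℂ).2 (Nat.factorial_ne_zero k)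
  have h4 := Nat.cast_add_one_ne_zero (R := ℂ) k
  push_cast
  field_simp

lemma taylor_sub_const (c : ℂ) : taylor (fun z => z - c) c = X := by
  have h : deriv (fun z : ℂ => z - c) = fun _ => 1 := by
    ext z; exact ((hasDerivAt_id z).sub_const c).deriv
  ext k
  rw [coeff_taylor, coeff_X]
  rcases k with _ | _ | k
  · simp
  · simp
  · rw [iteratedDeriv_succ', h, iteratedDeriv_const]
    simp

lemma taylor_const (a c : ℂ) : taylor (fun _ => a) c = C a := by
  ext k
  rw [coeff_taylor, iteratedDeriv_const, coeff_C]
  split_ifs with h <;> simp [h]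

/-- A function with removable singularities that vanishes at infinity vanishes. -/
lemma eq_zero_of_removable {H : ℂ → ℂ}
    (hH : ∀ c, ∃ h : ℂ → ℂ, AnalyticAt ℂ h c ∧ ∀ᶠ z in 𝓝[≠] c, H z = h z)
    (hd : Tendsto H (Bornology.cobounded ℂ) (𝓝 0)) {c : ℂ} (hc : ContinuousAt H c) : H c = 0 := by
  -- The function `H` may have arbitrary values at its removable singularities. The punctured limits
  -- `L` are entire and tend to zero at infinity, so Liouville's theorem applies to `L`.
  set L : ℂ → ℂ := fun c => limUnder (𝓝[≠] c) H
  have key : ∀ {c : ℂ} {h : ℂ → ℂ}, ContinuousAt h c → (∀ᶠ z in 𝓝[≠] c, H z = h z) → L c = h c := by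
    intro c h h1 h2
    refine Tendsto.limUnder_eq ?_
    exact (h1.tendsto.mono_left nhdsWithin_le_nhds).congr' (h2.mono fun z hz => hz.symm)
  have hL : ∀ c, ∃ h : ℂ → ℂ, AnalyticAt ℂ h c ∧ (∀ᶠ z in 𝓝 c, L z = h z) ∧
      ∀ᶠ z in 𝓝[≠] c, H z = h z := by
    intro c
    obtain ⟨h, h1, h2⟩ := hH c
    refine ⟨h, h1, ?_, h2⟩
    have h3 : ∀ᶠ z in 𝓝[≠] c, L z = h z := by
      have h4 := h1.eventually_analyticAt.filter_mono (nhdsWithin_le_nhds (s := {c}ᶜ))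
      filter_upwards [eventually_eventually_nhdsWithin.2 h2, h4, self_mem_nhdsWithin]
        with z hz hz2 hzc
      refine key hz2.continuousAt (Filter.Eventually.filter_mono ?_ hz)
      have : 𝓝[{c}ᶜ] z = 𝓝 z := (isOpen_compl_singleton).nhdsWithin_eq hzc
      rw [this]
      exact nhdsWithin_le_nhds
    rw [eventually_nhdsWithin_iff] at h3
    filter_upwards [h3] with z hz
    rcases eq_or_ne z c with rfl | h5
    · exact key h1.continuousAt h2
    · exact hz h5
  have hdiff : Differentiable ℂ L := by
    intro c
    obtain ⟨h, h1, h2, -⟩ := hL c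
    exact (h1.congr (h2.mono fun z hz => hz.symm)).differentiableAt
  have hLH : ∀ c, L c = 0 := by
    refine fun c => hdiff.apply_eq_of_tendsto_cocompact c ?_
    rw [← Metric.cobounded_eq_cocompact]
    rw [Metric.tendsto_nhds] at hd ⊢
    intro ε hε
    have h1 := hd (ε / 2) (by positivity)
    obtain ⟨R, hR⟩ := (Filter.hasBasis_cobounded_norm.eventually_iff).1 h1
    refine (Filter.hasBasis_cobounded_norm.eventually_iff).2 ⟨R + 1, trivial, fun z hz => ?_⟩
    obtain ⟨h, h1, -, h2⟩ := hL z
    have h3 : Tendsto H (𝓝[≠] z) (𝓝 (L z)) := by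
      rw [key h1.continuousAt h2]
      exact (h1.continuousAt.tendsto.mono_left nhdsWithin_le_nhds).congr' (h2.mono fun z hz => hz.symm)
    refine lt_of_le_of_lt ?_ (half_lt_self hε)
    refine le_of_tendsto (h3.dist tendsto_const_nhds) ?_
    have h4 : ∀ᶠ w in 𝓝[≠] z, R < ‖w‖ :=
      (continuous_norm.continuousAt.tendsto.eventually (lt_mem_nhds
        (show R < ‖z‖ from lt_of_lt_of_le (lt_add_one R) hz))).filter_mono nhdsWithin_le_nhds
    filter_upwards [h4] with w hw
    exact (hR.2 (le_of_lt hw)).le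
  obtain ⟨h, h1, h2, h3⟩ := hL c
  have h4 : Tendsto H (𝓝[≠] c) (𝓝 (L c)) := by
    rw [key h1.continuousAt h3]
    exact (h1.continuousAt.tendsto.mono_left nhdsWithin_le_nhds).congr' (h3.mono fun z hz => hz.symm)
  rw [← hLH c]
  exact tendsto_nhds_unique (hc.tendsto.mono_left nhdsWithin_le_nhds) h4

lemma val_eq (f : RatFunc ℂ) (x : ℂ) : val f x = f.num.eval x / f.denom.eval x := by
  simp [val, RatFunc.eval, Polynomial.eval₂_id]

lemma analyticAt_val {f : RatFunc ℂ} {c : ℂ} (h : f.denom.eval c ≠ 0) : AnalyticAt ℂ (val f) c := by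
  have : val f = fun x => f.num.eval x / f.denom.eval x := funext (val_eq f)
  rw [this]
  exact (AnalyticOnNhd.eval_polynomial f.num c trivial).div
    (AnalyticOnNhd.eval_polynomial f.denom c trivial) h

lemma IsPrimitiveNear.analyticAt {V : ℂ → ℂ} {dV : RatFunc ℂ} {c : ℂ} (h : IsPrimitiveNear V dV c) :
    AnalyticAt ℂ V c :=
  Complex.analyticAt_iff_eventually_differentiableAt.2 (h.mono fun _ hx => hx.differentiableAt)

/-- At a pole `val` has the value `0` by convention, so something must be shown. Near `c` the
numerator equals the denominator times the derivative of the primitive, which is bounded; a zero of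
the denominator would thus be a zero of the numerator, against coprimality. -/
lemma IsPrimitiveNear.denom_ne {V : ℂ → ℂ} {dV : RatFunc ℂ} {c : ℂ} (h : IsPrimitiveNear V dV c) :
    dV.denom.eval c ≠ 0 := by
  intro h0
  have h1 : ∀ᶠ x in 𝓝 c, dV.denom.eval x ≠ 0 ∨ x = c := by
    have hfin := dV.denom.roots.toFinset.finite_toSet
    have := (hfin.subset (Set.sdiff_subset (t := {c}))).isClosed.isOpen_compl.mem_nhds
      (x := c) (by simp)
    filter_upwards [this] with x hx
    by_contra! h2
    refine hx ⟨?_, h2.2⟩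
    simpa [Polynomial.mem_roots, dV.denom_ne_zero] using h2.1
  have h2 : ∀ᶠ x in 𝓝[≠] c, dV.num.eval x = dV.denom.eval x * deriv V x := by
    filter_upwards [h1.filter_mono nhdsWithin_le_nhds, h.filter_mono nhdsWithin_le_nhds,
      self_mem_nhdsWithin] with x hx hV hxc
    have hx' := hx.resolve_right hxc
    rw [hV.deriv, val_eq]
    field_simp
  have h3 : Tendsto (fun x => dV.num.eval x) (𝓝[≠] c) (𝓝 (dV.num.eval c)) :=
    (dV.num.continuous.tendsto c).mono_left nhdsWithin_le_nhds
  have h4 : Tendsto (fun x => dV.denom.eval x * deriv V x) (𝓝[≠] c)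
      (𝓝 (dV.denom.eval c * deriv V c)) :=
    ((dV.denom.continuous.tendsto c).mul h.analyticAt.deriv.continuousAt.tendsto).mono_left
      nhdsWithin_le_nhds
  have h5 := tendsto_nhds_unique (h3.congr' h2) h4
  rw [h0, zero_mul] at h5
  obtain ⟨a, b, hab⟩ := dV.isCoprime_num_denom
  have := congrArg (Polynomial.eval c) hab
  simp [h0, h5] at this

lemma denom_add_C_mul_ne {f g : RatFunc ℂ} {c : ℂ} (hf : f.denom.eval c ≠ 0)
    (hg : g.denom.eval c ≠ 0) (t : ℂ) :
    (f + RatFunc.C t * g).denom.eval c ≠ 0 ∧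
      val (f + RatFunc.C t * g) c = val f c + t * val g c := by
  have h1 : (RatFunc.C t * g).denom.eval c ≠ 0 := by
    intro h
    have := RatFunc.denom_mul_dvd (RatFunc.C t) g
    rw [RatFunc.denom_C, one_mul] at this
    exact hg (Polynomial.eval_eq_zero_of_dvd_of_eval_eq_zero this h)
  constructor
  · intro h
    have := Polynomial.eval_eq_zero_of_dvd_of_eval_eq_zero (RatFunc.denom_add_dvd f (RatFunc.C t * g)) h
    rw [Polynomial.eval_mul] at this
    exact (mul_ne_zero hf h1) this
  · rw [val, RatFunc.eval_add, RatFunc.eval_mul, RatFunc.eval_C]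
    · rfl
    · simp
    · simpa [Polynomial.eval₂_id] using hg
    · simpa [Polynomial.eval₂_id] using hf
    · simpa [Polynomial.eval₂_id] using h1

/-! ### From kernel systems to nondegenerate solutions of the Bethe equations. -/

/-- The points `s` are a nondegenerate solution of the Bethe equations. -/
structure IsBethe {m : ℕ} (ħ : ℂ) (dV : RatFunc ℂ) (s : Fin m → ℂ) : Prop where
  inj : Function.Injective s
  denom_ne : ∀ i, dV.denom.eval (s i) ≠ 0
  bethe : ∀ i, val dV (s i) = 2 * ħ * ∑ j ∈ Finset.univ.erase i, 1 / (s i - s j)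
  det_ne : (hessian ħ dV s).det ≠ 0

lemma hessian_symm {m : ℕ} (ħ : ℂ) (dV : RatFunc ℂ) (s : Fin m → ℂ) :
    (hessian ħ dV s).transpose = hessian ħ dV s := by
  ext i j
  rw [Matrix.transpose_apply, hessian, Matrix.of_apply, Matrix.of_apply]
  rcases eq_or_ne i j with rfl | h
  · rfl
  · rw [if_neg h, if_neg h.symm, ← neg_sub (s i), neg_sq]

lemma matA_symm {m : ℕ} (ħ : ℂ) (dV : RatFunc ℂ) (s : Fin m → ℂ) (i j : Fin m) :
    matA ħ dV s i j = matA ħ dV s j i := by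
  have : (matA ħ dV s).transpose = matA ħ dV s := by
    rw [matA, Matrix.transpose_nonsing_inv, hessian_symm]
  exact congrFun (congrFun this j) i

section LinearAlgebra

variable {m : ℕ} {s : Fin m → ℂ}

lemma eventually_notMem_range (s : Fin m → ℂ) (c : ℂ) : ∀ᶠ x in 𝓝[≠] c, x ∉ Set.range s := by
  have h := ((Set.finite_range s).subset (Set.sdiff_subset (t := {c}))).isClosed.isOpen_compl.mem_nhds
    (x := c) (by simp)
  filter_upwards [mem_nhdsWithin_of_mem_nhds h, self_mem_nhdsWithin] with x hx hxc hx'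
  exact hx ⟨hx', hxc⟩

lemma tendsto_pow_mul_sum (hs : Function.Injective s) {N : ℕ} (hN : N ≠ 0) (a : Fin m → ℂ)
    (j : Fin m) : Tendsto (fun x => (x - s j) ^ N * ∑ k, a k * ((x - s k)⁻¹) ^ N) (𝓝[≠] (s j))
      (𝓝 (a j)) := by
  have h : ∀ k, Tendsto (fun x => (x - s j) ^ N * (a k * ((x - s k)⁻¹) ^ N)) (𝓝[≠] (s j))
      (𝓝 (if k = j then a k else 0)) := by
    intro k
    split_ifs with hk
    · subst hk
      refine tendsto_const_nhds.congr' ?_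
      filter_upwards [self_mem_nhdsWithin] with x hx
      have := sub_ne_zero.2 hx
      rw [mul_left_comm, ← mul_pow, mul_inv_cancel₀ this, one_pow, mul_one]
    · have h1 : s j - s k ≠ 0 := sub_ne_zero.2 fun h => hk (hs h).symm
      have h2 : ContinuousAt (fun x => (x - s j) ^ N * (a k * ((x - s k)⁻¹) ^ N)) (s j) := by
        fun_prop (disch := assumption)
      have h3 := h2.tendsto.mono_left (nhdsWithin_le_nhds (s := {s j}ᶜ))
      simpa [hN] using h3
  have h2 := tendsto_finsetSum Finset.univ fun k _ => h k
  simp only [← Finset.mul_sum, Finset.sum_ite_eq', Finset.mem_univ, if_true] at h2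
  exact h2

lemma tendsto_sq_mul_sum (hs : Function.Injective s) (a b : Fin m → ℂ)
    (j : Fin m) : Tendsto (fun x => (x - s j) ^ 2 * ∑ k, (a k * ((x - s k)⁻¹) ^ 2 +
      b k * (x - s k)⁻¹)) (𝓝[≠] (s j)) (𝓝 (a j)) := by
  have h1 := tendsto_pow_mul_sum hs two_ne_zero a j
  have h2 := tendsto_pow_mul_sum hs one_ne_zero b j
  have h3 : Tendsto (fun x => x - s j) (𝓝[≠] (s j)) (𝓝 0) := by
    have : ContinuousAt (fun x => x - s j) (s j) := by fun_prop
    simpa using this.tendsto.mono_left (nhdsWithin_le_nhds (s := {s j}ᶜ))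
  have h4 := h1.add (h3.mul h2)
  rw [zero_mul, add_zero] at h4
  refine h4.congr fun x => ?_
  simp only [Finset.sum_add_distrib, pow_one]
  ring

/-- The linear system for the coefficients of a kernel with a symmetric derivative. -/
lemma linear_system (hs : Function.Injective s) (c : Fin m → ℂ) (M : Matrix (Fin m) (Fin m) ℂ)
    (α : ℂ → Fin m → ℂ)
    (hM : ∀ x₀ ∉ Set.range s, M.mulVec (α x₀) =
      fun i => -((s i - x₀)⁻¹) ^ 2 - c i * (s i - x₀)⁻¹)
    (hsymm : ∀ x₀ ∉ Set.range s, ∀ x ∉ Set.range s, x₀ ≠ x →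
      ∑ j, α x₀ j * ((x - s j)⁻¹) ^ 2 = ∑ j, α x j * ((x₀ - s j)⁻¹) ^ 2) :
    M.det ≠ 0 ∧ (∀ i, c i = 0) ∧
      ∀ x₀ ∉ Set.range s, ∀ j, α x₀ j = -∑ k, M⁻¹ j k * ((x₀ - s k)⁻¹) ^ 2 := by
  -- As `x₀ → sᵢ`, the right-hand side of `hM` multiplied by `-(x₀ - sᵢ)²` tends to the `i`-th basis
  -- vector. The range of `M` is closed, so it contains all basis vectors.
  have hdet : IsUnit M.det := by
    rw [← Matrix.isUnit_iff_isUnit_det, ← Matrix.mulVec_surjective_iff_isUnit]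
    have hcl : IsClosed ((LinearMap.range M.mulVecLin : Submodule ℂ (Fin m → ℂ)) :
        Set (Fin m → ℂ)) := Submodule.closed_of_finiteDimensional _
    have h1 : ∀ i, Pi.single i (1 : ℂ) ∈ LinearMap.range M.mulVecLin := by
      intro i
      have h2 : Tendsto (fun x₀ => -((x₀ - s i) ^ 2) • M.mulVec (α x₀)) (𝓝[≠] (s i))
          (𝓝 (Pi.single i (1 : ℂ))) := by
        rw [tendsto_pi_nhds]
        intro k
        have h3 := (tendsto_sq_mul_sum hs (fun l => if l = k then 1 else 0)
          (fun l => if l = k then -c k else 0) i)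
        have h4 : (Pi.single i (1 : ℂ) : Fin m → ℂ) k = if i = k then 1 else 0 := by
          rw [Pi.single_apply]; simp only [eq_comm]
        rw [h4]
        refine h3.congr' ?_
        filter_upwards [eventually_notMem_range s (s i)] with x hx
        rw [hM x hx, Pi.smul_apply, smul_eq_mul]
        simp only [ite_mul, one_mul, zero_mul, Finset.sum_add_distrib, Finset.sum_ite_eq',
          Finset.mem_univ, if_true]
        rw [← neg_sub x (s k), inv_neg]
        ring
      refine hcl.mem_of_tendsto h2 (Eventually.of_forall fun x => ?_)
      exact Submodule.smul_mem _ _ ⟨α x, rfl⟩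
    have h5 : LinearMap.range M.mulVecLin = ⊤ := by
      rw [eq_top_iff]
      intro v _
      rw [← Finset.univ_sum_single v]
      refine Submodule.sum_mem _ fun i _ => ?_
      have := Submodule.smul_mem _ (v i) (h1 i)
      rwa [← Pi.single_smul, smul_eq_mul, mul_one] at this
    exact LinearMap.range_eq_top.1 h5
  have hα : ∀ x₀ ∉ Set.range s, ∀ l, α x₀ l =
      ∑ k, (-M⁻¹ l k * ((x₀ - s k)⁻¹) ^ 2 + M⁻¹ l k * c k * (x₀ - s k)⁻¹) := by
    intro x₀ hx l
    have h1 := congrArg (M⁻¹.mulVec) (hM x₀ hx)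
    rw [Matrix.mulVec_mulVec, Matrix.nonsing_inv_mul M hdet, Matrix.one_mulVec] at h1
    rw [h1, Matrix.mulVec, dotProduct]
    refine Finset.sum_congr rfl fun k _ => ?_
    rw [← neg_sub x₀ (s k), inv_neg]
    ring
  -- The symmetry relation is multiplied by `(x - sⱼ)²`, with `x → sⱼ`: on one side this isolates `α
  -- x₀ j`, on the other it keeps only the double poles of the `α x l`.
  have hα' : ∀ x₀ ∉ Set.range s, ∀ j, α x₀ j = ∑ l, -M⁻¹ l j * ((x₀ - s l)⁻¹) ^ 2 := by
    intro x₀ hx₀ j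
    have h1 := tendsto_pow_mul_sum hs two_ne_zero (α x₀) j
    have h2 : Tendsto (fun x => ∑ l, ((x₀ - s l)⁻¹) ^ 2 * ((x - s j) ^ 2 *
        ∑ k, (-M⁻¹ l k * ((x - s k)⁻¹) ^ 2 + M⁻¹ l k * c k * (x - s k)⁻¹))) (𝓝[≠] (s j))
        (𝓝 (∑ l, ((x₀ - s l)⁻¹) ^ 2 * -M⁻¹ l j)) :=
      tendsto_finsetSum _ fun l _ => (tendsto_sq_mul_sum hs _ _ j).const_mul _
    have h3 : ∀ᶠ x in 𝓝[≠] (s j), (x - s j) ^ 2 * ∑ k, α x₀ k * ((x - s k)⁻¹) ^ 2 =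
        ∑ l, ((x₀ - s l)⁻¹) ^ 2 * ((x - s j) ^ 2 *
        ∑ k, (-M⁻¹ l k * ((x - s k)⁻¹) ^ 2 + M⁻¹ l k * c k * (x - s k)⁻¹)) := by
      have hne : ∀ᶠ x in 𝓝[≠] (s j), x₀ ≠ x := by
        have : s j ≠ x₀ := fun h => hx₀ ⟨j, h⟩
        filter_upwards [mem_nhdsWithin_of_mem_nhds (isOpen_ne.mem_nhds this)] with x hx using hx.symm
      filter_upwards [eventually_notMem_range s (s j), hne] with x hx hxx
      rw [hsymm x₀ hx₀ x hx hxx, Finset.mul_sum]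
      refine Finset.sum_congr rfl fun l _ => ?_
      rw [← hα x hx l]
      ring
    rw [tendsto_nhds_unique (h1.congr' h3) h2]
    exact Finset.sum_congr rfl fun _ _ => mul_comm _ _
  have hsym : ∀ j k, M⁻¹ j k = M⁻¹ k j := by
    intro j k
    have h1 := tendsto_sq_mul_sum hs (fun k => -M⁻¹ j k) (fun k => M⁻¹ j k * c k) k
    have h2 := tendsto_pow_mul_sum hs two_ne_zero (fun l => -M⁻¹ l j) k
    have h3 := tendsto_nhds_unique h1 (h2.congr' ?_)
    · exact neg_injective h3
    · filter_upwards [eventually_notMem_range s (s k)] with x hx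
      rw [← hα x hx, ← hα' x hx]
  refine ⟨hdet.ne_zero, fun k => ?_, fun x hx j => ?_⟩
  -- The two expressions for `α` differ by simple poles, whose coefficients must vanish; since no
  -- column of `M⁻¹` is zero, `c k = 0`.
  · have h1 : ∀ j, M⁻¹ j k * c k = 0 := by
      intro j
      have h1 := tendsto_pow_mul_sum hs one_ne_zero (fun k => M⁻¹ j k * c k) k
      refine tendsto_nhds_unique h1 (tendsto_const_nhds.congr' ?_)
      filter_upwards [eventually_notMem_range s (s k)] with x hx
      have h2 := hα x hx j
      rw [hα' x hx j, Finset.sum_add_distrib] at h2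
      simp only [hsym _ j] at h2
      simp only [pow_one]
      linear_combination (x - s k) * h2
    have h2 : ∑ j, M k j * M⁻¹ j k = 1 := by
      have := congrFun (congrFun (Matrix.mul_nonsing_inv M hdet) k) k
      rwa [Matrix.mul_apply, Matrix.one_apply_eq] at this
    have h3 : (∑ j, M k j * M⁻¹ j k) * c k = 0 := by
      rw [Finset.sum_mul]
      exact Finset.sum_eq_zero fun j _ => by rw [mul_assoc, h1, mul_zero]
    rwa [h2, one_mul] at h3
  · rw [hα' x hx j, ← Finset.sum_neg_distrib]
    exact Finset.sum_congr rfl fun k _ => by rw [hsym j k, neg_mul]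

end LinearAlgebra

section Local

variable {m : ℕ} {ħ : ℂ} {dV : RatFunc ℂ} {s : Fin m → ℂ}

/-- The part of `2ħ ∑ⱼ (x - sⱼ)⁻¹ - V'(x)` that is regular at `sᵢ`. -/
def regForce (ħ : ℂ) (dV : RatFunc ℂ) (s : Fin m → ℂ) (i : Fin m) (x : ℂ) : ℂ :=
  2 * ħ * ∑ j ∈ Finset.univ.erase i, (x - s j)⁻¹ - val dV x

lemma force_eq (ħ : ℂ) (dV : RatFunc ℂ) (s : Fin m → ℂ) (i : Fin m) (x : ℂ) :
    2 * ħ * ∑ j, 1 / (x - s j) - val dV x = 2 * ħ * (x - s i)⁻¹ + regForce ħ dV s i x := by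
  rw [regForce, ← Finset.add_sum_erase _ _ (Finset.mem_univ i)]
  simp only [one_div]
  ring

lemma hasDerivAt_inv_sub {b c : ℂ} (h : c ≠ b) :
    HasDerivAt (fun z => (z - b)⁻¹) (-((c - b)⁻¹) ^ 2) c := by
  have h1 := ((hasDerivAt_id c).sub_const b).fun_inv (sub_ne_zero.2 h)
  refine h1.congr_deriv ?_
  simp [div_eq_mul_inv]

variable (hs : Function.Injective s) (hd : ∀ i, dV.denom.eval (s i) ≠ 0)

include hs hd in
lemma analyticAt_regForce (i : Fin m) : AnalyticAt ℂ (regForce ħ dV s i) (s i) := by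
  refine AnalyticAt.sub (analyticAt_const.mul (Finset.analyticAt_fun_sum _ fun j hj => ?_))
    (analyticAt_val (hd i))
  exact analyticAt_inv_sub (hs.ne (Finset.ne_of_mem_erase hj).symm)

include hs hd in
lemma deriv_regForce (hħ : ħ ≠ 0) (i : Fin m) :
    deriv (regForce ħ dV s i) (s i) = -(ħ * hessian ħ dV s i i) := by
  have h1 : HasDerivAt (fun x => ∑ j ∈ Finset.univ.erase i, (x - s j)⁻¹)
      (∑ j ∈ Finset.univ.erase i, -((s i - s j)⁻¹) ^ 2) (s i) := by
    refine HasDerivAt.fun_sum fun j hj => hasDerivAt_inv_sub ?_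
    exact hs.ne (Finset.ne_of_mem_erase hj).symm
  have h2 := (h1.const_mul (2 * ħ)).sub (analyticAt_val (hd i)).differentiableAt.hasDerivAt
  have h3 : deriv (regForce ħ dV s i) (s i) = _ := h2.deriv
  rw [h3, hessian, Matrix.of_apply, if_pos rfl, Finset.sum_neg_distrib]
  simp only [one_div, inv_pow]
  field_simp
  ring

/-- The Taylor expansion of the differential equation for `K` at `sᵢ`. -/
lemma ode_taylor (hs : Function.Injective s) (hd : ∀ i, dV.denom.eval (s i) ≠ 0) {i : Fin m}
    {K : ℂ → ℂ} (hK : AnalyticAt ℂ K (s i)) :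
    AnalyticAt ℂ (fun x => (2 * ħ + (x - s i) * regForce ħ dV s i x) * K x -
      ħ * ((x - s i) * deriv K x)) (s i) ∧
    taylor (fun x => (2 * ħ + (x - s i) * regForce ħ dV s i x) * K x -
      ħ * ((x - s i) * deriv K x)) (s i) =
      (C (2 * ħ) + X * taylor (regForce ħ dV s i) (s i)) * taylor K (s i) +
        C (-ħ) * (X * derivative ℂ (taylor K (s i))) := by
  have h1 := analyticAt_regForce (ħ := ħ) hs hd i
  have h0 : AnalyticAt ℂ (fun x => x - s i) (s i) := by fun_prop
  have h2 : AnalyticAt ℂ (fun x => (2 * ħ + (x - s i) * regForce ħ dV s i x)) (s i) :=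
    analyticAt_const.add (h0.mul h1)
  have h3 : AnalyticAt ℂ (fun x => -ħ * ((x - s i) * deriv K x)) (s i) :=
    analyticAt_const.mul (h0.mul hK.deriv)
  have h4 : (fun x => (2 * ħ + (x - s i) * regForce ħ dV s i x) * K x -
      ħ * ((x - s i) * deriv K x)) = fun x => (2 * ħ + (x - s i) * regForce ħ dV s i x) * K x +
      -ħ * ((x - s i) * deriv K x) := by
    ext x; ring
  have h5 : AnalyticAt ℂ (fun x => (2 * ħ + (x - s i) * regForce ħ dV s i x) * K x) (s i) :=
    h2.mul hK
  have h6 : AnalyticAt ℂ (fun x => (x - s i) * regForce ħ dV s i x) (s i) := h0.mul h1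
  rw [h4]
  refine ⟨h5.add h3, ?_⟩
  rw [taylor_add h5 h3, taylor_mul h2 hK, taylor_add analyticAt_const h6,
    taylor_const, taylor_mul h0 h1, taylor_sub_const, taylor_const_mul, taylor_mul h0 hK.deriv,
    taylor_sub_const, taylor_deriv]

lemma eventually_eq_of_punctured {f g : ℂ → ℂ} {c : ℂ} (hf : AnalyticAt ℂ f c)
    (hg : AnalyticAt ℂ g c) (h : ∀ᶠ z in 𝓝[≠] c, f z = g z) : ∀ᶠ z in 𝓝 c, f z = g z :=
  (hf.frequently_eq_iff_eventually_eq hg).1 h.frequently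

end Local

lemma tendsto_inv_sub_cobounded (a : ℂ) :
    Tendsto (fun x : ℂ => (x - a)⁻¹) (Bornology.cobounded ℂ) (𝓝 0) :=
  tendsto_inv₀_cobounded.comp (tendsto_sub_const_cobounded a)

namespace IsKernelSystem

variable {m : ℕ} {ħ : ℂ} {dV : RatFunc ℂ} {s : Fin m → ℂ} {G K : ℂ → ℂ → ℂ}
  (h : IsKernelSystem ħ dV s G K)
include h

lemma sub_mul_G {x₀ : ℂ} (hx₀ : x₀ ∉ Set.range s) (i : Fin m) : ∀ᶠ x in 𝓝[≠] (s i),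
    (2 * ħ + (x - s i) * regForce ħ dV s i x) * K x₀ x - ħ * ((x - s i) * deriv (K x₀) x) =
      (x - s i) * G x₀ x := by
  filter_upwards [h.ode x₀ hx₀ i, self_mem_nhdsWithin] with x hx hxs
  rw [← hx, force_eq]
  have : (x - s i) * (x - s i)⁻¹ = 1 := mul_inv_cancel₀ (sub_ne_zero.2 hxs)
  linear_combination (-2 * ħ * K x₀ x) * this

/-- Since `K` is analytic at `sᵢ`, the differential equation leaves `G` only a simple pole there,
with residue `2ħ K(x₀, sᵢ)`. Subtracting all polar parts gives a function with removable
singularities that vanishes at infinity. -/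
lemma G_eq {x₀ x : ℂ} (hx₀ : x₀ ∉ Set.range s) (hx : x ∉ Set.range s) (hxx : x ≠ x₀) :
    G x₀ x = (x - x₀)⁻¹ + ∑ i, 2 * ħ * K x₀ (s i) * (x - s i)⁻¹ := by
  set H : ℂ → ℂ := fun x => G x₀ x - (x - x₀)⁻¹ - ∑ i, 2 * ħ * K x₀ (s i) * (x - s i)⁻¹ with hHdef
  have hnot : ∀ c, c ∉ Set.range s → ∀ᶠ z in 𝓝 c, z ∉ Set.range s := fun c hc =>
    (Set.finite_range s).isClosed.isOpen_compl.mem_nhds hc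
  have hsum : ∀ c, c ∉ Set.range s →
      AnalyticAt ℂ (fun x => ∑ i, 2 * ħ * K x₀ (s i) * (x - s i)⁻¹) c := fun c hc =>
    Finset.analyticAt_fun_sum _ fun i _ =>
      analyticAt_const.mul (analyticAt_inv_sub fun h => hc ⟨i, h.symm⟩)
  obtain ⟨p, N, hp⟩ := h.rational_right x₀ hx₀
  set Q : ℂ → ℂ := fun x => p.eval x / ∏ i, (x - s i) ^ N
  have hQ : ∀ c, c ∉ Set.range s → AnalyticAt ℂ Q c := by
    intro c hc
    refine (AnalyticOnNhd.eval_polynomial p c trivial).div ?_ ?_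
    · exact Finset.analyticAt_fun_prod _ fun i _ => by fun_prop
    · exact Finset.prod_ne_zero_iff.2 fun i _ => pow_ne_zero _ (sub_ne_zero.2 fun h => hc ⟨i, h.symm⟩)
  have hGQ : ∀ x, x ∉ Set.range s → x ≠ x₀ → G x₀ x = (x - x₀)⁻¹ * Q x := by
    intro x hx hxx
    rw [hp x hx hxx, mul_comm (x - x₀), ← div_div, div_eq_inv_mul]
  have hgerm : ∀ c, c ∉ Set.range s → c ≠ x₀ → ∃ g : ℂ → ℂ, AnalyticAt ℂ g c ∧
      ∀ᶠ z in 𝓝 c, H z = g z := by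
    intro c hc hcx
    refine ⟨fun z => (z - x₀)⁻¹ * Q z - (z - x₀)⁻¹ - ∑ i, 2 * ħ * K x₀ (s i) * (z - s i)⁻¹,
      (((analyticAt_inv_sub hcx).mul (hQ c hc)).sub (analyticAt_inv_sub hcx)).sub (hsum c hc), ?_⟩
    filter_upwards [hnot c hc, isOpen_ne.mem_nhds hcx] with z hz hzx
    rw [hHdef, ← hGQ z hz hzx]
  have hzero : H x = 0 := by
    refine eq_zero_of_removable (H := H) (fun c => ?_) ?_ ?_
    · by_cases hc : c ∈ Set.range s
      · obtain ⟨i, rfl⟩ := hc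
        have hx₀i : s i ≠ x₀ := fun h => hx₀ ⟨i, h⟩
        set R : ℂ → ℂ := fun x => (2 * ħ + (x - s i) * regForce ħ dV s i x) * K x₀ x -
          ħ * ((x - s i) * deriv (K x₀) x) with hR
        have hRan : AnalyticAt ℂ R (s i) := (ode_taylor h.inj h.denom_ne (h.analytic x₀ hx₀ i)).1
        have hRi : R (s i) = 2 * ħ * K x₀ (s i) := by simp [hR]
        refine ⟨fun z => dslope R (s i) z - (z - x₀)⁻¹ -
          ∑ j ∈ Finset.univ.erase i, 2 * ħ * K x₀ (s j) * (z - s j)⁻¹, ?_, ?_⟩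
        · refine ((AnalyticAt.dslope hRan).sub (analyticAt_inv_sub hx₀i)).sub
            (Finset.analyticAt_fun_sum _ fun j hj => analyticAt_const.mul (analyticAt_inv_sub ?_))
          exact h.inj.ne (Finset.ne_of_mem_erase hj).symm
        · filter_upwards [h.sub_mul_G hx₀ i, self_mem_nhdsWithin] with z hz hzs
          have hz' := sub_ne_zero.2 hzs
          rw [dslope_of_ne _ hzs, slope_def_field, hRi]
          simp only [hHdef, hR]
          rw [hz, ← Finset.add_sum_erase _ _ (Finset.mem_univ i), sub_div,
            mul_div_cancel_left₀ _ hz', div_eq_mul_inv]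
          ring
      · rcases eq_or_ne c x₀ with rfl | hcx
        · have hQ1 : Q c = 1 := by
            refine tendsto_nhds_unique (((hQ c hc).continuousAt.tendsto.mono_left
              nhdsWithin_le_nhds).congr' ?_) (h.residue_right c hc)
            filter_upwards [(hnot c hc).filter_mono nhdsWithin_le_nhds, self_mem_nhdsWithin]
              with z hz hzc
            rw [hGQ z hz hzc, mul_inv_cancel_left₀ (sub_ne_zero.2 hzc)]
          refine ⟨fun z => dslope Q c z - ∑ j, 2 * ħ * K c (s j) * (z - s j)⁻¹,
            (AnalyticAt.dslope (hQ c hc)).sub (hsum c hc), ?_⟩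
          filter_upwards [(hnot c hc).filter_mono nhdsWithin_le_nhds, self_mem_nhdsWithin]
              with z hz hzc
          simp only [hHdef]
          rw [hGQ z hz hzc, dslope_of_ne _ hzc, slope_def_field, hQ1, sub_div, div_eq_inv_mul,
            one_div]
        · obtain ⟨g, hg, hg2⟩ := hgerm c hc hcx
          exact ⟨g, hg, hg2.filter_mono nhdsWithin_le_nhds⟩
    · have h1 : Tendsto (fun x => G x₀ x) (Bornology.cobounded ℂ) (𝓝 0) :=
        (h.decay_right x₀ hx₀).trans_tendsto tendsto_inv₀_cobounded
      have h2 : Tendsto (fun x => ∑ i, 2 * ħ * K x₀ (s i) * (x - s i)⁻¹) (Bornology.cobounded ℂ)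
          (𝓝 (∑ i : Fin m, 2 * ħ * K x₀ (s i) * 0)) :=
        tendsto_finsetSum _ fun i _ => (tendsto_inv_sub_cobounded (s i)).const_mul _
      have h3 := (h1.sub (tendsto_inv_sub_cobounded x₀)).sub h2
      simpa using h3
    · obtain ⟨g, hg, hg2⟩ := hgerm x hx hxx
      exact hg.continuousAt.congr (hg2.mono fun _ h => h.symm)
  rw [hHdef] at hzero
  linear_combination hzero

lemma deriv_G {x₀ x : ℂ} (hx₀ : x₀ ∉ Set.range s) (hx : x ∉ Set.range s) (hxx : x ≠ x₀) :
    deriv (G x₀) x =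
      -((x - x₀)⁻¹) ^ 2 - ∑ i, 2 * ħ * K x₀ (s i) * ((x - s i)⁻¹) ^ 2 := by
  have h1 : HasDerivAt (fun x => (x - x₀)⁻¹ + ∑ i, 2 * ħ * K x₀ (s i) * (x - s i)⁻¹)
      (-((x - x₀)⁻¹) ^ 2 + ∑ i, 2 * ħ * K x₀ (s i) * -((x - s i)⁻¹) ^ 2) x := by
    refine (hasDerivAt_inv_sub hxx).add (HasDerivAt.fun_sum fun i _ => ?_)
    exact (hasDerivAt_inv_sub fun h => hx ⟨i, h.symm⟩).const_mul _
  have h2 : G x₀ =ᶠ[𝓝 x] fun x => (x - x₀)⁻¹ + ∑ i, 2 * ħ * K x₀ (s i) * (x - s i)⁻¹ := by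
    filter_upwards [(Set.finite_range s).isClosed.isOpen_compl.mem_nhds hx, isOpen_ne.mem_nhds hxx]
      with z hz hzx using h.G_eq hx₀ hz hzx
  rw [(h1.congr_of_eventuallyEq h2).deriv]
  simp only [mul_neg, Finset.sum_neg_distrib]
  ring

/-- The differential equation for `K`, multiplied by `x - sᵢ`, is compared at orders one and two. At
order two the unknown second Taylor coefficient of `K` has the factor `2ħ - 2ħ`. After elimination
of the first Taylor coefficient a relation between the values `K(x₀, sⱼ)` remains; it is the
condition for the absence of a logarithm. -/
lemma linear_eq (hħ : ħ ≠ 0) {x₀ : ℂ} (hx₀ : x₀ ∉ Set.range s) (i : Fin m) :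
    (-(hessian ħ dV s i i / 2) - regForce ħ dV s i (s i) ^ 2 / (2 * ħ ^ 2)) * (2 * ħ * K x₀ (s i)) +
      ∑ j ∈ Finset.univ.erase i, (((s i - s j)⁻¹) ^ 2 + regForce ħ dV s i (s i) / ħ *
        (s i - s j)⁻¹) * (2 * ħ * K x₀ (s j)) =
      -((s i - x₀)⁻¹) ^ 2 - regForce ħ dV s i (s i) / ħ * (s i - x₀)⁻¹ := by
  have hx₀i : s i ≠ x₀ := fun h => hx₀ ⟨i, h⟩
  set R : ℂ → ℂ := fun x => (x - x₀)⁻¹ + ∑ j ∈ Finset.univ.erase i, 2 * ħ * K x₀ (s j) * (x - s j)⁻¹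
  have hne : ∀ j ∈ Finset.univ.erase i, s i ≠ s j := fun j hj =>
    h.inj.ne (Finset.ne_of_mem_erase hj).symm
  have hR : AnalyticAt ℂ R (s i) := (analyticAt_inv_sub hx₀i).add
    (Finset.analyticAt_fun_sum _ fun j hj => analyticAt_const.mul (analyticAt_inv_sub (hne j hj)))
  have hR' : HasDerivAt R (-((s i - x₀)⁻¹) ^ 2 + ∑ j ∈ Finset.univ.erase i, 2 * ħ * K x₀ (s j) *
      -((s i - s j)⁻¹) ^ 2) (s i) :=
    (hasDerivAt_inv_sub hx₀i).add (HasDerivAt.fun_sum fun j hj =>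
      (hasDerivAt_inv_sub (hne j hj)).const_mul _)
  have h0 : AnalyticAt ℂ (fun x => x - s i) (s i) := by fun_prop
  have hXR : AnalyticAt ℂ (fun x => (x - s i) * R x) (s i) := h0.mul hR
  have hK := h.analytic x₀ hx₀ i
  obtain ⟨hL, ht⟩ := ode_taylor (ħ := ħ) h.inj h.denom_ne hK
  have hRR : AnalyticAt ℂ (fun x => 2 * ħ * K x₀ (s i) + (x - s i) * R x) (s i) :=
    analyticAt_const.add hXR
  have heq := taylor_congr (eventually_eq_of_punctured hL hRR (by
      filter_upwards [h.sub_mul_G hx₀ i, eventually_notMem_range s (s i), self_mem_nhdsWithin,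
        mem_nhdsWithin_of_mem_nhds (isOpen_ne.mem_nhds hx₀i)] with x hx hxs hxi hxx
      have hxi' := mul_inv_cancel₀ (sub_ne_zero.2 hxi)
      rw [hx, h.G_eq hx₀ hxs hxx, ← Finset.add_sum_erase _ _ (Finset.mem_univ i)]
      simp only [R]
      linear_combination (2 * ħ * K x₀ (s i)) * hxi'))
  rw [ht, taylor_add analyticAt_const hXR, taylor_const, taylor_mul h0 hR, taylor_sub_const] at heq
  have e1 := congrArg (coeff (0 + 1)) heq
  have e2 := congrArg (coeff (1 + 1)) heq
  have hc : ∀ k, coeff k (C (2 * ħ * K x₀ (s i))) = if k = 0 then 2 * ħ * K x₀ (s i) else 0 :=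
    fun k => coeff_C _ _
  have hs : ∀ (k : ℕ) (f : ℂ⟦X⟧), coeff (k + 1) (X * f) = coeff k f := fun k f =>
    coeff_succ_X_mul k f
  have hm0 : coeff 0 (taylor (regForce ħ dV s i) (s i) * taylor (K x₀) (s i)) =
      regForce ħ dV s i (s i) * K x₀ (s i) := by
    rw [coeff_mul, Finset.Nat.sum_antidiagonal_eq_sum_range_succ_mk, Finset.sum_range_one,
      Nat.sub_zero, coeff_zero_taylor, coeff_zero_taylor]
  have hm1 : coeff 1 (taylor (regForce ħ dV s i) (s i) * taylor (K x₀) (s i)) =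
      regForce ħ dV s i (s i) * coeff 1 (taylor (K x₀) (s i)) +
        -(ħ * hessian ħ dV s i i) * K x₀ (s i) := by
    rw [coeff_mul, Finset.Nat.sum_antidiagonal_eq_sum_range_succ_mk, Finset.sum_range_succ,
      Finset.sum_range_one, Nat.sub_zero, coeff_zero_taylor, Nat.sub_self, coeff_zero_taylor,
      coeff_one_taylor (regForce ħ dV s i), deriv_regForce h.inj h.denom_ne hħ]
  rw [add_mul, mul_assoc X] at e2
  rw [add_mul, mul_assoc X] at e1
  rw [map_add, map_add, map_add, coeff_C_mul, coeff_C_mul, hs, hs, hs, hc, hm1, coeff_derivative,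
    coeff_one_taylor R, hR'.deriv, if_neg (by norm_num)] at e2
  rw [map_add, map_add, map_add, coeff_C_mul, coeff_C_mul, hs, hs, hs, hc, hm0, coeff_derivative,
    coeff_zero_taylor R, if_neg (by norm_num), zero_add] at e1
  norm_num only at e1 e2
  have hRi : R (s i) = (s i - x₀)⁻¹ +
    ∑ j ∈ Finset.univ.erase i, 2 * ħ * K x₀ (s j) * (s i - s j)⁻¹ := rfl
  have hsum : ∑ j ∈ Finset.univ.erase i, (((s i - s j)⁻¹) ^ 2 + regForce ħ dV s i (s i) / ħ *
        (s i - s j)⁻¹) * (2 * ħ * K x₀ (s j)) =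
      ∑ j ∈ Finset.univ.erase i, 2 * ħ * K x₀ (s j) * ((s i - s j)⁻¹) ^ 2 +
      regForce ħ dV s i (s i) / ħ *
        ∑ j ∈ Finset.univ.erase i, 2 * ħ * K x₀ (s j) * (s i - s j)⁻¹ := by
    rw [Finset.mul_sum, ← Finset.sum_add_distrib]
    exact Finset.sum_congr rfl fun _ _ => by ring
  rw [hsum]
  rw [hRi] at e1
  simp only [mul_neg, Finset.sum_neg_distrib] at e2
  have e1' : coeff 1 (taylor (K x₀) (s i)) = ((s i - x₀)⁻¹ + ∑ j ∈ Finset.univ.erase i,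
      2 * ħ * K x₀ (s j) * (s i - s j)⁻¹ - regForce ħ dV s i (s i) * K x₀ (s i)) / ħ := by
    rw [eq_div_iff hħ]
    linear_combination e1
  rw [e1'] at e2
  field_simp at e2 ⊢
  linear_combination e2

/-- By `linear_system` the symmetry of `B` makes the matrix of these relations invertible and the `c
i` zero. The latter are the Bethe equations, after which the matrix is `-T / 2`. -/
lemma isBethe_and_K_eq (hħ : ħ ≠ 0) : IsBethe ħ dV s ∧ ∀ x₀ ∉ Set.range s, ∀ j,
    2 * ħ * K x₀ (s j) = 2 * ∑ k, matA ħ dV s j k * ((x₀ - s k)⁻¹) ^ 2 := by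
  set c : Fin m → ℂ := fun i => regForce ħ dV s i (s i) / ħ with hc
  set T := hessian ħ dV s with hT
  set M : Matrix (Fin m) (Fin m) ℂ := Matrix.of fun i j =>
    if i = j then -(T i i / 2) - c i ^ 2 / 2 else ((s i - s j)⁻¹) ^ 2 + c i * (s i - s j)⁻¹ with hM
  obtain ⟨h1, h2, h3⟩ := linear_system h.inj c M (fun x₀ j => 2 * ħ * K x₀ (s j)) (by
    intro x₀ hx₀
    ext i
    rw [← h.linear_eq hħ hx₀ i, Matrix.mulVec, dotProduct,
      ← Finset.add_sum_erase _ _ (Finset.mem_univ i)]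
    congr 1
    · simp only [hM, hc, Matrix.of_apply, if_true, div_pow, div_div, mul_comm 2 (ħ ^ 2), hT]
    · refine Finset.sum_congr rfl fun j hj => ?_
      simp only [hM, hc, Matrix.of_apply, if_neg (Finset.ne_of_mem_erase hj).symm]) (by
    intro x₀ hx₀ x hx hxx
    have := h.symm x₀ hx₀ x hx hxx
    rw [h.deriv_G hx₀ hx hxx.symm, h.deriv_G hx hx₀ hxx, ← neg_sub x x₀, inv_neg] at this
    linear_combination -this)
  have hMT : M = (-1 / 2 : ℂ) • T := by
    ext i j
    rw [Matrix.smul_apply, hM, Matrix.of_apply, smul_eq_mul]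
    split_ifs with hij
    · rw [h2 i, ← hij]; ring
    · rw [h2 i, hT, hessian, Matrix.of_apply, if_neg hij]
      simp only [inv_pow]
      ring
  have hTdet : T.det ≠ 0 := by
    intro h0
    rw [hMT, Matrix.det_smul, h0, mul_zero] at h1
    exact h1 rfl
  refine ⟨⟨h.inj, h.denom_ne, fun i => ?_, hTdet⟩, fun x₀ hx₀ j => ?_⟩
  · have h4 : regForce ħ dV s i (s i) = 0 := by
      have := h2 i
      rwa [hc, div_eq_zero_iff, or_iff_left hħ] at this
    simp only [one_div]
    rw [regForce] at h4
    linear_combination -h4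
  · have hinv : M⁻¹ = (-2 : ℂ) • T⁻¹ := by
      refine Matrix.inv_eq_right_inv ?_
      rw [hMT, Matrix.smul_mul, Matrix.mul_smul, Matrix.mul_nonsing_inv _ hTdet.isUnit, smul_smul]
      norm_num
    rw [h3 x₀ hx₀ j, hinv, Finset.mul_sum, ← Finset.sum_neg_distrib]
    refine Finset.sum_congr rfl fun k _ => ?_
    rw [Matrix.smul_apply, matA, smul_eq_mul]
    ring

lemma isBethe (hħ : ħ ≠ 0) : IsBethe ħ dV s := (h.isBethe_and_K_eq hħ).1

lemma K_eq (hħ : ħ ≠ 0) {x₀ : ℂ} (hx₀ : x₀ ∉ Set.range s) (j : Fin m) :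
    2 * ħ * K x₀ (s j) = 2 * ∑ k, matA ħ dV s j k * ((x₀ - s k)⁻¹) ^ 2 :=
  (h.isBethe_and_K_eq hħ).2 x₀ hx₀ j

/-- The part of `B` that is regular on the diagonal. -/
lemma kernelB_eq (hħ : ħ ≠ 0) {x₀ x : ℂ} (hx₀ : x₀ ∉ Set.range s) (hx : x ∉ Set.range s)
    (hxx : x ≠ x₀) : kernelB G x₀ x = 1 / 2 * ((x₀ - x)⁻¹) ^ 2 +
      ∑ j, ∑ k, matA ħ dV s j k * ((x - s j)⁻¹) ^ 2 * ((x₀ - s k)⁻¹) ^ 2 := by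
  rw [kernelB, h.deriv_G hx₀ hx hxx]
  simp only [h.K_eq hħ hx₀]
  have : ∑ j, ∑ k, matA ħ dV s j k * ((x - s j)⁻¹) ^ 2 * ((x₀ - s k)⁻¹) ^ 2 =
      1 / 2 * ∑ j, 2 * (∑ k, matA ħ dV s j k * ((x₀ - s k)⁻¹) ^ 2) * ((x - s j)⁻¹) ^ 2 := by
    rw [Finset.mul_sum]
    refine Finset.sum_congr rfl fun j _ => ?_
    rw [mul_assoc, ← mul_assoc (1 / 2 : ℂ), Finset.sum_mul, Finset.mul_sum]
    exact Finset.sum_congr rfl fun k _ => by ring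
  rw [this, ← neg_sub x₀ x, inv_neg]
  ring

lemma kernelBDiag_eq (hħ : ħ ≠ 0) {z : ℂ} (hz : z ∉ Set.range s) : kernelBDiag G z =
    ∑ j, ∑ k, matA ħ dV s j k * ((z - s j)⁻¹) ^ 2 * ((z - s k)⁻¹) ^ 2 := by
  have hc : ContinuousAt (fun y => ∑ j, ∑ k, matA ħ dV s j k * ((y - s j)⁻¹) ^ 2 *
      ((z - s k)⁻¹) ^ 2) z := by
    have : ∀ j, z - s j ≠ 0 := fun j => sub_ne_zero.2 fun h => hz ⟨j, h.symm⟩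
    refine tendsto_finsetSum _ fun j _ => tendsto_finsetSum _ fun k _ => ?_
    have hj := this j
    have : ContinuousAt (fun y => matA ħ dV s j k * ((y - s j)⁻¹) ^ 2 * ((z - s k)⁻¹) ^ 2) z := by
      fun_prop (disch := assumption)
    exact this
  refine Tendsto.limUnder_eq ((hc.tendsto.mono_left nhdsWithin_le_nhds).congr' ?_)
  filter_upwards [((Set.finite_range s).isClosed.isOpen_compl.mem_nhds hz : _ ∈ 𝓝 z) |>
    mem_nhdsWithin_of_mem_nhds, self_mem_nhdsWithin] with y hy hyz
  rw [h.kernelB_eq hħ hz hy hyz]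
  simp only [inv_pow]
  rw [one_div, one_div, mul_inv]
  ring

end IsKernelSystem

/-! ### From nondegenerate solutions of the Bethe equations to kernel systems. -/

lemma exists_local_primitive {f : ℂ → ℂ} {c : ℂ} (hf : AnalyticAt ℂ f c) :
    ∃ F : ℂ → ℂ, F c = 0 ∧ ∀ᶠ z in 𝓝 c, HasDerivAt F (f z) z := by
  obtain ⟨ε, hε, h⟩ := Metric.eventually_nhds_iff_ball.1 hf.eventually_analyticAt
  have h1 : DifferentiableOn ℂ f (Metric.ball c ε) := fun z hz =>
    (h z hz).differentiableAt.differentiableWithinAt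
  obtain ⟨F, hF, hF0⟩ := h1.isExactOn_ball.with_val_at c 0
  exact ⟨F, hF, Filter.eventually_of_mem (Metric.ball_mem_nhds c hε) hF0⟩

lemma analyticAt_of_eventually_hasDerivAt {F f : ℂ → ℂ} {c : ℂ}
    (h : ∀ᶠ z in 𝓝 c, HasDerivAt F (f z) z) : AnalyticAt ℂ F c :=
  Complex.analyticAt_iff_eventually_differentiableAt.2 (h.mono fun _ hx => hx.differentiableAt)

/-- The equation for `K` has a solution without monodromy. -/
lemma exists_local_kernel {ħ a c : ℂ} (hħ : ħ ≠ 0) {q R : ℂ → ℂ} (hq : AnalyticAt ℂ q c)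
    (hR : AnalyticAt ℂ R c) (hq0 : q c = 0) (hRq : 2 * ħ * deriv R c = deriv q c * a) :
    ∃ K : ℂ → ℂ, AnalyticAt ℂ K c ∧ ∀ᶠ x in 𝓝[≠] c,
      (2 * ħ * (x - c)⁻¹ + q x) * K x - ħ * deriv K x = a * (x - c)⁻¹ + R x := by
  obtain ⟨Q, hQ0, hQ⟩ := exists_local_primitive hq
  have hQan := analyticAt_of_eventually_hasDerivAt hQ
  set E : ℂ → ℂ := fun x => Complex.exp (-ħ⁻¹ * Q x)
  have hE : AnalyticAt ℂ E c := (analyticAt_const.mul hQan).cexp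
  have hE' : ∀ᶠ x in 𝓝 c, HasDerivAt E (-ħ⁻¹ * (q x * E x)) x := by
    filter_upwards [hQ] with x hx
    exact ((hx.const_mul (-ħ⁻¹)).cexp).congr_deriv (by ring)
  have h0 : AnalyticAt ℂ (fun x => x - c) c := by fun_prop
  have hXR : AnalyticAt ℂ (fun x => (x - c) * R x) c := h0.mul hR
  have haR : AnalyticAt ℂ (fun x => a + (x - c) * R x) c := analyticAt_const.add hXR
  have hφ : AnalyticAt ℂ (fun x => (a + (x - c) * R x) * E x) c := haR.mul hE
  have hEc : E c = 1 := by simp [E, hQ0]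
  have ht : derivative ℂ (taylor E c) = C (-ħ⁻¹) * (taylor q c * taylor E c) := by
    rw [← taylor_deriv, taylor_congr (hE'.mono fun x hx => hx.deriv), taylor_const_mul,
      taylor_mul hq hE]
  have hE1 : coeff 1 (taylor E c) = 0 := by
    have := congrArg (coeff 0) ht
    rw [coeff_derivative, coeff_C_mul, coeff_mul, Finset.Nat.sum_antidiagonal_eq_sum_range_succ_mk,
      Finset.sum_range_one, coeff_zero_taylor, hq0] at this
    simpa using this
  have hE2 : coeff 2 (taylor E c) * 2 = -ħ⁻¹ * deriv q c := by
    have := congrArg (coeff 1) ht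
    rw [coeff_derivative, coeff_C_mul, coeff_mul, Finset.Nat.sum_antidiagonal_eq_sum_range_succ_mk,
      Finset.sum_range_succ, Finset.sum_range_one, coeff_zero_taylor, hq0, coeff_one_taylor,
      Nat.sub_self, coeff_zero_taylor, hEc, zero_mul, zero_add, mul_one] at this
    norm_num at this
    rw [this, coeff_one_taylor]; ring
  -- Variation of constants gives `K = -ħ⁻¹ (x - c)² E⁻¹ ∫ (x - c)⁻³ (a + (x - c) R) E`. The
  -- integral produces no logarithm exactly when this coefficient of order two vanishes, which is
  -- the condition `hRq`.
  have hφ2 : coeff 2 (taylor (fun x => (a + (x - c) * R x) * E x) c) = 0 := by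
    rw [taylor_mul haR hE, taylor_add analyticAt_const hXR, taylor_mul h0 hR, taylor_const,
      taylor_sub_const, add_mul, mul_assoc X, map_add, coeff_C_mul,
      show (2 : ℕ) = 1 + 1 from rfl, coeff_succ_X_mul, coeff_mul,
      Finset.Nat.sum_antidiagonal_eq_sum_range_succ_mk, Finset.sum_range_succ, Finset.sum_range_one,
      coeff_zero_taylor, Nat.sub_self, Nat.sub_zero, hE1, coeff_zero_taylor, hEc, coeff_one_taylor]
    norm_num
    have h3 : deriv R c = deriv q c * a / (2 * ħ) := by
      rw [eq_div_iff (by simpa using hħ)]; linear_combination hRq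
    have h4 : coeff 2 (taylor E c) = -ħ⁻¹ * deriv q c / 2 := by
      rw [eq_div_iff two_ne_zero, hE2]
    rw [h3, h4]
    field_simp
    ring
  obtain ⟨h, hh, hrem⟩ := exists_taylor_remainder hφ 3
  simp only [Finset.sum_range_succ, Finset.sum_range_zero, hφ2] at hrem
  set a₀ := coeff 0 (taylor (fun x => (a + (x - c) * R x) * E x) c)
  set a₁ := coeff 1 (taylor (fun x => (a + (x - c) * R x) * E x) c)
  obtain ⟨H, -, hH⟩ := exists_local_primitive hh
  have hHan := analyticAt_of_eventually_hasDerivAt hH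
  set ψ : ℂ → ℂ := fun x => Complex.exp (ħ⁻¹ * Q x)
  have hψ : AnalyticAt ℂ ψ c := (analyticAt_const.mul hQan).cexp
  have hψE : ∀ x, ψ x * E x = 1 := fun x => by
    simp only [ψ, E]
    rw [← Complex.exp_add]; simp
  refine ⟨fun x => ψ x * (-ħ⁻¹ * (-a₀ / 2 - a₁ * (x - c) + (x - c) ^ 2 * H x)), ?_, ?_⟩
  · refine hψ.mul (analyticAt_const.mul (AnalyticAt.add ?_ ((h0.pow 2).mul hHan)))
    fun_prop
  · filter_upwards [hQ.filter_mono nhdsWithin_le_nhds, hH.filter_mono nhdsWithin_le_nhds,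
      self_mem_nhdsWithin] with x hQx hHx hxc
    have hxc' := sub_ne_zero.2 hxc
    have d1 : HasDerivAt ψ (ħ⁻¹ * q x * ψ x) x :=
      ((hQx.const_mul (ħ⁻¹)).cexp).congr_deriv (by ring)
    have d2 : HasDerivAt (fun x : ℂ => x - c) 1 x := (hasDerivAt_id x).sub_const c
    have d3 : HasDerivAt (fun x => -ħ⁻¹ * (-a₀ / 2 - a₁ * (x - c) + (x - c) ^ 2 * H x))
        (-ħ⁻¹ * (-(a₁ * 1) + (2 * (x - c) * H x + (x - c) ^ 2 * h x))) x := by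
      have e := (((d2.const_mul a₁).const_sub (-a₀ / 2)).add ((d2.pow 2).mul hHx)).const_mul (-ħ⁻¹)
      refine e.congr_deriv ?_
      simp
    rw [(d1.fun_mul d3).deriv]
    have h5 := hrem x
    have h6 := hψE x
    have h7 := mul_inv_cancel₀ hxc'
    have key : a * (x - c)⁻¹ + R x =
        (x - c)⁻¹ * ψ x * (a₀ + a₁ * (x - c) + (x - c) ^ 3 * h x) := by
      linear_combination (x - c)⁻¹ * ψ x * h5 - (x - c)⁻¹ * (a + (x - c) * R x) * h6 - R x * h7
    rw [key]
    field_simp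
    ring

lemma exists_rational_form {m : ℕ} (s : Fin m → ℂ) (N : ℕ) (a y₀ : ℂ) (b : Fin m → ℂ) :
    ∃ p : Polynomial ℂ, ∀ y ∉ Set.range s, y ≠ y₀ →
      a * (y - y₀)⁻¹ + ∑ j, b j * ((y - s j)⁻¹) ^ N =
        p.eval y / ((y - y₀) * ∏ i, (y - s i) ^ N) := by
  refine ⟨Polynomial.C a * ∏ i, (Polynomial.X - Polynomial.C (s i)) ^ N +
    ∑ j, Polynomial.C (b j) * (Polynomial.X - Polynomial.C y₀) *
      ∏ i ∈ Finset.univ.erase j, (Polynomial.X - Polynomial.C (s i)) ^ N, fun y hy hyy => ?_⟩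
  have h0 := sub_ne_zero.2 hyy
  have h1 : ∀ i, (y - s i) ^ N ≠ 0 := fun i =>
    pow_ne_zero _ (sub_ne_zero.2 fun h => hy ⟨i, h.symm⟩)
  have h2 : ∏ i, (y - s i) ^ N ≠ 0 := Finset.prod_ne_zero_iff.2 fun i _ => h1 i
  rw [eq_div_iff (mul_ne_zero h0 h2), add_mul, Finset.sum_mul]
  simp only [Polynomial.eval_add, Polynomial.eval_mul, Polynomial.eval_C, Polynomial.eval_prod,
    Polynomial.eval_pow, Polynomial.eval_sub, Polynomial.eval_X, Polynomial.eval_finsetSum]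
  congr 1
  · rw [mul_assoc, inv_mul_cancel_left₀ h0]
  · refine Finset.sum_congr rfl fun j _ => ?_
    rw [← Finset.mul_prod_erase _ _ (Finset.mem_univ j), inv_pow]
    have := inv_mul_cancel₀ (h1 j)
    linear_combination (b j * (y - y₀) * ∏ x ∈ Finset.univ.erase j, (y - s x) ^ N) * this

lemma isBigO_inv_sub (a : ℂ) :
    (fun x : ℂ => (x - a)⁻¹) =O[Bornology.cobounded ℂ] fun x => x⁻¹ := by
  refine IsBigO.of_bound 2 ?_
  refine (Filter.hasBasis_cobounded_norm.eventually_iff).2 ⟨2 * ‖a‖ + 1, trivial, fun x hx => ?_⟩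
  have hx' : 2 * ‖a‖ + 1 ≤ ‖x‖ := hx
  have h1 := norm_sub_norm_le x a
  have h2 := norm_nonneg a
  have h3 : 0 < ‖x‖ := by linarith
  have h4 : ‖x‖ / 2 ≤ ‖x - a‖ := by linarith
  rw [norm_inv, norm_inv]
  calc ‖x - a‖⁻¹ ≤ (‖x‖ / 2)⁻¹ := inv_anti₀ (by positivity) h4
    _ = 2 * ‖x‖⁻¹ := by rw [inv_div, div_eq_mul_inv]

lemma isBigO_inv_sub_sq (a : ℂ) :
    (fun x : ℂ => ((x - a)⁻¹) ^ 2) =O[Bornology.cobounded ℂ] fun x => x⁻¹ := by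
  have h1 := (isBigO_inv_sub a).mul ((tendsto_inv_sub_cobounded a).isBigO_one ℂ)
  simpa [sq] using h1

lemma hessian_mul_matA {m : ℕ} {ħ : ℂ} {dV : RatFunc ℂ} {s : Fin m → ℂ}
    (h : (hessian ħ dV s).det ≠ 0) : hessian ħ dV s * matA ħ dV s = 1 :=
  Matrix.mul_nonsing_inv _ h.isUnit

namespace IsBethe

variable {m : ℕ} {ħ : ℂ} {dV : RatFunc ℂ} {s : Fin m → ℂ} (h : IsBethe ħ dV s)

include h in
lemma regForce_eq_zero (i : Fin m) : regForce ħ dV s i (s i) = 0 := by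
  rw [regForce, h.bethe i]
  simp only [one_div]
  ring

-- The condition for the absence of a logarithm at `sᵢ` is the `i`-th row of `T A = 1`, applied to
-- the vector `2 / (x₀ - sₖ)²`.
include h in
lemma exists_germ (hħ : ħ ≠ 0) {x₀ : ℂ} (hx₀ : x₀ ∉ Set.range s) (i : Fin m) :
    ∃ K : ℂ → ℂ, AnalyticAt ℂ K (s i) ∧ ∀ᶠ x in 𝓝[≠] (s i),
      (2 * ħ * ∑ j, 1 / (x - s j) - val dV x) * K x - ħ * deriv K x = (x - x₀)⁻¹ +
        ∑ j, 2 * (∑ k, matA ħ dV s j k * ((x₀ - s k)⁻¹) ^ 2) * (x - s j)⁻¹ := by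
  set α : Fin m → ℂ := fun j => 2 * ∑ k, matA ħ dV s j k * ((x₀ - s k)⁻¹) ^ 2 with hα
  have hx₀i : s i ≠ x₀ := fun h => hx₀ ⟨i, h⟩
  have hne : ∀ j ∈ Finset.univ.erase i, s i ≠ s j := fun j hj =>
    h.inj.ne (Finset.ne_of_mem_erase hj).symm
  set R : ℂ → ℂ := fun x => (x - x₀)⁻¹ + ∑ j ∈ Finset.univ.erase i, α j * (x - s j)⁻¹
  have hR : AnalyticAt ℂ R (s i) := (analyticAt_inv_sub hx₀i).add
    (Finset.analyticAt_fun_sum _ fun j hj => analyticAt_const.mul (analyticAt_inv_sub (hne j hj)))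
  have hR' : HasDerivAt R (-((s i - x₀)⁻¹) ^ 2 + ∑ j ∈ Finset.univ.erase i, α j *
      -((s i - s j)⁻¹) ^ 2) (s i) :=
    (hasDerivAt_inv_sub hx₀i).add (HasDerivAt.fun_sum fun j hj =>
      (hasDerivAt_inv_sub (hne j hj)).const_mul _)
  have hT : ∑ j, hessian ħ dV s i j * α j = 2 * ((x₀ - s i)⁻¹) ^ 2 := by
    have h1 := congrArg (fun M : Matrix (Fin m) (Fin m) ℂ =>
      M.mulVec (fun k => 2 * ((x₀ - s k)⁻¹) ^ 2) i) (hessian_mul_matA h.det_ne)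
    simp only [← Matrix.mulVec_mulVec, Matrix.one_mulVec] at h1
    rw [← h1]
    simp only [Matrix.mulVec, dotProduct, hα]
    refine Finset.sum_congr rfl fun j _ => ?_
    rw [Finset.mul_sum]
    congr 1
    exact Finset.sum_congr rfl fun _ _ => by ring
  obtain ⟨K, hK, hK2⟩ := exists_local_kernel hħ (analyticAt_regForce (ħ := ħ) h.inj h.denom_ne i) hR
    (a := α i) (h.regForce_eq_zero i) (by
      rw [hR'.deriv, deriv_regForce h.inj h.denom_ne hħ]
      rw [← Finset.add_sum_erase _ _ (Finset.mem_univ i)] at hT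
      have h2 : ∑ j ∈ Finset.univ.erase i, hessian ħ dV s i j * α j =
          2 * ∑ j ∈ Finset.univ.erase i, α j * -((s i - s j)⁻¹) ^ 2 := by
        rw [Finset.mul_sum]
        refine Finset.sum_congr rfl fun j hj => ?_
        rw [hessian, Matrix.of_apply, if_neg (Finset.ne_of_mem_erase hj).symm, inv_pow]
        ring
      rw [h2, ← neg_sub (s i) x₀, inv_neg] at hT
      linear_combination ħ * hT)
  refine ⟨K, hK, hK2.mono fun x hx => ?_⟩
  rw [force_eq ħ dV s i, hx, ← Finset.add_sum_erase _ _ (Finset.mem_univ i)]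
  ring

include h in
lemma exists_isKernelSystem (hħ : ħ ≠ 0) : ∃ G K, IsKernelSystem ħ dV s G K := by
  have h0 : ∀ (x₀ : ℂ) (i : Fin m), ∃ K : ℂ → ℂ, x₀ ∉ Set.range s → (AnalyticAt ℂ K (s i) ∧
      ∀ᶠ x in 𝓝[≠] (s i),
      (2 * ħ * ∑ j, 1 / (x - s j) - val dV x) * K x - ħ * deriv K x = (x - x₀)⁻¹ +
        ∑ j, 2 * (∑ k, matA ħ dV s j k * ((x₀ - s k)⁻¹) ^ 2) * (x - s j)⁻¹) := by
    intro x₀ i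
    by_cases hx₀ : x₀ ∈ Set.range s
    · exact ⟨0, fun h => (h hx₀).elim⟩
    · obtain ⟨K, hK⟩ := h.exists_germ hħ hx₀ i
      exact ⟨K, fun _ => hK⟩
  choose Kf hKf using h0
  classical
  -- Only the germs at the points matter: each `x` is given the local solution that belongs to the
  -- nearest point.
  set K : ℂ → ℂ → ℂ := fun x₀ x =>
    ∑ i, if ∀ j ≠ i, dist x (s i) < dist x (s j) then Kf x₀ i x else 0 with hKdef
  have hK : ∀ x₀ i, ∀ᶠ x in 𝓝 (s i), K x₀ x = Kf x₀ i x := by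
    intro x₀ i
    have h1 : ∀ j, j ≠ i → ∀ᶠ x in 𝓝 (s i), dist x (s i) < dist x (s j) := by
      intro j hj
      have h2 : ContinuousAt (fun x => dist x (s i)) (s i) := by fun_prop
      have h3 : ContinuousAt (fun x => dist x (s j)) (s i) := by fun_prop
      refine h2.eventually_lt h3 ?_
      rw [dist_self]
      exact dist_pos.2 (h.inj.ne hj.symm)
    have h2 : ∀ᶠ x in 𝓝 (s i), ∀ j, j ≠ i → dist x (s i) < dist x (s j) :=
      eventually_all.2 fun j => by
        by_cases hj : j = i
        · exact Eventually.of_forall fun x hx => (hx hj).elim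
        · exact (h1 j hj).mono fun x hx _ => hx
    filter_upwards [h2] with x hx
    simp only [hKdef]
    rw [Finset.sum_eq_single i, if_pos hx]
    · intro k _ hk
      rw [if_neg]
      intro hk2
      exact lt_asymm (hx k hk) (hk2 i hk.symm)
    · simp
  set α : ℂ → Fin m → ℂ := fun x₀ j => 2 * ∑ k, matA ħ dV s j k * ((x₀ - s k)⁻¹) ^ 2 with hα
  set G : ℂ → ℂ → ℂ := fun x₀ x => (x - x₀)⁻¹ + ∑ j, α x₀ j * (x - s j)⁻¹ with hG
  -- The partial fraction expansion of the same function in the variable `x₀`, where the poles at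
  -- the `sₖ` are double.
  have hG2 : ∀ x₀ x, G x₀ x = -1 * (x₀ - x)⁻¹ +
      ∑ k, (∑ j, 2 * matA ħ dV s j k * (x - s j)⁻¹) * ((x₀ - s k)⁻¹) ^ 2 := by
    intro x₀ x
    simp only [hG, hα, Finset.mul_sum, Finset.sum_mul]
    rw [Finset.sum_comm, ← neg_sub x₀ x, inv_neg, neg_one_mul]
    congr 1
    exact Finset.sum_congr rfl fun _ _ => Finset.sum_congr rfl fun _ _ => by ring
  have hderiv : ∀ x₀ x, x ∉ Set.range s → x ≠ x₀ → deriv (G x₀) x =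
      -((x - x₀)⁻¹) ^ 2 + ∑ j, α x₀ j * -((x - s j)⁻¹) ^ 2 := by
    intro x₀ x hx hxx
    have := (hasDerivAt_inv_sub hxx).add (HasDerivAt.fun_sum (u := Finset.univ) fun j _ =>
      (hasDerivAt_inv_sub fun h => hx ⟨j, h.symm⟩).const_mul (α x₀ j))
    exact this.deriv
  refine ⟨G, K, h.inj, h.denom_ne, ?_, ?_, ?_, ?_, ?_, ?_, ?_, ?_⟩
  · intro x₀ _
    obtain ⟨p, hp⟩ := exists_rational_form s 1 1 x₀ (α x₀)
    refine ⟨p, 1, fun x hx hxx => ?_⟩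
    rw [← hp x hx hxx]
    simp [hG]
  · intro x₀ hx₀
    have h1 : ContinuousAt (fun x => ∑ j, α x₀ j * (x - s j)⁻¹) x₀ :=
      (Finset.analyticAt_fun_sum Finset.univ fun j _ => analyticAt_const.mul
        (analyticAt_inv_sub fun h => hx₀ ⟨j, h.symm⟩)).continuousAt
    have h2 : ContinuousAt (fun x => 1 + (x - x₀) * ∑ j, α x₀ j * (x - s j)⁻¹) x₀ :=
      continuousAt_const.add ((by fun_prop : ContinuousAt (fun x => x - x₀) x₀).mul h1)
    have h3 := h2.tendsto.mono_left (nhdsWithin_le_nhds (s := {x₀}ᶜ))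
    simp only [sub_self, zero_mul, add_zero] at h3
    refine h3.congr' ?_
    filter_upwards [self_mem_nhdsWithin] with x hx
    have := mul_inv_cancel₀ (sub_ne_zero.2 hx)
    simp only [hG]
    linear_combination -this
  · intro x₀ _
    refine (isBigO_inv_sub x₀).add (IsBigO.fun_sum fun j _ => ?_)
    exact (isBigO_inv_sub (s j)).const_mul_left _
  · intro x _
    obtain ⟨p, hp⟩ := exists_rational_form s 2 (-1) x (fun k => ∑ j, 2 * matA ħ dV s j k * (x - s j)⁻¹)
    refine ⟨p, 2, fun x₀ hx hxx => ?_⟩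
    rw [← hp x₀ hx hxx, hG2]
  · intro x _
    simp only [hG2]
    refine ((isBigO_inv_sub x).const_mul_left _).add (IsBigO.fun_sum fun j _ => ?_)
    exact (isBigO_inv_sub_sq (s j)).const_mul_left _
  · intro x₀ hx₀ x hx hxx
    rw [hderiv x₀ x hx hxx.symm, hderiv x x₀ hx₀ hxx, ← neg_sub x x₀, inv_neg]
    congr 1
    · ring
    · simp only [hα, Finset.mul_sum, Finset.sum_mul]
      rw [Finset.sum_comm]
      refine Finset.sum_congr rfl fun j _ => Finset.sum_congr rfl fun k _ => ?_
      rw [matA_symm ħ dV s j k]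
      ring
  · intro x₀ hx₀ i
    have h1 := (hK x₀ i).eventually_nhds
    filter_upwards [(hKf x₀ i hx₀).2, h1.filter_mono nhdsWithin_le_nhds] with x hx hx2
    have h3 : deriv (K x₀) x = deriv (Kf x₀ i) x := Filter.EventuallyEq.deriv_eq hx2
    rw [hx2.self_of_nhds, h3, hx]
  · intro x₀ hx₀ i
    exact (hKf x₀ i hx₀).1.congr ((hK x₀ i).mono fun _ h => h.symm)

end IsBethe

/-! ### Correlators as functionals of finitely many Taylor coefficients; the algebraic data over
`ℂ`. -/

namespace BetheData

section Functional

variable {m : ℕ} {A : Type*} [CommRing A] [Algebra ℂ A] (D : BetheData m A)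
  {ι : Type*} [DecidableEq ι] (φ : ι → Fin m → A⟦X⟧)

lemma corr_add (ψ χ : Fin m → A⟦X⟧) (J : Finset ι) :
    D.corr φ (fun i => ψ i + χ i) J = D.corr φ ψ J + D.corr φ χ J := by
  simp only [corr_eq_connL, ← map_add, stat, ← smul_add, linStat, ← Finset.sum_add_distrib]

lemma corr_C_mul (a : A) (ψ : Fin m → A⟦X⟧) (J : Finset ι) :
    D.corr φ (fun i => C a * ψ i) J = C a * D.corr φ ψ J := by
  have h : linStat (fun i => C a * ψ i) = (C a : A⟦X⟧) • linStat ψ := by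
    simp only [linStat, map_mul, substLin_C, Algebra.smul_def, algebraMap_apply'', map_C,
      Finset.mul_sum]
    rfl
  rw [corr_eq_connL, corr_eq_connL, stat, h, smul_comm, map_smul, stat, smul_eq_mul]

lemma corr_zero (J : Finset ι) : D.corr φ (fun _ => 0) J = 0 := by
  have := D.corr_C_mul φ 0 (fun _ => 0) J
  simpa using this

lemma corr_sum {κ : Type*} (t : Finset κ) (ψ : κ → Fin m → A⟦X⟧) (J : Finset ι) :
    D.corr φ (fun i => ∑ k ∈ t, ψ k i) J = ∑ k ∈ t, D.corr φ (ψ k) J := by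
  classical
  induction t using Finset.induction_on with
  | empty => simpa using D.corr_zero φ J
  | insert a t ha ih => simp only [Finset.sum_insert ha]; rw [corr_add, ih]

lemma corr_sub (ψ χ : Fin m → A⟦X⟧) (J : Finset ι) :
    D.corr φ (fun i => ψ i - χ i) J = D.corr φ ψ J - D.corr φ χ J := by
  have h1 := D.corr_add φ ψ (fun i => C (-1) * χ i) J
  rw [corr_C_mul] at h1
  simpa [sub_eq_add_neg] using h1

/-- The series at `sᵢ` is evaluated at `X uᵢ`, so a factor `X ^ N` of it comes out of the
correlator. Hence the coefficient of order `b` depends only on Taylor coefficients up to order `b`,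
and as a function of a resolvent argument it is rational. -/
lemma coeff_corr_X_pow_mul {b N : ℕ} (h : b < N) (ψ : Fin m → A⟦X⟧) (J : Finset ι) :
    coeff b (D.corr φ (fun i => X ^ N * ψ i) J) = 0 := by
  have h1 : linStat (fun i => X ^ N * ψ i) = (X ^ N : A⟦X⟧) •
      ∑ i, C (MvPolynomial.X i) ^ N * substLin (MvPolynomial.X i) (ψ i) := by
    rw [Algebra.smul_def, map_pow, algebraMap_apply'', map_X]
    simp only [linStat, map_mul, map_pow, substLin_X, Finset.mul_sum]
    exact Finset.sum_congr rfl fun _ _ => by ring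
  rw [corr_eq_connL, stat, h1, smul_comm, map_smul, smul_eq_mul, coeff_X_pow_mul', if_neg (by omega)]

/-- The functional `ψ ↦ [X^b] corr φ ψ J` in coordinates. -/
def jet (J : Finset ι) (b : ℕ) (i : Fin m) (k : ℕ) : A :=
  coeff b (D.corr φ (Pi.single i (X ^ k)) J)

lemma coeff_corr_eq_sum (ψ : Fin m → A⟦X⟧) (J : Finset ι) (b : ℕ) : coeff b (D.corr φ ψ J) =
    ∑ i, ∑ k ∈ Finset.range (b + 1), D.jet φ J b i k * coeff k (ψ i) := by
  have h1 : ∀ f : A⟦X⟧, ∃ g : A⟦X⟧, f = (∑ k ∈ Finset.range (b + 1), C (coeff k f) * X ^ k) +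
      X ^ (b + 1) * g := by
    intro f
    refine ⟨PowerSeries.mk fun l => coeff (l + (b + 1)) f, ?_⟩
    ext l
    rw [map_add, map_sum, coeff_X_pow_mul']
    simp only [coeff_C_mul, coeff_X_pow, mul_ite, mul_one, mul_zero, Finset.sum_ite_eq,
      Finset.mem_range, coeff_mk]
    split_ifs with h2 h3 h3
    · omega
    · simp
    · rw [Nat.sub_add_cancel h3]; simp
    · omega
  choose g hg using h1
  have h2 : ψ = fun i => (∑ p ∈ Finset.univ ×ˢ Finset.range (b + 1),
      C (coeff p.2 (ψ p.1)) * (Pi.single p.1 (X ^ p.2) : Fin m → A⟦X⟧) i) +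
      X ^ (b + 1) * g (ψ i) := by
    funext i
    conv_lhs => rw [hg (ψ i)]
    congr 1
    rw [Finset.sum_product, Finset.sum_eq_single i]
    · simp
    · intro j _ hj
      simp [hj.symm]
    · simp
  conv_lhs => rw [h2]
  rw [corr_add, map_add, coeff_corr_X_pow_mul _ _ (Nat.lt_succ_self b), add_zero, corr_sum, map_sum,
    Finset.sum_product]
  refine Finset.sum_congr rfl fun i _ => Finset.sum_congr rfl fun k _ => ?_
  rw [corr_C_mul, coeff_C_mul, jet, mul_comm]

end Functional

end BetheData

lemma dataHessian_eq {m : ℕ} {ħ : ℂ} (hħ : ħ ≠ 0) (dV : RatFunc ℂ) (s : Fin m → ℂ) (i j : Fin m) :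
    dataHessian ħ (fun i j => (s i - s j)⁻¹) (fun i => taylor (val dV) (s i)) i j =
      ħ ^ 2 * hessian ħ dV s i j := by
  rw [dataHessian, hessian, Matrix.of_apply, coeff_one_taylor,
    ← Finset.add_sum_erase Finset.univ _ (Finset.mem_univ i)]
  split_ifs with hij
  · simp only [sub_self, inv_zero, one_div, inv_pow]
    field_simp
    ring
  · simp only [inv_pow]
    field_simp

namespace IsBethe

variable {m : ℕ} {ħ : ℂ} {dV : RatFunc ℂ} {s : Fin m → ℂ}

/-- The algebraic data of a nondegenerate solution of the Bethe equations. -/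
def data (h : IsBethe ħ dV s) (hħ : ħ ≠ 0) : BetheData m ℂ where
  ħ := ħ
  ħinv := ħ⁻¹
  s := s
  r i j := (s i - s j)⁻¹
  v i := taylor (val dV) (s i)
  Γ i j := (ħ ^ 2)⁻¹ * matA ħ dV s i j
  mul_ħinv := mul_inv_cancel₀ hħ
  r_self i := by simp
  r_mul i j hij := mul_inv_cancel₀ (sub_ne_zero.2 (h.inj.ne hij))
  bethe i := by
    rw [← coeff_zero_eq_constantCoeff_apply, coeff_zero_taylor, h.bethe,
      ← Finset.add_sum_erase Finset.univ _ (Finset.mem_univ i)]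
    simp
  Γ_symm i j := by rw [matA_symm]
  hessian_mul i k := by
    have h2 := congrFun (congrFun (hessian_mul_matA h.det_ne) i) k
    rw [Matrix.mul_apply, Matrix.one_apply] at h2
    rw [← h2]
    refine Finset.sum_congr rfl fun j _ => ?_
    rw [dataHessian_eq hħ]
    field_simp

end IsBethe

/-! ### Residue calculus for rational functions with poles at the points, and inversion by `K`. -/

section Polar

variable {m : ℕ} {s : Fin m → ℂ}

/-- The Taylor series at the points `sᵢ` of `u ↦ 1 / (z - u)`. -/
def cauchyJet (s : Fin m → ℂ) (z : ℂ) (i : Fin m) : ℂ⟦X⟧ := geom (z - s i)⁻¹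

/-- The rational function with prescribed polar parts at the points `sᵢ`. -/
def polar (s : Fin m → ℂ) (N : ℕ) (μ : Fin m → ℕ → ℂ) (z : ℂ) : ℂ :=
  ∑ i, ∑ k ∈ Finset.range N, μ i k * ((z - s i)⁻¹) ^ (k + 1)

lemma sum_mul_coeff_cauchyJet (N : ℕ) (μ : Fin m → ℕ → ℂ) (z : ℂ) :
    ∑ i, ∑ k ∈ Finset.range N, μ i k * coeff k (cauchyJet s z i) = polar s N μ z := by
  simp [cauchyJet, geom, polar]

lemma analyticAt_inv_pow {b c : ℂ} (h : c ≠ b) (k : ℕ) :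
    AnalyticAt ℂ (fun z => ((z - b)⁻¹) ^ k) c := (analyticAt_inv_sub h).pow k

lemma analyticAt_polar {N : ℕ} {μ : Fin m → ℕ → ℂ} {z : ℂ} (hz : z ∉ Set.range s) :
    AnalyticAt ℂ (polar s N μ) z :=
  Finset.analyticAt_fun_sum _ fun i _ => Finset.analyticAt_fun_sum _ fun _ _ =>
    analyticAt_const.mul (analyticAt_inv_pow (fun h => hz ⟨i, h.symm⟩) _)

lemma hasRes_polar_mul (hs : Function.Injective s) (N : ℕ) (μ : Fin m → ℕ → ℂ) {w : ℂ → ℂ}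
    {i : Fin m} (hw : AnalyticAt ℂ w (s i)) : HasRes (fun z => polar s N μ z * w z) (s i)
      (∑ k ∈ Finset.range N, μ i k * coeff k (taylor w (s i))) := by
  have h : ∀ j, HasRes (fun z => ∑ k ∈ Finset.range N, μ j k * (w z * ((z - s j)⁻¹) ^ (k + 1))) (s i)
      (if j = i then ∑ k ∈ Finset.range N, μ i k * coeff k (taylor w (s i)) else 0) := by
    intro j
    split_ifs with hj
    · subst hj
      exact HasRes.sum _ fun k _ => (hasRes_mul_inv_pow hw k).const_mul _
    · refine HasRes.of_analyticAt (Finset.analyticAt_fun_sum _ fun k _ =>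
        analyticAt_const.mul (hw.mul (analyticAt_inv_pow (fun h => hj (hs h).symm) _)))
  have h2 := HasRes.sum Finset.univ fun j _ => h j
  simp only [Finset.sum_ite_eq', Finset.mem_univ, if_true] at h2
  refine h2.congr (Eventually.of_forall fun z => ?_)
  simp only [polar, Finset.sum_mul]
  exact Finset.sum_congr rfl fun _ _ => Finset.sum_congr rfl fun _ _ => by ring

/-- A rational function that decays at least like `z⁻²` has no residue at infinity, so its finite
residues add up to zero. -/
lemma sum_res_inv_mul_inv_pow (hs : Function.Injective s) (j l : Fin m) (k : ℕ) :
    ∃ a : Fin m → ℂ, (∀ i, HasRes (fun z => ((z - s j)⁻¹) ^ (k + 1) * (z - s l)⁻¹) (s i) (a i)) ∧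
      ∑ i, a i = 0 := by
  rcases eq_or_ne j l with rfl | hjl
  · refine ⟨0, fun i => ?_, by simp⟩
    by_cases hi : i = j
    · subst hi
      refine (HasRes.inv_pow (c := s i) (Nat.succ_ne_zero k)).congr (Eventually.of_forall fun z => ?_)
      rw [← inv_pow, pow_succ]
    · exact HasRes.of_analyticAt ((analyticAt_inv_pow (hs.ne hi) _).mul (analyticAt_inv_sub (hs.ne hi)))
  · refine ⟨fun i => if i = j then -(s l - s j)⁻¹ ^ (k + 1) else
      if i = l then (s l - s j)⁻¹ ^ (k + 1) else 0, fun i => ?_, ?_⟩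
    · dsimp only
      split_ifs with h1 h2
      · subst h1
        refine (hasRes_inv_mul_inv_pow (hs.ne hjl) k).congr (Eventually.of_forall fun z => ?_)
        ring
      · subst h2
        have := hasRes_mul_inv_pow (analyticAt_inv_pow (hs.ne h1) (k + 1)) 0
        rw [coeff_zero_taylor] at this
        simpa using this
      · exact HasRes.of_analyticAt ((analyticAt_inv_pow (hs.ne h1) _).mul
          (analyticAt_inv_sub (hs.ne h2)))
    · rw [← Finset.add_sum_erase _ _ (Finset.mem_univ j), if_pos rfl,
        Finset.sum_congr rfl fun i hi => if_neg (Finset.ne_of_mem_erase hi), Finset.sum_ite_eq',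
        if_pos (by simp [hjl.symm])]
      ring

/-- The second factor is the form of `G(x₀, ·)` found in `G_eq`. The missing residue is the one at
its simple pole `x₀`, namely the value of the polar function there. -/
lemma sum_res_polar_mul (hs : Function.Injective s) (N : ℕ) (μ : Fin m → ℕ → ℂ) {x₀ : ℂ}
    (hx₀ : x₀ ∉ Set.range s) (α : Fin m → ℂ) :
    ∃ a : Fin m → ℂ, (∀ i, HasRes (fun z => polar s N μ z *
      ((z - x₀)⁻¹ + ∑ l, α l * (z - s l)⁻¹)) (s i) (a i)) ∧ ∑ i, a i = -polar s N μ x₀ := by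
  choose a ha hsum using fun j l k => sum_res_inv_mul_inv_pow hs j l k
  refine ⟨fun i => -(∑ k ∈ Finset.range N, μ i k * ((x₀ - s i)⁻¹) ^ (k + 1)) +
    ∑ j, ∑ k ∈ Finset.range N, ∑ l, μ j k * α l * a j l k i, fun i => ?_, ?_⟩
  · have hx₀i : s i ≠ x₀ := fun h => hx₀ ⟨i, h⟩
    have h1 := hasRes_polar_mul hs N μ (analyticAt_inv_sub hx₀i)
    rw [taylor_inv_sub hx₀i] at h1
    simp only [map_neg, geom, coeff_mk, mul_neg, Finset.sum_neg_distrib] at h1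
    have h2 : HasRes (fun z => ∑ j, ∑ k ∈ Finset.range N, ∑ l, μ j k * α l *
        (((z - s j)⁻¹) ^ (k + 1) * (z - s l)⁻¹)) (s i)
        (∑ j, ∑ k ∈ Finset.range N, ∑ l, μ j k * α l * a j l k i) :=
      HasRes.sum _ fun j _ => HasRes.sum _ fun k _ => HasRes.sum _ fun l _ =>
        (ha j l k i).const_mul _
    refine (h1.add h2).congr (Eventually.of_forall fun z => ?_)
    rw [mul_add]
    congr 1
    rw [polar, Finset.sum_mul]
    refine Finset.sum_congr rfl fun _ _ => ?_
    rw [Finset.sum_mul]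
    refine Finset.sum_congr rfl fun _ _ => ?_
    rw [Finset.mul_sum]
    exact Finset.sum_congr rfl fun _ _ => by ring
  · rw [Finset.sum_add_distrib, Finset.sum_neg_distrib]
    have : ∑ i, ∑ j, ∑ k ∈ Finset.range N, ∑ l, μ j k * α l * a j l k i = 0 := by
      rw [Finset.sum_comm]
      refine Finset.sum_eq_zero fun j _ => ?_
      rw [Finset.sum_comm]
      refine Finset.sum_eq_zero fun k _ => ?_
      rw [Finset.sum_comm]
      refine Finset.sum_eq_zero fun l _ => ?_
      rw [← Finset.mul_sum, hsum, mul_zero]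
    rw [this, add_zero, polar]

/-- The kernel inverts the operator `2ħω - V' + ħ∂` modulo functions that are analytic at the
points `sᵢ`. -/
lemma IsKernelSystem.sum_res_eq {ħ : ℂ} {dV : RatFunc ℂ} {G K : ℂ → ℂ → ℂ}
    (h : IsKernelSystem ħ dV s G K) {x₀ : ℂ} (hx₀ : x₀ ∉ Set.range s) (N : ℕ) (μ : Fin m → ℕ → ℂ)
    (U : ℂ → ℂ) (hU : ∀ i, ∃ f : ℂ → ℂ, AnalyticAt ℂ f (s i) ∧ ∀ᶠ z in 𝓝[≠] (s i),
      U z + ((2 * ħ * ∑ j, 1 / (z - s j) - val dV z) * polar s N μ z +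
        ħ * deriv (polar s N μ) z) = f z) :
    ∃ a : Fin m → ℂ, (∀ i, HasRes (fun z => K x₀ z * U z) (s i) (a i)) ∧
      ∑ i, a i = polar s N μ x₀ := by
  obtain ⟨a, ha, hsum⟩ := sum_res_polar_mul h.inj N μ hx₀ (fun i => 2 * ħ * K x₀ (s i))
  refine ⟨fun i => -a i, fun i => ?_, by rw [Finset.sum_neg_distrib, hsum, neg_neg]⟩
  obtain ⟨f, hf, hfU⟩ := hU i
  have hK := h.analytic x₀ hx₀ i
  have h1 : HasRes (fun z => K x₀ z * f z) (s i) 0 := HasRes.of_analyticAt (hK.mul hf)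
  have hpol : ∀ᶠ z in 𝓝[≠] (s i), AnalyticAt ℂ (polar s N μ) z :=
    (eventually_notMem_range s (s i)).mono fun z hz => analyticAt_polar hz
  have hKan : ∀ᶠ z in 𝓝[≠] (s i), AnalyticAt ℂ (K x₀) z :=
    hK.eventually_analyticAt.filter_mono nhdsWithin_le_nhds
  -- The residue of a derivative vanishes. This integration by parts moves the operator from the
  -- polar function to `K`, where the differential equation replaces it by `G`.
  have h2 : HasRes (fun z => deriv (polar s N μ) z * K x₀ z + polar s N μ z * deriv (K x₀) z)
      (s i) 0 := by
    refine HasRes.of_hasDerivAt (F := fun z => polar s N μ z * K x₀ z) ?_ ?_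
    · filter_upwards [hpol, hKan] with z h3 h4
      exact h3.differentiableAt.hasDerivAt.mul h4.differentiableAt.hasDerivAt
    · filter_upwards [hpol, hKan] with z h3 h4
      exact (h3.deriv.continuousAt.mul h4.continuousAt).add (h3.continuousAt.mul h4.deriv.continuousAt)
  have h3 := (h1.sub (ha i)).sub (h2.const_mul ħ)
  rw [mul_zero, sub_zero, zero_sub] at h3
  have hne : ∀ᶠ z in 𝓝[≠] (s i), z ≠ x₀ :=
    (isOpen_ne.mem_nhds (fun h => hx₀ ⟨i, h⟩ : s i ≠ x₀)) |> mem_nhdsWithin_of_mem_nhds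
  refine h3.congr ?_
  filter_upwards [hfU, h.ode x₀ hx₀ i, eventually_notMem_range s (s i), hne] with z hz hode hzs hzx
  rw [← hz, ← h.G_eq hx₀ hzs hzx, ← hode]
  ring

end Polar

namespace BetheData

variable {m : ℕ} {A : Type*} [CommRing A] [Algebra ℂ A] (D : BetheData m A)
  {ι : Type*} [DecidableEq ι] (φ : ι → Fin m → A⟦X⟧)

/-- At order zero the fluctuations drop out and `κ = ħ`: the statistic has its classical value. -/
lemma coeff_zero_corr_empty (ψ : Fin m → A⟦X⟧) :
    coeff 0 (D.corr φ ψ ∅) = D.ħ * ∑ i, coeff 0 (ψ i) := by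
  rw [coeff_corr_eq_sum, Finset.mul_sum]
  refine Finset.sum_congr rfl fun i _ => ?_
  have h : linStat (Pi.single i (X ^ 0) : Fin m → A⟦X⟧) = 1 := by
    rw [linStat, Finset.sum_eq_single i]
    · simp
    · intro j _ hj
      simp [hj]
    · simp
  rw [zero_add, Finset.sum_range_one, jet, corr, stat, h, conn_empty, map_smul, expect_one]
  have h0 := coeff_zero_kappa D.ħ D.ħinv
  rw [coeff_zero_eq_constantCoeff_apply] at h0
  simp [kap, h0]

end BetheData

/-! ### Loop equations for the coefficients of the correlators of resolvents, and their solution by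
residues. -/

lemma geom_mul_geom {A : Type*} [CommRing A] {a b e ζ η : A} (hζ : a * ζ = 1) (hη : b * η = 1)
    (he : (a - b) * e = 1) : geom ζ * geom η ^ 2 =
      C (e ^ 2) * geom ζ - C (e ^ 2) * geom η + C e * geom η ^ 2 := by
  have h1 := mul_geom hζ
  have h2 := mul_geom hη
  have h3 : geom ζ * geom η = C e * (geom η - geom ζ) := by
    have h4 : (C (a - b) : A⟦X⟧) * C e = 1 := by rw [← map_mul, he, map_one]
    rw [map_sub] at h4
    linear_combination (-geom ζ * geom η) * h4 + (C e * geom η) * h1 - (C e * geom ζ) * h2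
  rw [map_pow]
  linear_combination (geom η - C e) * h3

namespace IsBethe

variable {m : ℕ} {ħ : ℂ} {dV : RatFunc ℂ} {s : Fin m → ℂ} (hB : IsBethe ħ dV s) (hħ : ħ ≠ 0)
  {n : ℕ} (x : Fin n → ℂ) (b : ℕ)

/-- The coefficient of order `b` of the correlator of the linear statistic of `ψ` and of the
resolvents at the points `x j`, `j ∈ I`. -/
def cr (ψ : Fin m → ℂ⟦X⟧) (I : Finset (Fin n)) : ℂ :=
  coeff b ((hB.data hħ).corr (fun j => cauchyJet s (x j)) ψ I)

/-- The coefficient of order `b` of the correlator of the resolvents at `z` and at the points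
`x j`, `j ∈ I`. -/
def res (I : Finset (Fin n)) (z : ℂ) : ℂ := hB.cr hħ x b (cauchyJet s z) I

lemma cr_eq_sum (ψ : Fin m → ℂ⟦X⟧) (I : Finset (Fin n)) : hB.cr hħ x b ψ I =
    ∑ i, ∑ k ∈ Finset.range (b + 1),
      (hB.data hħ).jet (fun j => cauchyJet s (x j)) I b i k * coeff k (ψ i) :=
  (hB.data hħ).coeff_corr_eq_sum _ _ _ _

lemma res_eq_polar (I : Finset (Fin n)) : hB.res hħ x b I =
    polar s (b + 1) ((hB.data hħ).jet (fun j => cauchyJet s (x j)) I b) := by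
  funext z
  rw [res, cr_eq_sum, sum_mul_coeff_cauchyJet]

lemma res_zero_empty (z : ℂ) : hB.res hħ x 0 ∅ z = ħ * ∑ i, 1 / (z - s i) := by
  rw [res, cr, BetheData.coeff_zero_corr_empty]
  simp [data, cauchyJet, geom]

lemma cr_subTuple (ψ : Fin m → ℂ⟦X⟧) (I : Finset (Fin n)) :
    hB.cr hħ (subTuple x I) b ψ Finset.univ = hB.cr hħ x b ψ I := by
  have h := (hB.data hħ).corr_map (fun j => cauchyJet s (x j)) (I.orderEmbOfFin rfl).toEmbedding ψ
    Finset.univ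
  rw [Finset.map_orderEmbOfFin_univ] at h
  rw [cr, cr, h]
  rfl

lemma res_subTuple (I : Finset (Fin n)) (z : ℂ) :
    hB.res hħ (subTuple x I) b Finset.univ z = hB.res hħ x b I z := hB.cr_subTuple hħ x b _ I

lemma hasDerivAt_res (I : Finset (Fin n)) {z : ℂ} (hz : z ∉ Set.range s) :
    HasDerivAt (hB.res hħ x b I) (-hB.cr hħ x b (fun i => cauchyJet s z i ^ 2) I) z := by
  have h1 : ∀ i k, HasDerivAt (fun z => coeff k (cauchyJet s z i))
      (-coeff k (cauchyJet s z i ^ 2)) z := by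
    intro i k
    have hzi : z - s i ≠ 0 := sub_ne_zero.2 fun h => hz ⟨i, h.symm⟩
    have h2 : (z - s i) * (z - s i)⁻¹ = 1 := mul_inv_cancel₀ hzi
    have h3 : coeff k (cauchyJet s z i ^ 2) = (k + 1) * ((z - s i)⁻¹) ^ (k + 2) := by
      rw [cauchyJet, ← BetheData.derivative_geom h2, coeff_derivative, geom, coeff_mk]
      ring
    simp only [cauchyJet, geom, coeff_mk] at h3 ⊢
    have h4 := ((((hasDerivAt_id z).sub_const (s i)).fun_inv hzi).fun_pow (k + 1))
    refine h4.congr_deriv ?_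
    rw [h3]
    simp only [id]
    push_cast
    rw [neg_div, one_div, ← inv_pow]
    ring
  have h5 := HasDerivAt.fun_sum (u := Finset.univ) fun i (_ : i ∈ Finset.univ) =>
    HasDerivAt.fun_sum (u := Finset.range (b + 1)) fun k _ => (h1 i k).const_mul
      ((hB.data hħ).jet (fun j => cauchyJet s (x j)) I b i k)
  have h6 : hB.res hħ x b I = fun z => ∑ i, ∑ k ∈ Finset.range (b + 1),
      (hB.data hħ).jet (fun j => cauchyJet s (x j)) I b i k * coeff k (cauchyJet s z i) := by
    funext z
    rw [res, cr_eq_sum]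
  rw [h6]
  refine h5.congr_deriv ?_
  rw [cr_eq_sum]
  simp only [mul_neg, Finset.sum_neg_distrib]

/-- The quadratic part of the loop equation, without the terms that are linear in the correlator of
all the resolvents. -/
def bracket (z : ℂ) : ℂ :=
  (if b = 0 then 0 else hB.res hħ (Fin.cons z x : Fin (n + 1) → ℂ) (b - 1) Finset.univ z +
    ∑ j, ((z - x j)⁻¹) ^ 2 * hB.res hħ x (b - 1) {j}ᶜ z) +
  ∑ I : Finset (Fin n), ∑ p ∈ Finset.HasAntidiagonal.antidiagonal b,
    if (p.1 = 0 ∧ I = ∅) ∨ (p.2 = 0 ∧ I = Finset.univ) then 0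
    else hB.res hħ x p.1 I z * hB.res hħ x p.2 Iᶜ z

/-- The insertion of the resolvent at `x j` contributes `1 / ((z - s)(x j - s)²)`, which partial
fractions split into a resolvent at `z` with a double pole at `x j` and terms that are analytic in
`z` near the points. -/
lemma loop_equation_coeff {z : ℂ} (hz : z ∉ Set.range s) (hx : ∀ j, x j ∉ Set.range s)
    (hzx : ∀ j, z ≠ x j) :
    (if b = 0 then 0 else hB.res hħ (Fin.cons z x : Fin (n + 1) → ℂ) (b - 1) Finset.univ z +
      ∑ j, (((z - x j)⁻¹) ^ 2 * hB.res hħ x (b - 1) {j}ᶜ z -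
        ((z - x j)⁻¹) ^ 2 * hB.cr hħ x (b - 1) (cauchyJet s (x j)) {j}ᶜ +
        (z - x j)⁻¹ * hB.cr hħ x (b - 1) (fun i => cauchyJet s (x j) i ^ 2) {j}ᶜ)) +
    ∑ I : Finset (Fin n), ∑ p ∈ Finset.HasAntidiagonal.antidiagonal b, hB.res hħ x p.1 I z * hB.res hħ x p.2 Iᶜ z -
    ħ * hB.cr hħ x b (fun i => cauchyJet s z i ^ 2) Finset.univ -
    hB.cr hħ x b (fun i => cauchyJet s z i * taylor (val dV) (s i)) Finset.univ = 0 := by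
  set D := hB.data hħ with hD
  set φ : Fin (n + 1) → Fin m → ℂ⟦X⟧ := fun j => cauchyJet s ((Fin.cons z x : Fin (n + 1) → ℂ) j)
    with hφ
  have hinv : ∀ y ∉ Set.range s, ∀ i, (y - s i) * (y - s i)⁻¹ = 1 := fun y hy i =>
    mul_inv_cancel₀ (sub_ne_zero.2 fun h => hy ⟨i, h.symm⟩)
  -- The label `0` belongs to the argument `z`, the labels `Fin.succ j` to the `x j`.
  have hloop := D.loop_equation φ (z := z) (ζ := fun i => (z - s i)⁻¹) (hinv z hz) (a := 0)
    (J := Finset.univ.map (Fin.succEmb n)) (by simp) (by funext i; simp [hφ, cauchyJet])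
  have hcomp : φ ∘ (Fin.succEmb n) = fun j => cauchyJet s (x j) := by
    funext j
    simp [hφ]
  have hmap : ∀ (ψ : Fin m → ℂ⟦X⟧) (I : Finset (Fin n)),
      D.corr φ ψ (I.map (Fin.succEmb n)) = D.corr (fun j => cauchyJet s (x j)) ψ I := by
    intro ψ I
    rw [D.corr_map, hcomp]
  have hins : insert (0 : Fin (n + 1)) (Finset.univ.map (Fin.succEmb n)) =
      Finset.univ := by
    rw [Fin.univ_succ, Finset.cons_eq_insert]
    rfl
  have hφ0 : φ 0 = cauchyJet s z := by simp [hφ]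
  have hpow : (Finset.univ.map (Fin.succEmb n)).powerset =
      (Finset.univ : Finset (Finset (Fin n))).map
        ⟨Finset.map (Fin.succEmb n), Finset.map_injective _⟩ := by
    ext I
    simp only [Finset.mem_powerset, Finset.mem_map, Finset.mem_univ, true_and,
      Function.Embedding.coeFn_mk, Finset.subset_map_iff]
    constructor
    · rintro ⟨u, _, rfl⟩
      exact ⟨u, rfl⟩
    · rintro ⟨u, rfl⟩
      exact ⟨u, Finset.subset_univ _, rfl⟩
  rw [hins, hpow, Finset.sum_map, Finset.sum_map] at hloop
  simp only [Function.Embedding.coeFn_mk, ← Finset.map_sdiff, hmap, hφ0] at hloop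
  have herase : ∀ j : Fin n, (Finset.univ.map (Fin.succEmb n)).erase
      ((Fin.succEmb n) j) = ({j}ᶜ : Finset (Fin n)).map (Fin.succEmb n) := by
    intro j
    rw [← Finset.map_erase]
    congr 1
    ext k
    simp
  have hgeom : ∀ j, (fun i => geom (z - s i)⁻¹ *
      derivative ℂ (φ ((Fin.succEmb n) j) i)) = fun i =>
      (C (((z - x j)⁻¹) ^ 2) * cauchyJet s z i - C (((z - x j)⁻¹) ^ 2) * cauchyJet s (x j) i) +
        C (z - x j)⁻¹ * cauchyJet s (x j) i ^ 2 := by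
    intro j
    funext i
    have h1 : φ ((Fin.succEmb n) j) i = geom (x j - s i)⁻¹ := by
      simp [hφ, cauchyJet]
    rw [h1, BetheData.derivative_geom (hinv _ (hx j) i), geom_mul_geom (hinv z hz i) (hinv _ (hx j) i)
      (e := (z - x j)⁻¹) (by
        rw [sub_sub_sub_cancel_right]; exact mul_inv_cancel₀ (sub_ne_zero.2 (hzx j)))]
    rfl
  simp only [herase, hmap, hgeom] at hloop
  have hcorr : ∀ j : Fin n, D.corr (fun j => cauchyJet s (x j)) (fun i =>
      (C (((z - x j)⁻¹) ^ 2) * cauchyJet s z i - C (((z - x j)⁻¹) ^ 2) * cauchyJet s (x j) i) +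
        C (z - x j)⁻¹ * cauchyJet s (x j) i ^ 2) {j}ᶜ =
      C (((z - x j)⁻¹) ^ 2) * D.corr (fun j => cauchyJet s (x j)) (cauchyJet s z) {j}ᶜ -
      C (((z - x j)⁻¹) ^ 2) * D.corr (fun j => cauchyJet s (x j)) (cauchyJet s (x j)) {j}ᶜ +
      C (z - x j)⁻¹ * D.corr (fun j => cauchyJet s (x j)) (fun i => cauchyJet s (x j) i ^ 2) {j}ᶜ := by
    intro j
    rw [D.corr_add, D.corr_sub, D.corr_C_mul, D.corr_C_mul, D.corr_C_mul]
  simp only [hcorr] at hloop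
  have hXb : ∀ f : ℂ⟦X⟧, coeff b (X * f) = if b = 0 then 0 else coeff (b - 1) f := by
    intro f
    cases b with
    | zero => simp
    | succ b => simp [coeff_succ_X_mul]
  have hmul : ∀ I : Finset (Fin n), coeff b
      (D.corr (fun j => cauchyJet s (x j)) (cauchyJet s z) I *
        D.corr (fun j => cauchyJet s (x j)) (cauchyJet s z) (Finset.univ \ I)) =
      ∑ p ∈ Finset.HasAntidiagonal.antidiagonal b,
        coeff p.1 (D.corr (fun j => cauchyJet s (x j)) (cauchyJet s z) I) *
          coeff p.2 (D.corr (fun j => cauchyJet s (x j)) (cauchyJet s z) (Finset.univ \ I)) :=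
    fun I => coeff_mul _ _ _
  have hc := congrArg (coeff b) hloop
  simp only [map_add, map_sub, map_zero, map_sum, hXb, hmul, coeff_C_mul] at hc
  have hv : D.v = fun i => taylor (val dV) (s i) := rfl
  rw [hv] at hc
  refine Eq.trans ?_ hc
  have hħD : D.ħ = ħ := rfl
  simp only [res, cr, ← hD, Finset.compl_eq_univ_sdiff, hħD, cauchyJet, hφ]
  split_ifs
  · ring
  · ring

end IsBethe

namespace IsBethe

variable {m : ℕ} {ħ : ℂ} {dV : RatFunc ℂ} {s : Fin m → ℂ} (hB : IsBethe ħ dV s) (hħ : ħ ≠ 0)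
  {n : ℕ} (x : Fin n → ℂ) (b : ℕ)

/-- The two excluded terms contain the full correlator times the one-point function of order zero.
They coincide as terms of the sum only for `n = 0` and `b = 0`. -/
lemma sum_mul_eq (hnb : ¬(n = 0 ∧ b = 0)) (z : ℂ) :
    ∑ I : Finset (Fin n), ∑ p ∈ Finset.HasAntidiagonal.antidiagonal b,
      hB.res hħ x p.1 I z * hB.res hħ x p.2 Iᶜ z =
    2 * (hB.res hħ x 0 ∅ z * hB.res hħ x b Finset.univ z) +
    ∑ I : Finset (Fin n), ∑ p ∈ Finset.HasAntidiagonal.antidiagonal b,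
      if (p.1 = 0 ∧ I = ∅) ∨ (p.2 = 0 ∧ I = Finset.univ) then 0
      else hB.res hħ x p.1 I z * hB.res hħ x p.2 Iᶜ z := by
  have h1 : ∑ I : Finset (Fin n), ∑ p ∈ Finset.HasAntidiagonal.antidiagonal b,
      (if p.1 = 0 ∧ I = ∅ then hB.res hħ x p.1 I z * hB.res hħ x p.2 Iᶜ z else 0) =
      hB.res hħ x 0 ∅ z * hB.res hħ x b Finset.univ z := by
    rw [Finset.sum_eq_single ∅ (fun I _ hI => Finset.sum_eq_zero fun p _ => if_neg fun h => hI h.2)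
      (by simp), Finset.sum_eq_single (0, b) _ (by simp)]
    · simp
    · rintro ⟨p, q⟩ hp hpq
      rw [Finset.HasAntidiagonal.mem_antidiagonal] at hp
      refine if_neg fun h => hpq ?_
      simp only at hp h
      rw [Prod.mk.injEq]
      omega
  have h2 : ∑ I : Finset (Fin n), ∑ p ∈ Finset.HasAntidiagonal.antidiagonal b,
      (if p.2 = 0 ∧ I = Finset.univ then hB.res hħ x p.1 I z * hB.res hħ x p.2 Iᶜ z else 0) =
      hB.res hħ x 0 ∅ z * hB.res hħ x b Finset.univ z := by
    rw [Finset.sum_eq_single Finset.univ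
      (fun I _ hI => Finset.sum_eq_zero fun p _ => if_neg fun h => hI h.2)
      (by simp), Finset.sum_eq_single (b, 0) _ (by simp)]
    · simp [mul_comm]
    · rintro ⟨p, q⟩ hp hpq
      rw [Finset.HasAntidiagonal.mem_antidiagonal] at hp
      refine if_neg fun h => hpq ?_
      simp only at hp h
      rw [Prod.mk.injEq]
      omega
  rw [two_mul]
  nth_rewrite 1 [← h1]
  rw [← h2]
  simp only [← Finset.sum_add_distrib]
  refine Finset.sum_congr rfl fun I _ => Finset.sum_congr rfl fun p hp => ?_
  rw [Finset.HasAntidiagonal.mem_antidiagonal] at hp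
  have hdisj : ¬((p.1 = 0 ∧ I = ∅) ∧ (p.2 = 0 ∧ I = Finset.univ)) := by
    rintro ⟨⟨h3, rfl⟩, h4, h5⟩
    refine hnb ⟨?_, by omega⟩
    simpa using congrArg Finset.card h5.symm
  by_cases hP : p.1 = 0 ∧ I = ∅ <;> by_cases hQ : p.2 = 0 ∧ I = Finset.univ
  · exact absurd ⟨hP, hQ⟩ hdisj
  · rw [if_pos hP, if_neg hQ, if_pos (Or.inl hP)]; ring
  · rw [if_neg hP, if_pos hQ, if_pos (Or.inr hQ)]; ring
  · rw [if_neg hP, if_neg hQ, if_neg (not_or.2 ⟨hP, hQ⟩)]; ring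

/-- Replacing the Taylor series of `V'` at `sⱼ` by the value `V'(z)` does not change the polar part
in `z`, because the coefficients of the product with the resolvent are truncations of `V'(z) / (z -
sⱼ)^(k+1)`. -/
lemma exists_analyticAt_cr_sub (I : Finset (Fin n)) (i : Fin m) :
    ∃ f : ℂ → ℂ, AnalyticAt ℂ f (s i) ∧ ∀ᶠ z in 𝓝[≠] (s i),
      hB.cr hħ x b (fun j => cauchyJet s z j * taylor (val dV) (s j)) I -
        val dV z * hB.res hħ x b I z = f z := by
  have h1 : ∀ (j : Fin m) (k : ℕ), ∃ f : ℂ → ℂ, AnalyticAt ℂ f (s i) ∧ ∀ᶠ z in 𝓝[≠] (s i),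
      coeff k (cauchyJet s z j * taylor (val dV) (s j)) - val dV z * coeff k (cauchyJet s z j) =
        f z := by
    intro j k
    have h2 : ∀ z, coeff k (cauchyJet s z j * taylor (val dV) (s j)) =
        ∑ l ∈ Finset.range (k + 1), coeff l (taylor (val dV) (s j)) *
          ((z - s j)⁻¹) ^ (k - l + 1) := by
      intro z
      rw [mul_comm, coeff_mul, Finset.Nat.sum_antidiagonal_eq_sum_range_succ_mk]
      simp [cauchyJet, geom]
    by_cases hij : j = i
    · subst hij
      obtain ⟨f, hf, h3⟩ := exists_polar_part (analyticAt_val (hB.denom_ne j)) k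
      refine ⟨fun z => -f z, hf.neg, eventually_nhdsWithin_of_forall fun z hz => ?_⟩
      rw [h2, cauchyJet, geom, coeff_mk, h3 z hz]
      ring
    · have hne : s i ≠ s j := fun h => hij (hB.inj h).symm
      refine ⟨fun z => ∑ l ∈ Finset.range (k + 1), coeff l (taylor (val dV) (s j)) *
          ((z - s j)⁻¹) ^ (k - l + 1) - val dV z * ((z - s j)⁻¹) ^ (k + 1), ?_, ?_⟩
      · exact (Finset.analyticAt_fun_sum _ fun l _ => analyticAt_const.mul
          (analyticAt_inv_pow hne _)).sub ((analyticAt_val (hB.denom_ne i)).mul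
            (analyticAt_inv_pow hne _))
      · refine Eventually.of_forall fun z => ?_
        rw [h2, cauchyJet, geom, coeff_mk]
  choose f hf h2 using h1
  refine ⟨fun z => ∑ j, ∑ k ∈ Finset.range (b + 1),
    (hB.data hħ).jet (fun j => cauchyJet s (x j)) I b j k * f j k z,
    Finset.analyticAt_fun_sum _ fun j _ => Finset.analyticAt_fun_sum _ fun k _ =>
      analyticAt_const.mul (hf j k), ?_⟩
  have h3 : ∀ᶠ z in 𝓝[≠] (s i), ∀ j, ∀ k ∈ Finset.range (b + 1),
      coeff k (cauchyJet s z j * taylor (val dV) (s j)) - val dV z * coeff k (cauchyJet s z j) =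
        f j k z :=
    eventually_all.2 fun j => (Filter.eventually_all_finset _).2 fun k _ => h2 j k
  filter_upwards [h3] with z hz
  rw [res, cr_eq_sum, cr_eq_sum, Finset.mul_sum, ← Finset.sum_sub_distrib]
  refine Finset.sum_congr rfl fun j _ => ?_
  rw [Finset.mul_sum, ← Finset.sum_sub_distrib]
  refine Finset.sum_congr rfl fun k hk => ?_
  rw [← hz j k hk]
  ring

lemma exists_analyticAt_bracket_add (hnb : ¬(n = 0 ∧ b = 0)) (hx : ∀ j, x j ∉ Set.range s)
    (i : Fin m) : ∃ f : ℂ → ℂ, AnalyticAt ℂ f (s i) ∧ ∀ᶠ z in 𝓝[≠] (s i),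
      hB.bracket hħ x b z + ((2 * ħ * ∑ j, 1 / (z - s j) - val dV z) *
        hB.res hħ x b Finset.univ z + ħ * deriv (hB.res hħ x b Finset.univ) z) = f z := by
  obtain ⟨f, hf, h1⟩ := hB.exists_analyticAt_cr_sub hħ x b Finset.univ i
  have hne : ∀ j, s i ≠ x j := fun j h => hx j ⟨i, h⟩
  refine ⟨fun z => f z + if b = 0 then 0 else ∑ j,
    (((z - x j)⁻¹) ^ 2 * hB.cr hħ x (b - 1) (cauchyJet s (x j)) {j}ᶜ -
        (z - x j)⁻¹ * hB.cr hħ x (b - 1) (fun i => cauchyJet s (x j) i ^ 2) {j}ᶜ), ?_, ?_⟩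
  · split_ifs
    · simpa using hf
    · exact hf.add (Finset.analyticAt_fun_sum _ fun j _ =>
        ((analyticAt_inv_pow (hne j) 2).mul analyticAt_const).sub
          ((analyticAt_inv_sub (hne j)).mul analyticAt_const))
  · have hne' : ∀ᶠ z in 𝓝[≠] (s i), ∀ j, z ≠ x j :=
      eventually_all.2 fun j => mem_nhdsWithin_of_mem_nhds (isOpen_ne.mem_nhds (hne j))
    filter_upwards [h1, hne', eventually_notMem_range s (s i)] with z hz hzx hzs
    have h2 := hB.loop_equation_coeff hħ x b hzs hx hzx
    rw [hB.sum_mul_eq hħ x b hnb, res_zero_empty] at h2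
    rw [(hB.hasDerivAt_res hħ x b Finset.univ hzs).deriv, ← hz, bracket]
    split_ifs with hb
    · rw [if_pos hb] at h2
      linear_combination h2
    · rw [if_neg hb, Finset.sum_add_distrib, Finset.sum_sub_distrib] at h2
      rw [Finset.sum_sub_distrib]
      linear_combination h2

/-- The loop equation says that the bracket plus the linear operator applied to the full correlator
is analytic at the points; the kernel inverts this operator. The result is the residue recursion,
for every order `b` rather than only `b = 2g + n`. -/
lemma exists_sum_res_bracket {G K : ℂ → ℂ → ℂ} (h : IsKernelSystem ħ dV s G K)
    (hnb : ¬(n = 0 ∧ b = 0)) (hx : ∀ j, x j ∉ Set.range s) {x₀ : ℂ} (hx₀ : x₀ ∉ Set.range s) :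
    ∃ a : Fin m → ℂ, (∀ i, HasRes (fun z => K x₀ z * hB.bracket hħ x b z) (s i) (a i)) ∧
      ∑ i, a i = hB.res hħ x b Finset.univ x₀ := by
  rw [res_eq_polar]
  refine h.sum_res_eq hx₀ _ _ _ fun i => ?_
  rw [← res_eq_polar]
  exact hB.exists_analyticAt_bracket_add hħ x b hnb hx i

/-- The correlator of `n + 1` resolvents only has contributions of the orders `2g + n`. -/
lemma res_univ_eq_zero {G K : ℂ → ℂ → ℂ} (h : IsKernelSystem ħ dV s G K) : ∀ (b n : ℕ)
    (x : Fin n → ℂ), (∀ j, x j ∉ Set.range s) → (∀ g, b ≠ 2 * g + n) → ∀ z ∉ Set.range s,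
      hB.res hħ x b Finset.univ z = 0 := by
  intro b
  -- The induction is lexicographic in `(b, n)`: the correlator with one more resolvent has order `b
  -- - 1`.
  induction b using Nat.strong_induction_on with
  | _ b ihb =>
    intro n
    induction n using Nat.strong_induction_on with
    | _ n ihn =>
      intro x hx hbn x₀ hx₀
      have hI : ∀ (p : ℕ) (I : Finset (Fin n)), (p < b ∨ p = b ∧ I.card < n) →
          (∀ g, p ≠ 2 * g + I.card) → ∀ z ∉ Set.range s, hB.res hħ x p I z = 0 := by
        intro p I hp hpI z hz
        rw [← res_subTuple]
        rcases hp with hp | ⟨rfl, hp⟩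
        · exact ihb p hp _ _ (fun _ => hx _) hpI z hz
        · exact ihn _ hp _ (fun _ => hx _) hpI z hz
      obtain ⟨a, ha, hsum⟩ := hB.exists_sum_res_bracket hħ x b h
        (fun h0 => hbn 0 (by omega)) hx hx₀
      rw [← hsum]
      refine Finset.sum_eq_zero fun i _ => ?_
      refine (ha i).residue_eq.symm.trans (HasRes.residue_eq ((HasRes.zero).congr ?_))
      filter_upwards [eventually_notMem_range s (s i)] with z hz
      rw [bracket]
      have h1 : (if b = 0 then 0 else hB.res hħ (Fin.cons z x : Fin (n + 1) → ℂ) (b - 1)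
          Finset.univ z + ∑ j, ((z - x j)⁻¹) ^ 2 * hB.res hħ x (b - 1) {j}ᶜ z) = 0 := by
        split_ifs with hb
        · rfl
        · rw [ihb (b - 1) (by omega) (n + 1) _ (fun j => Fin.cases hz (fun j => hx j) j)
            (fun g hg => hbn (g + 1) (by omega)) z hz, zero_add]
          refine Finset.sum_eq_zero fun j _ => ?_
          have hn : ({j}ᶜ : Finset (Fin n)).card = n - 1 := by
            rw [Finset.card_compl, Finset.card_singleton, Fintype.card_fin]
          have := j.2
          rw [hI (b - 1) {j}ᶜ (Or.inl (by omega)) (fun g hg => hbn g (by omega)) z hz, mul_zero]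
      rw [h1, zero_add, Finset.sum_eq_zero, mul_zero]
      intro I _
      refine Finset.sum_eq_zero fun p hp => ?_
      rw [Finset.HasAntidiagonal.mem_antidiagonal] at hp
      have hcard : I.card + Iᶜ.card = n := by
        rw [Finset.card_add_card_compl, Fintype.card_fin]
      split_ifs with hc
      · rfl
      · rw [not_or, not_and, not_and] at hc
        by_cases h2 : ∀ g, p.1 ≠ 2 * g + I.card
        · rw [hI p.1 I _ h2 z hz, zero_mul]
          rcases Nat.lt_or_ge p.1 b with h3 | h3
          · exact Or.inl h3
          · have h4 : I ≠ Finset.univ := hc.2 (by omega)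
            exact Or.inr ⟨by omega, by simpa using (Finset.card_lt_iff_ne_univ I).2 h4⟩
        · push Not at h2
          obtain ⟨g, hg⟩ := h2
          -- If both factors had admissible orders `2g + |I|` and `2g' + |Iᶜ|`, then `b` would be `2
          -- (g + g') + n`.
          rw [hI p.2 Iᶜ _ (fun g' hg' => hbn (g + g') (by omega)) z hz, mul_zero]
          rcases Nat.lt_or_ge p.2 b with h3 | h3
          · exact Or.inl h3
          · have h4 : I ≠ ∅ := hc.1 (by omega)
            have := Finset.card_pos.2 (Finset.nonempty_iff_ne_empty.2 h4)
            exact Or.inr ⟨by omega, by omega⟩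

lemma res_eq_zero {G K : ℂ → ℂ → ℂ} (h : IsKernelSystem ħ dV s G K) (hx : ∀ j, x j ∉ Set.range s)
    {I : Finset (Fin n)} (hI : ∀ g, b ≠ 2 * g + I.card) {z : ℂ} (hz : z ∉ Set.range s) :
    hB.res hħ x b I z = 0 := by
  rw [← res_subTuple]
  exact hB.res_univ_eq_zero hħ h _ _ _ (fun _ => hx _) hI z hz

/-- The only surviving term of the bracket is `(z - x)⁻²` times the one-point function of order
zero. It has simple poles at the points, so the residues involve only the values `K(x₀, sᵢ)`, which
are known. -/
lemma res_one {G K : ℂ → ℂ → ℂ} (h : IsKernelSystem ħ dV s G K) (x : Fin 1 → ℂ)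
    (hx : x 0 ∉ Set.range s) {x₀ : ℂ} (hx₀ : x₀ ∉ Set.range s) :
    hB.res hħ x 1 Finset.univ x₀ =
      ∑ j, ∑ k, matA ħ dV s j k * ((x 0 - s j)⁻¹) ^ 2 * ((x₀ - s k)⁻¹) ^ 2 := by
  have hx' : ∀ j, x j ∉ Set.range s := fun j => by rwa [Subsingleton.elim j 0]
  obtain ⟨a, ha, hsum⟩ := hB.exists_sum_res_bracket hħ x 1 h (by omega) hx' hx₀
  rw [← hsum]
  refine Finset.sum_congr rfl fun i _ => ?_
  have hne : s i ≠ x 0 := fun h => hx ⟨i, h⟩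
  have h1 : HasRes (fun z => ∑ j, K x₀ z * (((z - x 0)⁻¹) ^ 2 * (ħ * (z - s j)⁻¹))) (s i)
      (∑ j, if j = i then ħ * K x₀ (s i) * ((s i - x 0)⁻¹) ^ 2 else 0) := by
    refine HasRes.sum _ fun j _ => ?_
    split_ifs with hj
    · subst hj
      have h2 : AnalyticAt ℂ (fun z => K x₀ z * ((z - x 0)⁻¹) ^ 2) (s j) :=
        (h.analytic x₀ hx₀ j).mul (analyticAt_inv_pow hne 2)
      have h3 := (hasRes_mul_inv_pow h2 0).const_mul ħ
      rw [coeff_zero_taylor] at h3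
      rw [mul_assoc]
      exact h3.congr (Eventually.of_forall fun z => by ring)
    · exact HasRes.of_analyticAt ((h.analytic x₀ hx₀ i).mul ((analyticAt_inv_pow hne 2).mul
        (analyticAt_const.mul (analyticAt_inv_sub fun h => hj (hB.inj h).symm))))
  rw [Finset.sum_ite_eq' Finset.univ i, if_pos (Finset.mem_univ _)] at h1
  have h2 : a i = ħ * K x₀ (s i) * ((s i - x 0)⁻¹) ^ 2 := by
    refine (ha i).residue_eq.symm.trans (HasRes.residue_eq (h1.congr ?_))
    filter_upwards [eventually_notMem_range s (s i)] with z hz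
    rw [← Finset.mul_sum, ← Finset.mul_sum, ← Finset.mul_sum]
    congr 1
    have h0 : ∑ I : Finset (Fin 1), ∑ p ∈ Finset.HasAntidiagonal.antidiagonal 1,
        (if (p.1 = 0 ∧ I = ∅) ∨ (p.2 = 0 ∧ I = Finset.univ) then 0
        else hB.res hħ x p.1 I z * hB.res hħ x p.2 Iᶜ z) = 0 := by
      refine Finset.sum_eq_zero fun I _ => ?_
      refine Finset.sum_eq_zero fun p hp => ?_
      rw [Finset.HasAntidiagonal.mem_antidiagonal] at hp
      have hcard : I.card + Iᶜ.card = 1 := by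
        rw [Finset.card_add_card_compl, Fintype.card_fin]
      split_ifs with hc
      · rfl
      · rw [not_or, not_and, not_and] at hc
        have h4 : I = ∅ ∨ I = Finset.univ := by
          rcases Nat.eq_zero_or_pos I.card with h5 | h5
          · exact Or.inl (Finset.card_eq_zero.1 h5)
          · refine Or.inr (Finset.card_eq_iff_eq_univ I |>.1 ?_)
            rw [Fintype.card_fin]
            omega
        rcases h4 with rfl | rfl
        · have : p.1 ≠ 0 := fun h => hc.1 h rfl
          rw [hB.res_eq_zero hħ x p.1 h hx' _ hz, zero_mul]
          intro g
          simp only [Finset.card_empty]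
          omega
        · have : p.2 ≠ 0 := fun h => hc.2 h rfl
          rw [hB.res_eq_zero hħ x p.2 h hx' _ hz, mul_zero]
          intro g
          simp only [Finset.compl_univ, Finset.card_empty]
          omega
    rw [bracket, h0, if_neg one_ne_zero, Nat.sub_self, hB.res_eq_zero hħ _ 0 h
      (fun j => Fin.cases hz (fun j => hx' j) j) (by simp) hz, zero_add, add_zero, Fin.sum_univ_one]
    have : ({0}ᶜ : Finset (Fin 1)) = ∅ := by decide
    rw [this, res_zero_empty]
    simp
  have h3 := h.K_eq hħ hx₀ i
  have h4 : ħ * K x₀ (s i) = ∑ k, matA ħ dV s i k * ((x₀ - s k)⁻¹) ^ 2 := by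
    linear_combination h3 / 2
  rw [h2, h4, Finset.sum_mul]
  refine Finset.sum_congr rfl fun k _ => ?_
  rw [← neg_sub (x 0), inv_neg]
  ring

end IsBethe

/-! ### Comparison of the correlators `W` with the correlators of resolvents. -/

/-- The double pole of the two-point function, for the sub-tuples of `x` with one element. -/
def doublePole {n : ℕ} (x : Fin n → ℂ) (h : ℕ) (I : Finset (Fin n)) (z : ℂ) : ℂ :=
  if h = 0 then ∑ j, if I = {j} then 1 / 2 * ((z - x j)⁻¹) ^ 2 else 0 else 0

lemma analyticAt_doublePole {n : ℕ} {x : Fin n → ℂ} (h : ℕ) (I : Finset (Fin n)) {c : ℂ}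
    (hc : ∀ j, c ≠ x j) : AnalyticAt ℂ (doublePole x h I) c := by
  unfold doublePole
  split_ifs
  · refine Finset.analyticAt_fun_sum _ fun j _ => ?_
    split_ifs
    · exact analyticAt_const.mul (analyticAt_inv_pow (hc j) 2)
    · exact analyticAt_const
  · exact analyticAt_const

lemma cons_last_eq {n : ℕ} (hn : n ≠ 0) (z : ℂ) (y : Fin n → ℂ) :
    (Fin.cons z y : Fin (n + 1) → ℂ) (Fin.last n) = y ⟨n - 1, by omega⟩ := by
  cases n with
  | zero => exact absurd rfl hn
  | succ n => rw [← Fin.succ_last, Fin.cons_succ]; rfl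

lemma cons_subTuple_singleton {n : ℕ} (x : Fin n → ℂ) (I : Finset (Fin n)) (j : Fin n)
    (hI : I = {j}) (z : ℂ) :
    (Fin.cons z (subTuple x I) : Fin (I.card + 1) → ℂ) (Fin.last _) = x j := by
  rw [cons_last_eq (by simp [hI]), subTuple]
  congr 1
  have h : ∀ k, I.orderEmbOfFin rfl k ∈ ({j} : Finset (Fin n)) := fun k =>
    hI ▸ Finset.orderEmbOfFin_mem I rfl k
  exact Finset.mem_singleton.1 (h _)

lemma doublePole_eq {n : ℕ} (x : Fin n → ℂ) (h : ℕ) (I : Finset (Fin n)) (z : ℂ) :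
    (if h = 0 ∧ I.card = 1 then
      1 / 2 * ((z - (Fin.cons z (subTuple x I) : Fin (I.card + 1) → ℂ) (Fin.last _))⁻¹) ^ 2 else 0) =
      doublePole x h I z := by
  unfold doublePole
  by_cases hh : h = 0
  · rw [if_pos hh]
    by_cases hI : I.card = 1
    · obtain ⟨j, hj⟩ := Finset.card_eq_one.1 hI
      rw [if_pos ⟨hh, hI⟩, cons_subTuple_singleton x I j hj, Finset.sum_eq_single j]
      · rw [if_pos hj]
      · intro k _ hk
        rw [if_neg]
        rw [hj, Finset.singleton_inj]
        exact hk.symm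
      · simp
    · rw [if_neg fun h => hI h.2, Finset.sum_eq_zero]
      intro j _
      rw [if_neg]
      rintro rfl
      simp at hI
  · rw [if_neg hh, if_neg fun h => hh h.1]

namespace IsBethe

variable {m : ℕ} {ħ : ℂ} {dV : RatFunc ℂ} {s : Fin m → ℂ} (hB : IsBethe ħ dV s) (hħ : ħ ≠ 0)
  {n : ℕ} (x : Fin n → ℂ)

/-- The splittings of the genus embed into the splittings of the order by `k ↦ (2k + |I|, 2(g-k) +
|Iᶜ|)`. In all other splittings of the order one factor vanishes by `res_eq_zero`. -/
lemma sum_res_mul_res {G K : ℂ → ℂ → ℂ} (h : IsKernelSystem ħ dV s G K)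
    (hx : ∀ j, x j ∉ Set.range s) (g : ℕ) {z : ℂ} (hz : z ∉ Set.range s) :
    ∑ k : Fin (g + 1), ∑ I : Finset (Fin n),
      (if ((k : ℕ) = 0 ∧ I = ∅) ∨ ((k : ℕ) = g ∧ I = Finset.univ) then 0
      else hB.res hħ x (2 * k + I.card) I z * hB.res hħ x (2 * (g - k) + Iᶜ.card) Iᶜ z) =
    ∑ I : Finset (Fin n), ∑ p ∈ Finset.HasAntidiagonal.antidiagonal (2 * g + n),
      if (p.1 = 0 ∧ I = ∅) ∨ (p.2 = 0 ∧ I = Finset.univ) then 0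
      else hB.res hħ x p.1 I z * hB.res hħ x p.2 Iᶜ z := by
  rw [Finset.sum_comm]
  refine Finset.sum_congr rfl fun I _ => ?_
  have hcard : I.card + Iᶜ.card = n := by rw [Finset.card_add_card_compl, Fintype.card_fin]
  refine Finset.sum_of_injOn
    (fun k : Fin (g + 1) => (2 * (k : ℕ) + I.card, 2 * (g - k) + Iᶜ.card)) ?_ ?_ ?_ ?_
  · intro k _ l _ hkl
    simp only [Prod.mk.injEq] at hkl
    exact Fin.ext (by omega)
  · intro k _
    have := k.2
    simp only [Finset.mem_coe, Finset.HasAntidiagonal.mem_antidiagonal]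
    omega
  · intro p hp hpk
    rw [Finset.HasAntidiagonal.mem_antidiagonal] at hp
    split_ifs
    · rfl
    · by_cases h1 : ∀ a, p.1 ≠ 2 * a + I.card
      · rw [hB.res_eq_zero hħ x p.1 h hx h1 hz, zero_mul]
      · by_cases h2 : ∀ a, p.2 ≠ 2 * a + Iᶜ.card
        · rw [hB.res_eq_zero hħ x p.2 h hx h2 hz, mul_zero]
        · push Not at h1 h2
          obtain ⟨a, ha⟩ := h1
          obtain ⟨c, hc⟩ := h2
          refine absurd ⟨⟨a, by omega⟩, by simp, Prod.ext ?_ ?_⟩ hpk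
          · exact ha.symm
          · simp only
            omega
  · intro k _
    have := k.2
    have h1 : ((k : ℕ) = 0 ∧ I = ∅) ↔ 2 * (k : ℕ) + I.card = 0 ∧ I = ∅ :=
      ⟨fun h => ⟨by rw [h.1, h.2]; rfl, h.2⟩, fun h => ⟨by omega, h.2⟩⟩
    have h2 : ((k : ℕ) = g ∧ I = Finset.univ) ↔ 2 * (g - k) + Iᶜ.card = 0 ∧ I = Finset.univ := by
      refine ⟨fun h => ⟨?_, h.2⟩, fun h => ⟨by omega, h.2⟩⟩
      rw [h.1, h.2]
      simp
    simp only [h1, h2]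

lemma sum_doublePole_mul_res {g : ℕ} (hgn : ¬(g = 0 ∧ n = 1)) (z : ℂ) :
    ∑ k : Fin (g + 1), ∑ I : Finset (Fin n),
      (if ((k : ℕ) = 0 ∧ I = ∅) ∨ ((k : ℕ) = g ∧ I = Finset.univ) then 0
      else doublePole x k I z * hB.res hħ x (2 * (g - k) + Iᶜ.card) Iᶜ z) =
    ∑ j, 1 / 2 * ((z - x j)⁻¹) ^ 2 * hB.res hħ x (2 * g + n - 1) {j}ᶜ z := by
  have hn : ∀ j : Fin n, 2 * g + ({j}ᶜ : Finset (Fin n)).card = 2 * g + n - 1 := fun j => by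
    have := j.2
    rw [Finset.card_compl, Finset.card_singleton, Fintype.card_fin]
    omega
  rw [Finset.sum_eq_single (0 : Fin (g + 1))]
  · have h1 : ∀ I : Finset (Fin n),
        (if (((0 : Fin (g + 1)) : ℕ) = 0 ∧ I = ∅) ∨ (((0 : Fin (g + 1)) : ℕ) = g ∧ I = Finset.univ)
        then 0 else doublePole x ((0 : Fin (g + 1)) : ℕ) I z *
          hB.res hħ x (2 * (g - ((0 : Fin (g + 1)) : ℕ)) + Iᶜ.card) Iᶜ z) =
        ∑ j, if I = {j} then 1 / 2 * ((z - x j)⁻¹) ^ 2 * hB.res hħ x (2 * g + n - 1) {j}ᶜ z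
          else 0 := by
      intro I
      split_ifs with hI
      · refine (Finset.sum_eq_zero fun j _ => if_neg ?_).symm
        rintro rfl
        rcases hI with hI | hI
        · exact Finset.singleton_ne_empty _ hI.2
        · refine hgn ⟨hI.1.symm, ?_⟩
          simpa using (congrArg Finset.card hI.2).symm
      · rw [doublePole, if_pos (by simp), Finset.sum_mul]
        refine Finset.sum_congr rfl fun j _ => ?_
        split_ifs with hj
        · rw [hj, Fin.val_zero, Nat.sub_zero, hn]
        · rw [zero_mul]
    simp only [h1]
    rw [Finset.sum_comm]
    simp
  · intro k _ hk
    have hk0 : (k : ℕ) ≠ 0 := fun h => hk (Fin.ext h)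
    refine Finset.sum_eq_zero fun I _ => ?_
    simp only [doublePole, if_neg hk0, zero_mul, ite_self]
  · simp

lemma sum_res_mul_doublePole {g : ℕ} (hgn : ¬(g = 0 ∧ n = 1)) (z : ℂ) :
    ∑ k : Fin (g + 1), ∑ I : Finset (Fin n),
      (if ((k : ℕ) = 0 ∧ I = ∅) ∨ ((k : ℕ) = g ∧ I = Finset.univ) then 0
      else hB.res hħ x (2 * k + I.card) I z * doublePole x (g - k) Iᶜ z) =
    ∑ j, 1 / 2 * ((z - x j)⁻¹) ^ 2 * hB.res hħ x (2 * g + n - 1) {j}ᶜ z := by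
  rw [← hB.sum_doublePole_mul_res hħ x hgn z]
  refine Finset.sum_equiv Fin.revPerm (by simp) fun k _ => ?_
  refine Finset.sum_equiv (compl_involutive.toPerm _) (by simp) fun I _ => ?_
  have hk := k.2
  have h1 : ((Fin.revPerm k : Fin (g + 1)) : ℕ) = g - k := by
    rw [Fin.revPerm_apply, Fin.val_rev]
    omega
  have h2 : (compl_involutive.toPerm compl) I = Iᶜ := rfl
  have h3 : g - (g - (k : ℕ)) = k := by omega
  rw [h1, h2, h3, compl_compl]
  have h4 : (((k : ℕ) = 0 ∧ I = ∅) ∨ ((k : ℕ) = g ∧ I = Finset.univ)) ↔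
      ((g - (k : ℕ) = 0 ∧ Iᶜ = ∅) ∨ (g - (k : ℕ) = g ∧ Iᶜ = Finset.univ)) := by
    rw [Finset.compl_eq_empty_iff, Finset.compl_eq_univ_iff, or_comm]
    have h5 : (k : ℕ) = g ↔ g - (k : ℕ) = 0 := by omega
    by_cases h6 : (k : ℕ) = 0
    · rw [h5, h6]; simp
    · have : g - (k : ℕ) ≠ g := by omega
      simp only [h6, this, h5, false_and]
  simp only [h4, mul_comm]

/-- The bracket contains each `(z - x j)⁻²` once. In the recursion for `W` it arises as twice `½ (z
- x j)⁻²`, from the singular part of `B` in the first or in the second factor. -/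
lemma bracket_add_eq {G K : ℂ → ℂ → ℂ} (h : IsKernelSystem ħ dV s G K)
    (hx : ∀ j, x j ∉ Set.range s) {g : ℕ} (hgn : ¬(g = 0 ∧ n = 0)) (hgn' : ¬(g = 0 ∧ n = 1))
    {z : ℂ} (hz : z ∉ Set.range s) :
    (if g = 0 then 0 else hB.res hħ (Fin.cons z x : Fin (n + 1) → ℂ) (2 * g + n - 1)
      Finset.univ z) +
    ∑ k : Fin (g + 1), ∑ I : Finset (Fin n),
      (if ((k : ℕ) = 0 ∧ I = ∅) ∨ ((k : ℕ) = g ∧ I = Finset.univ) then 0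
      else (hB.res hħ x (2 * k + I.card) I z + doublePole x k I z) *
        (hB.res hħ x (2 * (g - k) + Iᶜ.card) Iᶜ z + doublePole x (g - k) Iᶜ z)) =
    hB.bracket hħ x (2 * g + n) z +
    ∑ k : Fin (g + 1), ∑ I : Finset (Fin n),
      (if ((k : ℕ) = 0 ∧ I = ∅) ∨ ((k : ℕ) = g ∧ I = Finset.univ) then 0
      else doublePole x k I z * doublePole x (g - k) Iᶜ z) := by
  have h1 : (if g = 0 then 0 else hB.res hħ (Fin.cons z x : Fin (n + 1) → ℂ) (2 * g + n - 1)
      Finset.univ z) = hB.res hħ (Fin.cons z x : Fin (n + 1) → ℂ) (2 * g + n - 1)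
      Finset.univ z := by
    split_ifs with hg
    · rw [hB.res_univ_eq_zero hħ h _ _ _ (fun j => Fin.cases hz (fun j => hx j) j) _ z hz]
      intro a
      omega
    · rfl
  rw [bracket, h1, if_neg (by omega : ¬2 * g + n = 0), ← hB.sum_res_mul_res hħ x h hx g hz]
  have h2 : ∑ j, ((z - x j)⁻¹) ^ 2 * hB.res hħ x (2 * g + n - 1) {j}ᶜ z =
      ∑ j, 1 / 2 * ((z - x j)⁻¹) ^ 2 * hB.res hħ x (2 * g + n - 1) {j}ᶜ z +
      ∑ j, 1 / 2 * ((z - x j)⁻¹) ^ 2 * hB.res hħ x (2 * g + n - 1) {j}ᶜ z := by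
    rw [← Finset.sum_add_distrib]
    exact Finset.sum_congr rfl fun j _ => by ring
  rw [h2]
  nth_rewrite 1 [← hB.sum_doublePole_mul_res hħ x hgn' z]
  rw [← hB.sum_res_mul_doublePole hħ x hgn' z]
  simp only [add_assoc, ← Finset.sum_add_distrib]
  congr 1
  refine Finset.sum_congr rfl fun k _ => Finset.sum_congr rfl fun I _ => ?_
  split_ifs
  · ring
  · ring

end IsBethe

/-- The correlators are the expansion coefficients of the correlators of resolvents. -/
theorem IsKernelSystem.W_eq {m : ℕ} {ħ : ℂ} {dV : RatFunc ℂ} {s : Fin m → ℂ} {G K : ℂ → ℂ → ℂ}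
    (h : IsKernelSystem ħ dV s G K) (hB : IsBethe ħ dV s) (hħ : ħ ≠ 0) (g n : ℕ)
    (y : Fin (n + 1) → ℂ) (hy : ∀ j, y j ∉ Set.range s)
    (hyy : g = 0 → n = 1 → y 0 ≠ y (Fin.last n)) : W ħ s G K g n y =
      hB.res hħ (Fin.tail y) (2 * g + n) Finset.univ (y 0) +
        if g = 0 ∧ n = 1 then 1 / 2 * ((y 0 - y (Fin.last n))⁻¹) ^ 2 else 0 := by
  induction hN : 2 * g + n using Nat.strong_induction_on generalizing g n with
  | _ N ih =>
    subst hN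
    rw [W]
    by_cases h00 : g = 0 ∧ n = 0
    · obtain ⟨rfl, rfl⟩ := h00
      rw [if_pos ⟨rfl, rfl⟩, if_neg (by omega), add_zero]
      exact (hB.res_zero_empty hħ (Fin.tail y) (y 0)).symm
    by_cases h01 : g = 0 ∧ n = 1
    · obtain ⟨rfl, rfl⟩ := h01
      rw [if_neg (by omega), if_pos ⟨rfl, rfl⟩, if_pos ⟨rfl, rfl⟩,
        h.kernelB_eq hħ (hy 0) (hy _) (hyy rfl rfl).symm,
        hB.res_one hħ h (Fin.tail y) (hy _) (hy 0), add_comm]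
      rfl
    rw [if_neg h00, if_neg h01, if_neg h01, add_zero]
    set x := Fin.tail y with hx_def
    have hx : ∀ j, x j ∉ Set.range s := fun j => hy _
    obtain ⟨a, ha, hsum⟩ := hB.exists_sum_res_bracket hħ x (2 * g + n) h (by omega) hx (hy 0)
    rw [← hsum]
    refine Finset.sum_congr rfl fun i _ => HasRes.residue_eq ?_
    have hne : ∀ j, s i ≠ x j := fun j h => hx j ⟨i, h⟩
    -- Products of two double poles at the `x j` are analytic at `s i` and do not contribute to the
    -- recursion.
    have h1 : HasRes (fun z => K (y 0) z * ∑ k : Fin (g + 1), ∑ I : Finset (Fin n),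
        (if ((k : ℕ) = 0 ∧ I = ∅) ∨ ((k : ℕ) = g ∧ I = Finset.univ) then 0
        else doublePole x k I z * doublePole x (g - k) Iᶜ z)) (s i) 0 := by
      refine HasRes.of_analyticAt ((h.analytic _ (hy 0) i).mul
        (Finset.analyticAt_fun_sum _ fun k _ => Finset.analyticAt_fun_sum _ fun I _ => ?_))
      split_ifs
      · exact analyticAt_const
      · exact (analyticAt_doublePole _ _ hne).mul (analyticAt_doublePole _ _ hne)
    have h2 := (ha i).add h1
    rw [add_zero] at h2
    refine h2.congr ?_
    have hne' : ∀ᶠ z in 𝓝[≠] (s i), ∀ j, z ≠ x j :=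
      eventually_all.2 fun j => mem_nhdsWithin_of_mem_nhds (isOpen_ne.mem_nhds (hne j))
    filter_upwards [hne', eventually_notMem_range s (s i)] with z hzx hz
    rw [← mul_add, ← hB.bracket_add_eq hħ x h hx h00 h01 hz]
    congr 1
    congr 1
    · by_cases hg : g = 0
      · rw [if_pos hg, dif_pos hg]
      · rw [if_neg hg, dif_neg hg]
        by_cases hg1 : g = 1 ∧ n = 0
        · obtain ⟨rfl, rfl⟩ := hg1
          -- For `g = 1`, `n = 0` the regularized diagonal value of `B` is the correlator of
          -- resolvents itself, which has no double pole at coinciding arguments.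
          rw [if_pos ⟨rfl, rfl⟩, h.kernelBDiag_eq hħ hz]
          exact hB.res_one hħ h _ hz hz
        · rw [if_neg hg1, ih (2 * (g - 1) + (n + 1)) (by omega) (g - 1) (n + 1) _
            (fun j => Fin.cases hz (fun j => Fin.cases hz (fun j => hx j) j) j) (by omega) rfl,
            if_neg (by omega), add_zero, Fin.tail_cons, Fin.cons_zero]
          congr 1
          omega
    · refine Finset.sum_congr rfl fun k _ => Finset.sum_congr rfl fun I _ => ?_
      have hk := k.2
      have hcard : I.card + Iᶜ.card = n := by rw [Finset.card_add_card_compl, Fintype.card_fin]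
      have hW : ∀ (l : ℕ) (I : Finset (Fin n)), 2 * l + I.card < 2 * g + n →
          W ħ s G K l I.card (Fin.cons z (subTuple x I)) =
            hB.res hħ x (2 * l + I.card) I z + doublePole x l I z := by
        intro l I hl
        rw [ih _ hl l I.card _ (fun j => Fin.cases hz (fun j => hx _) j) _ rfl, Fin.tail_cons,
          Fin.cons_zero, hB.res_subTuple, doublePole_eq]
        intro _ hI
        obtain ⟨j, hj⟩ := Finset.card_eq_one.1 hI
        rw [cons_subTuple_singleton x I j hj]
        exact hzx j
      split_ifs with hI
      · rfl
      · rw [not_or, not_and, not_and] at hI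
        rw [hW, hW]
        · have : (k : ℕ) = 0 → Iᶜ.card < n := fun h0 => by
            have := Finset.card_pos.2 (Finset.nonempty_iff_ne_empty.2 (hI.1 h0))
            omega
          rcases Nat.eq_zero_or_pos (k : ℕ) with h0 | h0
          · have := this h0
            omega
          · omega
        · have : (k : ℕ) = g → I.card < n := fun h0 => by
            simpa using (Finset.card_lt_iff_ne_univ I).2 (hI.2 h0)
          rcases Nat.lt_or_ge (k : ℕ) g with h0 | h0
          · omega
          · have := this (by omega)
            omega

/-- The residue pairing is the correlator of resolvents and of one linear statistic. -/
theorem IsKernelSystem.resPairing_eq {m : ℕ} {ħ : ℂ} {dV : RatFunc ℂ} {s : Fin m → ℂ}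
    {G K : ℂ → ℂ → ℂ} (h : IsKernelSystem ħ dV s G K) (hB : IsBethe ħ dV s) (hħ : ħ ≠ 0) (g n : ℕ)
    (x : Fin n → ℂ) (hx : ∀ j, x j ∉ Set.range s) {f : ℂ → ℂ}
    (hf : ∀ i, AnalyticAt ℂ f (s i)) : resPairing ħ s G K g n x f =
      hB.cr hħ x (2 * g + n) (fun i => taylor f (s i)) Finset.univ := by
  rw [resPairing, hB.cr_eq_sum]
  refine Finset.sum_congr rfl fun i _ => HasRes.residue_eq ?_
  have hne : ∀ j, s i ≠ x j := fun j h => hx j ⟨i, h⟩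
  have h1 := hasRes_polar_mul h.inj (2 * g + n + 1)
    ((hB.data hħ).jet (fun j => cauchyJet s (x j)) Finset.univ (2 * g + n)) (hf i)
  rw [← hB.res_eq_polar] at h1
  -- The double pole of `B` lies at an `x j`, away from the points, and does not affect the pairing.
  have h2 : HasRes (fun z => doublePole x g Finset.univ z * f z) (s i) 0 :=
    HasRes.of_analyticAt ((analyticAt_doublePole _ _ hne).mul (hf i))
  have h3 := h1.add h2
  rw [add_zero] at h3
  refine h3.congr ?_
  have hne' : ∀ᶠ z in 𝓝[≠] (s i), ∀ j, z ≠ x j :=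
    eventually_all.2 fun j => mem_nhdsWithin_of_mem_nhds (isOpen_ne.mem_nhds (hne j))
  filter_upwards [hne', eventually_notMem_range s (s i)] with z hzx hz
  rw [← add_mul]
  congr 1
  rw [h.W_eq hB hħ g n _ (fun j => Fin.cases hz (fun j => hx j) j), Fin.tail_cons, Fin.cons_zero]
  · congr 1
    rw [doublePole]
    by_cases hg : g = 0
    · subst hg
      rw [if_pos rfl]
      by_cases hn : n = 1
      · subst hn
        simp [Fin.last]
      · rw [if_neg fun h => hn h.2, Finset.sum_eq_zero]
        intro j _
        rw [if_neg]
        intro h4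
        exact hn (by simpa using congrArg Finset.card h4)
    · rw [if_neg hg, if_neg fun h => hg h.1]
  · rintro - rfl
    exact hzx _

/-! ### Linear families of potentials and the implicit function theorem. -/

section Pencil

variable {q m : ℕ} (dV : RatFunc ℂ) (dD : Fin q → RatFunc ℂ)

/-- A linear family of potentials. -/
def pencil (τ : Fin q → ℂ) : RatFunc ℂ := dV + ∑ k, RatFunc.C (τ k) * dD k

variable {dV dD}

lemma denom_pencil_ne {c : ℂ} (hV : dV.denom.eval c ≠ 0) (hD : ∀ k, (dD k).denom.eval c ≠ 0)
    (τ : Fin q → ℂ) : (pencil dV dD τ).denom.eval c ≠ 0 ∧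
      val (pencil dV dD τ) c = val dV c + ∑ k, τ k * val (dD k) c := by
  have h : ∀ t : Finset (Fin q), (dV + ∑ k ∈ t, RatFunc.C (τ k) * dD k).denom.eval c ≠ 0 ∧
      val (dV + ∑ k ∈ t, RatFunc.C (τ k) * dD k) c = val dV c + ∑ k ∈ t, τ k * val (dD k) c := by
    intro t
    induction t using Finset.induction_on with
    | empty => simpa using hV
    | insert a t ha ih =>
      have h1 := denom_add_C_mul_ne ih.1 (hD a) (τ a)
      rw [Finset.sum_insert ha, Finset.sum_insert ha, add_comm (RatFunc.C (τ a) * dD a), ← add_assoc]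
      refine ⟨h1.1, ?_⟩
      rw [h1.2, ih.2]
      ring
  exact h Finset.univ

lemma eventually_denom_ne {f : RatFunc ℂ} {c : ℂ} (h : f.denom.eval c ≠ 0) :
    ∀ᶠ z in 𝓝 c, f.denom.eval z ≠ 0 :=
  f.denom.continuous.continuousAt.eventually_ne h

lemma eventually_val_pencil {c : ℂ} (hV : dV.denom.eval c ≠ 0)
    (hD : ∀ k, (dD k).denom.eval c ≠ 0) (τ : Fin q → ℂ) :
    ∀ᶠ z in 𝓝 c, val (pencil dV dD τ) z = val dV z + ∑ k, τ k * val (dD k) z := by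
  filter_upwards [eventually_denom_ne hV, eventually_all.2 fun k => eventually_denom_ne (hD k)]
    with z h1 h2
  exact (denom_pencil_ne h1 h2 τ).2

lemma deriv_val_pencil {c : ℂ} (hV : dV.denom.eval c ≠ 0)
    (hD : ∀ k, (dD k).denom.eval c ≠ 0) (τ : Fin q → ℂ) :
    deriv (val (pencil dV dD τ)) c = deriv (val dV) c + ∑ k, τ k * deriv (val (dD k)) c := by
  rw [Filter.EventuallyEq.deriv_eq (eventually_val_pencil hV hD τ)]
  have h := (analyticAt_val hV).differentiableAt.hasDerivAt.fun_add
    (HasDerivAt.fun_sum (u := Finset.univ) fun k (_ : k ∈ Finset.univ) =>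
      ((analyticAt_val (hD k)).differentiableAt.hasDerivAt.const_mul (τ k)))
  exact h.deriv

variable (dV dD)

/-- The Bethe equations, as a function of the parameters and of the points. -/
def betheMap (ħ : ℂ) (p : (Fin q → ℂ) × (Fin m → ℂ)) (i : Fin m) : ℂ :=
  val dV (p.2 i) + ∑ k, p.1 k * val (dD k) (p.2 i) -
    2 * ħ * ∑ j ∈ Finset.univ.erase i, (p.2 i - p.2 j)⁻¹

variable {dV dD} {ħ : ℂ} {τ₀ : Fin q → ℂ} {s₀ : Fin m → ℂ}

lemma contDiffAt_betheMap (hs : Function.Injective s₀) (hV : ∀ i, dV.denom.eval (s₀ i) ≠ 0)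
    (hD : ∀ k i, (dD k).denom.eval (s₀ i) ≠ 0) : ContDiffAt ℂ 1 (betheMap dV dD ħ) (τ₀, s₀) := by
  refine contDiffAt_pi.2 fun i => ?_
  have h2 : ∀ i, ContDiffAt ℂ 1 (fun p : (Fin q → ℂ) × (Fin m → ℂ) => p.2 i) (τ₀, s₀) := fun i => by
    fun_prop
  have h1 : ∀ k, ContDiffAt ℂ 1 (fun p : (Fin q → ℂ) × (Fin m → ℂ) => p.1 k) (τ₀, s₀) := fun i => by
    fun_prop
  have hval : ∀ f : RatFunc ℂ, f.denom.eval (s₀ i) ≠ 0 →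
      ContDiffAt ℂ 1 (fun p : (Fin q → ℂ) × (Fin m → ℂ) => val f (p.2 i)) (τ₀, s₀) := fun f hf =>
    ContDiffAt.comp (τ₀, s₀) (g := val f) (analyticAt_val hf).contDiffAt (h2 i)
  refine ((hval _ (hV i)).add (ContDiffAt.sum fun k _ => (h1 k).mul (hval _ (hD k i)))).sub
    (contDiffAt_const.mul (ContDiffAt.sum fun j hj => ((h2 i).sub (h2 j)).inv ?_))
  exact sub_ne_zero.2 (hs.ne (Finset.ne_of_mem_erase hj).symm)

lemma hasDerivAt_betheMap_line (hħ : ħ ≠ 0) (hs : Function.Injective s₀)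
    (hV : ∀ i, dV.denom.eval (s₀ i) ≠ 0)
    (hD : ∀ k i, (dD k).denom.eval (s₀ i) ≠ 0) (w : Fin m → ℂ) (i : Fin m) :
    HasDerivAt (fun t : ℂ => betheMap dV dD ħ (τ₀, s₀ + t • w) i)
      (ħ * ∑ j, hessian ħ (pencil dV dD τ₀) s₀ i j * w j) 0 := by
  have hl : ∀ i, HasDerivAt (fun t : ℂ => (s₀ + t • w) i) (w i) 0 := by
    intro i
    simpa using ((hasDerivAt_id (0 : ℂ)).mul_const (w i)).const_add (s₀ i)
  have h0 : s₀ + (0 : ℂ) • w = s₀ := by simp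
  have hval : ∀ f : RatFunc ℂ, f.denom.eval (s₀ i) ≠ 0 →
      HasDerivAt (fun t : ℂ => val f ((s₀ + t • w) i)) (deriv (val f) (s₀ i) * w i) 0 := by
    intro f hf
    have h1 : HasDerivAt (val f) (deriv (val f) (s₀ i)) ((s₀ + (0 : ℂ) • w) i) := by
      rw [h0]
      exact (analyticAt_val hf).differentiableAt.hasDerivAt
    exact h1.comp (0 : ℂ) (hl i)
  have h := ((hval _ (hV i)).fun_add (HasDerivAt.fun_sum (u := Finset.univ)
    fun k (_ : k ∈ Finset.univ) => (hval _ (hD k i)).const_mul (τ₀ k))).fun_sub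
      ((HasDerivAt.fun_sum (u := Finset.univ.erase i) fun j hj =>
        ((hl i).fun_sub (hl j)).fun_inv (by
          rw [h0]; exact sub_ne_zero.2 (hs.ne (Finset.ne_of_mem_erase hj).symm))).const_mul (2 * ħ))
  refine h.congr_deriv ?_
  simp only [h0]
  rw [← Finset.add_sum_erase _ _ (Finset.mem_univ i)]
  have h1 : ∀ j ∈ Finset.univ.erase i, hessian ħ (pencil dV dD τ₀) s₀ i j * w j =
      -2 * (w j / (s₀ i - s₀ j) ^ 2) := by
    intro j hj
    rw [hessian, Matrix.of_apply, if_neg (Finset.ne_of_mem_erase hj).symm]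
    ring
  rw [Finset.sum_congr rfl h1, ← Finset.mul_sum, hessian, Matrix.of_apply, if_pos rfl,
    deriv_val_pencil (hV i) (fun k => hD k i)]
  have h2 : ∀ j, -(w i - w j) / (s₀ i - s₀ j) ^ 2 = -(1 / (s₀ i - s₀ j) ^ 2 * w i) +
      w j / (s₀ i - s₀ j) ^ 2 := by
    intro j
    ring
  have h3 : ∀ k, τ₀ k * (deriv (val (dD k)) (s₀ i) * w i) =
      τ₀ k * deriv (val (dD k)) (s₀ i) * w i := fun k => by ring
  simp only [h2, h3, Finset.sum_add_distrib, Finset.sum_neg_distrib, ← Finset.sum_mul]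
  generalize ∑ k ∈ Finset.univ.erase i, 1 / (s₀ i - s₀ k) ^ 2 = S₁
  generalize ∑ k ∈ Finset.univ.erase i, w k / (s₀ i - s₀ k) ^ 2 = S₂
  field_simp
  ring

/-- The derivative of the Bethe equations with respect to the points is `ħ T`, read off along lines.
-/
lemma isInvertible_betheMap (hħ : ħ ≠ 0) (h : IsBethe ħ (pencil dV dD τ₀) s₀)
    (hV : ∀ i, dV.denom.eval (s₀ i) ≠ 0) (hD : ∀ k i, (dD k).denom.eval (s₀ i) ≠ 0) :
    (fderiv ℂ (betheMap dV dD ħ) (τ₀, s₀) ∘L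
      .inr ℂ (Fin q → ℂ) (Fin m → ℂ)).IsInvertible := by
  set L := fderiv ℂ (betheMap dV dD ħ) (τ₀, s₀) ∘L .inr ℂ (Fin q → ℂ) (Fin m → ℂ) with hL
  have hinj : Function.Injective (L : (Fin m → ℂ) →ₗ[ℂ] (Fin m → ℂ)) := by
    rw [← LinearMap.ker_eq_bot, LinearMap.ker_eq_bot']
    intro w hw
    have hd := ((contDiffAt_betheMap (ħ := ħ) (τ₀ := τ₀) h.inj hV hD).differentiableAt
      one_ne_zero).hasFDerivAt
    have hl : HasDerivAt (fun t : ℂ => ((τ₀, s₀ + t • w) : (Fin q → ℂ) × (Fin m → ℂ)))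
        ((0, w) : (Fin q → ℂ) × (Fin m → ℂ)) 0 := by
      refine (hasDerivAt_const (0 : ℂ) τ₀).prodMk ?_
      simpa using ((hasDerivAt_id (0 : ℂ)).smul_const w).const_add s₀
    have h0 : ((τ₀, s₀ + (0 : ℂ) • w) : (Fin q → ℂ) × (Fin m → ℂ)) = (τ₀, s₀) := by simp
    rw [← h0] at hd
    have h1 := hd.comp_hasDerivAt (0 : ℂ) hl
    rw [h0] at h1
    have h2 : (hessian ħ (pencil dV dD τ₀) s₀).mulVec w = 0 := by
      funext i
      have h3 := (hasDerivAt_pi.1 h1 i).unique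
        (hasDerivAt_betheMap_line (τ₀ := τ₀) hħ h.inj hV hD w i)
      have h4 : fderiv ℂ (betheMap dV dD ħ) (τ₀, s₀) (0, w) = 0 := hw
      rw [h4] at h3
      exact (mul_eq_zero.1 h3.symm).resolve_left hħ
    exact Matrix.eq_zero_of_mulVec_eq_zero h.det_ne h2
  exact ⟨(LinearEquiv.ofInjectiveEndo _ hinj).toContinuousLinearEquiv, by ext; rfl⟩

lemma betheMap_eq_zero_iff {p : (Fin q → ℂ) × (Fin m → ℂ)} (hV : ∀ i, dV.denom.eval (p.2 i) ≠ 0)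
    (hD : ∀ k i, (dD k).denom.eval (p.2 i) ≠ 0) : betheMap dV dD ħ p = 0 ↔
      ∀ i, val (pencil dV dD p.1) (p.2 i) =
        2 * ħ * ∑ j ∈ Finset.univ.erase i, 1 / (p.2 i - p.2 j) := by
  rw [funext_iff]
  refine forall_congr' fun i => ?_
  rw [(denom_pencil_ne (hV i) (fun k => hD k i) p.1).2, betheMap, Pi.zero_apply, sub_eq_zero]
  simp only [one_div]

/-- A nondegenerate solution of the Bethe equations moves differentiably with the potential. -/
theorem IsBethe.exists_family (hħ : ħ ≠ 0) (h : IsBethe ħ (pencil dV dD τ₀) s₀)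
    (hV : ∀ i, dV.denom.eval (s₀ i) ≠ 0) (hD : ∀ k i, (dD k).denom.eval (s₀ i) ≠ 0) :
    ∃ ψ : (Fin q → ℂ) → Fin m → ℂ, ψ τ₀ = s₀ ∧
      (∀ᶠ τ in 𝓝 τ₀, DifferentiableAt ℂ ψ τ ∧ IsBethe ħ (pencil dV dD τ) (ψ τ)) ∧
      ∀ᶠ p in 𝓝 (τ₀, s₀), IsBethe ħ (pencil dV dD p.1) p.2 → p.2 = ψ p.1 := by
  have hc := contDiffAt_betheMap (ħ := ħ) (τ₀ := τ₀) h.inj hV hD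
  have hinv := isInvertible_betheMap hħ h hV hD
  set ψ := hc.implicitFunction one_ne_zero hinv with hψ
  have hψ0 : ψ τ₀ = s₀ := hc.implicitFunction_apply_self one_ne_zero hinv
  have hψc : ContDiffAt ℂ 1 ψ τ₀ := hc.contDiffAt_implicitFunction one_ne_zero hinv
  have hcont : ContinuousAt ψ τ₀ := hψc.continuousAt
  have hzero : betheMap dV dD ħ (τ₀, s₀) = 0 := (betheMap_eq_zero_iff hV hD).2 h.bethe
  have hgood : ∀ᶠ y in 𝓝 s₀, Function.Injective y ∧ (∀ i, dV.denom.eval (y i) ≠ 0) ∧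
      ∀ k i, (dD k).denom.eval (y i) ≠ 0 := by
    have hi : ∀ i, Tendsto (fun y : Fin m → ℂ => y i) (𝓝 s₀) (𝓝 (s₀ i)) := fun i =>
      (continuous_apply i).continuousAt
    have h1 : ∀ᶠ y : Fin m → ℂ in 𝓝 s₀, ∀ i j, i ≠ j → y i ≠ y j := by
      refine eventually_all.2 fun i => eventually_all.2 fun j => ?_
      by_cases hij : i = j
      · exact Eventually.of_forall fun _ h => absurd hij h
      · filter_upwards [((hi i).sub (hi j)).eventually_ne (sub_ne_zero.2 (h.inj.ne hij))] with y hy _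
        exact sub_ne_zero.1 hy
    filter_upwards [h1, eventually_all.2 fun i => (hi i).eventually (eventually_denom_ne (hV i)),
      eventually_all.2 fun k => eventually_all.2 fun i =>
        (hi i).eventually (eventually_denom_ne (hD k i))] with y h2 h3 h4
    exact ⟨fun i j hij => by_contra fun hne => h2 i j hne hij, h3, h4⟩
  have htend : Tendsto ψ (𝓝 τ₀) (𝓝 s₀) := by
    have := hcont.tendsto
    rwa [hψ0] at this
  refine ⟨ψ, hψ0, ?_, ?_⟩
  -- Nondegeneracy is an open condition: the Hessian depends continuously on the parameters along
  -- the implicit solution.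
  · have hdet : ∀ᶠ τ in 𝓝 τ₀, (hessian ħ (pencil dV dD τ) (ψ τ)).det ≠ 0 := by
      have hψi : ∀ i, Tendsto (fun τ => ψ τ i) (𝓝 τ₀) (𝓝 (s₀ i)) := fun i =>
        ((continuous_apply i).tendsto _).comp htend
      have hτ : ∀ k, Tendsto (fun τ : Fin q → ℂ => τ k) (𝓝 τ₀) (𝓝 (τ₀ k)) := fun k =>
        (continuous_apply k).continuousAt
      have hdv : ∀ (f : RatFunc ℂ) i, f.denom.eval (s₀ i) ≠ 0 →
          Tendsto (fun τ => deriv (val f) (ψ τ i)) (𝓝 τ₀) (𝓝 (deriv (val f) (s₀ i))) :=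
        fun f i hf => ((analyticAt_val hf).deriv.continuousAt.tendsto).comp (hψi i)
      have hT : Tendsto (fun τ => hessian ħ (pencil dV dD τ) (ψ τ)) (𝓝 τ₀)
          (𝓝 (hessian ħ (pencil dV dD τ₀) s₀)) := by
        refine tendsto_pi_nhds.2 fun i => tendsto_pi_nhds.2 fun j => ?_
        simp only [hessian, Matrix.of_apply]
        split_ifs with hij
        · have h1 : Tendsto (fun τ => (deriv (val dV) (ψ τ i) +
              ∑ k, τ k * deriv (val (dD k)) (ψ τ i)) / ħ +
              2 * ∑ k ∈ Finset.univ.erase i, 1 / (ψ τ i - ψ τ k) ^ 2) (𝓝 τ₀)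
              (𝓝 ((deriv (val dV) (s₀ i) + ∑ k, τ₀ k * deriv (val (dD k)) (s₀ i)) / ħ +
              2 * ∑ k ∈ Finset.univ.erase i, 1 / (s₀ i - s₀ k) ^ 2)) := by
            refine (((hdv _ i (hV i)).add (tendsto_finsetSum _ fun k _ =>
              (hτ k).mul (hdv _ i (hD k i)))).div_const _).add
              (tendsto_const_nhds.mul (tendsto_finsetSum _ fun k hk => ?_))
            exact tendsto_const_nhds.div (((hψi i).sub (hψi k)).pow 2)
              (pow_ne_zero _ (sub_ne_zero.2 (h.inj.ne (Finset.ne_of_mem_erase hk).symm)))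
          rw [deriv_val_pencil (hV i) (fun k => hD k i)]
          refine h1.congr' ?_
          filter_upwards [htend.eventually hgood] with τ hτg
          rw [deriv_val_pencil (hτg.2.1 i) (fun k => hτg.2.2 k i)]
        · exact tendsto_const_nhds.div (((hψi i).sub (hψi j)).pow 2)
            (pow_ne_zero _ (sub_ne_zero.2 (h.inj.ne hij)))
      exact ((Continuous.matrix_det continuous_id).continuousAt.tendsto.comp hT).eventually_ne
        h.det_ne
    have hdiff : ∀ᶠ τ in 𝓝 τ₀, DifferentiableAt ℂ ψ τ :=
      (hψc.eventually (by simp)).mono fun τ hτ => hτ.differentiableAt one_ne_zero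
    filter_upwards [hdiff, hdet, htend.eventually hgood,
      hc.eventually_apply_implicitFunction one_ne_zero hinv] with τ h1 h2 h3 h4
    refine ⟨h1, h3.1, fun i => (denom_pencil_ne (h3.2.1 i) (fun k => h3.2.2 k i) τ).1, ?_, h2⟩
    rw [hzero] at h4
    exact (betheMap_eq_zero_iff (p := (τ, ψ τ)) h3.2.1 h3.2.2).1 h4
  · have hg : ∀ᶠ p : (Fin q → ℂ) × (Fin m → ℂ) in 𝓝 (τ₀, s₀), Function.Injective p.2 ∧
        (∀ i, dV.denom.eval (p.2 i) ≠ 0) ∧ ∀ k i, (dD k).denom.eval (p.2 i) ≠ 0 :=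
      (continuous_snd.continuousAt (x := (τ₀, s₀))).eventually hgood
    filter_upwards [hg, hc.eventually_apply_eq_iff_implicitFunction one_ne_zero hinv] with p h1 h2 h3
    rw [hzero] at h2
    exact (h2.1 ((betheMap_eq_zero_iff h1.2.1 h1.2.2).2 h3.bethe)).symm

end Pencil

/-! ### The logarithm of the partition function. -/

section LogSeries

variable {A : Type*} [CommRing A] [Algebra ℂ A]

/-- The logarithm of a power series with constant coefficient `1`. -/
def logSeries (f : A⟦X⟧) : A⟦X⟧ :=
  PowerSeries.mk fun k => (k : ℂ)⁻¹ • coeff (k - 1) (derivative A f * invOfUnit f 1)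

lemma constantCoeff_logSeries (f : A⟦X⟧) : constantCoeff (logSeries f) = 0 := by
  rw [← coeff_zero_eq_constantCoeff_apply, logSeries, coeff_mk]
  simp

lemma derivative_logSeries (f : A⟦X⟧) :
    derivative A (logSeries f) = derivative A f * invOfUnit f 1 := by
  ext k
  rw [coeff_derivative, logSeries, coeff_mk, Nat.add_sub_cancel]
  have : ((k : A) + 1) = algebraMap ℂ A ((k + 1 : ℕ) : ℂ) := by simp
  rw [this, mul_comm, ← Algebra.smul_def, smul_smul,
    mul_inv_cancel₀ (Nat.cast_ne_zero.2 (Nat.succ_ne_zero k)), one_smul]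

lemma derivative_seriesDerivation (d : Derivation ℂ A A) (f : A⟦X⟧) :
    derivative A (seriesDerivation d f) = seriesDerivation d (derivative A f) := by
  ext k
  rw [coeff_derivative, coeff_seriesDerivation, coeff_seriesDerivation, coeff_derivative,
    Derivation.leibniz, map_add, Derivation.map_natCast, Derivation.map_one_eq_zero]
  simp [mul_comm]

/-- Both sides have no constant coefficient and the same derivative in `X`. -/
lemma seriesDerivation_logSeries (d : Derivation ℂ A A) {f : A⟦X⟧} (hf : constantCoeff f = 1) :
    seriesDerivation d (logSeries f) = seriesDerivation d f * invOfUnit f 1 := by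
  have h1 : f * invOfUnit f 1 = 1 := mul_invOfUnit f 1 hf
  set g := invOfUnit f 1 with hg
  have hfu : IsUnit f := IsUnit.of_mul_eq_one _ h1
  refine eq_of_derivative_eq ?_ ?_
  · have h2 := congrArg (seriesDerivation d) h1
    have h3 := congrArg (derivative A) h1
    rw [Derivation.leibniz, Derivation.map_one_eq_zero, smul_eq_mul, smul_eq_mul] at h2 h3
    rw [derivative_seriesDerivation, derivative_logSeries, Derivation.leibniz, Derivation.leibniz,
      derivative_seriesDerivation, ← hg]
    simp only [smul_eq_mul]
    refine hfu.mul_left_cancel ?_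
    linear_combination derivative A f * h2 - seriesDerivation d f * h3
  · rw [← coeff_zero_eq_constantCoeff_apply, ← coeff_zero_eq_constantCoeff_apply,
      coeff_seriesDerivation, coeff_zero_eq_constantCoeff_apply, constantCoeff_logSeries, coeff_mul]
    simp [coeff_seriesDerivation, hf]

lemma map_logSeries {B : Type*} [CommRing B] [Algebra ℂ B] (φ : A →ₐ[ℂ] B) {f : A⟦X⟧}
    (hf : constantCoeff f = 1) : PowerSeries.map (φ : A →+* B) (logSeries f) =
      logSeries (PowerSeries.map (φ : A →+* B) f) := by
  have h1 : PowerSeries.map (φ : A →+* B) (invOfUnit f 1) =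
      invOfUnit (PowerSeries.map (φ : A →+* B) f) 1 := by
    have h2 := congrArg (PowerSeries.map (φ : A →+* B)) (mul_invOfUnit f 1 hf)
    have h3 : constantCoeff (PowerSeries.map (φ : A →+* B) f) = 1 := by
      rw [← coeff_zero_eq_constantCoeff_apply, coeff_map, coeff_zero_eq_constantCoeff_apply, hf,
        map_one]
    have h4 := mul_invOfUnit _ 1 h3
    rw [map_mul, map_one] at h2
    exact (IsUnit.of_mul_eq_one _ h4).mul_left_cancel (h2.trans h4.symm)
  have h2 : PowerSeries.map (φ : A →+* B) (derivative A f) =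
      derivative B (PowerSeries.map (φ : A →+* B) f) := by
    ext k
    simp [coeff_derivative]
  ext k
  rw [coeff_map, logSeries, coeff_mk, logSeries, coeff_mk, ← h1, ← h2, ← map_mul, coeff_map]
  exact map_smul φ _ _

end LogSeries

namespace BetheData

lemma ext_of_eq {m : ℕ} {A : Type*} [CommRing A] {D D' : BetheData m A} (h1 : D.ħ = D'.ħ)
    (h2 : D.ħinv = D'.ħinv) (h3 : D.s = D'.s) (h4 : D.r = D'.r) (h5 : D.v = D'.v)
    (h6 : D.Γ = D'.Γ) : D = D' := by
  cases D
  cases D'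
  simp only at h1 h2 h3 h4 h5 h6
  subst h1 h2 h3 h4 h5 h6
  rfl

/-- The variation of the partition function, in terms of the one-point function. -/
lemma IsVariation.logPartitionFn {m : ℕ} {A : Type*} [CommRing A] [Algebra ℂ A]
    {D : BetheData m A} {d : Derivation ℂ A A} {w : Fin m → A⟦X⟧} (h : D.IsVariation d w)
    {ι : Type*} [DecidableEq ι] (φ : ι → Fin m → A⟦X⟧) :
    X ^ 2 * seriesDerivation d (logSeries D.partitionFn) = X ^ 2 * C (D.normShift d) -
      D.corr φ w ∅ + D.kap * C (∑ i, constantCoeff (w i)) := by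
  rw [seriesDerivation_logSeries d D.constantCoeff_partitionFn]
  have h1 := h.partitionFn
  have h2 := mul_invOfUnit D.partitionFn 1 D.constantCoeff_partitionFn
  have h3 : D.corr φ w ∅ = X * D.expect (D.insertion w) +
      D.kap * C (∑ i, constantCoeff (w i)) := by
    rw [BetheData.corr, conn_empty, stat_eq, map_add, map_smul, map_smul, expect_one, smul_eq_mul, smul_eq_mul,
      mul_one]
  rw [h3]
  linear_combination X * invOfUnit D.partitionFn 1 * h1 +
    X * (X * C (D.normShift d) - D.expect (D.insertion w)) * h2

end BetheData

/-! ### Derivatives of families through dual numbers. -/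

section Dual

variable {E : Type*} [NormedAddCommGroup E] [NormedSpace ℂ E]

/-- The algebra of functions that are differentiable at `p`. -/
def diffAlg (p : E) : Subalgebra ℂ (E → ℂ) where
  carrier := {f | DifferentiableAt ℂ f p}
  mul_mem' h1 h2 := DifferentiableAt.mul h1 h2
  add_mem' h1 h2 := DifferentiableAt.add h1 h2
  algebraMap_mem' c := differentiableAt_const c

/-- Evaluation at `τ`. -/
def evAlg (p τ : E) : diffAlg p →ₐ[ℂ] ℂ := (Pi.evalAlgHom ℂ (fun _ : E => ℂ) τ).comp (diffAlg p).val

lemma evAlg_apply (p τ : E) (f : diffAlg p) : evAlg p τ f = f.1 τ := rfl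

lemma diffAlg_ext {p : E} {f g : diffAlg p} (h : ∀ τ, evAlg p τ f = evAlg p τ g) : f = g :=
  Subtype.ext (funext h)

/-- The 1-jet at `p` in the direction `u`. -/
def dualAlg (p u : E) : diffAlg p →ₐ[ℂ] DualNumber ℂ where
  toFun f := TrivSqZeroExt.inl (f.1 p) + TrivSqZeroExt.inr (fderiv ℂ f.1 p u)
  map_one' := by
    ext <;> simp
  map_zero' := by
    ext <;> simp
  map_mul' f g := by
    have : fderiv ℂ ((f : E → ℂ) * (g : E → ℂ)) p = _ := fderiv_mul f.2 g.2
    ext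
    · simp
    · simp [this, mul_comm]
  map_add' f g := by
    have : fderiv ℂ ((f : E → ℂ) + (g : E → ℂ)) p = _ := fderiv_add f.2 g.2
    ext
    · simp
    · simp [this]
  commutes' c := by
    have : fderiv ℂ (algebraMap ℂ (E → ℂ) c) p = 0 :=
      fderiv_const_apply c
    ext
    · simp [TrivSqZeroExt.algebraMap_eq_inl]
    · simp [TrivSqZeroExt.algebraMap_eq_inl, this]

lemma fst_dualAlg (p u : E) (f : diffAlg p) : (dualAlg p u f).fst = f.1 p := by
  simp [dualAlg]

lemma snd_dualAlg (p u : E) (f : diffAlg p) : (dualAlg p u f).snd = fderiv ℂ f.1 p u := by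
  simp [dualAlg]

/-- The derivation `a + ε b ↦ ε b` of the dual numbers. -/
def epsDeriv : Derivation ℂ (DualNumber ℂ) (DualNumber ℂ) :=
  Derivation.mk' ((TrivSqZeroExt.inrHom ℂ ℂ).comp (TrivSqZeroExt.sndHom ℂ ℂ)) fun a b => by
    ext
    · simp
    · simp [mul_comm]

lemma fst_epsDeriv (a : DualNumber ℂ) : (epsDeriv a).fst = 0 := by simp [epsDeriv]

lemma snd_epsDeriv (a : DualNumber ℂ) : (epsDeriv a).snd = a.snd := by simp [epsDeriv]

/-- A family of power series whose coefficients are differentiable at `p`. -/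
def liftSeries {p : E} (f : E → ℂ⟦X⟧) (h : ∀ k, DifferentiableAt ℂ (fun τ => coeff k (f τ)) p) :
    (diffAlg p)⟦X⟧ := PowerSeries.mk fun k => ⟨fun τ => coeff k (f τ), h k⟩

lemma map_ev_liftSeries {p : E} (f : E → ℂ⟦X⟧)
    (h : ∀ k, DifferentiableAt ℂ (fun τ => coeff k (f τ)) p) (τ : E) :
    PowerSeries.map (evAlg p τ : diffAlg p →+* ℂ) (liftSeries f h) = f τ := by
  ext k
  rw [coeff_map, liftSeries, coeff_mk]
  rfl

lemma coe_coeff_liftSeries {p : E} (f : E → ℂ⟦X⟧)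
    (h : ∀ k, DifferentiableAt ℂ (fun τ => coeff k (f τ)) p) (k : ℕ) :
    (coeff k (liftSeries f h)).1 = fun τ => coeff k (f τ) := by
  rw [liftSeries, coeff_mk]

lemma ev_coeff_liftSeries {p : E} (f : E → ℂ⟦X⟧)
    (h : ∀ k, DifferentiableAt ℂ (fun τ => coeff k (f τ)) p) (k : ℕ) (τ : E) :
    evAlg p τ (coeff k (liftSeries f h)) = coeff k (f τ) := by
  rw [evAlg_apply, coe_coeff_liftSeries]

namespace BetheData

variable {m : ℕ}

/-- A differentiable family of solutions. -/
structure IsDiff (D : E → BetheData m ℂ) (p : E) : Prop where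
  ħ : DifferentiableAt ℂ (fun τ => (D τ).ħ) p
  ħinv : DifferentiableAt ℂ (fun τ => (D τ).ħinv) p
  s : ∀ i, DifferentiableAt ℂ (fun τ => (D τ).s i) p
  r : ∀ i j, DifferentiableAt ℂ (fun τ => (D τ).r i j) p
  v : ∀ i k, DifferentiableAt ℂ (fun τ => coeff k ((D τ).v i)) p
  Γ : ∀ i j, DifferentiableAt ℂ (fun τ => (D τ).Γ i j) p

variable {D : E → BetheData m ℂ} {p : E}

/-- A differentiable family of solutions as a solution over the algebra of differentiable
functions. -/
def IsDiff.lift (h : IsDiff D p) : BetheData m (diffAlg p) where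
  ħ := ⟨_, h.ħ⟩
  ħinv := ⟨_, h.ħinv⟩
  s i := ⟨_, h.s i⟩
  r i j := ⟨_, h.r i j⟩
  v i := liftSeries (fun τ => (D τ).v i) (h.v i)
  Γ i j := ⟨_, h.Γ i j⟩
  mul_ħinv := diffAlg_ext fun τ => (D τ).mul_ħinv
  r_self i := diffAlg_ext fun τ => (D τ).r_self i
  r_mul i j hij := diffAlg_ext fun τ => (D τ).r_mul i j hij
  bethe i := diffAlg_ext fun τ => by
    have h1 := (D τ).bethe i
    rw [← coeff_zero_eq_constantCoeff_apply] at h1 ⊢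
    rw [map_mul, map_mul, map_sum, _root_.map_ofNat, ev_coeff_liftSeries]
    exact h1
  Γ_symm i j := diffAlg_ext fun τ => (D τ).Γ_symm i j
  hessian_mul i k := diffAlg_ext fun τ => by
    have h1 := (D τ).hessian_mul i k
    rw [map_sum]
    have h2 : evAlg p τ (if i = k then 1 else 0) = if i = k then 1 else 0 := by
      split_ifs <;> simp
    rw [h2, ← h1]
    refine Finset.sum_congr rfl fun j _ => ?_
    rw [map_mul]
    congr 1
    rw [dataHessian, dataHessian]
    split_ifs
    · rw [map_add, map_mul, map_mul, map_mul, map_sum, map_pow, _root_.map_ofNat]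
      simp only [map_pow, ev_coeff_liftSeries]
      rfl
    · rw [map_mul, map_mul, map_pow, map_pow, map_neg, _root_.map_ofNat]
      rfl

lemma IsDiff.map_ev (h : IsDiff D p) (τ : E) : h.lift.map (evAlg p τ : diffAlg p →+* ℂ) = D τ :=
  ext_of_eq rfl rfl rfl rfl (funext fun i => map_ev_liftSeries _ (h.v i) τ) rfl

lemma IsDiff.map_fst (h : IsDiff D p) (u : E) : (h.lift.map
    (dualAlg p u : diffAlg p →+* DualNumber ℂ)).map
      (TrivSqZeroExt.fstHom ℂ ℂ ℂ : DualNumber ℂ →+* ℂ) = D p := by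
  have h1 : ∀ f : diffAlg p, TrivSqZeroExt.fstHom ℂ ℂ ℂ (dualAlg p u f) = f.1 p := fst_dualAlg p u
  refine ext_of_eq (h1 _) (h1 _) (funext fun i => h1 _) (funext fun i => funext fun j => h1 _)
    (funext fun i => ?_) (funext fun i => funext fun j => h1 _)
  ext k
  simp only [map, coeff_map]
  exact (h1 _).trans (congrFun (coe_coeff_liftSeries _ (h.v i) k) p)

end BetheData

end Dual

namespace BetheData

variable {E : Type*} [NormedAddCommGroup E] [NormedSpace ℂ E] {m : ℕ}

lemma differentiableAt_coe {p : E} (f : diffAlg p) : DifferentiableAt ℂ f.1 p := f.2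

lemma corr_empty_congr {A : Type*} [CommRing A] [Algebra ℂ A] (D : BetheData m A) {ι ι' : Type*}
    [DecidableEq ι] [DecidableEq ι'] (φ : ι → Fin m → A⟦X⟧) (φ' : ι' → Fin m → A⟦X⟧)
    (ψ : Fin m → A⟦X⟧) : D.corr φ ψ ∅ = D.corr φ' ψ ∅ := by
  rw [corr, corr, conn_empty, conn_empty]

/-- The derivative of the family `D` at `p` in the direction `u` is caused by a variation of the
potential with derivatives `δ`, at constant `ħ`. -/
structure IsVarFamily (D : E → BetheData m ℂ) (p u : E) (δ : Fin m → ℂ⟦X⟧) : Prop where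
  isDiff : IsDiff D p
  fderiv_ħ : fderiv ℂ (fun τ => (D τ).ħ) p u = 0
  fderiv_v : ∀ i k, fderiv ℂ (fun τ => coeff k ((D τ).v i)) p u =
    coeff (k + 1) ((D p).v i) * (k + 1) * fderiv ℂ (fun τ => (D τ).s i) p u +
      coeff (k + 1) (δ i) * (k + 1)

/-- The `f τ i` are the Taylor series at the moving points of a fixed function. -/
structure IsConstFamily (D : E → BetheData m ℂ) (p u : E) (f : E → Fin m → ℂ⟦X⟧) : Prop where
  diff : ∀ i k, DifferentiableAt ℂ (fun τ => coeff k (f τ i)) p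
  fderiv_coeff : ∀ i k, fderiv ℂ (fun τ => coeff k (f τ i)) p u =
    coeff (k + 1) (f p i) * (k + 1) * fderiv ℂ (fun τ => (D τ).s i) p u

variable {D : E → BetheData m ℂ} {p u : E} {δ : Fin m → ℂ⟦X⟧}

/-- The 1-jet of the family `D`. -/
def IsVarFamily.dual (h : IsVarFamily D p u δ) : BetheData m (DualNumber ℂ) :=
  h.isDiff.lift.map (dualAlg p u : diffAlg p →+* DualNumber ℂ)

/-- The variation of the potential. -/
def epsSeries (δ : Fin m → ℂ⟦X⟧) (i : Fin m) : (DualNumber ℂ)⟦X⟧ :=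
  C DualNumber.eps * PowerSeries.map (algebraMap ℂ (DualNumber ℂ)) (δ i)

lemma IsVarFamily.isVariation (h : IsVarFamily D p u δ) :
    h.dual.IsVariation epsDeriv (epsSeries δ) where
  d_ħ := by
    refine TrivSqZeroExt.ext (fst_epsDeriv _) ?_
    rw [snd_epsDeriv, TrivSqZeroExt.snd_zero]
    exact (snd_dualAlg p u _).trans h.fderiv_ħ
  d_v i := by
    have h1 : ∀ k, (coeff k (h.dual.v i)).fst = coeff k ((D p).v i) := by
      intro k
      rw [dual, map, coeff_map]
      exact (fst_dualAlg p u _).trans (congrFun (coe_coeff_liftSeries _ (h.isDiff.v i) k) p)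
    have h2 : ∀ k, (coeff k (h.dual.v i)).snd = fderiv ℂ (fun τ => coeff k ((D τ).v i)) p u := by
      intro k
      rw [dual, map, coeff_map]
      refine (snd_dualAlg p u _).trans ?_
      rw [IsDiff.lift, coe_coeff_liftSeries]
    have h3 : (h.dual.s i).snd = fderiv ℂ (fun τ => (D τ).s i) p u := snd_dualAlg p u _
    ext1 k
    rw [coeff_seriesDerivation, map_add, coeff_mul_C, coeff_derivative, coeff_derivative, epsSeries,
      coeff_C_mul, coeff_map, TrivSqZeroExt.algebraMap_eq_inl]
    refine TrivSqZeroExt.ext ?_ ?_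
    · simp [fst_epsDeriv]
    · rw [snd_epsDeriv, h2, h.fderiv_v]
      simp [fst_epsDeriv, snd_epsDeriv, h1, h3]

/-- The 1-jet of a family of power series. -/
def IsConstFamily.dual {f : E → Fin m → ℂ⟦X⟧} (hf : IsConstFamily D p u f) (i : Fin m) :
    (DualNumber ℂ)⟦X⟧ :=
  PowerSeries.map (dualAlg p u : diffAlg p →+* DualNumber ℂ)
    (liftSeries (fun τ => f τ i) (hf.diff i))

lemma IsConstFamily.isConstStat (h : IsVarFamily D p u δ) {f : E → Fin m → ℂ⟦X⟧}
    (hf : IsConstFamily D p u f) : h.dual.IsConstStat epsDeriv hf.dual := by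
  intro i
  have h1 : ∀ k, (coeff k (hf.dual i)).fst = coeff k (f p i) := by
    intro k
    rw [dual, coeff_map]
    exact (fst_dualAlg p u _).trans (congrFun (coe_coeff_liftSeries _ (hf.diff i) k) p)
  have h2 : ∀ k, (coeff k (hf.dual i)).snd = fderiv ℂ (fun τ => coeff k (f τ i)) p u := by
    intro k
    rw [dual, coeff_map]
    refine (snd_dualAlg p u _).trans ?_
    rw [coe_coeff_liftSeries]
  have h3 : (h.dual.s i).snd = fderiv ℂ (fun τ => (D τ).s i) p u := snd_dualAlg p u _
  ext1 k
  rw [coeff_seriesDerivation, coeff_C_mul, coeff_derivative]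
  refine TrivSqZeroExt.ext ?_ ?_
  · simp [fst_epsDeriv]
  · rw [snd_epsDeriv, h2, hf.fderiv_coeff]
    simp [fst_epsDeriv, snd_epsDeriv, h1, h3]
    ring

lemma IsConstFamily.map_fst_dual {f : E → Fin m → ℂ⟦X⟧} (hf : IsConstFamily D p u f) (i : Fin m) :
    PowerSeries.map (TrivSqZeroExt.fstHom ℂ ℂ ℂ : DualNumber ℂ →+* ℂ) (hf.dual i) = f p i := by
  ext k
  rw [coeff_map, dual, coeff_map]
  exact (fst_dualAlg p u _).trans (congrFun (coe_coeff_liftSeries _ (hf.diff i) k) p)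

lemma map_fst_algebraMap (f : ℂ⟦X⟧) :
    PowerSeries.map (TrivSqZeroExt.fstHom ℂ ℂ ℂ : DualNumber ℂ →+* ℂ)
      (PowerSeries.map (algebraMap ℂ (DualNumber ℂ)) f) = f := by
  ext k
  rw [coeff_map, coeff_map]
  rfl

lemma snd_eps_mul (a : DualNumber ℂ) : (DualNumber.eps * a).snd = a.fst := by simp

variable {ι : Type*} [DecidableEq ι]

lemma IsVarFamily.fst_corr (h : IsVarFamily D p u δ) {φ : ι → E → Fin m → ℂ⟦X⟧}
    (hφ : ∀ j, IsConstFamily D p u (φ j)) (J : Finset ι) (b : ℕ) :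
    (coeff b (h.dual.corr (fun j => (hφ j).dual)
      (fun i => PowerSeries.map (algebraMap ℂ (DualNumber ℂ)) (δ i)) J)).fst =
      coeff b ((D p).corr (fun j => φ j p) δ J) := by
  have h1 := h.dual.map_corr (TrivSqZeroExt.fstHom ℂ ℂ ℂ) (fun j => (hφ j).dual)
    (fun i => PowerSeries.map (algebraMap ℂ (DualNumber ℂ)) (δ i)) J
  have h2 : h.dual.map (TrivSqZeroExt.fstHom ℂ ℂ ℂ : DualNumber ℂ →+* ℂ) = D p :=
    h.isDiff.map_fst u
  rw [h2] at h1
  simp only [IsConstFamily.map_fst_dual, map_fst_algebraMap] at h1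
  rw [← h1, coeff_map]
  rfl

-- The correlator is formed once over the algebra of functions differentiable at `p`; evaluation at
-- each `τ` is a ring homomorphism and gives the correlator of `D τ`. Differentiability is thus
-- built into the ring.
omit [DecidableEq ι] in
lemma IsDiff.differentiableAt_corr [DecidableEq ι] (h : IsDiff D p) {φ : ι → E → Fin m → ℂ⟦X⟧}
    (hφ : ∀ j i k, DifferentiableAt ℂ (fun τ => coeff k (φ j τ i)) p)
    {ψ : E → Fin m → ℂ⟦X⟧} (hψ : ∀ i k, DifferentiableAt ℂ (fun τ => coeff k (ψ τ i)) p)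
    (J : Finset ι) (b : ℕ) :
    (coeff b (h.lift.corr (fun j i => liftSeries (fun τ => φ j τ i) (hφ j i))
      (fun i => liftSeries (fun τ => ψ τ i) (hψ i)) J)).1 =
        (fun τ => coeff b ((D τ).corr (fun j => φ j τ) (ψ τ) J)) ∧
    DifferentiableAt ℂ (fun τ => coeff b ((D τ).corr (fun j => φ j τ) (ψ τ) J)) p := by
  have h1 : (coeff b (h.lift.corr (fun j i => liftSeries (fun τ => φ j τ i) (hφ j i))
      (fun i => liftSeries (fun τ => ψ τ i) (hψ i)) J)).1 =
      fun τ => coeff b ((D τ).corr (fun j => φ j τ) (ψ τ) J) := by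
    funext τ
    have h2 := h.lift.map_corr (evAlg p τ) (fun j i => liftSeries (fun τ => φ j τ i) (hφ j i))
      (fun i => liftSeries (fun τ => ψ τ i) (hψ i)) J
    rw [h.map_ev] at h2
    simp only [map_ev_liftSeries] at h2
    rw [← h2, coeff_map]
    rfl
  exact ⟨h1, h1 ▸ differentiableAt_coe _⟩

/-- The variation of the correlators of a differentiable family. -/
theorem IsVarFamily.fderiv_corr (h : IsVarFamily D p u δ) {φ : ι → E → Fin m → ℂ⟦X⟧}
    (hφ : ∀ j, IsConstFamily D p u (φ j)) {a : ι} {J : Finset ι} (ha : a ∉ J) (b : ℕ) :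
    fderiv ℂ (fun τ => coeff b ((D τ).corr (fun j => φ j τ) (φ a τ) J)) p u =
      -coeff (b + 1) ((D p).corr (fun j => φ j p) δ (insert a J)) := by
  have h1 := (h.isDiff.differentiableAt_corr (fun j => (hφ j).diff) (hφ a).diff J b).1
  have h2 := h.isDiff.lift.map_corr (dualAlg p u)
    (fun j i => liftSeries (fun τ => φ j τ i) ((hφ j).diff i))
    (fun i => liftSeries (fun τ => φ a τ i) ((hφ a).diff i)) J
  -- The extra label `none` stands for the variation of the potential.
  set Φ : Option ι → Fin m → (DualNumber ℂ)⟦X⟧ := fun o =>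
    Option.elim o (epsSeries δ) fun j => (hφ j).dual with hΦ
  have hcomp : Φ ∘ Function.Embedding.some = fun j => (hφ j).dual := rfl
  have h3 := (h.isVariation).corr Φ (o := none) (J := J.map Function.Embedding.some)
    (ψ := Φ (some a)) (by simp) rfl
    (fun j hj => by
      obtain ⟨j, -, rfl⟩ := Finset.mem_map.1 hj
      exact (hφ j).isConstStat h) ((hφ a).isConstStat h)
  -- The variation is moved to the leading position, where the correlator is linear, so that the
  -- factor `ε` can be extracted and the rest evaluated at `ε = 0`.
  rw [h.dual.corr_swap (a := some a) (b := none) Φ (by simpa using ha) (by simp)] at h3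
  have hins : insert (some a) (J.map Function.Embedding.some) =
      (insert a J).map Function.Embedding.some := by
    rw [Finset.map_insert]; rfl
  rw [hins, h.dual.corr_map, h.dual.corr_map, hcomp] at h3
  have h4 : h.dual.corr (fun j => (hφ j).dual) (Φ none) (insert a J) = C DualNumber.eps *
      h.dual.corr (fun j => (hφ j).dual)
        (fun i => PowerSeries.map (algebraMap ℂ (DualNumber ℂ)) (δ i)) (insert a J) :=
    h.dual.corr_C_mul _ _ _ _
  rw [h4] at h3
  have h5 := congrArg (fun f => (coeff (b + 1) f).snd) h3
  simp only [coeff_succ_X_mul, coeff_seriesDerivation, snd_epsDeriv, map_neg, coeff_C_mul,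
    TrivSqZeroExt.snd_neg, snd_eps_mul] at h5
  rw [h.fst_corr hφ] at h5
  rw [← h5, ← h1, ← snd_dualAlg]
  have h6 := congrArg (coeff b) h2
  rw [coeff_map] at h6
  exact congrArg TrivSqZeroExt.snd h6

/-- The partition function of a differentiable family. -/
lemma IsDiff.differentiableAt_logPartitionFn (h : IsDiff D p) (b : ℕ) :
    (coeff b (logSeries h.lift.partitionFn)).1 =
      (fun τ => coeff b (logSeries (D τ).partitionFn)) ∧
    DifferentiableAt ℂ (fun τ => coeff b (logSeries (D τ).partitionFn)) p := by
  have h1 : (coeff b (logSeries h.lift.partitionFn)).1 =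
      fun τ => coeff b (logSeries (D τ).partitionFn) := by
    funext τ
    have h2 := map_logSeries (evAlg p τ) h.lift.constantCoeff_partitionFn
    rw [h.lift.map_partitionFn, h.map_ev] at h2
    rw [← h2, coeff_map]
    rfl
  exact ⟨h1, h1 ▸ differentiableAt_coe _⟩

/-- The variation of the partition function of a differentiable family. -/
theorem IsVarFamily.fderiv_logPartitionFn (h : IsVarFamily D p u δ) (φ : ι → Fin m → ℂ⟦X⟧) (b : ℕ) :
    fderiv ℂ (fun τ => coeff b (logSeries (D τ).partitionFn)) p u =
      (if b = 0 then (h.dual.normShift epsDeriv).snd else 0) -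
        coeff (b + 2) ((D p).corr φ δ ∅) +
        coeff (b + 2) (D p).kap * ∑ i, constantCoeff (δ i) := by
  have h1 := (h.isDiff.differentiableAt_logPartitionFn b).1
  have h2 := map_logSeries (dualAlg p u) h.isDiff.lift.constantCoeff_partitionFn
  rw [h.isDiff.lift.map_partitionFn] at h2
  -- The one-point function has no insertions, so any index type may be used; the empty one needs no
  -- lifts of `φ`.
  have hφ : ∀ j : Empty, IsConstFamily D p u (j.elim : E → Fin m → ℂ⟦X⟧) := fun j => j.elim
  have h3 := h.isVariation.logPartitionFn (fun j => (hφ j).dual)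
  have h4 : h.dual.corr (fun j => (hφ j).dual) (epsSeries δ) ∅ = C DualNumber.eps *
      h.dual.corr (fun j => (hφ j).dual)
        (fun i => PowerSeries.map (algebraMap ℂ (DualNumber ℂ)) (δ i)) ∅ :=
    h.dual.corr_C_mul _ _ _ _
  have h5 : ∑ i, constantCoeff (epsSeries δ i) =
      DualNumber.eps * algebraMap ℂ (DualNumber ℂ) (∑ i, constantCoeff (δ i)) := by
    simp only [epsSeries, map_mul, map_sum, Finset.mul_sum, constantCoeff_C]
    refine Finset.sum_congr rfl fun i _ => ?_
    rw [← coeff_zero_eq_constantCoeff_apply, coeff_map, coeff_zero_eq_constantCoeff_apply]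
  rw [h4, h5] at h3
  have h6 := congrArg (fun f => (coeff (b + 2) f).snd) h3
  have hk : (coeff (b + 2) h.dual.kap).fst = coeff (b + 2) (D p).kap := by
    have h7 : PowerSeries.map (TrivSqZeroExt.fstHom ℂ ℂ ℂ : DualNumber ℂ →+* ℂ) h.dual.kap =
        (D p).kap := by
      rw [kap, map_kappa, kap, ← h.isDiff.map_fst u]
      rfl
    rw [← h7, coeff_map]
    rfl
  have hcorr := h.fst_corr hφ ∅ (b + 2)
  rw [(D p).corr_empty_congr _ φ] at hcorr
  simp only [map_add, map_sub, coeff_X_pow_mul, coeff_seriesDerivation, snd_epsDeriv, coeff_C_mul,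
    coeff_mul_C, TrivSqZeroExt.snd_add, TrivSqZeroExt.snd_sub, snd_eps_mul, hcorr] at h6
  have h8 : (coeff (b + 2) h.dual.kap * (DualNumber.eps *
      algebraMap ℂ (DualNumber ℂ) (∑ i, constantCoeff (δ i)))).snd =
      coeff (b + 2) (D p).kap * ∑ i, constantCoeff (δ i) := by
    rw [mul_left_comm, snd_eps_mul, TrivSqZeroExt.fst_mul, hk]
    rfl
  rw [h8] at h6
  have h9 : (coeff (b + 2) (X ^ 2 : (DualNumber ℂ)⟦X⟧) * h.dual.normShift epsDeriv).snd =
      if b = 0 then (h.dual.normShift epsDeriv).snd else 0 := by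
    rw [coeff_X_pow]
    by_cases hb : b = 0
    · simp [hb]
    · simp [hb]
  rw [h9] at h6
  rw [← h6, ← h1, ← snd_dualAlg]
  have h10 := congrArg (coeff b) h2
  rw [coeff_map] at h10
  exact congrArg TrivSqZeroExt.snd h10

lemma map_hess {A B : Type*} [CommRing A] [CommRing B] (D : BetheData m A) (φ : A →+* B)
    (i j : Fin m) : (D.map φ).hess i j = φ (D.hess i j) := by
  have h2 : φ 2 = 2 := _root_.map_ofNat φ 2
  rw [hess, hess, dataHessian, dataHessian]
  split_ifs
  · simp [map, h2]
  · simp [map, h2]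

lemma IsVarFamily.snd_normShift (h : IsVarFamily D p u δ) :
    (h.dual.normShift epsDeriv).snd =
      1 / 2 * ∑ i, ∑ j, fderiv ℂ (fun τ => (D τ).hess i j) p u * (D p).Γ i j -
      2 * ∑ i, fderiv ℂ (fun τ => (D τ).s i) p u * ∑ j, (D p).r i j := by
  have h1 : ∀ i j, (h.dual.hess i j).snd = fderiv ℂ (fun τ => (D τ).hess i j) p u := by
    intro i j
    have h2 : (h.isDiff.lift.hess i j).1 = fun τ => (D τ).hess i j := by
      funext τ
      rw [← evAlg_apply]
      refine (map_hess h.isDiff.lift (evAlg p τ : diffAlg p →+* ℂ) i j).symm.trans ?_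
      rw [h.isDiff.map_ev]
    rw [← h2, ← snd_dualAlg]
    exact congrArg TrivSqZeroExt.snd (map_hess h.isDiff.lift _ i j)
  have hΓ : ∀ i j, (h.dual.Γ i j).fst = (D p).Γ i j := fun i j => fst_dualAlg p u _
  have hr : ∀ i j, (h.dual.r i j).fst = (D p).r i j := fun i j => fst_dualAlg p u _
  have hs : ∀ i, (h.dual.s i).snd = fderiv ℂ (fun τ => (D τ).s i) p u := fun i => snd_dualAlg p u _
  have hsum : ∀ (f : Fin m → DualNumber ℂ), (∑ i, f i).snd = ∑ i, (f i).snd := fun f =>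
    map_sum (TrivSqZeroExt.sndHom ℂ ℂ) f Finset.univ
  have hsum' : ∀ (f : Fin m → DualNumber ℂ), (∑ i, f i).fst = ∑ i, (f i).fst := fun f =>
    map_sum (TrivSqZeroExt.fstHom ℂ ℂ ℂ) f Finset.univ
  have h3 : (h.dual.halfTrace epsDeriv).snd =
      1 / 2 * ∑ i, ∑ j, fderiv ℂ (fun τ => (D τ).hess i j) p u * (D p).Γ i j := by
    rw [halfTrace, TrivSqZeroExt.snd_smul, smul_eq_mul, hsum]
    simp only [hsum]
    simp [fst_epsDeriv, snd_epsDeriv, h1, hΓ, mul_comm]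
  have h4 : (h.dual.shiftConst epsDeriv).snd =
      ∑ i, fderiv ℂ (fun τ => (D τ).s i) p u * ∑ j, (D p).r i j := by
    rw [shiftConst, hsum]
    simp [fst_epsDeriv, snd_epsDeriv, hs, hsum', hr, mul_comm]
  have h5 : (2 : DualNumber ℂ) * h.dual.shiftConst epsDeriv =
      (2 : ℂ) • h.dual.shiftConst epsDeriv := by
    rw [Algebra.smul_def, _root_.map_ofNat]
  rw [normShift, h5, TrivSqZeroExt.snd_sub, TrivSqZeroExt.snd_smul, h3, h4, smul_eq_mul]

end BetheData

/-! ### Differentiability of the algebraic data along a family of solutions. -/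

lemma hasDerivAt_coeff_taylor {f : ℂ → ℂ} {c : ℂ} (hf : AnalyticAt ℂ f c) (k : ℕ) :
    HasDerivAt (fun c => coeff k (taylor f c)) (coeff (k + 1) (taylor f c) * (k + 1)) c := by
  simp only [coeff_taylor]
  have h1 : DifferentiableAt ℂ (iteratedDeriv k f) c := by
    rw [iteratedDeriv_eq_iterate]
    exact (hf.iterated_deriv k).differentiableAt
  have h2 := h1.hasDerivAt.div_const ((k.factorial : ℕ) : ℂ)
  refine h2.congr_deriv ?_
  rw [← iteratedDeriv_succ, Nat.factorial_succ]
  have h3 : ((k.factorial : ℕ) : ℂ) ≠ 0 := Nat.cast_ne_zero.2 k.factorial_ne_zero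
  have h4 : ((k : ℂ) + 1) ≠ 0 := Nat.cast_add_one_ne_zero k
  push_cast
  field_simp

lemma differentiableAt_det {E : Type*} [NormedAddCommGroup E] [NormedSpace ℂ E] {n : Type*}
    [Fintype n] [DecidableEq n] {M : E → Matrix n n ℂ} {p : E}
    (hM : ∀ i j, DifferentiableAt ℂ (fun τ => M τ i j) p) :
    DifferentiableAt ℂ (fun τ => (M τ).det) p := by
  simp only [Matrix.det_apply]
  refine DifferentiableAt.fun_sum fun σ _ => DifferentiableAt.const_smul ?_ _
  have h : ∀ t : Finset n, DifferentiableAt ℂ (fun τ => ∏ i ∈ t, M τ (σ i) i) p := by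
    intro t
    induction t using Finset.induction_on with
    | empty => simp
    | insert a t ha ih =>
      simp only [Finset.prod_insert ha]
      exact (hM _ _).fun_mul ih
  exact h _

lemma differentiableAt_matrix_inv {E : Type*} [NormedAddCommGroup E] [NormedSpace ℂ E] {n : Type*}
    [Fintype n] [DecidableEq n] {M : E → Matrix n n ℂ} {p : E}
    (hM : ∀ i j, DifferentiableAt ℂ (fun τ => M τ i j) p) (hdet : (M p).det ≠ 0) (i j : n) :
    DifferentiableAt ℂ (fun τ => (M τ)⁻¹ i j) p := by
  have h1 : (fun τ => (M τ)⁻¹ i j) =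
      fun τ => ((M τ).det)⁻¹ * ((M τ).updateRow j (Pi.single i 1)).det := by
    funext τ
    rw [Matrix.inv_def, Ring.inverse_eq_inv', Matrix.smul_apply, Matrix.adjugate_apply, smul_eq_mul]
  rw [h1]
  refine ((differentiableAt_det hM).inv hdet).mul (differentiableAt_det fun k l => ?_)
  simp only [Matrix.updateRow_apply]
  split_ifs
  · exact differentiableAt_const _
  · exact hM k l

section Family

variable {q m : ℕ} {dV : RatFunc ℂ} {dD : Fin q → RatFunc ℂ} {ħ : ℂ} {p : Fin q → ℂ}
  {s : (Fin q → ℂ) → Fin m → ℂ}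

open Classical in
/-- The data of a family of solutions of the Bethe equations. -/
def dataFamily (hp : IsBethe ħ (pencil dV dD p) (s p)) (hħ : ħ ≠ 0) (τ : Fin q → ℂ) :
    BetheData m ℂ :=
  -- The default value is irrelevant: a family solves the equations near `p`, and only germs at `p`
  -- are differentiated.
  if h : IsBethe ħ (pencil dV dD τ) (s τ) then h.data hħ else hp.data hħ

lemma dataFamily_eq (hp : IsBethe ħ (pencil dV dD p) (s p)) (hħ : ħ ≠ 0) {τ : Fin q → ℂ}
    (h : IsBethe ħ (pencil dV dD τ) (s τ)) : dataFamily hp hħ τ = h.data hħ := dif_pos h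

/-- A family of nondegenerate solutions of the Bethe equations that is differentiable at `p`. -/
structure IsBetheFamily (ħ : ℂ) (dV : RatFunc ℂ) (dD : Fin q → RatFunc ℂ)
    (s : (Fin q → ℂ) → Fin m → ℂ) (p : Fin q → ℂ) : Prop where
  diff : DifferentiableAt ℂ s p
  bethe : ∀ᶠ τ in 𝓝 p, IsBethe ħ (pencil dV dD τ) (s τ)
  denom_ne : ∀ i, dV.denom.eval (s p i) ≠ 0
  denom_ne' : ∀ k i, (dD k).denom.eval (s p i) ≠ 0

namespace IsBetheFamily

variable (h : IsBetheFamily ħ dV dD s p) (hp : IsBethe ħ (pencil dV dD p) (s p)) (hħ : ħ ≠ 0)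

include h

lemma differentiableAt_apply (i : Fin m) : DifferentiableAt ℂ (fun τ => s τ i) p :=
  differentiableAt_pi.1 h.diff i

lemma differentiableAt_coeff_taylor {f : ℂ → ℂ} {i : Fin m} (hf : AnalyticAt ℂ f (s p i)) (k : ℕ) :
    HasFDerivAt (fun τ => coeff k (taylor f (s τ i)))
      ((coeff (k + 1) (taylor f (s p i)) * (k + 1)) • fderiv ℂ (fun τ => s τ i) p) p :=
  HasDerivAt.comp_hasFDerivAt (h₂ := fun c => coeff k (taylor f c)) p
    (hasDerivAt_coeff_taylor hf k) (h.differentiableAt_apply i).hasFDerivAt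

lemma eventually_denom_ne (i : Fin m) : ∀ᶠ τ in 𝓝 p, dV.denom.eval (s τ i) ≠ 0 ∧
    ∀ k, (dD k).denom.eval (s τ i) ≠ 0 := by
  have hc := (h.differentiableAt_apply i).continuousAt
  filter_upwards [hc.eventually (BetheRecursion.eventually_denom_ne (h.denom_ne i)),
    eventually_all.2 fun k => hc.eventually (BetheRecursion.eventually_denom_ne (h.denom_ne' k i))]
    with τ h1 h2
  exact ⟨h1, h2⟩

omit h in
lemma taylor_val_pencil {c : ℂ} (h1 : dV.denom.eval c ≠ 0) (h2 : ∀ k, (dD k).denom.eval c ≠ 0)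
    (τ : Fin q → ℂ) (k : ℕ) : coeff k (taylor (val (pencil dV dD τ)) c) =
      coeff k (taylor (val dV) c) + ∑ l, τ l * coeff k (taylor (val (dD l)) c) := by
  have h4 : ∀ t : Finset (Fin q), AnalyticAt ℂ (fun z => ∑ l ∈ t, τ l * val (dD l) z) c := fun t =>
    Finset.analyticAt_fun_sum _ fun l _ => analyticAt_const.mul (analyticAt_val (h2 l))
  rw [taylor_congr (eventually_val_pencil h1 h2 τ), taylor_add (analyticAt_val h1) (h4 _), map_add]
  congr 1
  have h3 : ∀ t : Finset (Fin q), taylor (fun z => ∑ l ∈ t, τ l * val (dD l) z) c =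
      ∑ l ∈ t, C (τ l) * taylor (val (dD l)) c := by
    intro t
    induction t using Finset.induction_on with
    | empty => simpa using taylor_const 0 c
    | insert a t ha ih =>
      simp only [Finset.sum_insert ha]
      have h5 : AnalyticAt ℂ (fun z => τ a * val (dD a) z) c :=
        analyticAt_const.mul (analyticAt_val (h2 a))
      rw [taylor_add h5 (h4 t), ih, taylor_const_mul]
  rw [h3, map_sum]
  simp only [coeff_C_mul]

lemma hasFDerivAt_coeff_v (i : Fin m) (k : ℕ) :
    HasFDerivAt (fun τ => coeff k (taylor (val (pencil dV dD τ)) (s τ i)))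
      ((coeff (k + 1) (taylor (val (pencil dV dD p)) (s p i)) * (k + 1)) •
        fderiv ℂ (fun τ => s τ i) p +
        ∑ l, coeff k (taylor (val (dD l)) (s p i)) •
          (ContinuousLinearMap.proj l : (Fin q → ℂ) →L[ℂ] ℂ)) p := by
  have h1 : HasFDerivAt (fun τ : Fin q → ℂ => coeff k (taylor (val dV) (s τ i)) +
      ∑ l, τ l * coeff k (taylor (val (dD l)) (s τ i)))
      ((coeff (k + 1) (taylor (val dV) (s p i)) * (k + 1)) • fderiv ℂ (fun τ => s τ i) p +
        ∑ l, (p l • ((coeff (k + 1) (taylor (val (dD l)) (s p i)) * (k + 1)) •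
          fderiv ℂ (fun τ => s τ i) p) + coeff k (taylor (val (dD l)) (s p i)) •
          (ContinuousLinearMap.proj l : (Fin q → ℂ) →L[ℂ] ℂ))) p :=
    (h.differentiableAt_coeff_taylor (analyticAt_val (h.denom_ne i)) k).add
      (HasFDerivAt.fun_sum fun l _ => ((ContinuousLinearMap.proj l :
        (Fin q → ℂ) →L[ℂ] ℂ).hasFDerivAt.mul
          (h.differentiableAt_coeff_taylor (analyticAt_val (h.denom_ne' l i)) k)))
  refine (h1.congr_of_eventuallyEq ?_).congr_fderiv ?_
  · filter_upwards [h.eventually_denom_ne i] with τ hτ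
    exact taylor_val_pencil hτ.1 hτ.2 τ k
  · rw [taylor_val_pencil (h.denom_ne i) (fun l => h.denom_ne' l i), Finset.sum_add_distrib,
      ← add_assoc]
    congr 1
    ext u
    simp only [add_apply, sum_apply, smul_apply, smul_eq_mul, add_mul, Finset.sum_mul, mul_assoc]

lemma differentiableAt_div_sub_sq (c : ℂ) {i j : Fin m} (hij : s p i ≠ s p j) :
    DifferentiableAt ℂ (fun τ => c / (s τ i - s τ j) ^ 2) p := by
  have h1 := h.differentiableAt_apply i
  have h2 := h.differentiableAt_apply j
  have h3 : (s p i - s p j) ^ 2 ≠ 0 := pow_ne_zero _ (sub_ne_zero.2 hij)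
  fun_prop (disch := assumption)

lemma differentiableAt_hessian (i j : Fin m) :
    DifferentiableAt ℂ (fun τ => hessian ħ (pencil dV dD τ) (s τ) i j) p := by
  have hinj := h.bethe.self_of_nhds.inj
  simp only [hessian, Matrix.of_apply]
  split_ifs with hij
  · have h1 : DifferentiableAt ℂ (fun τ => deriv (val (pencil dV dD τ)) (s τ i)) p := by
      have := (h.hasFDerivAt_coeff_v i 1).differentiableAt
      simpa only [coeff_one_taylor] using this
    have h2 : ∀ k ∈ Finset.univ.erase i,
        DifferentiableAt ℂ (fun τ => 1 / (s τ i - s τ k) ^ 2) p := fun k hk =>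
      h.differentiableAt_div_sub_sq 1 (hinj.ne (Finset.ne_of_mem_erase hk).symm)
    have h3 : DifferentiableAt ℂ (fun τ => deriv (val (pencil dV dD τ)) (s τ i) / ħ) p := by
      simp only [div_eq_mul_inv]
      exact h1.mul_const ħ⁻¹
    exact h3.fun_add ((DifferentiableAt.fun_sum h2).const_mul 2)
  · exact h.differentiableAt_div_sub_sq (-2) (hinj.ne hij)

lemma eventuallyEq_dataFamily {F : BetheData m ℂ → ℂ} {f : (Fin q → ℂ) → ℂ}
    (hF : ∀ τ (hτ : IsBethe ħ (pencil dV dD τ) (s τ)), F (hτ.data hħ) = f τ) :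
    (fun τ => F (dataFamily hp hħ τ)) =ᶠ[𝓝 p] f := by
  filter_upwards [h.bethe] with τ hτ
  rw [dataFamily_eq hp hħ hτ, hF]

lemma isDiff : BetheData.IsDiff (dataFamily hp hħ) p where
  ħ := (differentiableAt_const ħ).congr_of_eventuallyEq
    (h.eventuallyEq_dataFamily hp hħ (F := BetheData.ħ) fun _ _ => rfl)
  ħinv := (differentiableAt_const ħ⁻¹).congr_of_eventuallyEq
    (h.eventuallyEq_dataFamily hp hħ (F := BetheData.ħinv) fun _ _ => rfl)
  s i := (h.differentiableAt_apply i).congr_of_eventuallyEq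
    (h.eventuallyEq_dataFamily hp hħ (F := fun D => D.s i) fun _ _ => rfl)
  r i j := by
    refine DifferentiableAt.congr_of_eventuallyEq ?_
      (h.eventuallyEq_dataFamily hp hħ (F := fun D => D.r i j) (f := fun τ => (s τ i - s τ j)⁻¹)
        fun _ _ => rfl)
    rcases eq_or_ne i j with rfl | hij
    · simp
    · exact ((h.differentiableAt_apply i).sub (h.differentiableAt_apply j)).inv
        (sub_ne_zero.2 (hp.inj.ne hij))
  v i k := (h.hasFDerivAt_coeff_v i k).differentiableAt.congr_of_eventuallyEq
    (h.eventuallyEq_dataFamily hp hħ (F := fun D => coeff k (D.v i)) fun _ _ => rfl)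
  Γ i j := by
    refine DifferentiableAt.congr_of_eventuallyEq ?_
      (h.eventuallyEq_dataFamily hp hħ (F := fun D => D.Γ i j)
        (f := fun τ => (ħ ^ 2)⁻¹ * matA ħ (pencil dV dD τ) (s τ) i j) fun _ _ => rfl)
    exact (differentiableAt_matrix_inv (h.differentiableAt_hessian) hp.det_ne i j).const_mul _

lemma isVarFamily (u : Fin q → ℂ) {δ : ℂ → ℂ}
    (hδ : ∀ i, ∀ᶠ z in 𝓝 (s p i), HasDerivAt δ (∑ l, u l * val (dD l) z) z) :
    BetheData.IsVarFamily (dataFamily hp hħ) p u fun i => taylor δ (s p i) where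
  isDiff := h.isDiff hp hħ
  fderiv_ħ := by
    rw [Filter.EventuallyEq.fderiv_eq
      (h.eventuallyEq_dataFamily hp hħ (F := BetheData.ħ) (f := fun _ => ħ) fun _ _ => rfl)]
    simp
  fderiv_v i k := by
    rw [Filter.EventuallyEq.fderiv_eq (h.eventuallyEq_dataFamily hp hħ
        (F := fun D => coeff k (D.v i)) (f := fun τ => coeff k (taylor (val (pencil dV dD τ)) (s τ i)))
        fun _ _ => rfl),
      Filter.EventuallyEq.fderiv_eq (h.eventuallyEq_dataFamily hp hħ
        (F := fun D => D.s i) (f := fun τ => s τ i) fun _ _ => rfl),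
      (h.hasFDerivAt_coeff_v i k).fderiv, dataFamily_eq hp hħ hp]
    have h1 : coeff (k + 1) (taylor δ (s p i)) * (k + 1) =
        ∑ l, u l * coeff k (taylor (val (dD l)) (s p i)) := by
      rw [← coeff_derivative, ← taylor_deriv, taylor_congr ((hδ i).mono fun z hz => hz.deriv)]
      have h2 := taylor_val_pencil (dV := 0) (c := s p i) (by simp) (fun k => h.denom_ne' k i) u k
      have h3 : ∀ᶠ z in 𝓝 (s p i), val (pencil 0 dD u) z = ∑ l, u l * val (dD l) z := by
        filter_upwards [eventually_val_pencil (dV := 0) (c := s p i) (by simp)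
          (fun k => h.denom_ne' k i) u] with z hz
        rw [hz]
        simp [val]
      rw [taylor_congr h3] at h2
      rw [h2]
      have h4 : val (0 : RatFunc ℂ) = fun _ => 0 := by funext z; simp [val]
      rw [h4, taylor_const]
      simp
    rw [h1]
    simp [IsBethe.data, mul_comm]

lemma isConstFamily {f : ℂ → ℂ} (hf : ∀ i, AnalyticAt ℂ f (s p i)) (u : Fin q → ℂ) :
    BetheData.IsConstFamily (dataFamily hp hħ) p u fun τ i => taylor f (s τ i) where
  diff i k := (h.differentiableAt_coeff_taylor (hf i) k).differentiableAt
  fderiv_coeff i k := by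
    rw [(h.differentiableAt_coeff_taylor (hf i) k).fderiv,
      Filter.EventuallyEq.fderiv_eq (h.eventuallyEq_dataFamily hp hħ
        (F := fun D => D.s i) (f := fun τ => s τ i) fun _ _ => rfl)]
    rfl

/-- The variation of the correlators of the linear statistics of fixed functions. -/
theorem hasFDerivAt_corr {ι : Type*} [DecidableEq ι] {f : ι → ℂ → ℂ}
    (hf : ∀ j i, AnalyticAt ℂ (f j) (s p i)) {a : ι} {J : Finset ι} (ha : a ∉ J) (b : ℕ) :
    DifferentiableAt ℂ (fun τ => coeff b ((dataFamily hp hħ τ).corr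
      (fun j i => taylor (f j) (s τ i)) (fun i => taylor (f a) (s τ i)) J)) p ∧
    ∀ (u : Fin q → ℂ) (δ : ℂ → ℂ),
      (∀ i, ∀ᶠ z in 𝓝 (s p i), HasDerivAt δ (∑ l, u l * val (dD l) z) z) →
      fderiv ℂ (fun τ => coeff b ((dataFamily hp hħ τ).corr
        (fun j i => taylor (f j) (s τ i)) (fun i => taylor (f a) (s τ i)) J)) p u =
      -coeff (b + 1) ((hp.data hħ).corr (fun j i => taylor (f j) (s p i))
        (fun i => taylor δ (s p i)) (insert a J)) := by
  refine ⟨((h.isDiff hp hħ).differentiableAt_corr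
    (fun j => (h.isConstFamily hp hħ (hf j) 0).diff) (h.isConstFamily hp hħ (hf a) 0).diff J b).2,
    fun u δ hδ => ?_⟩
  have h1 := (h.isVarFamily hp hħ u hδ).fderiv_corr
    (fun j => h.isConstFamily hp hħ (hf j) u) ha b
  rw [dataFamily_eq hp hħ hp] at h1
  exact h1

end IsBetheFamily

end Family

/-! ### The variation of the correlators. -/

section Family

variable {q m : ℕ} {dV : RatFunc ℂ} {dD : Fin q → RatFunc ℂ} {ħ : ℂ} {p : Fin q → ℂ}
  {s : (Fin q → ℂ) → Fin m → ℂ}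

/-- Continuity at `p` suffices: by the local uniqueness in `exists_family` the points coincide with
the differentiable implicit solution. -/
lemma eventually_isBetheFamily (hħ : ħ ≠ 0) (hs : ContinuousAt s p)
    (hb : ∀ᶠ τ in 𝓝 p, IsBethe ħ (pencil dV dD τ) (s τ)) (hV : ∀ i, dV.denom.eval (s p i) ≠ 0)
    (hD : ∀ k i, (dD k).denom.eval (s p i) ≠ 0) : ∀ᶠ τ in 𝓝 p, IsBetheFamily ħ dV dD s τ := by
  obtain ⟨ψ, -, h1, h2⟩ := hb.self_of_nhds.exists_family hħ hV hD
  have h3 : Tendsto (fun τ => (τ, s τ)) (𝓝 p) (𝓝 (p, s p)) := tendsto_id.prodMk_nhds hs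
  have hi : ∀ i, ContinuousAt (fun τ => s τ i) p := fun i => (continuous_apply i).continuousAt.comp hs
  have h4 : s =ᶠ[𝓝 p] ψ := by
    filter_upwards [h3.eventually h2, hb] with τ h5 h6
    exact h5 h6
  filter_upwards [h1, h4.eventually_nhds, hb.eventually_nhds,
    eventually_all.2 fun i => (hi i).eventually (eventually_denom_ne (hV i)),
    eventually_all.2 fun k => eventually_all.2 fun i => (hi i).eventually (eventually_denom_ne (hD k i))]
    with τ h5 h6 h7 h8 h9
  exact ⟨h5.1.congr_of_eventuallyEq h6, h7, h8, h9⟩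

lemma cauchyJet_eq_taylor {s : Fin m → ℂ} {z : ℂ} {i : Fin m} (hz : s i ≠ z) :
    cauchyJet s z i = taylor (fun u => -(u - z)⁻¹) (s i) := by
  have h := taylor_const_mul (-1) (f := fun u => (u - z)⁻¹) (c := s i)
  simp only [neg_mul, one_mul] at h
  rw [h, taylor_inv_sub hz, cauchyJet]
  simp

namespace IsBetheFamily

variable (h : IsBetheFamily ħ dV dD s p) {G K : (Fin q → ℂ) → ℂ → ℂ → ℂ}
  (hK : ∀ᶠ τ in 𝓝 p, IsKernelSystem ħ (pencil dV dD τ) (s τ) (G τ) (K τ)) (hħ : ħ ≠ 0) (g : ℕ)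
include h hK hħ

/-- By `W_eq` the correlator is the coefficient of `X^(2g+n)` of a correlator of resolvents, up to a
double pole that does not depend on the parameters. Each resolvent is the statistic of a fixed
function. The variation inserts `δ` at order `2g + n + 1`, which by `resPairing_eq` is the residue
pairing of the correlator with one more argument. -/
theorem fderiv_W (n : ℕ) (x : Fin (n + 1) → ℂ)
    (hx : ∀ j, x j ∉ Set.range (s p)) (hxx : g = 0 → n = 1 → x 0 ≠ x (Fin.last n)) :
    DifferentiableAt ℂ (fun τ => W ħ (s τ) (G τ) (K τ) g n x) p ∧
    ∀ (u : Fin q → ℂ) (δ : ℂ → ℂ),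
      (∀ i, ∀ᶠ z in 𝓝 (s p i), HasDerivAt δ (∑ l, u l * val (dD l) z) z) →
      fderiv ℂ (fun τ => W ħ (s τ) (G τ) (K τ) g n x) p u =
        -resPairing ħ (s p) (G p) (K p) g (n + 1) x δ := by
  have hp := h.bethe.self_of_nhds
  have hxs : ∀ j i, s p i ≠ x j := fun j i hij => hx j ⟨i, hij⟩
  set f : Fin (n + 1) → ℂ → ℂ := fun j u => -(u - x j)⁻¹ with hf
  have hfa : ∀ j i, AnalyticAt ℂ (f j) (s p i) := fun j i =>
    (analyticAt_inv_sub (hxs j i)).neg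
  have hnot : (0 : Fin (n + 1)) ∉ Finset.univ.map (Fin.succEmb n) := by simp
  have hins : insert (0 : Fin (n + 1)) (Finset.univ.map (Fin.succEmb n)) = Finset.univ := by
    rw [Fin.univ_succ, Finset.cons_eq_insert]
    rfl
  have hmain := h.hasFDerivAt_corr hp hħ hfa hnot (2 * g + n)
  rw [hins] at hmain
  have hne : ∀ᶠ τ in 𝓝 p, ∀ j i, s τ i ≠ x j := eventually_all.2 fun j => eventually_all.2 fun i =>
    (h.differentiableAt_apply i).continuousAt.eventually_ne (hxs j i)
  have hev : (fun τ => W ħ (s τ) (G τ) (K τ) g n x) =ᶠ[𝓝 p] fun τ =>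
      coeff (2 * g + n) ((dataFamily hp hħ τ).corr (fun j i => taylor (f j) (s τ i))
        (fun i => taylor (f 0) (s τ i)) (Finset.univ.map (Fin.succEmb n))) +
        if g = 0 ∧ n = 1 then 1 / 2 * ((x 0 - x (Fin.last n))⁻¹) ^ 2 else 0 := by
    filter_upwards [h.bethe, hK, hne] with τ h1 h2 h3
    rw [h2.W_eq h1 hħ g n x (fun j hj => by obtain ⟨i, hi⟩ := hj; exact h3 j i hi) hxx,
      dataFamily_eq hp hħ h1, IsBethe.res, IsBethe.cr, BetheData.corr_map]
    have h4 : ∀ j, cauchyJet (s τ) (x j) = fun i => taylor (f j) (s τ i) := fun j =>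
      funext fun i => cauchyJet_eq_taylor (h3 j i)
    have h5 : (fun j => cauchyJet (s τ) (Fin.tail x j)) =
        (fun j i => taylor (f j) (s τ i)) ∘ Fin.succEmb n := funext fun j => h4 _
    rw [h5, h4 0]
  refine ⟨(hmain.1.add_const _).congr_of_eventuallyEq hev, fun u δ hδ => ?_⟩
  have hδa : ∀ i, AnalyticAt ℂ δ (s p i) := fun i =>
    DifferentiableOn.analyticAt (s := {z | DifferentiableAt ℂ δ z})
      (fun z hz => DifferentiableAt.differentiableWithinAt hz)
      ((hδ i).mono fun z hz => hz.differentiableAt)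
  rw [hev.fderiv_eq, fderiv_add_const, hmain.2 u δ hδ, hK.self_of_nhds.resPairing_eq hp hħ g (n + 1) x
    hx hδa, IsBethe.cr, ← add_assoc]
  have h5 : (fun j => cauchyJet (s p) (x j)) = fun j i => taylor (f j) (s p i) :=
    funext fun j => funext fun i => cauchyJet_eq_taylor (hxs j i)
  rw [h5]

end IsBetheFamily

end Family

/-! ### Derivatives of determinants and logarithms; the variation of `F0` and `F1`. -/

section Calculus

variable {E : Type*} [NormedAddCommGroup E] [NormedSpace ℂ E] {p : E}

lemma hasFDerivAt_det {n : Type*} [Fintype n] [DecidableEq n] {M : E → Matrix n n ℂ}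
    (hM : ∀ i j, DifferentiableAt ℂ (fun τ => M τ i j) p) :
    HasFDerivAt (fun τ => (M τ).det)
      (∑ i, ∑ j, (M p).adjugate j i • fderiv ℂ (fun τ => M τ i j) p) p := by
  let f : ContinuousMultilinearMap ℂ (fun _ : n => n → ℂ) ℂ :=
    ⟨Matrix.detRowAlternating.toMultilinearMap, Continuous.matrix_det continuous_id⟩
  have h1 : HasFDerivAt (fun τ i j => M τ i j) (ContinuousLinearMap.pi fun i =>
      ContinuousLinearMap.pi fun j => fderiv ℂ (fun τ => M τ i j) p) p :=
    hasFDerivAt_pi.2 fun i => hasFDerivAt_pi.2 fun j => (hM i j).hasFDerivAt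
  refine ((f.hasFDerivAt fun i j => M p i j).comp p h1).congr_fderiv ?_
  ext u
  rw [ContinuousLinearMap.comp_apply, ContinuousMultilinearMap.linearDeriv_apply]
  simp only [sum_apply, smul_apply, smul_eq_mul]
  refine Finset.sum_congr rfl fun i _ => ?_
  have h2 := Matrix.cramer_transpose_apply (M p) (fun j => fderiv ℂ (fun τ => M τ i j) p u) i
  rw [Matrix.cramer_eq_adjugate_mulVec, ← Matrix.adjugate_transpose] at h2
  exact h2.symm

/-- A continuous branch of the logarithm of a differentiable function is differentiable. -/
lemma hasFDerivAt_log_branch {f L : E → ℂ} {f' : E →L[ℂ] ℂ} (hf : HasFDerivAt f f' p)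
    (hL : ContinuousAt L p) (he : ∀ᶠ τ in 𝓝 p, Complex.exp (L τ) = f τ) :
    HasFDerivAt L ((f p)⁻¹ • f') p := by
  have h0 : f p ≠ 0 := he.self_of_nhds ▸ Complex.exp_ne_zero _
  have h1 : HasFDerivAt (fun τ => (f p)⁻¹ * f τ) ((f p)⁻¹ • f') p := hf.const_mul _
  have h2 : (f p)⁻¹ * f p = 1 := inv_mul_cancel₀ h0
  have h3 := (h1.clog (by rw [h2]; exact Complex.one_mem_slitPlane)).const_add (L p)
  rw [h2, inv_one, one_smul] at h3
  refine h3.congr_of_eventuallyEq ?_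
  have h4 : Tendsto (fun τ => (L τ - L p).im) (𝓝 p) (𝓝 0) := by
    have h5 : ContinuousAt (fun τ => (L τ - L p).im) p :=
      Complex.continuous_im.continuousAt.comp (hL.sub continuousAt_const)
    simpa using h5.tendsto
  filter_upwards [he, h4.eventually (Ioo_mem_nhds (neg_lt_zero.2 Real.pi_pos) Real.pi_pos)]
    with τ h5 h6
  rw [← h5, ← he.self_of_nhds, ← Complex.exp_neg, ← Complex.exp_add, neg_add_eq_sub,
    Complex.log_exp h6.1 h6.2.le]
  ring

end Calculus

section Sums

variable {m : ℕ} {r : Fin m → Fin m → ℂ}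

lemma sum_sub_mul_antisymm (hr : ∀ i j, r j i = -r i j) (σ : Fin m → ℂ) :
    ∑ i, ∑ j, (σ i - σ j) * r i j = 2 * ∑ i, σ i * ∑ j, r i j := by
  have h : ∑ i, ∑ j, σ j * r i j = -∑ i, σ i * ∑ j, r i j := by
    rw [Finset.sum_comm, ← Finset.sum_neg_distrib]
    refine Finset.sum_congr rfl fun i _ => ?_
    rw [Finset.mul_sum, ← Finset.sum_neg_distrib]
    refine Finset.sum_congr rfl fun j _ => ?_
    rw [hr i j]
    ring
  simp only [sub_mul, Finset.sum_sub_distrib, h, ← Finset.mul_sum]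
  ring

lemma two_mul_sum_Iio (f : Fin m → Fin m → ℂ) (hf : ∀ i j, f j i = f i j) (h0 : ∀ i, f i i = 0) :
    2 * ∑ i, ∑ j ∈ Finset.Iio i, f i j = ∑ i, ∑ j, f i j := by
  have h1 : ∑ i, ∑ j ∈ Finset.Iio i, f i j = ∑ i, ∑ j, if j < i then f i j else 0 := by
    refine Finset.sum_congr rfl fun i _ => ?_
    rw [← Finset.sum_filter]
    refine Finset.sum_congr ?_ fun _ _ => rfl
    ext j
    simp
  have h2 : ∑ i, ∑ j, (if j < i then f i j else 0) = ∑ i, ∑ j, if i < j then f i j else 0 := by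
    rw [Finset.sum_comm]
    simp only [hf]
  rw [two_mul]
  nth_rw 2 [h1]
  rw [h1, h2, ← h2]
  nth_rw 2 [h2]
  simp only [← Finset.sum_add_distrib]
  refine Finset.sum_congr rfl fun i _ => Finset.sum_congr rfl fun j _ => ?_
  rcases lt_trichotomy i j with h | rfl | h
  · simp [h, h.not_gt]
  · simp [h0]
  · simp [h, h.not_gt]

end Sums

namespace IsBetheFamily

variable {q m : ℕ} {dV : RatFunc ℂ} {dD : Fin q → RatFunc ℂ} {ħ : ℂ} {p : Fin q → ℂ}
  {s : (Fin q → ℂ) → Fin m → ℂ} (h : IsBetheFamily ħ dV dD s p) {V : ℂ → ℂ} {D : Fin q → ℂ → ℂ}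
  (hV : ∀ i, IsPrimitiveNear V dV (s p i)) (hD : ∀ k i, IsPrimitiveNear (D k) (dD k) (s p i))
  {l : (Fin q → ℂ) → Fin m → Fin m → ℂ}
  (hl : ∀ i j, i ≠ j → HasFDerivAt (fun τ => l τ i j) ((s p i - s p j)⁻¹ •
    (fderiv ℂ (fun τ => s τ i) p - fderiv ℂ (fun τ => s τ j) p)) p)
include h hV hD hl

/-- The points are critical for `F0`: by the Bethe equations their motion contributes nothing, and
only the explicit dependence on the potential remains. -/
lemma fderiv_F0 :
    DifferentiableAt ℂ (fun τ => F0 ħ (fun z => V z + ∑ k, τ k * D k z) (s τ) (l τ)) p ∧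
    ∀ u, fderiv ℂ (fun τ => F0 ħ (fun z => V z + ∑ k, τ k * D k z) (s τ) (l τ)) p u =
      -ħ * ∑ i, ∑ k, u k * D k (s p i) := by
  have hp := h.bethe.self_of_nhds
  have hcomp : ∀ {f : ℂ → ℂ} {df : RatFunc ℂ} {i : Fin m}, IsPrimitiveNear f df (s p i) →
      HasFDerivAt (fun τ => f (s τ i)) (val df (s p i) • fderiv ℂ (fun τ => s τ i) p) p :=
    fun {f df i} hf => HasDerivAt.comp_hasFDerivAt (h₂ := f) p
      (Filter.Eventually.self_of_nhds (p := fun z => HasDerivAt f (val df z) z) hf)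
      (h.differentiableAt_apply i).hasFDerivAt
  have hpot : ∀ i, HasFDerivAt (fun τ : Fin q → ℂ => V (s τ i) + ∑ k, τ k * D k (s τ i))
      (val dV (s p i) • fderiv ℂ (fun τ => s τ i) p +
        ∑ k, (p k • (val (dD k) (s p i) • fderiv ℂ (fun τ => s τ i) p) + D k (s p i) •
          (ContinuousLinearMap.proj k : (Fin q → ℂ) →L[ℂ] ℂ))) p := fun i =>
    (hcomp (hV i)).add (HasFDerivAt.fun_sum fun k _ => ((ContinuousLinearMap.proj k :
      (Fin q → ℂ) →L[ℂ] ℂ).hasFDerivAt.mul (hcomp (hD k i))))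
  have hF : HasFDerivAt (fun τ => F0 ħ (fun z => V z + ∑ k, τ k * D k z) (s τ) (l τ)) _ p :=
    HasFDerivAt.sub ((HasFDerivAt.fun_sum (u := Finset.univ) fun i _ =>
      HasFDerivAt.fun_sum (u := Finset.univ.erase i) fun j hj =>
        hl i j (Finset.ne_of_mem_erase hj).symm).const_mul (ħ ^ 2))
      ((HasFDerivAt.fun_sum (u := Finset.univ) fun i _ => hpot i).const_mul ħ)
  refine ⟨hF.differentiableAt, fun u => ?_⟩
  rw [hF.fderiv]
  simp only [sub_apply, add_apply, sum_apply, smul_apply, smul_eq_mul,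
    ContinuousLinearMap.proj_apply]
  set σ : Fin m → ℂ := fun i => fderiv ℂ (fun τ => s τ i) p u with hσ
  have h1 := sum_sub_mul_antisymm (r := fun i j => (s p i - s p j)⁻¹)
    (fun i j => by rw [← neg_sub (s p i), inv_neg]) σ
  have h2 : ∀ i, val dV (s p i) + ∑ k, p k * val (dD k) (s p i) =
      2 * ħ * ∑ j, (s p i - s p j)⁻¹ := by
    intro i
    rw [← (denom_pencil_ne (h.denom_ne i) (fun k => h.denom_ne' k i) p).2, hp.bethe,
      ← Finset.sum_erase (f := fun j => (s p i - s p j)⁻¹) Finset.univ (a := i) (by simp)]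
    simp only [one_div]
  have h3 : ∀ i, ∑ j ∈ Finset.univ.erase i, (s p i - s p j)⁻¹ * (σ i - σ j) =
      ∑ j, (σ i - σ j) * (s p i - s p j)⁻¹ := by
    intro i
    rw [Finset.sum_erase _ (by simp)]
    exact Finset.sum_congr rfl fun j _ => mul_comm _ _
  have h4 : ∀ i, val dV (s p i) * σ i + ∑ k, (p k * (val (dD k) (s p i) * σ i) +
      D k (s p i) * u k) = σ i * (2 * ħ * ∑ j, (s p i - s p j)⁻¹) + ∑ k, u k * D k (s p i) := by
    intro i
    rw [← h2, Finset.sum_add_distrib, mul_add, Finset.mul_sum, ← add_assoc, mul_comm (val dV _)]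
    exact congrArg₂ _ (congrArg _ (Finset.sum_congr rfl fun k _ => by ring))
      (Finset.sum_congr rfl fun k _ => mul_comm _ _)
  have h5 : ∑ i, ∑ j ∈ Finset.univ.erase i, (s p i - s p j)⁻¹ * (σ i - σ j) =
      2 * ∑ i, σ i * ∑ j, (s p i - s p j)⁻¹ := by
    rw [Finset.sum_congr rfl fun i _ => h3 i, h1]
  have h6 : ∀ i, σ i * (2 * ħ * ∑ j, (s p i - s p j)⁻¹) =
      2 * ħ * (σ i * ∑ j, (s p i - s p j)⁻¹) := fun i => by ring
  rw [h5, Finset.sum_congr rfl fun i _ => h4 i, Finset.sum_add_distrib,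
    Finset.sum_congr rfl fun i _ => h6 i, ← Finset.mul_sum]
  ring

/-- The formula is read off from order zero of the variation of `log Z`. There `normShift` collects
minus the variations of `½ ln det A` and of `ln Δ²`, and the coefficient `ħ⁻¹` of order two of `κ`
matches the variation of `F0 / ħ²`. -/
theorem fderiv_F1 (hħ : ħ ≠ 0) {lA lΔ : (Fin q → ℂ) → ℂ}
    (hA : ContinuousAt lA p) (hA' : ∀ᶠ τ in 𝓝 p, Complex.exp (lA τ) =
      (matA ħ (pencil dV dD τ) (s τ)).det)
    (hΔ : HasFDerivAt lΔ (2 • ∑ i, ∑ j ∈ Finset.Iio i, (s p i - s p j)⁻¹ •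
      (fderiv ℂ (fun τ => s τ i) p - fderiv ℂ (fun τ => s τ j) p)) p) :
    DifferentiableAt ℂ (fun τ => F1 ħ (fun z => V z + ∑ k, τ k * D k z) (s τ) (l τ)
      (lA τ) (lΔ τ)) p ∧
    ∀ u, fderiv ℂ (fun τ => F1 ħ (fun z => V z + ∑ k, τ k * D k z) (s τ) (l τ) (lA τ) (lΔ τ)) p u =
      -coeff 2 ((h.bethe.self_of_nhds.data hħ).corr (fun (j : Fin 0) _ => j.elim0)
        (fun i => taylor (fun z => ∑ k, u k * D k z) (s p i)) ∅) := by
  have hp := h.bethe.self_of_nhds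
  have hT := hasFDerivAt_det (M := fun τ => hessian ħ (pencil dV dD τ) (s τ))
    h.differentiableAt_hessian
  have hT' := hasFDerivAt_log_branch hT hA.neg (hA'.mono fun τ hτ => by
    change Complex.exp (-lA τ) = _
    rw [Complex.exp_neg, hτ, matA, Matrix.det_nonsing_inv, Ring.inverse_eq_inv', inv_inv])
  have h0 := h.fderiv_F0 hV hD hl
  have hF := ((hT'.neg.const_mul (1 / 2)).add hΔ).add (h0.1.hasFDerivAt.mul_const (ħ ^ 2)⁻¹)
  have hFe : (fun τ => F1 ħ (fun z => V z + ∑ k, τ k * D k z) (s τ) (l τ) (lA τ) (lΔ τ)) =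
      ((fun τ => 1 / 2 * (- -lA) τ) + lΔ + fun τ =>
        F0 ħ (fun z => V z + ∑ k, τ k * D k z) (s τ) (l τ) * (ħ ^ 2)⁻¹) := by
    funext τ
    simp [F1, div_eq_mul_inv]
  rw [hFe]
  refine ⟨hF.differentiableAt, fun u => ?_⟩
  have hδ : ∀ i, ∀ᶠ z in 𝓝 (s p i), HasDerivAt (fun z => ∑ k, u k * D k z)
      (∑ k, u k * val (dD k) z) z := by
    intro i
    filter_upwards [eventually_all.2 fun k => hD k i] with z hz
    exact HasDerivAt.fun_sum fun k _ => (hz k).const_mul (u k)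
  have hvar := h.isVarFamily hp hħ u hδ
  have h1 := hvar.fderiv_logPartitionFn (fun (j : Fin 0) _ => j.elim0) 0
  -- The partition function starts with `1`, so the left-hand side of `h1` is the derivative of
  -- zero.
  have h2 : (fun τ => coeff 0 (logSeries (dataFamily hp hħ τ).partitionFn)) = fun _ => 0 := by
    funext τ
    rw [coeff_zero_eq_constantCoeff_apply, constantCoeff_logSeries]
  have h3 : ∀ i j, fderiv ℂ (fun τ => (dataFamily hp hħ τ).hess i j) p u =
      ħ ^ 2 * fderiv ℂ (fun τ => hessian ħ (pencil dV dD τ) (s τ) i j) p u := by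
    intro i j
    rw [Filter.EventuallyEq.fderiv_eq (h.eventuallyEq_dataFamily hp hħ (F := fun D => D.hess i j)
      (f := fun τ => ħ ^ 2 * hessian ħ (pencil dV dD τ) (s τ) i j)
      fun τ hτ => dataHessian_eq hħ _ _ i j), fderiv_const_mul (h.differentiableAt_hessian i j)]
    rfl
  have h4 : ∀ i, fderiv ℂ (fun τ => (dataFamily hp hħ τ).s i) p u =
      fderiv ℂ (fun τ => s τ i) p u := by
    intro i
    rw [Filter.EventuallyEq.fderiv_eq (h.eventuallyEq_dataFamily hp hħ
        (F := fun D => D.s i) (f := fun τ => s τ i) fun _ _ => rfl)]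
  rw [h2, hvar.snd_normShift, dataFamily_eq hp hħ hp] at h1
  simp only [zero_add] at h1
  generalize coeff 2 ((hp.data hħ).corr (fun (j : Fin 0) _ => j.elim0)
    (fun i => taylor (fun z => ∑ k, u k * D k z) (s p i)) ∅) = c at h1 ⊢
  simp only [h3, h4, IsBethe.data, BetheData.kap, coeff_two_kappa, fderiv_fun_const, Pi.zero_apply,
    zero_apply, if_true, ← coeff_zero_eq_constantCoeff_apply, coeff_zero_taylor] at h1
  rw [hF.fderiv]
  simp only [add_apply, neg_apply, sum_apply, smul_apply, smul_eq_mul, sub_apply, h0.2]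
  set σ : Fin m → ℂ := fun i => fderiv ℂ (fun τ => s τ i) p u with hσ
  have h5 := sum_sub_mul_antisymm (r := fun i j => (s p i - s p j)⁻¹)
    (fun i j => by rw [← neg_sub (s p i), inv_neg]) σ
  have h6 := two_mul_sum_Iio (fun i j => (s p i - s p j)⁻¹ * (σ i - σ j))
    (fun i j => by rw [← neg_sub (s p i), ← neg_sub (σ i), inv_neg, neg_mul_neg]) (by simp)
  have h7 : ∑ i, ∑ j, (s p i - s p j)⁻¹ * (σ i - σ j) = 2 * ∑ i, σ i * ∑ j, (s p i - s p j)⁻¹ := by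
    rw [← h5]
    exact Finset.sum_congr rfl fun i _ => Finset.sum_congr rfl fun j _ => mul_comm _ _
  have h8 : (hessian ħ (pencil dV dD p) (s p)).det⁻¹ *
      ∑ i, ∑ j, (hessian ħ (pencil dV dD p) (s p)).adjugate j i *
        fderiv ℂ (fun τ => hessian ħ (pencil dV dD τ) (s τ) i j) p u =
      ∑ i, ∑ j, ħ ^ 2 * fderiv ℂ (fun τ => hessian ħ (pencil dV dD τ) (s τ) i j) p u *
        ((ħ ^ 2)⁻¹ * matA ħ (pencil dV dD p) (s p) i j) := by
    simp only [Finset.mul_sum]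
    refine Finset.sum_congr rfl fun i _ => Finset.sum_congr rfl fun j _ => ?_
    rw [matA_symm, matA, Matrix.inv_def, Ring.inverse_eq_inv',
      Matrix.smul_apply, smul_eq_mul]
    field_simp
  have h9 : (ħ ^ 2)⁻¹ * ħ = ħ⁻¹ := by field_simp
  rw [h8, nsmul_eq_mul, Nat.cast_ofNat]
  linear_combination h1 + h6 + h7 - (∑ i, ∑ k, u k * D k (s p i)) * h9

end IsBetheFamily

lemma IsKernelSystem.resPairing_zero_eq {m : ℕ} {ħ : ℂ} {dV : RatFunc ℂ} {s : Fin m → ℂ}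
    {G K : ℂ → ℂ → ℂ} (h : IsKernelSystem ħ dV s G K) (hB : IsBethe ħ dV s) (hħ : ħ ≠ 0) (g : ℕ)
    {ι : Type*} [DecidableEq ι] (φ : ι → Fin m → ℂ⟦X⟧) {f : ℂ → ℂ}
    (hf : ∀ i, AnalyticAt ℂ f (s i)) : resPairing ħ s G K g 0 Fin.elim0 f =
      coeff (2 * g) ((hB.data hħ).corr φ (fun i => taylor f (s i)) ∅) := by
  rw [h.resPairing_eq hB hħ g 0 _ (fun j => j.elim0) hf, IsBethe.cr]
  exact congrArg _ (BetheData.corr_empty_congr _ _ _ _)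

lemma hasFDerivAt_of_exp_eq_exp {E : Type*} [NormedAddCommGroup E] [NormedSpace ℂ E] {p : E}
    {L M : E → ℂ} {M' : E →L[ℂ] ℂ} (hM : HasFDerivAt M M' p) (hL : ContinuousAt L p)
    (he : ∀ᶠ τ in 𝓝 p, Complex.exp (L τ) = Complex.exp (M τ)) : HasFDerivAt L M' p := by
  refine (hasFDerivAt_log_branch hM.cexp hL he).congr_fderiv ?_
  rw [smul_smul, inv_mul_cancel₀ (Complex.exp_ne_zero _), one_smul]

lemma hasDerivAt_of_differentiableAt_fin_one {f : ℂ → ℂ}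
    (h : DifferentiableAt ℂ (fun τ : Fin 1 → ℂ => f (τ 0)) 0) :
    HasDerivAt f (fderiv ℂ (fun τ : Fin 1 → ℂ => f (τ 0)) 0 fun _ => 1) 0 := by
  have h1 : HasDerivAt (fun (t : ℂ) (_ : Fin 1) => t) (fun _ => 1) 0 :=
    hasDerivAt_pi.2 fun _ => hasDerivAt_id 0
  exact h.hasFDerivAt.comp_hasDerivAt (0 : ℂ) h1

/-! ### Deformations with one parameter. -/

section OneParameter

variable {m : ℕ} {ħ : ℂ} {dV dδV : RatFunc ℂ} {V δV : ℂ → ℂ}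

lemma pencil_fin_one (τ : Fin 1 → ℂ) :
    pencil dV (fun _ => dδV) τ = dV + RatFunc.C (τ 0) * dδV := by simp [pencil]

theorem exists_deformation (hħ : ħ ≠ 0) {s₀ : Fin m → ℂ} (h : IsBethe ħ dV s₀)
    (hδV : ∀ i, dδV.denom.eval (s₀ i) ≠ 0) :
    ∃ (s : ℂ → Fin m → ℂ) (G K : ℂ → ℂ → ℂ → ℂ), s 0 = s₀ ∧ ContinuousAt s 0 ∧
      ∀ᶠ t in 𝓝 (0 : ℂ), IsKernelSystem ħ (dV + RatFunc.C t * dδV) (s t) (G t) (K t) := by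
  have h0 : IsBethe ħ (pencil dV (fun _ : Fin 1 => dδV) 0) s₀ := by
    rw [pencil_fin_one]
    simpa using h
  obtain ⟨ψ, h1, h2, -⟩ := h0.exists_family hħ h.denom_ne fun _ => hδV
  have hc : Continuous fun (t : ℂ) (_ : Fin 1) => t := by fun_prop
  have hψ : ContinuousAt (fun t => ψ fun _ => t) 0 :=
    ContinuousAt.comp (g := ψ) h2.self_of_nhds.1.continuousAt hc.continuousAt
  have h3 : ∀ t : ℂ, ∃ G K : ℂ → ℂ → ℂ, IsBethe ħ (dV + RatFunc.C t * dδV) (ψ fun _ => t) →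
      IsKernelSystem ħ (dV + RatFunc.C t * dδV) (ψ fun _ => t) G K := by
    intro t
    by_cases h4 : IsBethe ħ (dV + RatFunc.C t * dδV) (ψ fun _ => t)
    · obtain ⟨G, K, h5⟩ := h4.exists_isKernelSystem hħ
      exact ⟨G, K, fun _ => h5⟩
    · exact ⟨0, 0, fun h5 => absurd h5 h4⟩
  choose G K hGK using h3
  refine ⟨fun t => ψ fun _ => t, G, K, h1, hψ, ?_⟩
  filter_upwards [(hc.tendsto 0).eventually h2] with t ht
  have h4 := ht.2
  rw [pencil_fin_one] at h4
  exact hGK t h4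

variable {s : ℂ → Fin m → ℂ} {G K : ℂ → ℂ → ℂ → ℂ} (hħ : ħ ≠ 0) (hs : ContinuousAt s 0)
  (hK : ∀ᶠ t in 𝓝 (0 : ℂ), IsKernelSystem ħ (dV + RatFunc.C t * dδV) (s t) (G t) (K t))
  (hV : ∀ i, IsPrimitiveNear V dV (s 0 i)) (hδV : ∀ i, IsPrimitiveNear δV dδV (s 0 i))
include hħ hs hK hV hδV

omit hs hV hδV hħ in
lemma eventually_isKernelSystem_fin_one : ∀ᶠ τ : Fin 1 → ℂ in 𝓝 0,
    IsKernelSystem ħ (pencil dV (fun _ => dδV) τ) (s (τ 0)) (G (τ 0)) (K (τ 0)) := by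
  have ht : Tendsto (fun τ : Fin 1 → ℂ => τ 0) (𝓝 0) (𝓝 0) := (continuous_apply 0).continuousAt
  filter_upwards [ht.eventually hK] with τ hτ
  rwa [pencil_fin_one]

lemma isBetheFamily_fin_one :
    IsBetheFamily ħ dV (fun _ => dδV) (fun τ : Fin 1 → ℂ => s (τ 0)) 0 := by
  have hc : ContinuousAt (fun τ : Fin 1 → ℂ => s (τ 0)) 0 :=
    ContinuousAt.comp (g := s) (f := fun τ : Fin 1 → ℂ => τ 0) hs (continuous_apply 0).continuousAt
  exact (eventually_isBetheFamily hħ hc ((eventually_isKernelSystem_fin_one hK).mono fun τ hτ =>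
    hτ.isBethe hħ) (fun i => (hV i).denom_ne) fun _ i => (hδV i).denom_ne).self_of_nhds

theorem hasDerivAt_W (g n : ℕ) (x : Fin (n + 1) → ℂ) (hx : ∀ j, x j ∉ Set.range (s 0))
    (hxx : g = 0 → n = 1 → x 0 ≠ x (Fin.last n)) :
    HasDerivAt (fun t => W ħ (s t) (G t) (K t) g n x)
      (-resPairing ħ (s 0) (G 0) (K 0) g (n + 1) x δV) 0 := by
  have h1 := (isBetheFamily_fin_one hħ hs hK hV hδV).fderiv_W
    (eventually_isKernelSystem_fin_one hK) hħ g n x hx hxx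
  have h2 := hasDerivAt_of_differentiableAt_fin_one
    (f := fun t => W ħ (s t) (G t) (K t) g n x) h1.1
  rwa [h1.2 (fun _ => 1) δV (fun i => by
    simp only [Finset.univ_unique, Finset.sum_singleton, one_mul]
    exact hδV i)] at h2

theorem hasDerivAt_F0_F1 {l : ℂ → Fin m → Fin m → ℂ}
    (hl : ∀ i j, i ≠ j → IsLogBranch (fun t => s t i - s t j) (fun t => l t i j) 0) :
    HasDerivAt (fun t => F0 ħ (fun x => V x + t * δV x) (s t) (l t))
      (-resPairing ħ (s 0) (G 0) (K 0) 0 0 Fin.elim0 δV) 0 ∧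
    ∀ lA lΔ : ℂ → ℂ,
      IsLogBranch (fun t => (matA ħ (dV + RatFunc.C t * dδV) (s t)).det) lA 0 →
      IsLogBranch (fun t => vandermonde (s t) ^ 2) lΔ 0 →
      HasDerivAt (fun t => F1 ħ (fun x => V x + t * δV x) (s t) (l t) (lA t) (lΔ t))
        (-resPairing ħ (s 0) (G 0) (K 0) 1 0 Fin.elim0 δV) 0 := by
  have hB := isBetheFamily_fin_one hħ hs hK hV hδV
  have hp := hB.bethe.self_of_nhds
  have hK0 := (eventually_isKernelSystem_fin_one hK).self_of_nhds
  have ht : Tendsto (fun τ : Fin 1 → ℂ => τ 0) (𝓝 0) (𝓝 0) := (continuous_apply 0).continuousAt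
  have hct : ∀ {f : ℂ → ℂ}, ContinuousAt f 0 →
      ContinuousAt (fun τ : Fin 1 → ℂ => f (τ 0)) 0 := fun {f} hf =>
    ContinuousAt.comp (g := f) (f := fun τ : Fin 1 → ℂ => τ 0) hf ht
  have hl' : ∀ i j, i ≠ j → HasFDerivAt (fun τ : Fin 1 → ℂ => l (τ 0) i j)
      ((s 0 i - s 0 j)⁻¹ • (fderiv ℂ (fun τ : Fin 1 → ℂ => s (τ 0) i) 0 -
        fderiv ℂ (fun τ : Fin 1 → ℂ => s (τ 0) j) 0)) 0 := fun i j hij =>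
    hasFDerivAt_log_branch
      ((hB.differentiableAt_apply i).hasFDerivAt.sub (hB.differentiableAt_apply j).hasFDerivAt)
      (hct (hl i j hij).1) (ht.eventually (hl i j hij).2)
  have hsum : ∀ (τ : Fin 1 → ℂ), (fun z => V z + ∑ k, τ k * (fun _ : Fin 1 => δV) k z) =
      fun z => V z + τ 0 * δV z := fun τ => by funext z; simp
  have hpair : ∀ g, resPairing ħ (s 0) (G 0) (K 0) g 0 Fin.elim0 δV = coeff (2 * g)
      ((hp.data hħ).corr (fun (j : Fin 0) _ => j.elim0) (fun i => taylor δV (s 0 i)) ∅) := by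
    exact fun g => hK0.resPairing_zero_eq hp hħ g _ fun i => (hδV i).analyticAt
  have h0 := hB.fderiv_F0 hV (D := fun _ => δV) (fun _ => hδV) (l := fun τ => l (τ 0)) hl'
  simp only [hsum] at h0
  refine ⟨?_, fun lA lΔ hA hΔ => ?_⟩
  · refine (hasDerivAt_of_differentiableAt_fin_one
      (f := fun t => F0 ħ (fun x => V x + t * δV x) (s t) (l t)) h0.1).congr_deriv ?_
    rw [h0.2, hpair 0, mul_zero, BetheData.coeff_zero_corr_empty]
    simp [IsBethe.data, coeff_zero_taylor]
  · have hΔ' : HasFDerivAt (fun τ : Fin 1 → ℂ => lΔ (τ 0)) (2 • ∑ i, ∑ j ∈ Finset.Iio i,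
        (s 0 i - s 0 j)⁻¹ • (fderiv ℂ (fun τ : Fin 1 → ℂ => s (τ 0) i) 0 -
          fderiv ℂ (fun τ : Fin 1 → ℂ => s (τ 0) j) 0)) 0 := by
      -- The given branch of `ln Δ²` need not be `2 ∑_{i > j} ln(sᵢ - sⱼ)`, but both have the same
      -- exponential and hence the same derivative.
      have h1 := (HasFDerivAt.fun_sum (u := Finset.univ) fun i (_ : i ∈ Finset.univ) =>
        HasFDerivAt.fun_sum (u := Finset.Iio i) fun j hj =>
          hl' i j (Finset.mem_Iio.1 hj).ne').const_smul 2
      refine hasFDerivAt_of_exp_eq_exp h1 (hct hΔ.1) ?_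
      filter_upwards [ht.eventually hΔ.2, eventually_all.2 fun i => eventually_all.2 fun j =>
        eventually_imp_distrib_left.2 fun hij => ht.eventually (hl i j hij).2] with τ h2 h3
      rw [h2, Pi.smul_apply, nsmul_eq_mul, Complex.exp_nat_mul, Complex.exp_sum, vandermonde]
      congr 1
      refine Finset.prod_congr rfl fun i _ => ?_
      rw [Complex.exp_sum]
      exact Finset.prod_congr rfl fun j hj => (h3 i j (Finset.mem_Iio.1 hj).ne').symm
    have h1 := hB.fderiv_F1 hV (D := fun _ => δV) (fun _ => hδV) (l := fun τ => l (τ 0)) hl' hħ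
      (lA := fun τ => lA (τ 0)) (lΔ := fun τ => lΔ (τ 0)) (hct hA.1)
      (by simpa only [pencil_fin_one] using ht.eventually hA.2) hΔ'
    simp only [hsum] at h1
    refine (hasDerivAt_of_differentiableAt_fin_one
      (f := fun t => F1 ħ (fun x => V x + t * δV x) (s t) (l t) (lA t) (lΔ t)) h1.1).congr_deriv ?_
    rw [h1.2, hpair 1]
    simp

end OneParameter

/-! ### Homogeneity in `ħ` and the potential. -/

section Scaling

variable {m : ℕ} {ħ c : ℂ} {dV dV' : RatFunc ℂ} {s : Fin m → ℂ} {G K G' K' : ℂ → ℂ → ℂ}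

/-- The equations are homogeneous in `ħ`, `V'` and `1 / K`. -/
lemma IsKernelSystem.scale (h : IsKernelSystem ħ dV s G K) (hc : c ≠ 0)
    (hd : ∀ i, dV'.denom.eval (s i) ≠ 0)
    (hv : ∀ i, ∀ᶠ z in 𝓝 (s i), val dV' z = c * val dV z) :
    IsKernelSystem (c * ħ) dV' s G fun x₀ x => c⁻¹ * K x₀ x where
  inj := h.inj
  denom_ne := hd
  rational_right := h.rational_right
  residue_right := h.residue_right
  decay_right := h.decay_right
  rational_left := h.rational_left
  decay_left := h.decay_left
  symm := h.symm
  ode x₀ hx₀ i := by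
    filter_upwards [h.ode x₀ hx₀ i, mem_nhdsWithin_of_mem_nhds (hv i)] with x h1 h2
    rw [h2, ← h1, deriv_const_mul_field]
    field_simp
  analytic x₀ hx₀ i := analyticAt_const.mul (h.analytic x₀ hx₀ i)

/-- Both sides satisfy the residue recursion: the bracket is quadratic in the correlators and scales
by `c²`, while the kernel scales by `c⁻¹`. -/
lemma IsBethe.res_scale (h : IsKernelSystem ħ dV s G K)
    (h' : IsKernelSystem (c * ħ) dV' s G' fun x₀ x => c⁻¹ * K x₀ x) (hħ : ħ ≠ 0) (hc : c ≠ 0)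
    (hcħ : c * ħ ≠ 0) (hB : IsBethe ħ dV s) (hB' : IsBethe (c * ħ) dV' s) (b n : ℕ) (x : Fin n → ℂ)
    (hx : ∀ j, x j ∉ Set.range s) {z : ℂ} (hz : z ∉ Set.range s) :
    c ^ b * hB'.res hcħ x b Finset.univ z = c * hB.res hħ x b Finset.univ z := by
  induction b using Nat.strong_induction_on generalizing n z with
  | _ b ihb =>
  induction n using Nat.strong_induction_on generalizing z with
  | _ n ihn =>
  have hsub : ∀ (b' : ℕ) (I : Finset (Fin n)) (y : ℂ), y ∉ Set.range s →
      (b' < b ∨ b' = b ∧ I ≠ Finset.univ) →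
      c ^ b' * hB'.res hcħ x b' I y = c * hB.res hħ x b' I y := by
    intro b' I y hy hI
    rw [← hB'.res_subTuple hcħ x b' I y, ← hB.res_subTuple hħ x b' I y]
    rcases hI with hI | ⟨rfl, hI⟩
    · exact ihb b' hI _ _ (fun j => hx _) hy
    · obtain ⟨j, hj⟩ : ∃ j, j ∉ I := by
        by_contra! h1
        exact hI (Finset.eq_univ_iff_forall.2 h1)
      exact ihn _ (by simpa using Finset.card_lt_univ_of_notMem hj) _ (fun j => hx _) hy
  by_cases hnb : n = 0 ∧ b = 0
  · obtain ⟨rfl, rfl⟩ := hnb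
    rw [Finset.univ_eq_empty, hB'.res_zero_empty, hB.res_zero_empty]
    ring
  have hbr : ∀ y, y ∉ Set.range s → c ^ b * hB'.bracket hcħ x b y = c ^ 2 * hB.bracket hħ x b y := by
    intro y hy
    rw [bracket, bracket, mul_add, mul_add]
    congr 1
    · split_ifs with hb
      · simp
      · obtain ⟨b, rfl⟩ := Nat.exists_eq_succ_of_ne_zero hb
        simp only [Nat.succ_sub_one, Nat.succ_eq_add_one, pow_succ', pow_zero, mul_one, mul_assoc]
        congr 1
        rw [mul_add, mul_add, ihb b (Nat.lt_succ_self b) _ _ (Fin.cases hy hx) hy, Finset.mul_sum,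
          Finset.mul_sum]
        congr 1
        refine Finset.sum_congr rfl fun j _ => ?_
        linear_combination ((y - x j)⁻¹) ^ 2 * hsub b _ y hy (Or.inl (Nat.lt_succ_self b))
    · simp only [Finset.mul_sum]
      refine Finset.sum_congr rfl fun I _ => Finset.sum_congr rfl fun q hq => ?_
      split_ifs with hI
      · simp
      · have hq' := Finset.HasAntidiagonal.mem_antidiagonal.1 hq
        rw [not_or, not_and, not_and] at hI
        rw [← hq', pow_add, mul_mul_mul_comm, hsub q.1 I y hy, hsub q.2 Iᶜ y hy]
        · ring
        · rcases Nat.eq_zero_or_pos q.1 with h1 | h1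
          · exact Or.inr ⟨by omega, fun h2 => hI.1 h1 (by simpa using h2)⟩
          · exact Or.inl (by omega)
        · rcases Nat.eq_zero_or_pos q.2 with h1 | h1
          · exact Or.inr ⟨by omega, hI.2 h1⟩
          · exact Or.inl (by omega)
  obtain ⟨a, ha, hsum⟩ := hB.exists_sum_res_bracket hħ x b h hnb hx hz
  obtain ⟨a', ha', hsum'⟩ := hB'.exists_sum_res_bracket hcħ x b h' hnb hx hz
  rw [← hsum, ← hsum', Finset.mul_sum, Finset.mul_sum]
  refine Finset.sum_congr rfl fun i _ => ?_
  refine ((ha' i).const_mul (c ^ b)).residue_eq.symm.trans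
    (((ha i).const_mul c).congr ?_).residue_eq
  filter_upwards [eventually_notMem_range s (s i)] with y hy
  rw [mul_left_comm (c ^ b), hbr y hy]
  field_simp

/-- The kernel system of the scaled problem may be arbitrary, since the pairing depends only on the
points and the potential. -/
theorem IsKernelSystem.resPairing_scale (h : IsKernelSystem ħ dV s G K)
    (h' : IsKernelSystem (c * ħ) dV' s G' K') (hħ : ħ ≠ 0) (hc : c ≠ 0)
    (hv : ∀ i, ∀ᶠ z in 𝓝 (s i), val dV' z = c * val dV z) (g n : ℕ)
    (x : Fin n → ℂ) (hx : ∀ j, x j ∉ Set.range s) {f : ℂ → ℂ}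
    (hf : ∀ i, AnalyticAt ℂ f (s i)) :
    c ^ (2 * g + n) * resPairing (c * ħ) s G' K' g n x f =
      c * resPairing ħ s G K g n x f := by
  have hcħ := mul_ne_zero hc hħ
  have hB := h.isBethe hħ
  have hB' := h'.isBethe hcħ
  have hres := fun z hz => IsBethe.res_scale h (h.scale hc h'.denom_ne hv) hħ hc hcħ hB hB' (2 * g + n) n
    x hx (z := z) hz
  rw [h.resPairing_eq hB hħ g n x hx hf,
    h'.resPairing_eq hB' hcħ g n x hx hf, IsBethe.cr_eq_sum, IsBethe.cr_eq_sum,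
    Finset.mul_sum, Finset.mul_sum]
  refine Finset.sum_congr rfl fun i _ => ?_
  have h1 := (hasRes_polar_mul h.inj (2 * g + n + 1) ((hB.data hħ).jet
    (fun j => cauchyJet s (x j)) Finset.univ (2 * g + n)) (hf i)).const_mul c
  have h2 := (hasRes_polar_mul h.inj (2 * g + n + 1) ((hB'.data hcħ).jet
    (fun j => cauchyJet s (x j)) Finset.univ (2 * g + n)) (hf i)).const_mul (c ^ (2 * g + n))
  rw [← IsBethe.res_eq_polar] at h1 h2
  refine h2.residue_eq.symm.trans (h1.congr ?_).residue_eq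
  filter_upwards [eventually_notMem_range s (s i)] with z hz
  rw [← mul_assoc, ← mul_assoc]
  exact congrArg (· * f z) (hres z hz).symm

end Scaling

/-! ### Free energies of genus at least two. -/

section FreeEnergy

variable {q m : ℕ} {dV : RatFunc ℂ} {dD : Fin q → RatFunc ℂ} {ħ : ℂ} {p : Fin q → ℂ}
  {s : (Fin q → ℂ) → Fin m → ℂ}

/-- At constant `ħ`, there is a free energy of genus at least two whose derivatives are given by the
variation formula. -/
theorem exists_freeEnergy (hħ : ħ ≠ 0) (hs : ContinuousAt s p)
    (hb : ∀ᶠ τ in 𝓝 p, IsBethe ħ (pencil dV dD τ) (s τ)) {V : ℂ → ℂ}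
    {D : Fin q → ℂ → ℂ} (hV : ∀ i, IsPrimitiveNear V dV (s p i))
    (hD : ∀ k i, IsPrimitiveNear (D k) (dD k) (s p i)) {g : ℕ} (hg : 2 ≤ g) :
    ∃ F : (Fin q → ℂ) → ℂ, ∀ᶠ τ in 𝓝 p, DifferentiableAt ℂ F τ ∧
      ∀ G K, IsKernelSystem ħ (pencil dV dD τ) (s τ) G K → ∀ u, fderiv ℂ F τ u =
        -resPairing ħ (s τ) G K g 0 Fin.elim0 fun z => ∑ k, u k * D k z := by
  have hp := hb.self_of_nhds
  have hfam := eventually_isBetheFamily hħ hs hb (fun i => (hV i).denom_ne)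
    fun k i => (hD k i).denom_ne
  have hsi : ∀ i, Tendsto (fun τ => s τ i) (𝓝 p) (𝓝 (s p i)) := fun i =>
    ((continuous_apply i).continuousAt (x := s p)).tendsto.comp hs
  have hprim : ∀ {f : ℂ → ℂ} {df : RatFunc ℂ} {i : Fin m}, IsPrimitiveNear f df (s p i) →
      ∀ᶠ τ in 𝓝 p, IsPrimitiveNear f df (s τ i) := fun {f df i} hf =>
    (hsi i).eventually (eventually_eventually_nhds.2 hf)
  have hslit : ∀ᶠ τ in 𝓝 p, ∀ i j, i ≠ j →
      (s p i - s p j)⁻¹ * (s τ i - s τ j) ∈ Complex.slitPlane := by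
    refine eventually_all.2 fun i => eventually_all.2 fun j => eventually_imp_distrib_left.2 fun hij =>
      (((hsi i).sub (hsi j)).const_mul (s p i - s p j)⁻¹).eventually
        (Complex.isOpen_slitPlane.mem_nhds ?_)
    rw [inv_mul_cancel₀ (sub_ne_zero.2 (hp.inj.ne hij))]
    exact Complex.one_mem_slitPlane
  set l : (Fin q → ℂ) → Fin m → Fin m → ℂ := fun τ i j =>
    Complex.log ((s p i - s p j)⁻¹ * (s τ i - s τ j)) with hl
  -- The variation of the coefficient of `X^(2g-2)` of `log Z` is minus the pairing plus the
  -- coefficient of `X^(2g)` of `κ` times `∑ᵢ δ(sᵢ)`. As the variation of `F0` is `-ħ ∑ᵢ δ(sᵢ)`, the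
  -- second summand removes that term.
  refine ⟨fun τ => coeff (2 * g - 2) (logSeries (dataFamily hp hħ τ).partitionFn) +
    coeff (2 * g) (kappa ħ ħ⁻¹) / ħ * F0 ħ (fun z => V z + ∑ k, τ k * D k z) (s τ) (l τ), ?_⟩
  filter_upwards [hfam, eventually_all.2 fun i => hprim (hV i),
    eventually_all.2 fun k => eventually_all.2 fun i => hprim (hD k i), hslit] with τ h1 h3 h4 h5
  have hτ := h1.bethe.self_of_nhds
  have h6 := h1.fderiv_F0 h3 h4 (l := l) fun i j hij => by
    have h7 := (((h1.differentiableAt_apply i).hasFDerivAt.sub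
      (h1.differentiableAt_apply j).hasFDerivAt).const_mul (s p i - s p j)⁻¹).clog (h5 i j hij)
    refine h7.congr_fderiv ?_
    rw [smul_smul, mul_inv, inv_inv, mul_right_comm,
      mul_inv_cancel₀ (sub_ne_zero.2 (hp.inj.ne hij)), one_mul]
    rfl
  have h7 : (fun τ => coeff (2 * g - 2) (logSeries (dataFamily hp hħ τ).partitionFn)) =ᶠ[𝓝 τ]
      fun τ => coeff (2 * g - 2) (logSeries (dataFamily hτ hħ τ).partitionFn) := by
    -- The data families based at `p` and at `τ` differ only in their default values.
    filter_upwards [h1.bethe] with τ' h8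
    rw [dataFamily_eq hp hħ h8, dataFamily_eq hτ hħ h8]
  have h8 := ((h1.isDiff hτ hħ).differentiableAt_logPartitionFn (2 * g - 2)).2.congr_of_eventuallyEq
    h7
  have h9 := h6.1.const_mul (coeff (2 * g) (kappa ħ ħ⁻¹) / ħ)
  refine ⟨h8.fun_add h9, fun G K h2 u => ?_⟩
  have hδ : ∀ i, ∀ᶠ z in 𝓝 (s τ i), HasDerivAt (fun z => ∑ k, u k * D k z)
      (∑ k, u k * val (dD k) z) z := by
    intro i
    filter_upwards [eventually_all.2 fun k => h4 k i] with z hz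
    exact HasDerivAt.fun_sum fun k _ => (hz k).const_mul (u k)
  rw [fderiv_fun_add h8 h9, fderiv_const_mul h6.1, add_apply, smul_apply, h6.2, h7.fderiv_eq,
    (h1.isVarFamily hτ hħ u hδ).fderiv_logPartitionFn (fun (j : Fin 0) _ => j.elim0),
    if_neg (by omega), show 2 * g - 2 + 2 = 2 * g by omega, dataFamily_eq hτ hħ hτ,
    h2.resPairing_zero_eq hτ hħ g (fun (j : Fin 0) _ => j.elim0) fun i =>
      Complex.analyticAt_iff_eventually_differentiableAt.2 ((hδ i).mono fun z hz =>
        hz.differentiableAt)]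
  simp only [← coeff_zero_eq_constantCoeff_apply, coeff_zero_taylor, smul_eq_mul]
  have h10 : (hτ.data hħ).kap = kappa ħ ħ⁻¹ := rfl
  rw [h10]
  field_simp
  ring

end FreeEnergy

/-! ### The differential equation in `h`. -/

section Rescaled

variable {r m : ℕ} {ħ : ℂ} {dV : RatFunc ℂ} {dD : Fin r → RatFunc ℂ} {V : ℂ → ℂ} {D : Fin r → ℂ → ℂ}

/-- The parameters of the problem for `(h, V' + ∑ₖ tₖ Dₖ')`, after rescaling it to the value `ħ` of
the first parameter. -/
def toPencil (ħ : ℂ) (q : ℂ × (Fin r → ℂ)) : Fin (r + 1) → ℂ :=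
  -- The rescaled potential `(ħ/h) (V' + ∑ tₖ Dₖ')` is `V'` plus a deformation in the directions
  -- `V', D₁', …`; the first parameter belongs to the direction `V'`.
  Fin.cons (ħ / q.1 - 1) fun k => ħ / q.1 * q.2 k

/-- The inverse of the map `toPencil`. -/
def ofPencil (ħ : ℂ) (τ : Fin (r + 1) → ℂ) : ℂ × (Fin r → ℂ) :=
  (ħ / (1 + τ 0), fun k => τ k.succ / (1 + τ 0))

lemma ofPencil_toPencil (hħ : ħ ≠ 0) {q : ℂ × (Fin r → ℂ)} (hq : q.1 ≠ 0) :
    ofPencil ħ (toPencil ħ q) = q := by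
  refine Prod.ext ?_ (funext fun k => ?_)
  · simp only [ofPencil, toPencil, Fin.cons_zero, add_sub_cancel]
    field_simp
  · simp only [ofPencil, toPencil, Fin.cons_zero, Fin.cons_succ, add_sub_cancel]
    field_simp

lemma toPencil_ofPencil (hħ : ħ ≠ 0) {τ : Fin (r + 1) → ℂ} (hτ : 1 + τ 0 ≠ 0) :
    toPencil ħ (ofPencil ħ τ) = τ := by
  have h : ħ / (ħ / (1 + τ 0)) = 1 + τ 0 := by field_simp
  refine funext fun k => Fin.cases ?_ (fun k => ?_) k
  · simp [ofPencil, toPencil, h]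
  · simp only [ofPencil, toPencil, Fin.cons_succ, h]
    field_simp

lemma IsKernelSystem.toPencil (hħ : ħ ≠ 0) {q : ℂ × (Fin r → ℂ)} (hq : q.1 ≠ 0) {s : Fin m → ℂ}
    {G K : ℂ → ℂ → ℂ} (h : IsKernelSystem q.1 (dV + ∑ k, RatFunc.C (q.2 k) * dD k) s G K)
    (hV : ∀ i, dV.denom.eval (s i) ≠ 0) (hD : ∀ k i, (dD k).denom.eval (s i) ≠ 0) :
    IsKernelSystem ħ (pencil dV (Fin.cons dV dD : Fin (r + 1) → RatFunc ℂ) (toPencil ħ q)) s G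
      (fun x₀ x => (ħ / q.1)⁻¹ * K x₀ x) ∧
    ∀ (g : ℕ) {f : ℂ → ℂ}, (∀ i, AnalyticAt ℂ f (s i)) →
      (ħ / q.1) ^ (2 * g) * resPairing ħ s G (fun x₀ x => (ħ / q.1)⁻¹ * K x₀ x) g 0 Fin.elim0 f =
        ħ / q.1 * resPairing q.1 s G K g 0 Fin.elim0 f := by
  have hD' : ∀ k i, ((Fin.cons dV dD : Fin (r + 1) → RatFunc ℂ) k).denom.eval (s i) ≠ 0 :=
    fun k i => Fin.cases (motive := fun k =>
      ((Fin.cons dV dD : Fin (r + 1) → RatFunc ℂ) k).denom.eval (s i) ≠ 0) (hV i) (fun k => hD k i) k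
  have hc : ħ / q.1 ≠ 0 := div_ne_zero hħ hq
  have hv : ∀ i, ∀ᶠ z in 𝓝 (s i),
      val (pencil dV (Fin.cons dV dD : Fin (r + 1) → RatFunc ℂ) (BetheRecursion.toPencil ħ q)) z =
        ħ / q.1 * val (dV + ∑ k, RatFunc.C (q.2 k) * dD k) z := by
    intro i
    filter_upwards [eventually_val_pencil (hV i) (fun k => hD' k i) (BetheRecursion.toPencil ħ q),
      eventually_val_pencil (hV i) (fun k => hD k i) q.2] with z h1 h2
    rw [h1, ← pencil, h2, Fin.sum_univ_succ]
    simp only [BetheRecursion.toPencil, Fin.cons_zero, Fin.cons_succ, mul_add, Finset.mul_sum,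
      mul_assoc]
    ring
  have h1 := h.scale hc (fun i => (denom_pencil_ne (hV i) (fun k => hD' k i) _).1) hv
  have h2 := fun (g : ℕ) (f : ℂ → ℂ) (hf : ∀ i, AnalyticAt ℂ f (s i)) =>
    h.resPairing_scale h1 hq hc hv g 0 Fin.elim0 (fun j => j.elim0) hf
  rw [div_mul_cancel₀ _ hq] at h1
  simp only [div_mul_cancel₀ _ hq] at h2
  exact ⟨h1, fun g f hf => h2 g f hf⟩

lemma hasDerivAt_toPencil (ħ : ℂ) {h : ℂ} (hh : h ≠ 0) (t : Fin r → ℂ) :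
    HasDerivAt (fun h => ħ / h) (-(ħ / h) / h) h ∧ HasDerivAt (fun h => toPencil ħ (h, t))
      ((-(ħ / h) / h) • (Fin.cons 1 t : Fin (r + 1) → ℂ)) h := by
  have h6 : HasDerivAt (fun h => ħ / h) (-(ħ / h) / h) h := by
    refine ((hasDerivAt_inv hh).const_mul ħ).congr_deriv ?_
    field_simp
  refine ⟨h6, hasDerivAt_pi.2 fun k => Fin.cases ?_ (fun k => ?_) k⟩
  · simpa [toPencil] using h6.sub_const 1
  · simpa [toPencil] using h6.mul_const (t k)

/-- The free energy at constant `ħ`, pulled back by `toPencil`, is multiplied by the power of `ħ /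
h` for which it has degree `2 - 2g` under common scaling of `h` and the potential. Euler's relation
for this homogeneity then expresses `2 - 2g - h ∂ₕ` by the derivative in the direction of the
potential, which is the pairing with it. -/
theorem exists_freeEnergy_solution (hħ : ħ ≠ 0) {s : ℂ × (Fin r → ℂ) → Fin m → ℂ}
    {G K : ℂ × (Fin r → ℂ) → ℂ → ℂ → ℂ} (hs : ContinuousAt s (ħ, 0))
    (hK : ∀ᶠ q in 𝓝 (ħ, (0 : Fin r → ℂ)),
      IsKernelSystem q.1 (dV + ∑ k, RatFunc.C (q.2 k) * dD k) (s q) (G q) (K q))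
    (hV : ∀ i, IsPrimitiveNear V dV (s (ħ, 0) i))
    (hD : ∀ k i, IsPrimitiveNear (D k) (dD k) (s (ħ, 0) i)) {g : ℕ} (hg : 2 ≤ g) :
    ∃ F : ℂ × (Fin r → ℂ) → ℂ, ∀ᶠ q in 𝓝 (ħ, (0 : Fin r → ℂ)),
      DifferentiableAt ℂ F q ∧
      (2 - 2 * (g : ℂ)) * F q - q.1 * deriv (fun h => F (h, q.2)) q.1 =
        -resPairing q.1 (s q) (G q) (K q) g 0 Fin.elim0 (fun x => V x + ∑ k, q.2 k * D k x) ∧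
      ∀ k, HasDerivAt (fun u => F (q.1, Function.update q.2 k u))
        (-resPairing q.1 (s q) (G q) (K q) g 0 Fin.elim0 (D k)) (q.2 k) := by
  set q₀ : ℂ × (Fin r → ℂ) := (ħ, 0) with hq₀
  have hsi : ∀ i, Tendsto (fun q => s q i) (𝓝 q₀) (𝓝 (s q₀ i)) := fun i =>
    ((continuous_apply i).continuousAt (x := s q₀)).tendsto.comp hs
  have hprim : ∀ {f : ℂ → ℂ} {df : RatFunc ℂ} {i : Fin m}, IsPrimitiveNear f df (s q₀ i) →
      ∀ᶠ q in 𝓝 q₀, IsPrimitiveNear f df (s q i) := fun {f df i} hf =>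
    (hsi i).eventually (eventually_eventually_nhds.2 hf)
  have hne : ∀ᶠ q in 𝓝 q₀, q.1 ≠ 0 := continuous_fst.continuousAt.eventually_ne hħ
  have hV' := eventually_all.2 fun i => hprim (hV i)
  have hD' := eventually_all.2 fun k => eventually_all.2 fun i => hprim (hD k i)
  have hscale := ((hK.and hne).and (hV'.and hD')).mono fun q hq =>
    hq.1.1.toPencil hħ hq.1.2 (fun i => (hq.2.1 i).denom_ne) fun k i => (hq.2.2 k i).denom_ne
  have hof0 : ofPencil ħ (0 : Fin (r + 1) → ℂ) = q₀ := by
    simp only [ofPencil, Pi.zero_apply, add_zero, div_one, hq₀]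
    rfl
  have hofc : Tendsto (ofPencil ħ) (𝓝 (0 : Fin (r + 1) → ℂ)) (𝓝 q₀) := by
    rw [← hof0]
    have h1 : ∀ k, ContinuousAt (fun τ : Fin (r + 1) → ℂ => τ k) 0 := fun k =>
      (continuous_apply k).continuousAt
    have h2 : ContinuousAt (fun τ : Fin (r + 1) → ℂ => 1 + τ 0) 0 := continuousAt_const.add (h1 0)
    exact (continuousAt_const.div h2 (by simp)).prodMk
      (continuousAt_pi.2 fun k => (h1 k.succ).div h2 (by simp))
  have htoc : Tendsto (toPencil ħ) (𝓝 q₀) (𝓝 (0 : Fin (r + 1) → ℂ)) := by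
    have h1 : ContinuousAt (fun q : ℂ × (Fin r → ℂ) => ħ / q.1) q₀ :=
      continuousAt_const.div continuous_fst.continuousAt hħ
    have h2 : ContinuousAt (toPencil (r := r) ħ) q₀ := by
      refine continuousAt_pi.2 fun k => Fin.cases ?_ (fun k => ?_) k
      · exact h1.sub continuousAt_const
      · exact h1.mul ((continuous_apply k).comp continuous_snd).continuousAt
    have h3 : toPencil ħ q₀ = 0 := by
      refine funext fun k => Fin.cases ?_ (fun k => ?_) k <;> simp [toPencil, hq₀, hħ]
    rw [← h3]
    exact h2
  have h1τ : ∀ᶠ τ : Fin (r + 1) → ℂ in 𝓝 0, 1 + τ 0 ≠ 0 :=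
    (continuousAt_const.add (continuous_apply 0).continuousAt).eventually_ne (by simp)
  obtain ⟨F, hF⟩ := exists_freeEnergy (p := 0) (dV := dV)
    (dD := (Fin.cons dV dD : Fin (r + 1) → RatFunc ℂ)) (s := fun τ => s (ofPencil ħ τ))
    (V := V)
    (D := (Fin.cons V D : Fin (r + 1) → ℂ → ℂ)) hħ
    (ContinuousAt.comp (g := s) (by rw [hof0]; exact hs) (by rw [← hof0] at hofc; exact hofc))
    (by
      filter_upwards [hofc.eventually hscale, h1τ] with τ h1 h2
      have h3 := h1.1
      rw [toPencil_ofPencil hħ h2] at h3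
      exact h3.isBethe hħ)
    (fun i => by rw [hof0]; exact hV i)
    (fun k i => by
      rw [hof0]
      exact Fin.cases (motive := fun k => IsPrimitiveNear ((Fin.cons V D : Fin (r + 1) → ℂ → ℂ) k)
        ((Fin.cons dV dD : Fin (r + 1) → RatFunc ℂ) k) (s q₀ i)) (hV i) (fun k => hD k i) k) hg
  refine ⟨fun q => (ħ / q.1) ^ (2 * g - 2) * F (toPencil ħ q), ?_⟩
  filter_upwards [htoc.eventually hF, hscale, hne, hV', hD'] with q h1 h2 h3 h4 h5
  rw [ofPencil_toPencil hħ h3] at h1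
  obtain ⟨hFd, hFu'⟩ := h1
  have hFu := hFu' _ _ h2.1
  have hc : ħ / q.1 ≠ 0 := div_ne_zero hħ h3
  have hpow : (ħ / q.1) ^ (2 * g) = ħ / q.1 * ((ħ / q.1) ^ (2 * g - 2) * (ħ / q.1)) := by
    rw [← pow_succ, ← pow_succ']
    congr 1
    omega
  -- The weight `(ħ/h)^(2g-2)` and the factor `ħ/h` from the chain rule together convert the pairing
  -- at `ħ` into the pairing at `h`.
  have hpair : ∀ {f : ℂ → ℂ}, (∀ i, AnalyticAt ℂ f (s q i)) →
      (ħ / q.1) ^ (2 * g - 2) * (ħ / q.1) * resPairing ħ (s q) (G q)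
        (fun x₀ x => (ħ / q.1)⁻¹ * K q x₀ x) g 0 Fin.elim0 f =
      resPairing q.1 (s q) (G q) (K q) g 0 Fin.elim0 f := fun {f} hf => by
    have h6 := h2.2 g hf
    rw [hpow, mul_assoc] at h6
    exact mul_left_cancel₀ hc h6
  refine ⟨?_, ?_, fun k => ?_⟩
  · have h6 : DifferentiableAt ℂ (fun q : ℂ × (Fin r → ℂ) => ħ / q.1) q := by
      fun_prop (disch := assumption)
    have h7 : DifferentiableAt ℂ (toPencil (r := r) ħ) q := by
      refine differentiableAt_pi.2 fun k => Fin.cases ?_ (fun k => ?_) k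
      · exact h6.sub_const 1
      · exact h6.mul (by fun_prop)
    exact (h6.pow _).mul (DifferentiableAt.comp q hFd h7)
  · obtain ⟨h6, h7⟩ := hasDerivAt_toPencil ħ h3 q.2
    have h8 : HasDerivAt (fun h => (ħ / h) ^ (2 * g - 2) * F (toPencil ħ (h, q.2))) _ q.1 :=
      (h6.fun_pow (2 * g - 2)).fun_mul (hFd.hasFDerivAt.comp_hasDerivAt q.1 h7)
    have h9 := hFu (Fin.cons 1 q.2)
    have h10 : (fun z => ∑ k, (Fin.cons 1 q.2 : Fin (r + 1) → ℂ) k *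
        (Fin.cons V D : Fin (r + 1) → ℂ → ℂ) k z) = fun z => V z + ∑ k, q.2 k * D k z := by
      funext z
      simp [Fin.sum_univ_succ]
    rw [h10] at h9
    have hfa : ∀ i, AnalyticAt ℂ (fun z => V z + ∑ k, q.2 k * D k z) (s q i) := fun i =>
      (h4 i).analyticAt.fun_add
        (Finset.analyticAt_fun_sum _ fun k _ => analyticAt_const.mul (h5 k i).analyticAt)
    rw [h8.deriv, map_smul, h9, ← hpair hfa]
    obtain ⟨N, hN⟩ : ∃ N, 2 * g - 2 = N + 1 := ⟨2 * g - 3, by omega⟩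
    have h11 : (2 : ℂ) - 2 * g = -(N + 1) := by
      have h12 : 2 * g = N + 3 := by omega
      have h13 : (2 : ℂ) * g = N + 3 := by exact_mod_cast h12
      rw [h13]
      ring
    have h14 : q.1 * (-(ħ / q.1) / q.1) = -(ħ / q.1) := mul_div_cancel₀ _ h3
    rw [hN, h11, Nat.add_sub_cancel, smul_eq_mul, Prod.mk.eta]
    push_cast
    generalize resPairing ħ (s q) (G q) _ g 0 Fin.elim0 _ = R at *
    generalize -(ħ / q.1) / q.1 = e at *
    generalize ħ / q.1 = c at *
    linear_combination (-((N + 1) * c ^ N * F (toPencil ħ q)) + c ^ (N + 1) * R) * h14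
  · have h7 : HasDerivAt (fun u => toPencil ħ (q.1, Function.update q.2 k u))
        ((ħ / q.1) • (Fin.cons 0 (Pi.single k 1) : Fin (r + 1) → ℂ)) (q.2 k) := by
      refine hasDerivAt_pi.2 fun j => Fin.cases ?_ (fun j => ?_) j
      · simpa [toPencil] using hasDerivAt_const (q.2 k) (ħ / q.1 - 1)
      · simpa [toPencil] using (hasDerivAt_pi.1 (hasDerivAt_update q.2 k (q.2 k)) j).const_mul
          (ħ / q.1)
    have h0 : toPencil ħ (q.1, Function.update q.2 k (q.2 k)) = toPencil ħ q := by
      rw [Function.update_eq_self]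
    rw [← h0] at hFd
    have h8 := (hFd.hasFDerivAt.comp_hasDerivAt (q.2 k) h7).const_mul ((ħ / q.1) ^ (2 * g - 2))
    refine h8.congr_deriv ?_
    have h10 : (fun z => ∑ j, (Fin.cons 0 (Pi.single k 1) : Fin (r + 1) → ℂ) j *
        (Fin.cons V D : Fin (r + 1) → ℂ → ℂ) j z) = D k := by
      funext z
      simp [Fin.sum_univ_succ, Pi.single_apply]
    rw [h0, map_smul, hFu, h10, ← hpair fun i => (h5 k i).analyticAt, smul_eq_mul]
    ring

end Rescaled

/-! ### The free energy as an integral over the segment from `0` to `ħ`. -/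

section Segment

variable {m : ℕ} {ħ : ℂ} {dV dδV : RatFunc ℂ} {V δV : ℂ → ℂ} {r : ℝ} {s : ℝ → ℂ → Fin m → ℂ}
  {G K : ℝ → ℂ → ℂ → ℂ → ℂ} {g : ℕ}

/-- Near each point, the free energy at constant `ħ` is a primitive of the integrand of the free
energy, along the segment, and of the variation formula. -/
lemma exists_local_freeEnergy (hħ : ħ ≠ 0)
    (hs : ContinuousOn (fun q : ℝ × ℂ => s q.1 q.2) (Set.Ioc 0 1 ×ˢ Metric.ball 0 r))
    (hK : ∀ u ∈ Set.Ioc (0 : ℝ) 1, ∀ t ∈ Metric.ball (0 : ℂ) r,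
      IsKernelSystem ((u : ℂ) * ħ) (dV + RatFunc.C t * dδV) (s u t) (G u t) (K u t) ∧
      ∀ i, IsPrimitiveNear V dV (s u t i) ∧ IsPrimitiveNear δV dδV (s u t i)) (hg : 2 ≤ g)
    {u₀ : ℝ} (hu₀ : u₀ ∈ Set.Ioc (0 : ℝ) 1) {t₀ : ℂ} (ht₀ : t₀ ∈ Metric.ball (0 : ℂ) r) :
    ∃ F : ℝ → ℂ → ℂ, ∀ᶠ q in 𝓝[Set.Ioc 0 1 ×ˢ Metric.ball 0 r] (u₀, t₀),
      HasDerivAt (fun u => F u q.2) (((q.1 : ℂ) ^ 2)⁻¹ * (q.1 : ℂ) ^ (2 * g - 1) *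
        resPairing ((q.1 : ℂ) * ħ) (s q.1 q.2) (G q.1 q.2) (K q.1 q.2) g 0 Fin.elim0
          (fun x => V x + q.2 * δV x)) q.1 ∧
      HasDerivAt (F q.1) (-((q.1 : ℂ)⁻¹ * (q.1 : ℂ) ^ (2 * g - 1) *
        resPairing ((q.1 : ℂ) * ħ) (s q.1 q.2) (G q.1 q.2) (K q.1 q.2) g 0 Fin.elim0 δV)) q.2 := by
  set P : ℝ → ℂ → Fin 2 → ℂ := fun u t => toPencil ħ ((u : ℂ) * ħ, fun _ : Fin 1 => t) with hP
  have hne : ∀ {u : ℝ}, u ∈ Set.Ioc (0 : ℝ) 1 → (u : ℂ) ≠ 0 := fun {u} hu =>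
    Complex.ofReal_ne_zero.2 hu.1.ne'
  have hsys : ∀ u ∈ Set.Ioc (0 : ℝ) 1, ∀ t ∈ Metric.ball (0 : ℂ) r, _ := fun u hu t ht =>
    IsKernelSystem.toPencil (dD := fun _ : Fin 1 => dδV) (q := ((u : ℂ) * ħ, fun _ : Fin 1 => t)) hħ
      (mul_ne_zero (hne hu) hħ) (by simpa using (hK u hu t ht).1)
      (fun i => ((hK u hu t ht).2 i).1.denom_ne) fun _ i => ((hK u hu t ht).2 i).2.denom_ne
  have hcons : ∀ (Q : RatFunc ℂ → Prop), Q dV → Q dδV →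
      ∀ k, Q ((Fin.cons dV (fun _ : Fin 1 => dδV) : Fin 2 → RatFunc ℂ) k) := fun Q h1 h2 k =>
    Fin.cases (motive := fun k => Q ((Fin.cons dV (fun _ : Fin 1 => dδV) : Fin 2 → RatFunc ℂ) k)) h1
      (fun _ => h2) k
  have hK₀ := hK u₀ hu₀ t₀ ht₀
  have hV₀ := fun i => (hK₀.2 i).1
  obtain ⟨ψ, hψ0, hψ, hψu⟩ := ((hsys u₀ hu₀ t₀ ht₀).1.isBethe hħ).exists_family hħ
    (fun i => (hV₀ i).denom_ne) fun k i => hcons (fun f => f.denom.eval (s u₀ t₀ i) ≠ 0)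
      (hV₀ i).denom_ne (hK₀.2 i).2.denom_ne k
  have hψc : ContinuousAt ψ (P u₀ t₀) := hψ.self_of_nhds.1.continuousAt
  obtain ⟨F, hF⟩ := exists_freeEnergy (dD := (Fin.cons dV (fun _ : Fin 1 => dδV)))
    (D := (Fin.cons V (fun _ : Fin 1 => δV) : Fin 2 → ℂ → ℂ)) (V := V) hħ hψc
    (hψ.mono fun τ hτ => hτ.2) (fun i => by rw [hψ0]; exact hV₀ i) (fun k i => by
      rw [hψ0]
      exact Fin.cases (motive := fun k => IsPrimitiveNear
        ((Fin.cons V (fun _ : Fin 1 => δV) : Fin 2 → ℂ → ℂ) k)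
        ((Fin.cons dV (fun _ : Fin 1 => dδV) : Fin 2 → RatFunc ℂ) k) (s u₀ t₀ i)) (hV₀ i)
          (fun _ => (hK₀.2 i).2) k) hg
  have hPc : Tendsto (fun q : ℝ × ℂ => P q.1 q.2) (𝓝 (u₀, t₀)) (𝓝 (P u₀ t₀)) := by
    have h1 : ContinuousAt (fun q : ℝ × ℂ => ħ / ((q.1 : ℂ) * ħ)) (u₀, t₀) :=
      continuousAt_const.div (by fun_prop) (mul_ne_zero (hne hu₀) hħ)
    refine ContinuousAt.tendsto (x := (u₀, t₀)) (f := fun q : ℝ × ℂ => P q.1 q.2) ?_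
    refine continuousAt_pi.2 fun k => Fin.cases ?_ (fun k => ?_) k
    · exact h1.sub continuousAt_const
    · exact h1.mul continuous_snd.continuousAt
  -- Without the power of `ħ / h` the rescaled free energy has no Euler term, so its derivative in
  -- `u` is just the integrand.
  refine ⟨fun u t => F (P u t), ?_⟩
  have hPs : Tendsto (fun q : ℝ × ℂ => (P q.1 q.2, s q.1 q.2))
      (𝓝[Set.Ioc 0 1 ×ˢ Metric.ball 0 r] (u₀, t₀)) (𝓝 (P u₀ t₀, s u₀ t₀)) :=
    (hPc.mono_left nhdsWithin_le_nhds).prodMk_nhds (hs (u₀, t₀) ⟨hu₀, ht₀⟩)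
  filter_upwards [hPs.eventually hψu, (hPc.mono_left nhdsWithin_le_nhds).eventually hF,
    self_mem_nhdsWithin] with q h1 h2 hq
  obtain ⟨u, t⟩ := q
  obtain ⟨hu, ht⟩ : u ∈ Set.Ioc (0 : ℝ) 1 ∧ t ∈ Metric.ball (0 : ℂ) r := hq
  have h3 := hsys u hu t ht
  -- The given points depend only continuously on `(u, t)`; local uniqueness identifies them with
  -- the implicit solution.
  have h4 : s u t = ψ (P u t) := h1 (h3.1.isBethe hħ)
  have hu0 := hne hu
  have huħ : (u : ℂ) * ħ ≠ 0 := mul_ne_zero hu0 hħ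
  have hFu := h2.2 (G u t) (fun x₀ x => (ħ / ((u : ℂ) * ħ))⁻¹ * K u t x₀ x)
    (by rw [← h4]; exact h3.1)
  rw [← h4] at hFu
  have hc : ħ / ((u : ℂ) * ħ) = (u : ℂ)⁻¹ := by field_simp
  have hpair : ∀ {f : ℂ → ℂ}, (∀ i, AnalyticAt ℂ f (s u t i)) →
      resPairing ħ (s u t) (G u t) (fun x₀ x => (ħ / ((u : ℂ) * ħ))⁻¹ * K u t x₀ x) g 0 Fin.elim0 f =
      (u : ℂ) ^ (2 * g - 1) * resPairing ((u : ℂ) * ħ) (s u t) (G u t) (K u t) g 0 Fin.elim0 f :=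
    fun {f} hf => by
      have h5 := h3.2 g hf
      obtain ⟨N, hN⟩ : ∃ N, 2 * g = N + 1 := ⟨2 * g - 1, by omega⟩
      simp only [hc] at h5 ⊢
      rw [hN] at h5 ⊢
      generalize resPairing ħ _ _ _ g 0 _ f = A at h5 ⊢
      have h6 : A = (u : ℂ) ^ (N + 1) * ((u : ℂ)⁻¹ ^ (N + 1) * A) := by
        rw [← mul_assoc, ← mul_pow, mul_inv_cancel₀ hu0, one_pow, one_mul]
      refine h6.trans ?_
      rw [h5, Nat.add_sub_cancel, pow_succ, mul_assoc, mul_inv_cancel_left₀ hu0]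
  have hfa : ∀ i, AnalyticAt ℂ δV (s u t i) := fun i => ((hK u hu t ht).2 i).2.analyticAt
  have hfa' : ∀ i, AnalyticAt ℂ (fun x => V x + t * δV x) (s u t i) := fun i =>
    ((hK u hu t ht).2 i).1.analyticAt.fun_add (analyticAt_const.mul (hfa i))
  constructor
  · have h5 : HasDerivAt (fun u : ℝ => (u : ℂ) * ħ) ħ u := by
      simpa using (Complex.ofRealCLM.hasDerivAt (x := u)).mul_const ħ
    have h6 : HasDerivAt (fun u : ℝ => P u t) (ħ • (-(ħ / ((u : ℂ) * ħ)) / ((u : ℂ) * ħ)) •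
        (Fin.cons 1 (fun _ : Fin 1 => t) : Fin 2 → ℂ)) u :=
      HasDerivAt.scomp (g₁ := fun h => toPencil ħ (h, fun _ : Fin 1 => t))
        (h := fun u : ℝ => (u : ℂ) * ħ) u (hasDerivAt_toPencil ħ huħ (fun _ : Fin 1 => t)).2 h5
    have h7 : HasDerivAt (fun u : ℝ => F (P u t)) _ u :=
      (h2.1.hasFDerivAt.restrictScalars ℝ).comp_hasDerivAt u h6
    refine h7.congr_deriv ?_
    rw [ContinuousLinearMap.coe_restrictScalars']
    have h8 : (fun z => ∑ k, (Fin.cons 1 (fun _ : Fin 1 => t) : Fin 2 → ℂ) k *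
        (Fin.cons V (fun _ : Fin 1 => δV) : Fin 2 → ℂ → ℂ) k z) = fun z => V z + t * δV z := by
      funext z
      simp [Fin.sum_univ_succ]
    rw [map_smul, map_smul, hFu, h8, hpair hfa', hc, smul_eq_mul, smul_eq_mul]
    field_simp
  · have h6 : HasDerivAt (fun t => P u t)
        ((u : ℂ)⁻¹ • (Fin.cons 0 (fun _ : Fin 1 => 1) : Fin 2 → ℂ)) t := by
      refine hasDerivAt_pi.2 fun j => Fin.cases ?_ (fun j => ?_) j
      · simpa [P, toPencil] using hasDerivAt_const t (ħ / (u * ħ) - 1)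
      · simpa [P, toPencil, hc] using (hasDerivAt_id t).const_mul (u : ℂ)⁻¹
    refine (h2.1.hasFDerivAt.comp_hasDerivAt t h6).congr_deriv ?_
    have h8 : (fun z => ∑ k, (Fin.cons 0 (fun _ : Fin 1 => 1) : Fin 2 → ℂ) k *
        (Fin.cons V (fun _ : Fin 1 => δV) : Fin 2 → ℂ → ℂ) k z) = δV := by
      funext z
      simp [Fin.sum_univ_succ]
    rw [map_smul, hFu, h8, hpair hfa, smul_eq_mul]
    ring

end Segment

section Segment

variable {m : ℕ} {ħ : ℂ} {dV dδV : RatFunc ℂ} {V δV : ℂ → ℂ} {r : ℝ} {s : ℝ → ℂ → Fin m → ℂ}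
  {G K : ℝ → ℂ → ℂ → ℂ → ℂ} {g : ℕ}

/-- The integrand and `-Q` are the two partial derivatives of one local function of `(u, t)`. Hence
the `t`-derivative of the integral over `[a, 1]` is `Q a - Q 1`, and `Q a` tends to zero uniformly
in `t`. -/
theorem hasDerivAt_freeEnergy (hħ : ħ ≠ 0) (hr : 0 < r)
    (hs : ContinuousOn (fun q : ℝ × ℂ => s q.1 q.2) (Set.Ioc 0 1 ×ˢ Metric.ball 0 r))
    (hK : ∀ u ∈ Set.Ioc (0 : ℝ) 1, ∀ t ∈ Metric.ball (0 : ℂ) r,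
      IsKernelSystem ((u : ℂ) * ħ) (dV + RatFunc.C t * dδV) (s u t) (G u t) (K u t) ∧
      ∀ i, IsPrimitiveNear V dV (s u t i) ∧ IsPrimitiveNear δV dδV (s u t i)) (hg : 2 ≤ g)
    (hint : ∀ t ∈ Metric.ball (0 : ℂ) r, IntervalIntegrable (freeEnergyIntegrand ħ g fun u =>
      resPairing ((u : ℂ) * ħ) (s u t) (G u t) (K u t) g 0 Fin.elim0 (fun x => V x + t * δV x))
        MeasureTheory.volume 0 1)
    (hlim : TendstoUniformlyOn (fun (u : ℝ) (t : ℂ) => ((u : ℂ) * ħ) ^ (2 * g - 2) *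
      resPairing ((u : ℂ) * ħ) (s u t) (G u t) (K u t) g 0 Fin.elim0 δV)
        (fun _ => 0) (𝓝[>] 0) (Metric.ball 0 r)) :
    HasDerivAt (fun t => freeEnergy ħ g fun u =>
      resPairing ((u : ℂ) * ħ) (s u t) (G u t) (K u t) g 0 Fin.elim0 (fun x => V x + t * δV x))
      (-resPairing ħ (s 1 0) (G 1 0) (K 1 0) g 0 Fin.elim0 δV) 0 := by
  set P : ℂ → ℝ → ℂ := fun t u => ħ ^ (2 - 2 * (g : ℤ)) * (freeEnergyIntegrand ħ g (fun u =>
    resPairing ((u : ℂ) * ħ) (s u t) (G u t) (K u t) g 0 Fin.elim0 (fun x => V x + t * δV x)) u * ħ)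
    with hP
  set Q : ℝ → ℂ → ℂ := fun u t => (ħ ^ (2 * g - 2))⁻¹ * (((u : ℂ) * ħ) ^ (2 * g - 2) *
    resPairing ((u : ℂ) * ħ) (s u t) (G u t) (K u t) g 0 Fin.elim0 δV) with hQ
  have hintP : ∀ t ∈ Metric.ball (0 : ℂ) r, IntervalIntegrable (P t) MeasureTheory.volume 0 1 :=
    fun t ht => ((hint t ht).mul_const ħ).const_mul _
  have hsub : ∀ {t : ℂ}, t ∈ Metric.ball (0 : ℂ) r → ∀ {a b : ℝ}, a ∈ Set.Ioc (0 : ℝ) 1 →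
      b ∈ Set.Ioc (0 : ℝ) 1 → IntervalIntegrable (P t) MeasureTheory.volume a b :=
    fun {t} ht {a b} ha hb => (hintP t ht).mono_set <| by
      rw [Set.uIcc_of_le zero_le_one]
      exact Set.uIcc_subset_Icc ⟨ha.1.le, ha.2⟩ ⟨hb.1.le, hb.2⟩
  have hgrow : ∀ {u : ℝ} {R : ℂ}, u ∈ Set.Ioc (0 : ℝ) 1 →
      ((u : ℂ) ^ 2)⁻¹ * (u : ℂ) ^ (2 * g - 1) * R =
        ħ ^ (2 - 2 * (g : ℤ)) * (((u : ℂ) * ħ) ^ (2 * (g : ℤ) - 3) * R * ħ) ∧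
      (u : ℂ)⁻¹ * (u : ℂ) ^ (2 * g - 1) * R =
        (ħ ^ (2 * g - 2))⁻¹ * (((u : ℂ) * ħ) ^ (2 * g - 2) * R) := by
    intro u R hu
    have hu0 : (u : ℂ) ≠ 0 := Complex.ofReal_ne_zero.2 hu.1.ne'
    obtain ⟨N, hN⟩ : ∃ N, g = N + 2 := ⟨g - 2, by omega⟩
    have e1 : 2 * g - 1 = 2 * N + 3 := by omega
    have e2 : 2 * g - 2 = 2 * N + 2 := by omega
    have e3 : 2 * (g : ℤ) - 3 = ((2 * N + 1 : ℕ) : ℤ) := by push_cast; omega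
    have e4 : 2 - 2 * (g : ℤ) = -((2 * N + 2 : ℕ) : ℤ) := by push_cast; omega
    rw [e1, e2, e3, e4, zpow_natCast, zpow_neg, zpow_natCast]
    constructor <;> (field_simp; try ring)
  have hrel : ∀ t₀ ∈ Metric.ball (0 : ℂ) r, ∀ a ∈ Set.Ioc (0 : ℝ) 1, HasDerivAt
      (fun t => ∫ u in a..1, P t u) (Q a t₀ - Q 1 t₀) t₀ := by
    intro t₀ ht₀ a ha
    have hnhds := Metric.isOpen_ball.mem_nhds ht₀
    -- The local functions need not agree on overlaps. The formula for the integral from `a` to `b`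
    -- is additive and antisymmetric in the end points and holds for nearby ones, so connectedness
    -- of `(0, 1]` gives all pairs.
    refine (isPreconnected_Ioc (a := (0 : ℝ)) (b := 1)).induction₂ (fun a b => HasDerivAt
      (fun t => ∫ u in a..b, P t u) (Q a t₀ - Q b t₀) t₀) ?_ ?_ ?_ ha ⟨one_pos, le_rfl⟩
    · intro u₀ hu₀
      obtain ⟨F, hF⟩ := exists_local_freeEnergy hħ hs hK hg hu₀ ht₀
      rw [nhdsWithin_prod_eq, Metric.isOpen_ball.nhdsWithin_eq ht₀] at hF
      obtain ⟨pa, hpa, pb, hpb, hab⟩ := eventually_prod_iff.1 hF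
      obtain ⟨ε, hε, hball⟩ := Metric.mem_nhdsWithin_iff.1 hpa
      rw [Real.ball_eq_Ioo] at hball
      have hu₀' : u₀ ∈ Set.Ioo (u₀ - ε) (u₀ + ε) := ⟨by linarith, by linarith⟩
      filter_upwards [self_mem_nhdsWithin, mem_nhdsWithin_of_mem_nhds
        (Ioo_mem_nhds hu₀'.1 hu₀'.2)] with y hy hy'
      have hseg : ∀ u ∈ Set.uIcc u₀ y, pa u ∧ u ∈ Set.Ioc (0 : ℝ) 1 := fun u hu =>
        have h1 := Set.ordConnected_Ioc.uIcc_subset hu₀ hy hu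
        ⟨hball ⟨Set.ordConnected_Ioo.uIcc_subset hu₀' hy' hu, h1⟩, h1⟩
      have h1 : ∀ u, pa u → u ∈ Set.Ioc (0 : ℝ) 1 → HasDerivAt (F u) (-Q u t₀) t₀ := by
        intro u hu hu'
        refine (hab hu hpb.self_of_nhds).2.congr_deriv ?_
        rw [(hgrow hu').2]
      have h2 := (h1 y (hseg y Set.right_mem_uIcc).1 hy).sub
        (h1 u₀ (hseg u₀ Set.left_mem_uIcc).1 hu₀)
      refine (h2.congr_of_eventuallyEq ?_).congr_deriv (by ring)
      filter_upwards [hpb, hnhds] with t ht ht'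
      refine intervalIntegral.integral_eq_sub_of_hasDerivAt (f := fun u => F u t) (fun u hu => ?_)
        (hsub ht' hu₀ hy)
      refine (hab (hseg u hu).1 ht).1.congr_deriv ?_
      rw [(hgrow (hseg u hu).2).1]
      rfl
    · intro x y z hx hy hz h1 h2
      refine ((h1.add h2).congr_of_eventuallyEq ?_).congr_deriv (by ring)
      filter_upwards [hnhds] with t ht
      exact (intervalIntegral.integral_add_adjacent_intervals (hsub ht hx hy) (hsub ht hy hz)).symm
    · intro x y _ _ h1
      refine (h1.neg.congr_of_eventuallyEq (Eventually.of_forall fun t => ?_)).congr_deriv (by ring)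
      exact intervalIntegral.integral_symm _ _
  have hval : Q 1 0 = resPairing ħ (s 1 0) (G 1 0) (K 1 0) g 0 Fin.elim0 δV := by
    simp only [hQ, Complex.ofReal_one, one_mul]
    rw [inv_mul_cancel_left₀ (pow_ne_zero _ hħ)]
  rw [← hval]
  -- The limit `a → 0` may be exchanged with the derivative: the derivatives converge uniformly, and
  -- integrability up to `0` gives the convergence of the integrals.
  refine hasDerivAt_of_tendstoUniformlyOn (l := 𝓝[>] (0 : ℝ)) (f := fun a t => ∫ u in a..1, P t u)
    (f' := fun a t => Q a t - Q 1 t) (g' := fun t => -Q 1 t) Metric.isOpen_ball ?_ ?_ ?_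
    (Metric.mem_ball_self hr)
  · rw [Metric.tendstoUniformlyOn_iff] at hlim ⊢
    intro ε hε
    have hc : 0 < ‖ħ ^ (2 * g - 2)‖ := norm_pos_iff.2 (pow_ne_zero _ hħ)
    filter_upwards [hlim (ε * ‖ħ ^ (2 * g - 2)‖) (mul_pos hε hc)] with u hu t ht
    have h1 := hu t ht
    rw [dist_zero_left] at h1
    rw [dist_eq_norm, show -Q 1 t - (Q u t - Q 1 t) = -Q u t by ring, norm_neg, hQ, norm_mul,
      norm_inv, inv_mul_lt_iff₀ hc, mul_comm _ ε]
    exact h1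
  · filter_upwards [Ioc_mem_nhdsGT one_pos] with a ha t ht
    exact hrel t ht a ha
  · intro t ht
    have h1 : ContinuousOn (fun a => ∫ u in a..1, P t u) (Set.uIcc 0 1) :=
      intervalIntegral.continuousOn_primitive_interval_left
        ((intervalIntegrable_iff' (μ := MeasureTheory.volume)).1 (hintP t ht))
    have h2 := (h1 0 Set.left_mem_uIcc).tendsto
    have h3 : freeEnergy ħ g (fun u => resPairing ((u : ℂ) * ħ) (s u t) (G u t) (K u t) g 0 Fin.elim0
        (fun x => V x + t * δV x)) = ∫ u in (0 : ℝ)..1, P t u := by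
      rw [freeEnergy, hP, intervalIntegral.integral_const_mul]
    rw [h3]
    refine h2.mono_left ?_
    rw [Set.uIcc_of_le zero_le_one, ← nhdsWithin_Ioc_eq_nhdsGT one_pos]
    exact nhdsWithin_mono _ Set.Ioc_subset_Icc_self

end Segment

end BetheRecursion
end

/-! ### The main theorem. -/

theorem mainTheorem2 {m : ℕ} (ħ : ℂ) (hħ : ħ ≠ 0)
    (dV dδV : RatFunc ℂ) (V δV : ℂ → ℂ) (s₀ : Fin m → ℂ)
    (h₀ : ∃ G K, BetheRecursion.IsKernelSystem ħ dV s₀ G K)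
    (hV : ∀ i, BetheRecursion.IsPrimitiveNear V dV (s₀ i))
    (hδV : ∀ i, BetheRecursion.IsPrimitiveNear δV dδV (s₀ i)) :
    -- the deformed problem has a solution near the given one
    (∃ (s : ℂ → Fin m → ℂ) (G K : ℂ → ℂ → ℂ → ℂ), s 0 = s₀ ∧ ContinuousAt s 0 ∧
      ∀ᶠ t in 𝓝 (0 : ℂ),
        BetheRecursion.IsKernelSystem ħ (dV + RatFunc.C t * dδV) (s t) (G t) (K t)) ∧
    -- the variation formula, along every such deformation
    (∀ (s : ℂ → Fin m → ℂ) (G K : ℂ → ℂ → ℂ → ℂ), s 0 = s₀ → ContinuousAt s 0 →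
      (∀ᶠ t in 𝓝 (0 : ℂ),
        BetheRecursion.IsKernelSystem ħ (dV + RatFunc.C t * dδV) (s t) (G t) (K t)) →
      -- at least one argument
      (∀ (g n : ℕ) (x : Fin (n + 1) → ℂ), (∀ j i, x j ≠ s₀ i) →
        (g = 0 → n = 1 → x 0 ≠ x (Fin.last n)) →
        HasDerivAt (fun t => BetheRecursion.W ħ (s t) (G t) (K t) g n x)
          (-BetheRecursion.resPairing ħ (s 0) (G 0) (K 0) g (n + 1) x δV) 0) ∧
      -- no argument, genus 0 and genus 1
      (∀ l : ℂ → Fin m → Fin m → ℂ,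
        (∀ i j, i ≠ j →
          BetheRecursion.IsLogBranch (fun t => s t i - s t j) (fun t => l t i j) 0) →
        HasDerivAt (fun t => BetheRecursion.F0 ħ (fun x => V x + t * δV x) (s t) (l t))
          (-BetheRecursion.resPairing ħ (s 0) (G 0) (K 0) 0 0 Fin.elim0 δV) 0 ∧
        ∀ lA lΔ : ℂ → ℂ,
          BetheRecursion.IsLogBranch
            (fun t => (BetheRecursion.matA ħ (dV + RatFunc.C t * dδV) (s t)).det) lA 0 →
          BetheRecursion.IsLogBranch (fun t => BetheRecursion.vandermonde (s t) ^ 2) lΔ 0 →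
          HasDerivAt
            (fun t =>
              BetheRecursion.F1 ħ (fun x => V x + t * δV x) (s t) (l t) (lA t) (lΔ t))
            (-BetheRecursion.resPairing ħ (s 0) (G 0) (K 0) 1 0 Fin.elim0 δV) 0)) ∧
    -- no argument, genus at least 2: a solution of the differential equation in `ħ`
    (∀ (p : ℕ) (dD : Fin p → RatFunc ℂ) (D : Fin p → ℂ → ℂ),
      (∀ k i, BetheRecursion.IsPrimitiveNear (D k) (dD k) (s₀ i)) →
      ∀ (s : ℂ × (Fin p → ℂ) → Fin m → ℂ) (G K : ℂ × (Fin p → ℂ) → ℂ → ℂ → ℂ),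
        s (ħ, 0) = s₀ → ContinuousAt s (ħ, 0) →
        (∀ᶠ q in 𝓝 (ħ, (0 : Fin p → ℂ)), BetheRecursion.IsKernelSystem q.1
          (dV + ∑ k, RatFunc.C (q.2 k) * dD k) (s q) (G q) (K q)) →
        ∀ g : ℕ, 2 ≤ g → ∃ F : ℂ × (Fin p → ℂ) → ℂ,
          ∀ᶠ q in 𝓝 (ħ, (0 : Fin p → ℂ)),
            DifferentiableAt ℂ F q ∧
            (2 - 2 * (g : ℂ)) * F q - q.1 * deriv (fun h => F (h, q.2)) q.1 =
              -BetheRecursion.resPairing q.1 (s q) (G q) (K q) g 0 Fin.elim0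
                (fun x => V x + ∑ k, q.2 k * D k x) ∧
            ∀ k, HasDerivAt (fun u => F (q.1, Function.update q.2 k u))
              (-BetheRecursion.resPairing q.1 (s q) (G q) (K q) g 0 Fin.elim0 (D k)) (q.2 k)) ∧
    -- no argument, genus at least 2: the solution given by the integral from `0` to `ħ`
    (∀ (r : ℝ), 0 < r → ∀ (s : ℝ → ℂ → Fin m → ℂ) (G K : ℝ → ℂ → ℂ → ℂ → ℂ),
      s 1 0 = s₀ →
      ContinuousOn (fun q : ℝ × ℂ => s q.1 q.2) (Set.Ioc 0 1 ×ˢ Metric.ball 0 r) →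
      (∀ u ∈ Set.Ioc (0 : ℝ) 1, ∀ t ∈ Metric.ball (0 : ℂ) r,
        BetheRecursion.IsKernelSystem ((u : ℂ) * ħ) (dV + RatFunc.C t * dδV)
          (s u t) (G u t) (K u t) ∧
        ∀ i, BetheRecursion.IsPrimitiveNear V dV (s u t i) ∧
          BetheRecursion.IsPrimitiveNear δV dδV (s u t i)) →
      ∀ g : ℕ, 2 ≤ g →
        (∀ t ∈ Metric.ball (0 : ℂ) r, IntervalIntegrable
          (BetheRecursion.freeEnergyIntegrand ħ g fun u =>
            BetheRecursion.resPairing ((u : ℂ) * ħ) (s u t) (G u t) (K u t) g 0 Fin.elim0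
              (fun x => V x + t * δV x)) MeasureTheory.volume 0 1) →
        TendstoUniformlyOn
          (fun (u : ℝ) (t : ℂ) => ((u : ℂ) * ħ) ^ (2 * g - 2) *
            BetheRecursion.resPairing ((u : ℂ) * ħ) (s u t) (G u t) (K u t) g 0 Fin.elim0 δV)
          (fun _ => 0) (𝓝[>] 0) (Metric.ball 0 r) →
        HasDerivAt
          (fun t => BetheRecursion.freeEnergy ħ g fun u =>
            BetheRecursion.resPairing ((u : ℂ) * ħ) (s u t) (G u t) (K u t) g 0 Fin.elim0
              (fun x => V x + t * δV x))
          (-BetheRecursion.resPairing ħ (s 1 0) (G 1 0) (K 1 0) g 0 Fin.elim0 δV) 0) := by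
  obtain ⟨G₀, K₀, h₀⟩ := h₀
  refine ⟨BetheRecursion.exists_deformation hħ (h₀.isBethe hħ) fun i => (hδV i).denom_ne, ?_, ?_, ?_⟩
  · rintro s G K rfl hs hK
    exact ⟨fun g n x hx hxx => BetheRecursion.hasDerivAt_W hħ hs hK hV hδV g n x
        (fun j => by rintro ⟨i, hi⟩; exact hx j i hi.symm) hxx,
      fun l hl => BetheRecursion.hasDerivAt_F0_F1 hħ hs hK hV hδV hl⟩
  · rintro p dD D hD s G K rfl hs hK g hg
    exact BetheRecursion.exists_freeEnergy_solution hħ hs hK hV hD hg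
  · intro r hr s G K _ hs hK g hg hint hlim
    exact BetheRecursion.hasDerivAt_freeEnergy hħ hr hs hK hg hint hlim
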